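/- **Setting.** Let $f:\mathbb R^m\times\mathbb R^d\to\mathbb R^m$, $C:\mathbb R^m\to\mathbb R$, let $U_{ad}\subset\mathbb R^d$ be closed and convex, $T>0$, $y_0\in\mathbb R^m$; vectors carry the maximum norm. Consider minimizing $C(y(T))$ subject to $y'=f(y,u)$, $u\in U_{ad}$, $y(0)=y_0$. For a control map $u(y,p)$ put $g(y,p)=f(y,u(y,p))$ and $\phi(y,p)=-\nabla_yf(y,u(y,p))^{\sf T}p$. The KKT boundary value problem is $$y'=g(y,p),\quad y(0)=y_0,\qquad p'=\phi(y,p),\quad p(T)=\nabla C(y(T))^{\sf T}.\tag{1}$$ Let $(y,p)$ be a solution of (1) with $y\in C^{s+1}$, $p\in C^s$, the differential equations holding on $I=[-\delta,T+\delta]$, where $\delta>0$, or $\delta=0$ in the case that all nodes $c_j$ lie in $[0,1]$. Put $u^\star(t)=u(y(t),p(t))$ and assume: * *(smoothness)* $f$ is $C^{s+1}$ near the points $(y(t),u^\star(t))$ and $u(\cdot,\cdot)$ is $C^s$ near the points $(y(t),p(t))$, $t\in I$; $C$ is $C^2$ near $y(T)$; * *(control)* for all $(\bar y,\bar p)$ near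 $(y(t),p(t))$, $t\in I$, $u(\bar y,\bar p)$ is a locally unique minimizer of $v\mapsto\bar p^{\sf T}f(\bar y,v)$ over $U_{ad}$; * *(coercivity)* there is $\alpha>0$ such that, with $H(y,u,p)=p^{\sf T}f(y,u)$, $$\nabla^2C(y(T))[\omega(T),\omega(T)]+\int_0^T\nabla^2_{(y,u)}H(y,u^\star,p)[(\omega,\nu),(\omega,\nu)]\,dt\ \ge\ \alpha\int_0^T\nu^{\sf T}\nu\,dt$$ for all continuous $\nu$ with values in $U_{ad}-U_{ad}$ and $\omega'=\nabla_yf(y,u^\star)\,\omega+\nabla_uf(y,u^\star)\,\nu$, $\omega(0)=0$. **Peer triplet.** Let $s>1$. A Peer triplet consists of nodes $\mathbf c\in\mathbb R^s$, vectors $a,b,w,v\in\mathbb R^s$, and real $s\times s$ matrices: a starting method $(A_0,K_0)$, a standard method $(A_n,B_n,K_n)=(A,B,K)$, $0<n<N$, and an end method $(A_N,B_N,K_N)$. All $A_n$, $K_n$ are nonsingular and $K$ is diagonal; if $s\ge5$, let $K_0,K_N$ be diagonal as well. With $h=T/(N+1)$, $t_n=nh$, $t_{nj}=t_n+c_jh$,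 a *Peer solution* consists of stages $Y_n=(Y_{nj})_j$, $P_n=(P_{nj})_j$, $0\le n\le N$, with ($M$ also denotes $M\otimes I$) $$\begin{aligned} A_0Y_0&=a\otimes y_0+hb\otimes g(y_0,p_h(0))+hK_0G(Y_0,P_0),\\ A_nY_n&=B_nY_{n-1}+hK_nG(Y_n,P_n),\quad 1\le n\le N,\\ A_n^{\sf T}P_n&=B_{n+1}^{\sf T}P_{n+1}-h\Phi_n,\quad 0\le n\le N-1,\\ A_N^{\sf T}P_N&=w\otimes\nabla C(y_h(T))^{\sf T}-h\Phi_N, \end{aligned}$$ where $y_h(T)=(w^{\sf T}\otimes I)Y_N$, $p_h(0)=(v^{\sf T}\otimes I)P_0$, $G(Y_n,P_n)=\big(g(Y_{ni},P_{ni})\big)_i$ and $\Phi_n=\big(-\nabla_yf(Y_{ni},u(Y_{ni},P_{ni}))^{\sf T}(K_n^{\sf T}P_n)_i\big)_i$. **Order conditions.** Let $V_q=(c_i^{\,j-1})\in\mathbb R^{s\times q}$, $\mathcal P_q=\big(\binom{j-1}{i-1}\big)$ and $\tilde E_q=(i\,\delta_{i+1,j})$ in $\mathbb R^{q\times q}$;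 $e_i$ are unit vectors, $\mathbb 1=(1,\dots,1)^{\sf T}$, powers of $\mathbf c$ are componentwise, and $q=s-1$. Assume $$\begin{aligned} &A_0V_s=ae_1^{\sf T}+be_2^{\sf T}+K_0V_s\tilde E_s,\quad w^{\sf T}V_s=\mathbb 1^{\sf T},\quad v^{\sf T}V_q=e_1^{\sf T},\\ &A_nV_s=B_nV_s\mathcal P_s^{-1}+K_nV_s\tilde E_s\quad\text{for the standard and the end method},\\ &A_0^{\sf T}V_q=B^{\sf T}V_q\mathcal P_q-K_0^{\sf T}V_q\tilde E_q,\quad A^{\sf T}V_q=B^{\sf T}V_q\mathcal P_q-K^{\sf T}V_q\tilde E_q,\\ &A^{\sf T}V_q=B_N^{\sf T}V_q\mathcal P_q-K^{\sf T}V_q\tilde E_q,\quad A_N^{\sf T}V_q=w\mathbb 1^{\sf T}-K_N^{\sf T}V_q\tilde E_q,\\ &\textstyle\sum_{i}(c_i-c_j)(K_\beta)_{ij}=0\quad(j=1,\dots,s,\ \beta\in\{0,N\}),\\ &\mathbb 1^{\sf T}B\mathbb 1=1,\quad \mathbb 1^{\sf T}B\mathbf c-\mathbf c^{\sf T}B\mathbb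 1=1,\quad\text{and, if }s\ge4,\ \ \mathbb 1^{\sf T}B\mathbf c^2-2\mathbf c^{\sf T}B\mathbf c+(\mathbf c^2)^{\sf T}B\mathbb 1=1. \end{aligned}$$ Let the standard method satisfy the superconvergence conditions $$\mathbb 1^{\sf T}\big(A\mathbf c^s-B(\mathbf c-\mathbb 1)^s-sK\mathbf c^{s-1}\big)=0,\qquad \mathbb 1^{\sf T}\big(A^{\sf T}\mathbf c^{s-1}-B^{\sf T}(\mathbf c+\mathbb 1)^{s-1}+(s-1)K\mathbf c^{s-2}\big)=0,$$ and let $1$ be a simple eigenvalue of $A^{-1}B$, all other eigenvalues having modulus less than $1$. **Theorem.** There are constants $r>0$, $h_0>0$ and $M$ such that for every $N$ with $h=T/(N+1)\le h_0$, every Peer solution with $\|Y_{nj}-y(t_{nj})\|_\infty\le r$ and $\|P_{nj}-p(t_{nj})\|_\infty\le r$ for all $n,j$ satisfies $$\|Y_{nj}-y(t_{nj})\|_\infty+h\,\|P_{nj}-p(t_{nj})\|_\infty\le M\,h^s,\qquad n=0,\dots,N,\ j=1,\dots,s.$$ That is, the state has global order $s$ and the adjoint has order $s-1$. -/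

import Mathlib

open Matrix Set Topology

noncomputable section

/-! ### Peer triplets and their algebraic conditions -/

/-- The coefficients of an `s`-stage Peer triplet: the common nodes `c`, the starting method
`(A0, K0, a, b)`, the standard method `(A, B, K)`, the end method `(AN, BN, KN)`, the weights `w`
of the end point evaluation `y_h(T)` and the weights `v` of the interpolant `p_h(0)`. -/
structure PeerTriplet (s : ℕ) where
  c : Fin s → ℝ
  a : Fin s → ℝ
  b : Fin s → ℝ
  w : Fin s → ℝ
  v : Fin s → ℝ
  A0 : Matrix (Fin s) (Fin s) ℝ
  K0 : Matrix (Fin s) (Fin s) ℝ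
  A : Matrix (Fin s) (Fin s) ℝ
  B : Matrix (Fin s) (Fin s) ℝ
  K : Matrix (Fin s) (Fin s) ℝ
  AN : Matrix (Fin s) (Fin s) ℝ
  BN : Matrix (Fin s) (Fin s) ℝ
  KN : Matrix (Fin s) (Fin s) ℝ

/-- The Vandermonde matrix `V_q = (𝟙, c, c², …, c^(q-1))`. -/
def vand {s : ℕ} (c : Fin s → ℝ) (q : ℕ) : Matrix (Fin s) (Fin q) ℝ :=
  Matrix.of fun i j => c i ^ (j : ℕ)

/-- The upper triangular Pascal matrix; with indices from `0` its entries are `j choose i`. -/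
def pascal (q : ℕ) : Matrix (Fin q) (Fin q) ℝ :=
  Matrix.of fun i j => (Nat.choose (j : ℕ) (i : ℕ) : ℝ)

/-- The nilpotent matrix `(i δ_{i+1,j})`, `i, j = 1, …, q`; here the indices start from `0`. -/
def nilE (q : ℕ) : Matrix (Fin q) (Fin q) ℝ :=
  Matrix.of fun i j => if (i : ℕ) + 1 = (j : ℕ) then ((i : ℕ) : ℝ) + 1 else 0

/-- The coordinate vector with a one at the (zero-based) position `k`. -/
def coordVec (q k : ℕ) : Fin q → ℝ := fun j => if (j : ℕ) = k then 1 else 0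

namespace PeerTriplet

variable {s : ℕ}

/-- All matrices `A_n` and `K_n` are nonsingular, and `K` of the standard method is diagonal
(the matrices `K0` and `KN` of the boundary methods may be full). -/
structure Admissible (θ : PeerTriplet s) : Prop where
  A0_unit : IsUnit θ.A0.det
  A_unit : IsUnit θ.A.det
  AN_unit : IsUnit θ.AN.det
  K0_unit : IsUnit θ.K0.det
  K_unit : IsUnit θ.K.det
  KN_unit : IsUnit θ.KN.det
  K_diag : θ.K.IsDiag

/-- The combined order conditions with local order `s` for the state and `s - 1` for the
adjoint: the forward conditions, the interpolation condition on `v`, the adjoint conditions, the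
one-leg conditions for full matrices `K0`, `KN`, and the compatibility conditions (the third of
which belongs to methods with at least four stages). -/
structure OrderConditions (θ : PeerTriplet s) : Prop where
  fwd_start : θ.A0 * vand θ.c s =
    vecMulVec θ.a (coordVec s 0) + vecMulVec θ.b (coordVec s 1) + θ.K0 * vand θ.c s * nilE s
  fwd_standard : θ.A * vand θ.c s =
    θ.B * vand θ.c s * (pascal s)⁻¹ + θ.K * vand θ.c s * nilE s
  fwd_last : θ.AN * vand θ.c s =
    θ.BN * vand θ.c s * (pascal s)⁻¹ + θ.KN * vand θ.c s * nilE s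
  fwd_end : θ.w ᵥ* vand θ.c s = 1
  adj_init : θ.v ᵥ* vand θ.c (s - 1) = coordVec (s - 1) 0
  adj_start : θ.A0ᵀ * vand θ.c (s - 1) =
    θ.Bᵀ * vand θ.c (s - 1) * pascal (s - 1) - θ.K0ᵀ * vand θ.c (s - 1) * nilE (s - 1)
  adj_standard : θ.Aᵀ * vand θ.c (s - 1) =
    θ.Bᵀ * vand θ.c (s - 1) * pascal (s - 1) - θ.Kᵀ * vand θ.c (s - 1) * nilE (s - 1)
  adj_last : θ.Aᵀ * vand θ.c (s - 1) =
    θ.BNᵀ * vand θ.c (s - 1) * pascal (s - 1) - θ.Kᵀ * vand θ.c (s - 1) * nilE (s - 1)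
  adj_end : θ.ANᵀ * vand θ.c (s - 1) =
    vecMulVec θ.w 1 - θ.KNᵀ * vand θ.c (s - 1) * nilE (s - 1)
  oneleg_start : ∀ j, ∑ i, (θ.c i - θ.c j) * θ.K0 i j = 0
  oneleg_end : ∀ j, ∑ i, (θ.c i - θ.c j) * θ.KN i j = 0
  compat_zero : (1 : Fin s → ℝ) ⬝ᵥ (θ.B *ᵥ 1) = 1
  compat_one : (1 : Fin s → ℝ) ⬝ᵥ (θ.B *ᵥ θ.c) - θ.c ⬝ᵥ (θ.B *ᵥ 1) = 1
  compat_two : 4 ≤ s → (1 : Fin s → ℝ) ⬝ᵥ (θ.B *ᵥ (θ.c ^ 2)) - 2 * (θ.c ⬝ᵥ (θ.B *ᵥ θ.c))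
    + (θ.c ^ 2) ⬝ᵥ (θ.B *ᵥ 1) = 1

/-- The two superconvergence conditions on the standard method. -/
structure Superconvergence (θ : PeerTriplet s) : Prop where
  fwd : (1 : Fin s → ℝ) ⬝ᵥ (θ.A *ᵥ (θ.c ^ s) - θ.B *ᵥ ((θ.c - 1) ^ s)
    - (s : ℝ) • (θ.K *ᵥ (θ.c ^ (s - 1)))) = 0
  adj : (1 : Fin s → ℝ) ⬝ᵥ (θ.Aᵀ *ᵥ (θ.c ^ (s - 1)) - θ.Bᵀ *ᵥ ((θ.c + 1) ^ (s - 1))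
    + ((s : ℝ) - 1) • (θ.K *ᵥ (θ.c ^ (s - 2)))) = 0

/-- The coefficient matrices `A_n` of a triplet on a grid with the intervals `0, …, N`. -/
def AA (θ : PeerTriplet s) (N n : ℕ) : Matrix (Fin s) (Fin s) ℝ :=
  if n = 0 then θ.A0 else if n = N then θ.AN else θ.A

/-- The coefficient matrices `B_n`, `1 ≤ n ≤ N`. -/
def BB (θ : PeerTriplet s) (N n : ℕ) : Matrix (Fin s) (Fin s) ℝ :=
  if n = N then θ.BN else θ.B

/-- The coefficient matrices `K_n`, `0 ≤ n ≤ N`. -/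
def KK (θ : PeerTriplet s) (N n : ℕ) : Matrix (Fin s) (Fin s) ℝ :=
  if n = 0 then θ.K0 else if n = N then θ.KN else θ.K

end PeerTriplet

/-- The eigenvalues of `M`, counted with multiplicity, satisfy `1 = λ₁ > |λ₂| ≥ … ≥ |λ_s|`. -/
def OneStrictlyDominant {s : ℕ} (M : Matrix (Fin s) (Fin s) ℝ) : Prop :=
  (M.map (algebraMap ℝ ℂ)).charpoly.rootMultiplicity 1 = 1 ∧
    ∀ μ : ℂ, (M.map (algebraMap ℝ ℂ)).charpoly.IsRoot μ → μ ≠ 1 → ‖μ‖ < 1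

/-! ### The optimal control problem and its boundary value problem

States and adjoints live in `Fin m → ℝ` and controls in `Fin d → ℝ`, with the maximum norm.
`f` is the right-hand side of the state equation, `C` the objective function, and `u` the map that
gives the control in terms of state and adjoint. -/

section Problem

variable {m d : ℕ}

/-- The gradient of the objective function. -/
def gradC (C : (Fin m → ℝ) → ℝ) (x : Fin m → ℝ) : Fin m → ℝ :=
  fun i => fderiv ℝ C x (Pi.single i 1)

/-- The product `(∇_y f(x, v))ᵀ q` with the transposed Jacobian. -/
def jacT (f : (Fin m → ℝ) → (Fin d → ℝ) → (Fin m → ℝ)) (x : Fin m → ℝ) (v : Fin d → ℝ)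
    (q : Fin m → ℝ) : Fin m → ℝ :=
  fun i => q ⬝ᵥ (fderiv ℝ (fun x' => f x' v) x (Pi.single i 1))

/-- The source function `g(x, q) = f(x, u(x, q))` of the state equation. -/
def srcG (f : (Fin m → ℝ) → (Fin d → ℝ) → (Fin m → ℝ))
    (u : (Fin m → ℝ) → (Fin m → ℝ) → (Fin d → ℝ)) (x q : Fin m → ℝ) : Fin m → ℝ :=
  f x (u x q)

/-- The source function `φ(x, q) = -∇_y f(x, u(x, q))ᵀ q` of the adjoint equation. -/
def srcPhi (f : (Fin m → ℝ) → (Fin d → ℝ) → (Fin m → ℝ))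
    (u : (Fin m → ℝ) → (Fin m → ℝ) → (Fin d → ℝ)) (x q : Fin m → ℝ) : Fin m → ℝ :=
  -jacT f x (u x q) q

/-- `v` is a locally unique minimizer of `H` over `Uad`. -/
def IsLocallyUniqueMinimizer (Uad : Set (Fin d → ℝ)) (H : (Fin d → ℝ) → ℝ) (v : Fin d → ℝ) :
    Prop :=
  v ∈ Uad ∧ ∀ᶠ v' in 𝓝[Uad \ {v}] v, H v < H v'

/-- `(y, p)` solves the two-point boundary value problem `y' = g(y, p)`, `y(0) = y0`,
`p' = φ(y, p)`, `p(T) = ∇C(y(T))`, with the differential equations holding on `[-δ, T + δ]`. -/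
structure SolvesBVP (f : (Fin m → ℝ) → (Fin d → ℝ) → (Fin m → ℝ)) (C : (Fin m → ℝ) → ℝ)
    (u : (Fin m → ℝ) → (Fin m → ℝ) → (Fin d → ℝ)) (y0 : Fin m → ℝ) (T δ : ℝ)
    (y p : ℝ → Fin m → ℝ) : Prop where
  ode_y : ∀ t ∈ Icc (-δ) (T + δ),
    HasDerivWithinAt y (srcG f u (y t) (p t)) (Icc (-δ) (T + δ)) t
  ode_p : ∀ t ∈ Icc (-δ) (T + δ),
    HasDerivWithinAt p (srcPhi f u (y t) (p t)) (Icc (-δ) (T + δ)) t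
  init : y 0 = y0
  final : p T = gradC C (y T)

/-- The coercivity assumption (strong second-order condition) along `(y, p)` with the control
`t ↦ u (y t) (p t)`: the second variation, with the Hamiltonian `pᵀ f` and the objective function
`C`, is coercive in the control on all solutions `(ω, ν)` of the linearized state equation with
`ω(0) = 0` and control variations `ν` with values in `Uad - Uad`. -/
def Coercive (f : (Fin m → ℝ) → (Fin d → ℝ) → (Fin m → ℝ)) (C : (Fin m → ℝ) → ℝ)
    (Uad : Set (Fin d → ℝ)) (u : (Fin m → ℝ) → (Fin m → ℝ) → (Fin d → ℝ)) (T : ℝ)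
    (y p : ℝ → Fin m → ℝ) : Prop :=
  ∃ α : ℝ, 0 < α ∧ ∀ (ω : ℝ → Fin m → ℝ) (ν : ℝ → Fin d → ℝ),
    ContinuousOn ν (Icc 0 T) →
    (∀ t ∈ Icc 0 T, ∃ v₁ ∈ Uad, ∃ v₂ ∈ Uad, ν t = v₁ - v₂) →
    ω 0 = 0 →
    (∀ t ∈ Icc 0 T, HasDerivWithinAt ω
      (fderiv ℝ (Function.uncurry f) (y t, u (y t) (p t)) (ω t, ν t)) (Icc 0 T) t) →
    α * ∫ t in (0 : ℝ)..T, ν t ⬝ᵥ ν t ≤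
      iteratedFDeriv ℝ 2 C (y T) ![ω T, ω T] +
      ∫ t in (0 : ℝ)..T,
        iteratedFDeriv ℝ 2 (fun z : (Fin m → ℝ) × (Fin d → ℝ) => p t ⬝ᵥ f z.1 z.2)
          (y t, u (y t) (p t)) ![(ω t, ν t), (ω t, ν t)]

/-! ### The discrete boundary value problem -/

/-- The action of `M ⊗ I` on a long vector of stages. -/
def stageMul {s : ℕ} (M : Matrix (Fin s) (Fin s) ℝ) (Z : Fin s → Fin m → ℝ) :
    Fin s → Fin m → ℝ :=
  fun i => ∑ j, M i j • Z j

/-- The evaluation `(rᵀ ⊗ I) Z`. -/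
def stageDot {s : ℕ} (r : Fin s → ℝ) (Z : Fin s → Fin m → ℝ) : Fin m → ℝ :=
  ∑ j, r j • Z j

/-- The long vector `r ⊗ x`. -/
def stageTensor {s : ℕ} (r : Fin s → ℝ) (x : Fin m → ℝ) : Fin s → Fin m → ℝ :=
  fun i => r i • x

/-- The stage vector `G(Y_n, P_n) = (g(Y_ni, P_ni))_i`. -/
def stageG {s : ℕ} (f : (Fin m → ℝ) → (Fin d → ℝ) → (Fin m → ℝ))
    (u : (Fin m → ℝ) → (Fin m → ℝ) → (Fin d → ℝ)) (Z Q : Fin s → Fin m → ℝ) :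
    Fin s → Fin m → ℝ :=
  fun i => srcG f u (Z i) (Q i)

/-- The stage vector `Φ_n = (-∇_y f(Y_ni, U_ni)ᵀ (K_nᵀ P_n)_i)_i` with the stage controls
`U_ni = u(Y_ni, P_ni)`. -/
def stagePhi {s : ℕ} (f : (Fin m → ℝ) → (Fin d → ℝ) → (Fin m → ℝ))
    (u : (Fin m → ℝ) → (Fin m → ℝ) → (Fin d → ℝ)) (M : Matrix (Fin s) (Fin s) ℝ)
    (Z Q : Fin s → Fin m → ℝ) : Fin s → Fin m → ℝ :=
  fun i => -jacT f (Z i) (u (Z i) (Q i)) (stageMul Mᵀ Q i)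

/-- `(Y, P)` with the stages `Y n j`, `P n j`, `0 ≤ n ≤ N`, solves the discrete boundary value
problem of the Peer triplet with step size `h`. -/
structure IsPeerSolution {s : ℕ} (θ : PeerTriplet s)
    (f : (Fin m → ℝ) → (Fin d → ℝ) → (Fin m → ℝ)) (C : (Fin m → ℝ) → ℝ)
    (u : (Fin m → ℝ) → (Fin m → ℝ) → (Fin d → ℝ)) (y0 : Fin m → ℝ) (h : ℝ) (N : ℕ)
    (Y P : ℕ → Fin s → Fin m → ℝ) : Prop where
  fwd_start : stageMul (θ.AA N 0) (Y 0) =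
    stageTensor θ.a y0 + h • stageTensor θ.b (srcG f u y0 (stageDot θ.v (P 0)))
      + h • stageMul (θ.KK N 0) (stageG f u (Y 0) (P 0))
  fwd_step : ∀ n, 1 ≤ n → n ≤ N → stageMul (θ.AA N n) (Y n) =
    stageMul (θ.BB N n) (Y (n - 1)) + h • stageMul (θ.KK N n) (stageG f u (Y n) (P n))
  adj_step : ∀ n, n < N → stageMul (θ.AA N n)ᵀ (P n) =
    stageMul (θ.BB N (n + 1))ᵀ (P (n + 1)) - h • stagePhi f u (θ.KK N n) (Y n) (P n)
  adj_end : stageMul (θ.AA N N)ᵀ (P N) =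
    stageTensor θ.w (gradC C (stageDot θ.w (Y N))) - h • stagePhi f u (θ.KK N N) (Y N) (P N)

end Problem

end

/-!
The proof is the classical scheme "consistency + stability ⇒ convergence" with two refinements: the
reference values, to which the discrete adjoint is compared, carry a correction, and the stability
estimate weighs adjoint errors by `h`.

*Reference values.* The order conditions make the local errors of the adjoint equations only
`O(h ^ (s - 1))` in the interior of the grid, which by itself would spoil the order `s` of the
state. By the second superconvergence condition the leading coefficient vector of these local
errors, `adjDefect`, is orthogonal to `𝟙`; hence it is in the range of the singular matrix
`(A - B)ᵀ`, and there is a vector `ρ` with `(A - B)ᵀ ρ = -adjDefect`, normalized by `𝟙ᵀ K ρ = 0`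
(`IsCorrector`, `exists_isCorrector`). The adjoint stages are compared with
`p + h ^ (s - 1) / (s - 1)! • ρ ⊗ p^(s - 1)` at the nodes (`correctedAdjoint`), the state stages
with `y`. At these values the standard equations have residuals `O(h ^ s)` with means
`O(h ^ (s + 1))`. For the state this is the first superconvergence condition together with
`𝟙ᵀ K ρ = 0` (`exists_forward_residual`). For the adjoint it needs the identity
`momentDefect_degree` between the two moments of degree `s` that the order conditions leave open
(`IsCorrector.mean_adjDefect_succ`, `exists_adjoint_residual`). Near the ends of the interval
the adjoint equations keep residuals of order `s - 1`, but those of the last two equations cancel in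
the mean (`IsCorrector.mean_adjDefect_end`, `exists_adjoint_mean_end`). If the boundary methods have
full matrices `K_0`, `K_N`, the control in `Φ` is evaluated at another node than the adjoint; the
one-leg conditions remove the first-order effect of this, and for four stages the second-order effect
vanishes in the mean by `form_KN_sq`.

*The continuous problem.* For a solution `(ω, π)` of the homogeneous linearized boundary value
problem the control direction is `ν = Du(y, p)(ω, π)`, and the quadratic form of the coercivity
condition equals the integral of a quantity that is nonpositive since `u(y, p)` minimizes the
Hamiltonian over a convex set (`fderiv_control_nonpos`). Hence `ν = 0`, then `ω = 0` and `π = 0`: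
the linearized problem is uniquely solvable (`Coercive.uniquelySolvable`).

*Stability.* The eigenvalue condition splits the errors into the means `𝟙ᵀ A E`, `𝟙ᵀ Aᵀ e` and
parasitic components, on which the recursions contract (`StrictlyStable`). The means satisfy a
one-step discretization of the linearized problem, whose stability follows from unique solvability
(`UniquelySolvable.exists_discrete_bound`). Parasitic state components are bounded in the maximum
norm. Those of the adjoint are bounded in the `ℓ¹` norm weighted with `h`, so that a boundary layer of
height `h ^ (s - 1)` costs only `h ^ s`. The result is `StrictlyStable.exists_discrete_bound`: state
errors, and `h` times adjoint errors, are bounded by the defects.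

The errors of a Peer solution near `(y, p)` satisfy the perturbed linear equations required there
with defects `O(h ^ s)` (`exists_perturbedLinearization`); the correction itself contributes
`h * O(h ^ (s - 1))` to the weighted adjoint error.
-/

noncomputable section

/-! ### Stage operators -/

section StageOperators

variable {s m : ℕ}

lemma stageMul_add (M : Matrix (Fin s) (Fin s) ℝ) (Z W : Fin s → Fin m → ℝ) :
    stageMul M (Z + W) = stageMul M Z + stageMul M W := by
  funext i; simp [stageMul, Finset.sum_add_distrib]

lemma stageMul_smul (M : Matrix (Fin s) (Fin s) ℝ) (r : ℝ) (Z : Fin s → Fin m → ℝ) :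
    stageMul M (r • Z) = r • stageMul M Z := by
  funext i; simp [stageMul, Finset.smul_sum, smul_comm r]

/-- The operator `M ⊗ I` as a continuous linear map. -/
def stageMulL (M : Matrix (Fin s) (Fin s) ℝ) :
    (Fin s → Fin m → ℝ) →L[ℝ] (Fin s → Fin m → ℝ) :=
  LinearMap.toContinuousLinearMap
    { toFun := stageMul M, map_add' := stageMul_add M, map_smul' := stageMul_smul M }

lemma stageMul_sub (M : Matrix (Fin s) (Fin s) ℝ) (Z W : Fin s → Fin m → ℝ) :
    stageMul M (Z - W) = stageMul M Z - stageMul M W := map_sub (stageMulL M) Z W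

lemma stageMul_sum {ι : Type*} (M : Matrix (Fin s) (Fin s) ℝ) (t : Finset ι)
    (Z : ι → Fin s → Fin m → ℝ) :
    stageMul M (∑ k ∈ t, Z k) = ∑ k ∈ t, stageMul M (Z k) := map_sum (stageMulL M) Z t

lemma stageMul_norm_le (M : Matrix (Fin s) (Fin s) ℝ) (Z : Fin s → Fin m → ℝ) :
    ‖stageMul M Z‖ ≤ ‖stageMulL (m := m) M‖ * ‖Z‖ := (stageMulL M).le_opNorm Z

lemma sub_stageMul (M L : Matrix (Fin s) (Fin s) ℝ) (Z : Fin s → Fin m → ℝ) :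
    stageMul (M - L) Z = stageMul M Z - stageMul L Z := by
  funext i; simp [stageMul, Finset.sum_sub_distrib, sub_smul]

lemma stageMul_mul (M L : Matrix (Fin s) (Fin s) ℝ) (Z : Fin s → Fin m → ℝ) :
    stageMul (M * L) Z = stageMul M (stageMul L Z) := by
  funext i
  simp only [stageMul, Matrix.mul_apply, Finset.sum_smul, Finset.smul_sum, mul_smul]
  rw [Finset.sum_comm]

@[simp] lemma one_stageMul (Z : Fin s → Fin m → ℝ) :
    stageMul (1 : Matrix (Fin s) (Fin s) ℝ) Z = Z := by
  funext i
  simp [stageMul, Matrix.one_apply, ite_smul]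

lemma stageMul_stageTensor (M : Matrix (Fin s) (Fin s) ℝ) (a : Fin s → ℝ) (x : Fin m → ℝ) :
    stageMul M (stageTensor a x) = stageTensor (M *ᵥ a) x := by
  funext i
  simp [stageMul, stageTensor, Matrix.mulVec, dotProduct, Finset.sum_smul, mul_smul]

lemma stageDot_stageTensor (r a : Fin s → ℝ) (x : Fin m → ℝ) :
    stageDot r (stageTensor a x) = (r ⬝ᵥ a) • x := by
  simp [stageDot, stageTensor, dotProduct, Finset.sum_smul, mul_smul]

lemma stageDot_stageMul (r : Fin s → ℝ) (M : Matrix (Fin s) (Fin s) ℝ)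
    (Z : Fin s → Fin m → ℝ) : stageDot r (stageMul M Z) = stageDot (r ᵥ* M) Z := by
  simp only [stageDot, stageMul, Matrix.vecMul, dotProduct, Finset.sum_smul, Finset.smul_sum,
    mul_smul]
  rw [Finset.sum_comm]

lemma stageDot_add (r : Fin s → ℝ) (Z W : Fin s → Fin m → ℝ) :
    stageDot r (Z + W) = stageDot r Z + stageDot r W := by
  simp [stageDot, Finset.sum_add_distrib]

lemma stageDot_smul (r : Fin s → ℝ) (t : ℝ) (Z : Fin s → Fin m → ℝ) :
    stageDot r (t • Z) = t • stageDot r Z := by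
  simp [stageDot, Finset.smul_sum, smul_comm t]

/-- The evaluation `rᵀ ⊗ I` as a continuous linear map. -/
def stageDotL (r : Fin s → ℝ) : (Fin s → Fin m → ℝ) →L[ℝ] (Fin m → ℝ) :=
  LinearMap.toContinuousLinearMap
    { toFun := stageDot r, map_add' := stageDot_add r, map_smul' := stageDot_smul r }

lemma stageDot_sub (r : Fin s → ℝ) (Z W : Fin s → Fin m → ℝ) :
    stageDot r (Z - W) = stageDot r Z - stageDot r W := map_sub (stageDotL r) Z W

lemma stageDot_sum {ι : Type*} (r : Fin s → ℝ) (t : Finset ι) (Z : ι → Fin s → Fin m → ℝ) :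
    stageDot r (∑ k ∈ t, Z k) = ∑ k ∈ t, stageDot r (Z k) := map_sum (stageDotL r) Z t

lemma stageDot_norm_le (r : Fin s → ℝ) (Z : Fin s → Fin m → ℝ) :
    ‖stageDot r Z‖ ≤ ‖stageDotL (m := m) r‖ * ‖Z‖ := (stageDotL r).le_opNorm Z

lemma stageTensor_norm_le (a : Fin s → ℝ) (x : Fin m → ℝ) :
    ‖stageTensor a x‖ ≤ ‖a‖ * ‖x‖ := by
  refine (pi_norm_le_iff_of_nonneg (by positivity)).2 fun i => ?_
  simp only [stageTensor, norm_smul]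
  gcongr
  exact norm_le_pi_norm a i

lemma stageTensor_one_norm_le (x : Fin m → ℝ) :
    ‖stageTensor (1 : Fin s → ℝ) x‖ ≤ ‖x‖ :=
  (pi_norm_le_iff_of_nonneg (norm_nonneg x)).2 fun i => by simp [stageTensor]

lemma stageTensor_add (a : Fin s → ℝ) (x y : Fin m → ℝ) :
    stageTensor a (x + y) = stageTensor a x + stageTensor a y := by
  funext i; simp [stageTensor]

lemma stageTensor_sub (a : Fin s → ℝ) (x y : Fin m → ℝ) :
    stageTensor a (x - y) = stageTensor a x - stageTensor a y := by
  funext i; simp [stageTensor, smul_sub]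

lemma stageTensor_smul (a : Fin s → ℝ) (t : ℝ) (x : Fin m → ℝ) :
    stageTensor a (t • x) = t • stageTensor a x := by
  funext i; simp [stageTensor, smul_comm t]

lemma sub_stageTensor (a b : Fin s → ℝ) (x : Fin m → ℝ) :
    stageTensor (a - b) x = stageTensor a x - stageTensor b x := by
  funext i; simp [stageTensor, sub_smul]

lemma smul_stageTensor (t : ℝ) (a : Fin s → ℝ) (x : Fin m → ℝ) :
    stageTensor (t • a) x = t • stageTensor a x := by
  funext i; simp [stageTensor, mul_smul]

lemma stageMul_vecMulVec (a r : Fin s → ℝ) (Z : Fin s → Fin m → ℝ) :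
    stageMul (vecMulVec a r) Z = stageTensor a (stageDot r Z) := by
  funext i
  simp [stageMul, stageTensor, stageDot, vecMulVec_apply, Finset.smul_sum, mul_smul]

lemma stageMul_inv_cancel {M : Matrix (Fin s) (Fin s) ℝ} (hM : IsUnit M.det)
    (Z : Fin s → Fin m → ℝ) : stageMul M⁻¹ (stageMul M Z) = Z := by
  rw [← stageMul_mul, Matrix.nonsing_inv_mul _ hM, one_stageMul]

/-- A nonsingular matrix bounds a stage vector by its image. -/
lemma norm_le_of_isUnit_det {M : Matrix (Fin s) (Fin s) ℝ} (hM : IsUnit M.det)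
    (Z : Fin s → Fin m → ℝ) : ‖Z‖ ≤ ‖stageMulL (m := m) M⁻¹‖ * ‖stageMul M Z‖ := by
  conv_lhs => rw [← stageMul_inv_cancel hM Z]
  exact stageMul_norm_le _ _

lemma stageMul_norm_le_of_entry_le {M : Matrix (Fin s) (Fin s) ℝ} {c : ℝ}
    (hM : ∀ i j, |M i j| ≤ c) (Z : Fin s → Fin m → ℝ) : ‖stageMul M Z‖ ≤ s * c * ‖Z‖ := by
  rcases Nat.eq_zero_or_pos s with rfl | hs
  · rw [Subsingleton.elim (stageMul M Z) 0, norm_zero]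
    simp
  have hc : 0 ≤ c := (abs_nonneg _).trans (hM ⟨0, hs⟩ ⟨0, hs⟩)
  refine (pi_norm_le_iff_of_nonneg (by positivity)).2 fun i => ?_
  calc ‖stageMul M Z i‖ ≤ ∑ j, ‖M i j • Z j‖ := norm_sum_le _ _
    _ ≤ ∑ _j : Fin s, c * ‖Z‖ := by
        gcongr with j
        rw [norm_smul]
        exact mul_le_mul (hM i j) (norm_le_pi_norm Z j) (norm_nonneg _) hc
    _ = s * c * ‖Z‖ := by simp [mul_assoc]

end StageOperators

/-! ### Zero-stability of the standard method -/

section ZeroStability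

variable {s m : ℕ}

/-- The part `A⁻¹ B - 𝟙 𝟙ᵀ A` of `A⁻¹ B` complementary to the eigenvector `𝟙`. -/
def complPart (A B : Matrix (Fin s) (Fin s) ℝ) : Matrix (Fin s) (Fin s) ℝ :=
  A⁻¹ * B - vecMulVec (1 : Fin s → ℝ) ((1 : Fin s → ℝ) ᵥ* A)

/-- A pair `(A, B)` of the recursion `A Zₙ₊₁ = B Zₙ` for which `1` is an eigenvalue of `A⁻¹ B` with
right eigenvector `𝟙` and left eigenvector `𝟙ᵀ A`, normalized by `𝟙ᵀ A 𝟙 = 1`, and for which the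
powers of the complementary part `A⁻¹ B - 𝟙 𝟙ᵀ A` decay geometrically. -/
structure StrictlyStable (A B : Matrix (Fin s) (Fin s) ℝ) : Prop where
  unit : IsUnit A.det
  row : (1 : Fin s → ℝ) ᵥ* A = 1 ᵥ* B
  col : A *ᵥ 1 = B *ᵥ 1
  total : (1 : Fin s → ℝ) ⬝ᵥ (A *ᵥ 1) = 1
  decay : ∃ C q : ℝ, 0 ≤ C ∧ 0 ≤ q ∧ q < 1 ∧ ∀ k i j,
    |(complPart A B ^ k) i j| ≤ C * q ^ k

/-- The adjoint recursion, run backward in time, inherits strict stability. -/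
lemma StrictlyStable.transpose {A B : Matrix (Fin s) (Fin s) ℝ} (h : StrictlyStable A B) :
    StrictlyStable Aᵀ Bᵀ := by
  obtain ⟨C, q, hC, hq0, hq1, hd⟩ := h.decay
  refine ⟨by rw [det_transpose]; exact h.unit, ?_, ?_, ?_, ?_⟩
  · rw [vecMul_transpose, vecMul_transpose, h.col]
  · rw [mulVec_transpose, mulVec_transpose, h.row]
  · rw [mulVec_transpose, dotProduct_comm, ← dotProduct_mulVec, h.total]
  · set M := complPart A B with hM
    have hu : IsUnit Aᵀ.det := by rw [det_transpose]; exact h.unit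
    -- The complementary part of the transposed pair is similar to the transpose of that of `(A, B)`.
    have hsim : complPart Aᵀ Bᵀ = Aᵀ⁻¹ * Mᵀ * Aᵀ := by
      have h1 : Mᵀ * Aᵀ = Bᵀ - (vecMulVec (A *ᵥ 1) (1 ᵥ* A))ᵀ := by
        rw [← transpose_mul, ← transpose_sub, hM, complPart, mul_sub, ← mul_assoc,
          mul_nonsing_inv _ h.unit, one_mul, mul_vecMulVec]
      rw [complPart, mul_assoc, h1, mul_sub, transpose_vecMulVec, mul_vecMulVec, vecMul_transpose]
      congr 2
      rw [← mulVec_transpose, mulVec_mulVec, nonsing_inv_mul _ hu, one_mulVec]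
    have hpow : ∀ k, (Aᵀ⁻¹ * Mᵀ * Aᵀ) ^ k = Aᵀ⁻¹ * (M ^ k)ᵀ * Aᵀ := by
      intro k
      induction k with
      | zero => simp [nonsing_inv_mul _ hu]
      | succ k ih =>
        rw [pow_succ, ih, pow_succ', transpose_mul]
        simp only [mul_assoc]
        rw [← mul_assoc Aᵀ Aᵀ⁻¹, mul_nonsing_inv _ hu, one_mul]
    refine ⟨∑ i, ∑ j, ∑ k, ∑ l, |Aᵀ⁻¹ i j| * C * |Aᵀ k l|, q, ?_, hq0, hq1, fun k i j => ?_⟩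
    · positivity
    · rw [hsim, hpow]
      calc |(Aᵀ⁻¹ * (M ^ k)ᵀ * Aᵀ) i j|
          = |∑ b, ∑ a, Aᵀ⁻¹ i a * (M ^ k) b a * Aᵀ b j| := by
            simp only [Matrix.mul_apply, Finset.sum_mul, transpose_apply]
        _ ≤ ∑ b, ∑ a, |Aᵀ⁻¹ i a| * C * |Aᵀ b j| * q ^ k := by
            refine (Finset.abs_sum_le_sum_abs _ _).trans (Finset.sum_le_sum fun b _ => ?_)
            refine (Finset.abs_sum_le_sum_abs _ _).trans (Finset.sum_le_sum fun a _ => ?_)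
            rw [abs_mul, abs_mul]
            calc |Aᵀ⁻¹ i a| * |(M ^ k) b a| * |Aᵀ b j|
                ≤ |Aᵀ⁻¹ i a| * (C * q ^ k) * |Aᵀ b j| := by gcongr; exact hd k b a
              _ = _ := by ring
        _ = (∑ a, ∑ b, |Aᵀ⁻¹ i a| * C * |Aᵀ b j|) * q ^ k := by
            rw [Finset.sum_comm]
            simp only [Finset.sum_mul]
        _ ≤ (∑ i, ∑ j, ∑ k, ∑ l, |Aᵀ⁻¹ i j| * C * |Aᵀ k l|) * q ^ k := by
            refine mul_le_mul_of_nonneg_right ?_ (by positivity)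
            refine le_trans (Finset.sum_le_sum fun a _ => Finset.sum_le_sum fun b _ => ?_)
              (Finset.single_le_sum
                (f := fun i => ∑ j, ∑ k, ∑ l, |Aᵀ⁻¹ i j| * C * |Aᵀ k l|)
                (fun i _ => by positivity) (Finset.mem_univ i))
            exact Finset.single_le_sum (f := fun l => |Aᵀ⁻¹ i a| * C * |Aᵀ b l|)
              (fun l _ => by positivity) (Finset.mem_univ j)

/-- Subtracting `u vᵀ` from `M`, with `M u = u` and `vᵀ u = 1`, replaces the eigenvalue `1` by `0`. -/
lemma X_sub_one_mul_charpoly_sub_vecMulVec {K : Type*} [Field K] [Infinite K]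
    (M : Matrix (Fin s) (Fin s) K) (u v : Fin s → K) (hu : M *ᵥ u = u) (hv : v ⬝ᵥ u = 1) :
    (Polynomial.X - Polynomial.C 1) * (M - vecMulVec u v).charpoly =
      Polynomial.X * M.charpoly := by
  refine Polynomial.eq_of_infinite_eval_eq _ _ ((Set.finite_singleton (1 : K)).infinite_compl.mono
    fun x hx => ?_)
  have hx1 : x - 1 ≠ 0 := sub_ne_zero.2 hx
  simp only [mem_ofPred_eq, Polynomial.eval_mul, Polynomial.eval_sub, Polynomial.eval_X,
    Polynomial.eval_C, eval_charpoly]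
  have hfac : scalar (Fin s) x - (M - vecMulVec u v) =
      (scalar (Fin s) x - M) * (1 + vecMulVec ((x - 1)⁻¹ • u) v) := by
    rw [mul_add, mul_one, mul_vecMulVec, mulVec_smul, sub_mulVec, hu]
    have : (scalar (Fin s) x) *ᵥ u - u = (x - 1) • u := by
      rw [scalar_apply, sub_smul, one_smul]
      congr 1
      funext i
      simp [mulVec_diagonal]
    rw [this, smul_smul, inv_mul_cancel₀ hx1, one_smul]
    abel
  rw [hfac, det_mul, vecMulVec_eq Unit, det_one_add_replicateCol_mul_replicateRow,
    dotProduct_smul, hv]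
  rw [smul_eq_mul, mul_one]
  have h2 : (x - 1) * (1 + (x - 1)⁻¹) = x := by rw [mul_add, mul_inv_cancel₀ hx1]; ring
  linear_combination (scalar (Fin s) x - M).det * h2

/-- The entries of the powers of a complex matrix with spectrum in the open unit disc decay
geometrically. -/
lemma exists_pow_entry_le {M : Matrix (Fin s) (Fin s) ℂ}
    (hM : ∀ μ : ℂ, M.charpoly.IsRoot μ → ‖μ‖ < 1) :
    ∃ C q : ℝ, 0 ≤ C ∧ 0 ≤ q ∧ q < 1 ∧ ∀ k i j, ‖(M ^ k) i j‖ ≤ C * q ^ k := by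
  rcases Nat.eq_zero_or_pos s with rfl | hs
  · exact ⟨0, 0, le_rfl, le_rfl, one_pos, fun k i => i.elim0⟩
  have : Nonempty (Fin s) := ⟨⟨0, hs⟩⟩
  let _ := Matrix.linftyOpNormedRing (n := Fin s) (α := ℂ)
  let _ := Matrix.linftyOpNormedAlgebra (R := ℂ) (n := Fin s) (α := ℂ)
  have : CompleteSpace (Matrix (Fin s) (Fin s) ℂ) := FiniteDimensional.complete ℂ _
  have hentry : ∀ (L : Matrix (Fin s) (Fin s) ℂ) i j, ‖L i j‖ ≤ ‖L‖ := by
    intro L i j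
    have h1 : ‖L i j‖₊ ≤ ‖L‖₊ := by
      rw [Matrix.linfty_opNNNorm_def]
      exact (Finset.single_le_sum (f := fun j => ‖L i j‖₊) (fun _ _ => zero_le)
        (Finset.mem_univ j)).trans
        (Finset.le_sup (f := fun i => ∑ j, ‖L i j‖₊) (Finset.mem_univ i))
    exact_mod_cast h1
  have hrad : spectralRadius ℂ M < (1 : NNReal) := by
    refine spectrum.spectralRadius_lt_of_forall_lt M fun z hz => ?_
    exact_mod_cast hM z (Matrix.mem_spectrum_iff_isRoot_charpoly.1 hz)
  obtain ⟨q, hq, hq1⟩ := ENNReal.lt_iff_exists_nnreal_btwn.1 hrad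
  have hq1' : q < 1 := by exact_mod_cast hq1
  have hev := (spectrum.pow_nnnorm_pow_one_div_tendsto_nhds_spectralRadius M).eventually
    (gt_mem_nhds hq)
  obtain ⟨n0, hn0⟩ := Filter.eventually_atTop.1 hev
  have hbig : ∀ n, n0 + 1 ≤ n → ‖M ^ n‖ ≤ (q : ℝ) ^ n := by
    intro n hn
    have h1 := hn0 n (by omega)
    have hnpos : (0 : ℝ) < n := by exact_mod_cast (by omega : 0 < n)
    have h2 : (‖M ^ n‖₊ : ENNReal) ≤ (q : ENNReal) ^ n := by
      have h3 := ENNReal.rpow_le_rpow h1.le hnpos.le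
      rwa [← ENNReal.rpow_mul, one_div, inv_mul_cancel₀ hnpos.ne', ENNReal.rpow_one,
        ENNReal.rpow_natCast] at h3
    have h3 : ‖M ^ n‖₊ ≤ q ^ n := by exact_mod_cast h2
    exact_mod_cast h3
  -- A positive rate is needed to absorb the finitely many initial powers.
  obtain ⟨p, hqp, hp1⟩ := exists_between hq1'
  have hp0 : (0 : ℝ) < p := lt_of_le_of_lt q.2 (by exact_mod_cast hqp)
  refine ⟨1 + ∑ n ∈ Finset.range (n0 + 1), ‖M ^ n‖ / (p : ℝ) ^ n, p, by positivity, p.2,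
    by exact_mod_cast hp1, fun k i j => (hentry _ i j).trans ?_⟩
  rcases lt_or_ge k (n0 + 1) with hk | hk
  · have h1 : ‖M ^ k‖ / (p : ℝ) ^ k ≤ ∑ n ∈ Finset.range (n0 + 1), ‖M ^ n‖ / (p : ℝ) ^ n :=
      Finset.single_le_sum (f := fun n => ‖M ^ n‖ / (p : ℝ) ^ n) (fun n _ => by positivity)
        (Finset.mem_range.2 hk)
    calc ‖M ^ k‖ = ‖M ^ k‖ / (p : ℝ) ^ k * (p : ℝ) ^ k := by field_simp
      _ ≤ _ := by gcongr; linarith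
  · calc ‖M ^ k‖ ≤ (q : ℝ) ^ k := hbig k hk
      _ ≤ 1 * (p : ℝ) ^ k := by
        rw [one_mul]; gcongr
      _ ≤ _ := by
        gcongr
        have : 0 ≤ ∑ n ∈ Finset.range (n0 + 1), ‖M ^ n‖ / (p : ℝ) ^ n := by positivity
        linarith

/-- The spectral condition on the standard method yields strict stability. -/
lemma strictlyStable_of_oneStrictlyDominant {A B : Matrix (Fin s) (Fin s) ℝ}
    (hA : IsUnit A.det) (hrow : (1 : Fin s → ℝ) ᵥ* A = 1 ᵥ* B) (hcol : A *ᵥ 1 = B *ᵥ 1)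
    (htot : (1 : Fin s → ℝ) ⬝ᵥ (A *ᵥ 1) = 1) (hdom : OneStrictlyDominant (A⁻¹ * B)) :
    StrictlyStable A B := by
  refine ⟨hA, hrow, hcol, htot, ?_⟩
  set φ := algebraMap ℝ ℂ
  set M := (A⁻¹ * B).map φ with hM
  set v : Fin s → ℂ := fun j => φ ((1 ᵥ* A) j) with hv
  have hMu : M *ᵥ 1 = 1 := by
    have h1 : (A⁻¹ * B) *ᵥ 1 = 1 := by
      rw [← mulVec_mulVec, ← hcol, mulVec_mulVec, nonsing_inv_mul _ hA, one_mulVec]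
    funext i
    have h2 := congrArg φ (congrFun h1 i)
    rw [RingHom.map_mulVec] at h2
    simpa [hM, Function.comp_def, Pi.one_def] using h2
  have hvu : v ⬝ᵥ 1 = 1 := by
    rw [dotProduct_mulVec] at htot
    have h2 := congrArg φ htot
    rw [RingHom.map_dotProduct] at h2
    simpa [hv, Function.comp_def, Pi.one_def] using h2
  have hmap : (complPart A B).map φ = M - vecMulVec 1 v := by
    ext i j
    simp [hM, hv, complPart, φ]
  have hpoly := X_sub_one_mul_charpoly_sub_vecMulVec M 1 v hMu hvu
  have hroot : ∀ μ : ℂ, (M - vecMulVec 1 v).charpoly.IsRoot μ → ‖μ‖ < 1 := by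
    intro μ hμ
    by_cases hμ0 : μ = 0
    · simp [hμ0]
    have hne : M.charpoly ≠ 0 := (charpoly_monic M).ne_zero
    have hne' : (M - vecMulVec 1 v).charpoly ≠ 0 := (charpoly_monic _).ne_zero
    by_cases hμ1 : μ = 1
    · -- At `1` the two sides of `hpoly` would have different root multiplicities.
      exfalso
      subst hμ1
      have h1 := congrArg (Polynomial.rootMultiplicity 1) hpoly
      rw [Polynomial.rootMultiplicity_mul
          (mul_ne_zero (Polynomial.X_sub_C_ne_zero 1) hne'),
        Polynomial.rootMultiplicity_mul (mul_ne_zero Polynomial.X_ne_zero hne),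
        Polynomial.rootMultiplicity_X_sub_C_self, hdom.1,
        Polynomial.rootMultiplicity_eq_zero (p := Polynomial.X) (by simp)] at h1
      have h2 := (Polynomial.rootMultiplicity_pos hne').2 hμ
      omega
    · have h1 := congrArg (Polynomial.eval μ) hpoly
      rw [Polynomial.eval_mul, hμ, mul_zero, Polynomial.eval_mul, Polynomial.eval_X] at h1
      exact hdom.2 μ ((mul_eq_zero.1 h1.symm).resolve_left hμ0) hμ1
  obtain ⟨C, q, hC, hq0, hq1, hb⟩ := exists_pow_entry_le hroot
  refine ⟨C, q, hC, hq0, hq1, fun k i j => ?_⟩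
  have h1 := hb k i j
  rw [← hmap] at h1
  have h2 : ((complPart A B).map φ) ^ k = (complPart A B ^ k).map φ := by
    rw [← RingHom.mapMatrix_apply, ← map_pow, RingHom.mapMatrix_apply]
  rw [h2] at h1
  simpa [φ] using h1

/-- The majorant `Sₙ₊₁ = q Sₙ + rₙ₊₁` of a recursion with a geometrically decaying propagator. -/
def geomMajorant (q S0 : ℝ) (r : ℕ → ℝ) : ℕ → ℝ
  | 0 => S0
  | n + 1 => q * geomMajorant q S0 r n + r (n + 1)

lemma geomMajorant_nonneg {q S0 : ℝ} {r : ℕ → ℝ} (hq : 0 ≤ q) (hS : 0 ≤ S0) (hr : ∀ n, 0 ≤ r n) :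
    ∀ n, 0 ≤ geomMajorant q S0 r n
  | 0 => hS
  | n + 1 => add_nonneg (mul_nonneg hq (geomMajorant_nonneg hq hS hr n)) (hr _)

lemma geomMajorant_le {q S0 ρ : ℝ} {r : ℕ → ℝ} (hq : 0 ≤ q) (hq1 : q < 1) (hS : 0 ≤ S0)
    (hρ : 0 ≤ ρ) {L : ℕ} (hr : ∀ n, 1 ≤ n → n ≤ L → r n ≤ ρ) :
    ∀ n ≤ L, geomMajorant q S0 r n ≤ (1 - q)⁻¹ * (S0 + ρ) := by
  have h1 : (0 : ℝ) < 1 - q := by linarith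
  have hinv : 1 ≤ (1 - q)⁻¹ := (one_le_inv₀ h1).2 (by linarith)
  intro n
  induction n with
  | zero => intro _; simp only [geomMajorant]; nlinarith
  | succ n ih =>
    intro hn
    have h2 := ih (by omega)
    have h3 := hr (n + 1) (by omega) hn
    simp only [geomMajorant]
    calc q * geomMajorant q S0 r n + r (n + 1)
        ≤ q * ((1 - q)⁻¹ * (S0 + ρ)) + (S0 + ρ) := by gcongr; linarith
      _ = (1 - q)⁻¹ * (S0 + ρ) := by field_simp; ring

lemma sum_geomMajorant_le {q S0 : ℝ} {r : ℕ → ℝ} (hq : 0 ≤ q) (hq1 : q < 1) (hS : 0 ≤ S0)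
    (hr : ∀ n, 0 ≤ r n) (L : ℕ) :
    ∑ n ∈ Finset.range (L + 1), geomMajorant q S0 r n ≤
      (1 - q)⁻¹ * (S0 + ∑ n ∈ Finset.range L, r (n + 1)) := by
  have h1 : (0 : ℝ) < 1 - q := by linarith
  have key : (1 - q) * ∑ n ∈ Finset.range (L + 1), geomMajorant q S0 r n +
      q * geomMajorant q S0 r L = S0 + ∑ n ∈ Finset.range L, r (n + 1) := by
    induction L with
    | zero => simp [geomMajorant]; ring
    | succ L ih =>
      rw [Finset.sum_range_succ, Finset.sum_range_succ (fun n => r (n + 1)), ← add_assoc, ← ih]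
      simp only [geomMajorant]
      ring
  rw [← key, inv_mul_eq_div, le_div_iff₀ h1]
  have := mul_nonneg hq (geomMajorant_nonneg hq hS hr L)
  linarith

/-- The difference of a stage vector and the constant stage vector of its mean `𝟙ᵀ A Z`. -/
def parasitic (A : Matrix (Fin s) (Fin s) ℝ) (Z : Fin s → Fin m → ℝ) : Fin s → Fin m → ℝ :=
  Z - stageTensor 1 (stageDot (1 ᵥ* A) Z)

lemma StrictlyStable.mean_eq {A B : Matrix (Fin s) (Fin s) ℝ} (h : StrictlyStable A B)
    (Z Z' : Fin s → Fin m → ℝ) :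
    stageDot (1 ᵥ* A) Z' = stageDot (1 ᵥ* A) Z + stageDot 1 (stageMul A Z' - stageMul B Z) := by
  rw [stageDot_sub, stageDot_stageMul, stageDot_stageMul, h.row]
  abel

lemma StrictlyStable.complPart_mulVec_one {A B : Matrix (Fin s) (Fin s) ℝ}
    (h : StrictlyStable A B) : complPart A B *ᵥ 1 = 0 := by
  have h1 : A⁻¹ *ᵥ (B *ᵥ 1) = 1 := by
    rw [← h.col, mulVec_mulVec, nonsing_inv_mul _ h.unit, one_mulVec]
  have h2 : (1 ᵥ* A) ⬝ᵥ (1 : Fin s → ℝ) = 1 := by rw [← dotProduct_mulVec, h.total]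
  rw [complPart, sub_mulVec, ← mulVec_mulVec, h1, vecMulVec_mulVec, h2]
  simp

lemma StrictlyStable.parasitic_eq {A B : Matrix (Fin s) (Fin s) ℝ} (h : StrictlyStable A B)
    (Z Z' : Fin s → Fin m → ℝ) :
    parasitic A Z' = stageMul (complPart A B) (parasitic A Z) +
      parasitic A (stageMul A⁻¹ (stageMul A Z' - stageMul B Z)) := by
  have hinv : (1 ᵥ* A) ᵥ* A⁻¹ = (1 : Fin s → ℝ) := by
    rw [vecMul_vecMul, mul_nonsing_inv _ h.unit, vecMul_one]
  have h0 : ∀ x : Fin m → ℝ, stageTensor (0 : Fin s → ℝ) x = 0 := fun x => by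
    funext i; simp [stageTensor]
  have h1 : stageMul (complPart A B) (parasitic A Z) = stageMul A⁻¹ (stageMul B Z) -
      stageTensor 1 (stageDot (1 ᵥ* A) Z) := by
    rw [parasitic, stageMul_sub, stageMul_stageTensor, h.complPart_mulVec_one, h0, sub_zero,
      complPart, sub_stageMul, stageMul_mul, stageMul_vecMulVec]
  rw [h1]
  simp only [parasitic, stageMul_sub, stageMul_inv_cancel h.unit, stageDot_sub,
    stageDot_stageMul (1 ᵥ* A) A⁻¹, hinv]
  simp only [stageDot_stageMul, ← h.row, stageTensor_sub]
  abel

/-- Bounds for the parasitic components in `A Zₙ₊₁ = B Zₙ + Rₙ₊₁`, in the maximum norm and in the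
sum norm. -/
lemma StrictlyStable.exists_parasitic_bound {A B : Matrix (Fin s) (Fin s) ℝ}
    (h : StrictlyStable A B) (m : ℕ) :
    ∃ C : ℝ, 0 ≤ C ∧ ∀ (L : ℕ) (Z : ℕ → Fin s → Fin m → ℝ),
      (∀ ρ : ℝ, 0 ≤ ρ →
        (∀ n < L, ‖stageMul A (Z (n + 1)) - stageMul B (Z n)‖ ≤ ρ) →
        ∀ n ≤ L, ‖parasitic A (Z n)‖ ≤ C * (‖Z 0‖ + ρ)) ∧
      ∑ n ∈ Finset.range (L + 1), ‖parasitic A (Z n)‖ ≤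
        C * (‖Z 0‖ + ∑ n ∈ Finset.range L, ‖stageMul A (Z (n + 1)) - stageMul B (Z n)‖) := by
  obtain ⟨C, q, hC, hq0, hq1, hd⟩ := h.decay
  set M := complPart A B with hM
  have hpow : ∀ k (X : Fin s → Fin m → ℝ), ‖stageMul (M ^ k) X‖ ≤ s * C * q ^ k * ‖X‖ := by
    intro k X
    have := stageMul_norm_le_of_entry_le (hd k) X
    calc _ ≤ _ := this
      _ = _ := by ring
  -- The projection onto the parasitic components is bounded.
  obtain ⟨c1, hc1, hpar⟩ : ∃ c1 : ℝ, 0 ≤ c1 ∧ ∀ X : Fin s → Fin m → ℝ,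
      ‖parasitic A X‖ ≤ c1 * ‖X‖ := by
    refine ⟨1 + ‖stageDotL (m := m) (1 ᵥ* A)‖, by positivity, fun X => ?_⟩
    calc ‖parasitic A X‖ ≤ ‖X‖ + ‖stageTensor 1 (stageDot (1 ᵥ* A) X)‖ := norm_sub_le _ _
      _ ≤ ‖X‖ + ‖stageDotL (m := m) (1 ᵥ* A)‖ * ‖X‖ := by
        gcongr
        exact (stageTensor_one_norm_le _).trans (stageDot_norm_le _ _)
      _ = _ := by ring
  set c2 := ‖stageMulL (m := m) A⁻¹‖ with hc2
  have hq1' : (0 : ℝ) < 1 - q := by linarith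
  set c3 := c1 + c1 * c2 with hc3
  have hc3' : 0 ≤ c3 := by positivity
  refine ⟨s * C * ((1 - q)⁻¹ * c3), by positivity, fun L Z => ?_⟩
  set r : ℕ → ℝ := fun n => c3 * ‖stageMul A (Z n) - stageMul B (Z (n - 1))‖ with hr
  have hr0 : ∀ n, 0 ≤ r n := fun n => by positivity
  set S := geomMajorant q (c3 * ‖Z 0‖) r with hS
  have hmaj : ∀ n k, ‖stageMul (M ^ k) (parasitic A (Z n))‖ ≤ s * C * q ^ k * S n := by
    intro n
    induction n with
    | zero =>
      intro k
      refine (hpow k _).trans ?_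
      simp only [hS, geomMajorant]
      gcongr
      refine (hpar _).trans ?_
      gcongr
      rw [hc3]
      have : 0 ≤ c1 * c2 := by positivity
      linarith
    | succ n ih =>
      intro k
      rw [h.parasitic_eq (Z n) (Z (n + 1)), stageMul_add, ← stageMul_mul, ← hM, ← pow_succ]
      refine (norm_add_le _ _).trans ?_
      have h1 := ih (k + 1)
      have h2 : ‖stageMul (M ^ k)
          (parasitic A (stageMul A⁻¹ (stageMul A (Z (n + 1)) - stageMul B (Z n))))‖ ≤
          s * C * q ^ k * r (n + 1) := by
        refine (hpow k _).trans ?_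
        gcongr
        refine (hpar _).trans ?_
        simp only [hr, Nat.add_sub_cancel]
        calc c1 * ‖stageMul A⁻¹ (stageMul A (Z (n + 1)) - stageMul B (Z n))‖
            ≤ c1 * (c2 * ‖stageMul A (Z (n + 1)) - stageMul B (Z n)‖) := by
              gcongr
              exact stageMul_norm_le _ _
          _ = c1 * c2 * ‖stageMul A (Z (n + 1)) - stageMul B (Z n)‖ := by ring
          _ ≤ _ := by gcongr; rw [hc3]; linarith
      calc _ ≤ s * C * q ^ (k + 1) * S n + s * C * q ^ k * r (n + 1) := add_le_add h1 h2
        _ = s * C * q ^ k * S (n + 1) := by simp only [hS, geomMajorant]; ring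
  have hmaj0 : ∀ n, ‖parasitic A (Z n)‖ ≤ s * C * S n := fun n => by
    simpa using hmaj n 0
  refine ⟨fun ρ hρ hR n hn => ?_, ?_⟩
  · have h1 : S n ≤ (1 - q)⁻¹ * (c3 * ‖Z 0‖ + c3 * ρ) := by
      refine geomMajorant_le hq0 hq1 (by positivity) (by positivity) (L := L) ?_ n hn
      intro k hk1 hk2
      simp only [hr]
      gcongr
      have := hR (k - 1) (by omega)
      rwa [Nat.sub_add_cancel hk1] at this
    calc ‖parasitic A (Z n)‖ ≤ s * C * S n := hmaj0 n
      _ ≤ s * C * ((1 - q)⁻¹ * (c3 * ‖Z 0‖ + c3 * ρ)) := by gcongr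
      _ = _ := by ring
  · calc ∑ n ∈ Finset.range (L + 1), ‖parasitic A (Z n)‖
        ≤ ∑ n ∈ Finset.range (L + 1), s * C * S n := Finset.sum_le_sum fun n _ => hmaj0 n
      _ = s * C * ∑ n ∈ Finset.range (L + 1), S n := by rw [Finset.mul_sum]
      _ ≤ s * C * ((1 - q)⁻¹ * (c3 * ‖Z 0‖ + ∑ n ∈ Finset.range L, r (n + 1))) := by
        gcongr
        exact sum_geomMajorant_le hq0 hq1 (by positivity) hr0 L
      _ = _ := by
        simp only [hr, Nat.add_sub_cancel, ← Finset.mul_sum]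
        ring

end ZeroStability

/-! ### Moments of the order conditions -/

section Moments

variable {s : ℕ}

lemma mul_vand_apply (M : Matrix (Fin s) (Fin s) ℝ) (c : Fin s → ℝ) (q : ℕ) (i : Fin s)
    (k : Fin q) : (M * vand c q) i k = (M *ᵥ (c ^ (k : ℕ))) i := by
  simp [Matrix.mul_apply, vand, mulVec, dotProduct]

lemma vand_mul_nilE (c : Fin s → ℝ) (q : ℕ) (i : Fin s) (k : Fin q) :
    (vand c q * nilE q) i k = (k : ℕ) * c i ^ ((k : ℕ) - 1) := by
  simp only [Matrix.mul_apply, vand, nilE, of_apply]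
  rcases Nat.eq_zero_or_pos (k : ℕ) with hk | hk
  · rw [hk]
    simp
  · rw [Finset.sum_eq_single (⟨(k : ℕ) - 1, by omega⟩ : Fin q)]
    · have h1 : ((k : ℕ) - 1) + 1 = (k : ℕ) := by omega
      have h2 : (((k : ℕ) - 1 : ℕ) : ℝ) + 1 = (k : ℕ) := by exact_mod_cast h1
      simp only [h1, if_true, h2]
      ring
    · intro l _ hl
      have : (l : ℕ) + 1 ≠ (k : ℕ) := fun h => hl (Fin.ext (by simp; omega))
      simp [this]
    · simp

lemma vand_mul_pascal (c : Fin s → ℝ) (q : ℕ) : vand c q * pascal q = vand (c + 1) q := by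
  ext i k
  simp only [Matrix.mul_apply, vand, pascal, of_apply, Pi.add_apply, Pi.one_apply]
  rw [add_pow, Finset.sum_subset (Finset.range_subset_range.2 (Nat.succ_le_of_lt k.2)),
    Finset.sum_range]
  · simp
  · intro l _ hl
    rw [Nat.choose_eq_zero_of_lt (by simpa using hl)]
    simp

lemma isUnit_det_pascal (q : ℕ) : IsUnit (pascal q).det := by
  rw [det_of_isUpperTriangular]
  · simp [pascal]
  · intro i j hij
    have h : (j : ℕ) < (i : ℕ) := hij
    simp [pascal, Nat.choose_eq_zero_of_lt h]

lemma vand_mul_pascal_inv (c : Fin s → ℝ) (q : ℕ) :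
    vand c q * (pascal q)⁻¹ = vand (c - 1) q := by
  have h := vand_mul_pascal (c - 1) q
  rw [sub_add_cancel] at h
  rw [← h, Matrix.mul_assoc, mul_nonsing_inv _ (isUnit_det_pascal q), Matrix.mul_one]

/-- The bilinear form `∑ᵢⱼ Mᵢⱼ φ(cᵢ, cⱼ)`, as a linear functional of the function `φ`. -/
def nodeForm (M : Matrix (Fin s) (Fin s) ℝ) (c : Fin s → ℝ) : (ℝ → ℝ → ℝ) →ₗ[ℝ] ℝ where
  toFun φ := ∑ i, ∑ j, M i j * φ (c i) (c j)
  map_add' φ ψ := by simp [mul_add, Finset.sum_add_distrib]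
  map_smul' r φ := by
    simp only [Pi.smul_apply, smul_eq_mul, RingHom.id_apply, Finset.mul_sum]
    refine Finset.sum_congr rfl fun i _ => Finset.sum_congr rfl fun j _ => by ring

lemma nodeForm_apply (M : Matrix (Fin s) (Fin s) ℝ) (c : Fin s → ℝ) (φ : ℝ → ℝ → ℝ) :
    nodeForm M c φ = ∑ i, ∑ j, M i j * φ (c i) (c j) := rfl

lemma nodeForm_mul (M : Matrix (Fin s) (Fin s) ℝ) (c : Fin s → ℝ) (φ ψ : ℝ → ℝ) :
    nodeForm M c (fun x y => φ x * ψ y) = (fun i => φ (c i)) ⬝ᵥ (M *ᵥ fun j => ψ (c j)) := by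
  simp only [nodeForm_apply, dotProduct, mulVec, Finset.mul_sum]
  refine Finset.sum_congr rfl fun i _ => Finset.sum_congr rfl fun j _ => by ring

lemma nodeForm_mul' (M : Matrix (Fin s) (Fin s) ℝ) (c : Fin s → ℝ) (φ ψ : ℝ → ℝ) :
    nodeForm M c (fun x y => φ x * ψ y) = (fun j => ψ (c j)) ⬝ᵥ (Mᵀ *ᵥ fun i => φ (c i)) := by
  rw [nodeForm_mul, mulVec_transpose, dotProduct_comm _ (_ ᵥ* _), ← dotProduct_mulVec]

lemma nodeForm_congr_of_isDiag {M : Matrix (Fin s) (Fin s) ℝ} (hM : M.IsDiag) (c : Fin s → ℝ)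
    {φ ψ : ℝ → ℝ → ℝ} (h : ∀ x, φ x x = ψ x x) : nodeForm M c φ = nodeForm M c ψ := by
  simp only [nodeForm_apply]
  refine Finset.sum_congr rfl fun i _ => Finset.sum_congr rfl fun j _ => ?_
  by_cases hij : i = j
  · subst hij; rw [h]
  · rw [hM hij]; simp

namespace PeerTriplet

namespace OrderConditions

variable {θ : PeerTriplet s}

lemma fwd_start_moment (h : θ.OrderConditions) {k : ℕ} (hk : k < s) :
    θ.A0 *ᵥ (θ.c ^ k) = (if k = 0 then θ.a else 0) + (if k = 1 then θ.b else 0) +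
      (k : ℝ) • (θ.K0 *ᵥ (θ.c ^ (k - 1))) := by
  funext i
  have h1 := congrFun (congrFun h.fwd_start i) ⟨k, hk⟩
  rw [mul_vand_apply, Matrix.mul_assoc] at h1
  rw [h1]
  simp only [Matrix.add_apply, vecMulVec_apply, coordVec, Pi.add_apply, Pi.smul_apply, smul_eq_mul]
  congr 1
  · split_ifs <;> simp
  · simp only [Matrix.mul_apply (M := θ.K0), vand_mul_nilE, mulVec, dotProduct, Finset.mul_sum,
      Pi.pow_apply]
    exact Finset.sum_congr rfl fun j _ => by ring

lemma fwd_moment_aux {A B K : Matrix (Fin s) (Fin s) ℝ} {c : Fin s → ℝ}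
    (h : A * vand c s = B * vand c s * (pascal s)⁻¹ + K * vand c s * nilE s) {k : ℕ} (hk : k < s) :
    A *ᵥ (c ^ k) = B *ᵥ ((c - 1) ^ k) + (k : ℝ) • (K *ᵥ (c ^ (k - 1))) := by
  funext i
  have h1 := congrFun (congrFun h i) ⟨k, hk⟩
  rw [mul_vand_apply, Matrix.mul_assoc, Matrix.mul_assoc, vand_mul_pascal_inv, Matrix.add_apply,
    mul_vand_apply] at h1
  rw [h1]
  simp only [Pi.add_apply, Pi.smul_apply, smul_eq_mul]
  congr 1
  simp only [Matrix.mul_apply (M := K), vand_mul_nilE, mulVec, dotProduct, Finset.mul_sum,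
    Pi.pow_apply]
  exact Finset.sum_congr rfl fun j _ => by ring

lemma adj_moment_aux {A B K : Matrix (Fin s) (Fin s) ℝ} {c : Fin s → ℝ} {q : ℕ}
    (h : A * vand c q = B * vand c q * pascal q - K * vand c q * nilE q) {k : ℕ} (hk : k < q) :
    A *ᵥ (c ^ k) = B *ᵥ ((c + 1) ^ k) - (k : ℝ) • (K *ᵥ (c ^ (k - 1))) := by
  funext i
  have h1 := congrFun (congrFun h i) ⟨k, hk⟩
  rw [mul_vand_apply, Matrix.mul_assoc, Matrix.mul_assoc, vand_mul_pascal, Matrix.sub_apply,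
    mul_vand_apply] at h1
  rw [h1]
  simp only [Pi.sub_apply, Pi.smul_apply, smul_eq_mul]
  congr 1
  simp only [Matrix.mul_apply (M := K), vand_mul_nilE, mulVec, dotProduct, Finset.mul_sum,
    Pi.pow_apply]
  exact Finset.sum_congr rfl fun j _ => by ring

lemma fwd_standard_moment (h : θ.OrderConditions) {k : ℕ} (hk : k < s) :
    θ.A *ᵥ (θ.c ^ k) = θ.B *ᵥ ((θ.c - 1) ^ k) + (k : ℝ) • (θ.K *ᵥ (θ.c ^ (k - 1))) :=
  fwd_moment_aux h.fwd_standard hk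

lemma fwd_last_moment (h : θ.OrderConditions) {k : ℕ} (hk : k < s) :
    θ.AN *ᵥ (θ.c ^ k) = θ.BN *ᵥ ((θ.c - 1) ^ k) + (k : ℝ) • (θ.KN *ᵥ (θ.c ^ (k - 1))) :=
  fwd_moment_aux h.fwd_last hk

lemma fwd_end_moment (h : θ.OrderConditions) {k : ℕ} (hk : k < s) : θ.w ⬝ᵥ (θ.c ^ k) = 1 := by
  have h1 := congrFun h.fwd_end ⟨k, hk⟩
  simpa [vecMul, vand, dotProduct] using h1

lemma adj_init_moment (h : θ.OrderConditions) {k : ℕ} (hk : k < s - 1) :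
    θ.v ⬝ᵥ (θ.c ^ k) = if k = 0 then 1 else 0 := by
  have h1 := congrFun h.adj_init ⟨k, hk⟩
  simpa [vecMul, vand, dotProduct, coordVec] using h1

lemma adj_start_moment (h : θ.OrderConditions) {k : ℕ} (hk : k < s - 1) :
    θ.A0ᵀ *ᵥ (θ.c ^ k) = θ.Bᵀ *ᵥ ((θ.c + 1) ^ k) - (k : ℝ) • (θ.K0ᵀ *ᵥ (θ.c ^ (k - 1))) :=
  adj_moment_aux h.adj_start hk

lemma adj_standard_moment (h : θ.OrderConditions) {k : ℕ} (hk : k < s - 1) :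
    θ.Aᵀ *ᵥ (θ.c ^ k) = θ.Bᵀ *ᵥ ((θ.c + 1) ^ k) - (k : ℝ) • (θ.Kᵀ *ᵥ (θ.c ^ (k - 1))) :=
  adj_moment_aux h.adj_standard hk

lemma adj_last_moment (h : θ.OrderConditions) {k : ℕ} (hk : k < s - 1) :
    θ.Aᵀ *ᵥ (θ.c ^ k) = θ.BNᵀ *ᵥ ((θ.c + 1) ^ k) - (k : ℝ) • (θ.Kᵀ *ᵥ (θ.c ^ (k - 1))) :=
  adj_moment_aux h.adj_last hk

lemma adj_end_moment (h : θ.OrderConditions) {k : ℕ} (hk : k < s - 1) :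
    θ.ANᵀ *ᵥ (θ.c ^ k) = θ.w - (k : ℝ) • (θ.KNᵀ *ᵥ (θ.c ^ (k - 1))) := by
  funext i
  have h1 := congrFun (congrFun h.adj_end i) ⟨k, hk⟩
  rw [mul_vand_apply, Matrix.mul_assoc, Matrix.sub_apply, vecMulVec_apply] at h1
  rw [h1]
  simp only [Pi.sub_apply, Pi.smul_apply, smul_eq_mul, Pi.one_apply, mul_one]
  congr 1
  simp only [Matrix.mul_apply (M := θ.KNᵀ), vand_mul_nilE, mulVec, dotProduct, Finset.mul_sum,
    Pi.pow_apply]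
  exact Finset.sum_congr rfl fun j _ => by ring

/-- The standard and the end method agree in the first `s - 1` left moments of `B`. -/
lemma BN_moment (h : θ.OrderConditions) {k : ℕ} (hk : k < s - 1) :
    θ.BNᵀ *ᵥ (θ.c ^ k) = θ.Bᵀ *ᵥ (θ.c ^ k) := by
  have h1 : θ.BNᵀ * vand θ.c (s - 1) * pascal (s - 1) =
      θ.Bᵀ * vand θ.c (s - 1) * pascal (s - 1) := by
    have h2 := h.adj_standard
    rw [h.adj_last] at h2
    exact sub_left_injective h2
  have h2 : θ.BNᵀ * vand θ.c (s - 1) = θ.Bᵀ * vand θ.c (s - 1) := by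
    have h3 := congrArg (· * (pascal (s - 1))⁻¹) h1
    simpa [Matrix.mul_assoc, mul_nonsing_inv _ (isUnit_det_pascal (s - 1))] using h3
  funext i
  have h3 := congrFun (congrFun h2 i) ⟨k, hk⟩
  simpa only [mul_vand_apply] using h3

end OrderConditions

/-! ### Strict stability of the standard method -/

variable {θ : PeerTriplet s}

lemma A_mulVec_one (h : θ.OrderConditions) (hs : 1 < s) : θ.A *ᵥ 1 = θ.B *ᵥ 1 := by
  simpa using h.fwd_standard_moment (k := 0) (by omega)

lemma one_vecMul_A (h : θ.OrderConditions) (hs : 1 < s) :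
    (1 : Fin s → ℝ) ᵥ* θ.A = 1 ᵥ* θ.B := by
  have := h.adj_standard_moment (k := 0) (by omega)
  simpa [mulVec_transpose] using this

lemma strictlyStable (h : θ.OrderConditions) (hs : 1 < s) (hadm : θ.Admissible)
    (hdom : OneStrictlyDominant (θ.A⁻¹ * θ.B)) : StrictlyStable θ.A θ.B :=
  strictlyStable_of_oneStrictlyDominant hadm.A_unit (one_vecMul_A h hs) (A_mulVec_one h hs)
    (by rw [A_mulVec_one h hs]; exact h.compat_zero) hdom

end PeerTriplet

end Moments

/-! ### Algebraic consequences of superconvergence -/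

namespace PeerTriplet

section Superconvergence

variable {n : ℕ} {θ : PeerTriplet (n + 2)}

/-- The forward order condition of order `j` as an identity of bilinear forms: powers of the second
variable under `A` are traded for forms in `B` and `K`. The lemmas `form_*_left` do the same for the
adjoint conditions and powers of the first variable. -/
lemma form_A_right (h : θ.OrderConditions) (φ : ℝ → ℝ) {j : ℕ} (hj : j < n + 2) :
    nodeForm θ.A θ.c (fun x y => φ x * y ^ j) =
      nodeForm θ.B θ.c (fun x y => φ x * (y - 1) ^ j) +
        j * nodeForm θ.K θ.c (fun x y => φ x * y ^ (j - 1)) := by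
  have h1 := h.fwd_standard_moment hj
  rw [nodeForm_mul θ.A θ.c φ (fun y => y ^ j), nodeForm_mul θ.B θ.c φ (fun y => (y - 1) ^ j),
    nodeForm_mul θ.K θ.c φ (fun y => y ^ (j - 1)), ← smul_eq_mul (a := (j : ℝ)),
    ← dotProduct_smul, ← dotProduct_add]
  exact congrArg _ h1

lemma form_AN_right (h : θ.OrderConditions) (φ : ℝ → ℝ) {j : ℕ} (hj : j < n + 2) :
    nodeForm θ.AN θ.c (fun x y => φ x * y ^ j) =
      nodeForm θ.BN θ.c (fun x y => φ x * (y - 1) ^ j) +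
        j * nodeForm θ.KN θ.c (fun x y => φ x * y ^ (j - 1)) := by
  have h1 := h.fwd_last_moment hj
  rw [nodeForm_mul θ.AN θ.c φ (fun y => y ^ j), nodeForm_mul θ.BN θ.c φ (fun y => (y - 1) ^ j),
    nodeForm_mul θ.KN θ.c φ (fun y => y ^ (j - 1)), ← smul_eq_mul (a := (j : ℝ)),
    ← dotProduct_smul, ← dotProduct_add]
  exact congrArg _ h1

lemma form_A_left (h : θ.OrderConditions) (φ : ℝ → ℝ) {i : ℕ} (hi : i < n + 1) :
    nodeForm θ.A θ.c (fun x y => x ^ i * φ y) =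
      nodeForm θ.B θ.c (fun x y => (x + 1) ^ i * φ y) -
        i * nodeForm θ.K θ.c (fun x y => x ^ (i - 1) * φ y) := by
  have h1 := h.adj_standard_moment hi
  rw [nodeForm_mul' θ.A θ.c (fun x => x ^ i) φ, nodeForm_mul' θ.B θ.c (fun x => (x + 1) ^ i) φ,
    nodeForm_mul' θ.K θ.c (fun x => x ^ (i - 1)) φ, ← smul_eq_mul (a := (i : ℝ)),
    ← dotProduct_smul, ← dotProduct_sub]
  exact congrArg _ h1

lemma form_AN_left (h : θ.OrderConditions) (φ : ℝ → ℝ) {i : ℕ} (hi : i < n + 1) :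
    nodeForm θ.AN θ.c (fun x y => x ^ i * φ y) =
      θ.w ⬝ᵥ (fun j => φ (θ.c j)) -
        i * nodeForm θ.KN θ.c (fun x y => x ^ (i - 1) * φ y) := by
  have h1 := h.adj_end_moment hi
  rw [nodeForm_mul' θ.AN θ.c (fun x => x ^ i) φ,
    nodeForm_mul' θ.KN θ.c (fun x => x ^ (i - 1)) φ, ← smul_eq_mul (a := (i : ℝ)),
    ← dotProduct_smul, dotProduct_comm θ.w, ← dotProduct_sub]
  exact congrArg _ h1

lemma form_BN_left (h : θ.OrderConditions) (φ : ℝ → ℝ) {i : ℕ} (hi : i < n + 1) :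
    nodeForm θ.BN θ.c (fun x y => x ^ i * φ y) = nodeForm θ.B θ.c (fun x y => x ^ i * φ y) := by
  have h1 := h.BN_moment hi
  rw [nodeForm_mul' θ.BN θ.c (fun x => x ^ i) φ, nodeForm_mul' θ.B θ.c (fun x => x ^ i) φ]
  exact congrArg _ h1

/-- The defect of the relation between the moments `xⁱ yʲ` of `B` and of `K` that results from the
forward condition of order `j` and the adjoint condition of order `i`. -/
def momentDefect (θ : PeerTriplet (n + 2)) (i j : ℕ) : ℝ :=
  nodeForm θ.B θ.c (fun x y => x ^ i * (y - 1) ^ j) -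
    nodeForm θ.B θ.c (fun x y => (x + 1) ^ i * y ^ j) +
    ((i : ℝ) + j) * nodeForm θ.K θ.c (fun x _ => x ^ (i + j - 1))

lemma form_K_pow (hK : θ.K.IsDiag) {i j k : ℕ} (hk : i + j = k) :
    nodeForm θ.K θ.c (fun x y => x ^ i * y ^ j) = nodeForm θ.K θ.c (fun x _ => x ^ k) :=
  nodeForm_congr_of_isDiag hK θ.c fun x => by rw [← pow_add, hk]

lemma momentDefect_eq_adj (h : θ.OrderConditions) (hK : θ.K.IsDiag) {j : ℕ} (hj : j < n + 2)
    (i : ℕ) : momentDefect θ i j =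
      nodeForm θ.A θ.c (fun x y => x ^ i * y ^ j) -
        nodeForm θ.B θ.c (fun x y => (x + 1) ^ i * y ^ j) +
        i * nodeForm θ.K θ.c (fun x y => x ^ (i - 1) * y ^ j) := by
  rw [form_A_right h (fun x => x ^ i) hj, momentDefect]
  have h1 : (j : ℝ) * nodeForm θ.K θ.c (fun x y => x ^ i * y ^ (j - 1)) =
      j * nodeForm θ.K θ.c (fun x _ => x ^ (i + j - 1)) := by
    rcases Nat.eq_zero_or_pos j with rfl | hj0
    · simp
    · rw [form_K_pow hK (k := i + j - 1) (by omega)]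
  have h2 : (i : ℝ) * nodeForm θ.K θ.c (fun x y => x ^ (i - 1) * y ^ j) =
      i * nodeForm θ.K θ.c (fun x _ => x ^ (i + j - 1)) := by
    rcases Nat.eq_zero_or_pos i with rfl | hi0
    · simp
    · rw [form_K_pow hK (k := i + j - 1) (by omega)]
  rw [h1, h2]
  ring

/-- Below the degrees left open, the forward and the adjoint condition both evaluate the same form of
`A`, so that the moment defects vanish. -/
lemma momentDefect_eq_zero (h : θ.OrderConditions) (hK : θ.K.IsDiag) {i j : ℕ} (hi : i < n + 1)
    (hj : j < n + 2) : momentDefect θ i j = 0 := by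
  rw [momentDefect_eq_adj h hK hj, form_A_left h (fun y => y ^ j) hi]
  ring

lemma form_A_const_left (h : θ.OrderConditions) (φ : ℝ → ℝ) :
    nodeForm θ.A θ.c (fun _ y => φ y) = nodeForm θ.B θ.c (fun _ y => φ y) := by
  simpa using form_A_left h φ (i := 0) (by omega)

lemma form_A_const_right (h : θ.OrderConditions) (φ : ℝ → ℝ) :
    nodeForm θ.A θ.c (fun x _ => φ x) = nodeForm θ.B θ.c (fun x _ => φ x) := by
  simpa using form_A_right h φ (j := 0) (by omega)

/-- The superconvergence condition of the forward scheme as a vanishing moment defect. -/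
lemma momentDefect_zero_left (h : θ.OrderConditions) (hK : θ.K.IsDiag)
    (hsup : θ.Superconvergence) : momentDefect θ 0 (n + 2) = 0 := by
  have h1 := hsup.fwd
  rw [dotProduct_sub, dotProduct_sub, dotProduct_smul] at h1
  have e1 := nodeForm_mul θ.A θ.c (fun _ => 1) (fun y => y ^ (n + 2))
  have e2 := nodeForm_mul θ.B θ.c (fun _ => 1) (fun y => (y - 1) ^ (n + 2))
  have e3 := nodeForm_mul θ.K θ.c (fun _ => 1) (fun y => y ^ (n + 1))
  have e4 := form_A_const_left h (fun y => y ^ (n + 2))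
  have e5 := form_K_pow hK (θ := θ) (i := 0) (j := n + 1) (k := n + 1) (by omega)
  have h2 : (1 : Fin (n + 2) → ℝ) ⬝ᵥ (θ.A *ᵥ (θ.c ^ (n + 2))) =
      nodeForm θ.A θ.c (fun x y => 1 * y ^ (n + 2)) := e1.symm
  have h3 : (1 : Fin (n + 2) → ℝ) ⬝ᵥ (θ.B *ᵥ ((θ.c - 1) ^ (n + 2))) =
      nodeForm θ.B θ.c (fun x y => 1 * (y - 1) ^ (n + 2)) := e2.symm
  have h4 : (1 : Fin (n + 2) → ℝ) ⬝ᵥ (θ.K *ᵥ (θ.c ^ (n + 2 - 1))) =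
      nodeForm θ.K θ.c (fun x y => 1 * y ^ (n + 1)) := e3.symm
  rw [h2, h3, h4] at h1
  simp only [one_mul, pow_zero, smul_eq_mul] at h1 e5
  rw [e4, e5] at h1
  simp only [momentDefect, pow_zero, one_mul]
  have e6 : 0 + (n + 2) - 1 = n + 1 := by omega
  rw [e6]
  push_cast at h1 ⊢
  linarith

/-- The vector `Aᵀ c^(s-1) - Bᵀ (c + 𝟙)^(s-1) + (s-1) Kᵀ c^(s-2)` of the leading coefficients of the
adjoint local error. -/
def adjDefect (A B K : Matrix (Fin (n + 2)) (Fin (n + 2)) ℝ) (c : Fin (n + 2) → ℝ) (k : ℕ) :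
    Fin (n + 2) → ℝ :=
  Aᵀ *ᵥ (c ^ k) - Bᵀ *ᵥ ((c + 1) ^ k) + (k : ℝ) • (Kᵀ *ᵥ (c ^ (k - 1)))

lemma dotProduct_adjDefect (A B K : Matrix (Fin (n + 2)) (Fin (n + 2)) ℝ)
    (c : Fin (n + 2) → ℝ) (k j : ℕ) :
    (c ^ j) ⬝ᵥ adjDefect A B K c k = nodeForm A c (fun x y => x ^ k * y ^ j) -
        nodeForm B c (fun x y => (x + 1) ^ k * y ^ j) +
        k * nodeForm K c (fun x y => x ^ (k - 1) * y ^ j) := by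
  rw [nodeForm_mul' A c (fun x => x ^ k) (fun y => y ^ j),
    nodeForm_mul' B c (fun x => (x + 1) ^ k) (fun y => y ^ j),
    nodeForm_mul' K c (fun x => x ^ (k - 1)) (fun y => y ^ j), adjDefect, dotProduct_add,
    dotProduct_sub, dotProduct_smul]
  rfl

lemma dotProduct_adjDefect_standard (h : θ.OrderConditions) (hK : θ.K.IsDiag) (k : ℕ) {j : ℕ}
    (hj : j < n + 2) :
    (θ.c ^ j) ⬝ᵥ adjDefect θ.A θ.B θ.K θ.c k = momentDefect θ k j := by
  rw [dotProduct_adjDefect, momentDefect_eq_adj h hK hj]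

/-- The superconvergence condition of the adjoint scheme is the solvability condition for the corrector. -/
lemma one_dotProduct_adjDefect (hK : θ.K.IsDiag) (hsup : θ.Superconvergence) :
    (1 : Fin (n + 2) → ℝ) ⬝ᵥ adjDefect θ.A θ.B θ.K θ.c (n + 1) = 0 := by
  have h1 := hsup.adj
  have h2 : (((n + 2 : ℕ) : ℝ) - 1) = ((n + 1 : ℕ) : ℝ) := by push_cast; ring
  have h3 : θ.Kᵀ = θ.K := hK.isSymm
  rw [h2] at h1
  rw [adjDefect, h3]
  exact h1

/-- The superconvergence condition of the adjoint scheme as a vanishing moment defect. -/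
lemma momentDefect_zero_right (h : θ.OrderConditions) (hK : θ.K.IsDiag)
    (hsup : θ.Superconvergence) : momentDefect θ (n + 1) 0 = 0 := by
  rw [← dotProduct_adjDefect_standard h hK (n + 1) (j := 0) (by omega), pow_zero,
    one_dotProduct_adjDefect hK hsup]

/-- The only two moment defects of degree `s` that may be different from zero are proportional,
since the function `(y - 1 - x) ^ s` is invariant under a common shift of `x` and `y` and vanishes
for `y = x + 1`. -/
lemma momentDefect_degree (h : θ.OrderConditions) (hK : θ.K.IsDiag)
    (hsup : θ.Superconvergence) :
    momentDefect θ (n + 2) 0 = ((n : ℝ) + 2) * momentDefect θ (n + 1) 1 := by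
  set a : ℕ → ℝ := fun j => (-1) ^ (n + 2 - j) * ((n + 2).choose j : ℝ) with ha
  have hbin : ∀ x y : ℝ, ∑ j ∈ Finset.range (n + 3), a j * (x ^ (n + 2 - j) * y ^ j) =
      (y - x) ^ (n + 2) := by
    intro x y
    rw [sub_eq_add_neg, add_pow]
    refine Finset.sum_congr rfl fun j _ => ?_
    rw [ha, neg_pow x]
    ring
  have hsum : ∑ j ∈ Finset.range (n + 3), a j * momentDefect θ (n + 2 - j) j = 0 := by
    have e1 : ∑ j ∈ Finset.range (n + 3), a j *
        nodeForm θ.B θ.c (fun x y => x ^ (n + 2 - j) * (y - 1) ^ j) =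
        nodeForm θ.B θ.c (fun x y => (y - 1 - x) ^ (n + 2)) := by
      simp only [← smul_eq_mul (a := a _), ← map_smul, ← map_sum]
      congr 1
      funext x y
      simpa using hbin x (y - 1)
    have e2 : ∑ j ∈ Finset.range (n + 3), a j *
        nodeForm θ.B θ.c (fun x y => (x + 1) ^ (n + 2 - j) * y ^ j) =
        nodeForm θ.B θ.c (fun x y => (y - 1 - x) ^ (n + 2)) := by
      simp only [← smul_eq_mul (a := a _), ← map_smul, ← map_sum]
      congr 1
      funext x y
      have := hbin (x + 1) y
      simp only [Finset.sum_apply, Pi.smul_apply, smul_eq_mul]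
      rw [this]
      ring
    have e3 : ∑ j ∈ Finset.range (n + 3), a j = 0 := by
      have := hbin 1 1
      simpa using this
    have e4 : ∀ j ∈ Finset.range (n + 3), a j * momentDefect θ (n + 2 - j) j =
        a j * nodeForm θ.B θ.c (fun x y => x ^ (n + 2 - j) * (y - 1) ^ j) -
        a j * nodeForm θ.B θ.c (fun x y => (x + 1) ^ (n + 2 - j) * y ^ j) +
        a j * (((n : ℝ) + 2) * nodeForm θ.K θ.c (fun x _ => x ^ (n + 1))) := by
      intro j hj
      have hj' : j ≤ n + 2 := Nat.lt_succ_iff.1 (Finset.mem_range.1 hj)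
      have h1 : n + 2 - j + j - 1 = n + 1 := by omega
      have h2 : ((n + 2 - j : ℕ) : ℝ) + j = n + 2 := by
        rw [Nat.cast_sub hj']; push_cast; ring
      rw [momentDefect, h1, h2]
      ring
    rw [Finset.sum_congr rfl e4, Finset.sum_add_distrib, Finset.sum_sub_distrib, e1, e2,
      ← Finset.sum_mul, e3]
    ring
  rw [Finset.sum_range_succ', Finset.sum_range_succ'] at hsum
  have hrest : ∑ j ∈ Finset.range (n + 1), a (j + 1 + 1) *
      momentDefect θ (n + 2 - (j + 1 + 1)) (j + 1 + 1) = 0 := by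
    refine Finset.sum_eq_zero fun j hj => ?_
    have hj' : j < n + 1 := Finset.mem_range.1 hj
    rcases Nat.lt_or_ge j n with hjn | hjn
    · rw [momentDefect_eq_zero h hK (by omega) (by omega), mul_zero]
    · have : j = n := by omega
      subst this
      have h0 : j + 2 - (j + 1 + 1) = 0 := by omega
      rw [h0, momentDefect_zero_left h hK hsup, mul_zero]
  rw [hrest] at hsum
  have ha0 : a 0 = (-1) ^ (n + 2) := by simp [ha]
  have ha1 : a (0 + 1) = (-1) ^ (n + 1) * ((n : ℝ) + 2) := by
    simp [ha]
  rw [ha0, ha1] at hsum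
  have e0 : n + 2 - (0 + 1) = n + 1 := by omega
  rw [e0, Nat.sub_zero, zero_add, zero_add] at hsum
  have hne : ((-1 : ℝ)) ^ (n + 1) ≠ 0 := pow_ne_zero _ (by norm_num)
  have : (-1 : ℝ) ^ (n + 1) *
      (((n : ℝ) + 2) * momentDefect θ (n + 1) 1 - momentDefect θ (n + 2) 0) = 0 := by
    rw [pow_succ _ (n + 1)] at hsum
    linarith
  rcases mul_eq_zero.1 this with h1 | h1
  · exact absurd h1 hne
  · linarith


lemma form_shift_linear (k : ℕ) :
    nodeForm θ.B θ.c (fun x y => ((x + 1) ^ (k + 1) - x ^ (k + 1)) * (y - 1 - x)) =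
      momentDefect θ (k + 2) 0 - momentDefect θ (k + 1) 1 := by
  have e : (fun x y : ℝ => ((x + 1) ^ (k + 1) - x ^ (k + 1)) * (y - 1 - x)) =
      (fun x y : ℝ => x ^ (k + 2) * (y - 1) ^ 0) - (fun x y : ℝ => (x + 1) ^ (k + 2) * y ^ 0) -
      (fun x y : ℝ => x ^ (k + 1) * (y - 1) ^ 1) + (fun x y : ℝ => (x + 1) ^ (k + 1) * y ^ 1) := by
    funext x y
    simp only [Pi.sub_apply, Pi.add_apply]
    ring
  rw [e, map_add, map_sub, map_sub]
  have h1 : k + 1 + 1 - 1 = k + 2 + 0 - 1 := by omega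
  simp only [momentDefect, h1]
  push_cast
  ring

lemma form_shift_expand (k : ℕ) (ψ : ℝ → ℝ → ℝ) :
    nodeForm θ.B θ.c (fun x y => ((x + 1) ^ (k + 1) - x ^ (k + 1)) * ψ x y) =
      ∑ l ∈ Finset.range (k + 1), ((k + 1).choose l : ℝ) *
        nodeForm θ.B θ.c (fun x y => x ^ l * ψ x y) := by
  simp only [← smul_eq_mul (a := (Nat.choose _ _ : ℝ)), ← map_smul, ← map_sum]
  congr 1
  funext x y
  simp only [Finset.sum_apply, Pi.smul_apply, smul_eq_mul]
  rw [add_pow, Finset.sum_range_succ]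
  simp only [one_pow, mul_one, Nat.choose_self, Nat.cast_one, add_sub_cancel_right,
    Finset.sum_mul]
  exact Finset.sum_congr rfl fun l _ => by ring

/-- Induction on `k`: the binomial expansion of `(x + 1) ^ (k + 1) - x ^ (k + 1)` in `form_shift_linear`
leaves only the moment with `x ^ k`. -/
lemma form_pow_mul_linear_eq_zero (h : θ.OrderConditions) (hK : θ.K.IsDiag)
    (hsup : θ.Superconvergence) : ∀ k < n,
    nodeForm θ.B θ.c (fun x y => x ^ k * (y - 1 - x)) = 0 := by
  intro k
  induction k using Nat.strong_induction_on with
  | _ k ih =>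
    intro hk
    have h1 := form_shift_linear (θ := θ) k
    have h2 : momentDefect θ (k + 2) 0 = 0 := by
      rcases Nat.lt_or_ge (k + 2) (n + 1) with h3 | h3
      · exact momentDefect_eq_zero h hK h3 (by omega)
      · have : k + 2 = n + 1 := by omega
        rw [this]
        exact momentDefect_zero_right h hK hsup
    rw [h2, momentDefect_eq_zero h hK (by omega) (by omega), sub_zero, form_shift_expand,
      Finset.sum_range_succ, Finset.sum_eq_zero, zero_add] at h1
    · refine (mul_eq_zero.1 h1).resolve_left ?_
      rw [Nat.choose_succ_self_right]
      positivity
    · intro l hl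
      have hl' := Finset.mem_range.1 hl
      rw [ih l hl' (by omega), mul_zero]

/-- In the first degree not covered by `form_pow_mul_linear_eq_zero` the moment is the remaining
defect. -/
lemma form_pow_mul_linear (h : θ.OrderConditions) (hK : θ.K.IsDiag)
    (hsup : θ.Superconvergence) :
    nodeForm θ.B θ.c (fun x y => x ^ n * (y - 1 - x)) = momentDefect θ (n + 1) 1 := by
  have h1 := form_shift_linear (θ := θ) n
  rw [momentDefect_degree h hK hsup, form_shift_expand, Finset.sum_range_succ,
    Finset.sum_eq_zero, zero_add, Nat.choose_succ_self_right] at h1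
  · push_cast at h1
    have h2 : ((n : ℝ) + 1) ≠ 0 := by positivity
    apply mul_left_cancel₀ h2
    linarith
  · intro l hl
    rw [form_pow_mul_linear_eq_zero h hK hsup l (Finset.mem_range.1 hl), mul_zero]

/-- The one-leg condition of the end method: under `K_N` one factor may be moved between the
variables. -/
lemma form_KN_oneleg (h : θ.OrderConditions) (φ : ℝ → ℝ) :
    nodeForm θ.KN θ.c (fun x y => x * φ y) = nodeForm θ.KN θ.c (fun _ y => y * φ y) := by
  rw [← sub_eq_zero, ← map_sub]
  simp only [nodeForm_apply]
  rw [Finset.sum_comm]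
  refine Finset.sum_eq_zero fun j _ => ?_
  have h1 := h.oneleg_end j
  calc _ = (∑ i, (θ.c i - θ.c j) * θ.KN i j) * φ (θ.c j) := by
        rw [Finset.sum_mul]
        refine Finset.sum_congr rfl fun i _ => ?_
        simp only [Pi.sub_apply]
        ring
    _ = 0 := by rw [h1, zero_mul]

end Superconvergence

/-- For four stages the two second moments of `K_N` coincide also for full matrices. -/
lemma form_KN_sq {θ : PeerTriplet 4} (h : θ.OrderConditions) (hK : θ.K.IsDiag)
    (hsup : θ.Superconvergence) :
    nodeForm θ.KN θ.c (fun x _ => x ^ 2) = nodeForm θ.KN θ.c (fun _ y => y ^ 2) := by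
  set F := nodeForm θ.B θ.c with hF
  set d := momentDefect (n := 2) θ 3 1 with hd
  have a1 : F (fun x y => x ^ 2 * (y - 1 - x)) = d := form_pow_mul_linear (n := 2) h hK hsup
  have d40 : momentDefect (n := 2) θ 4 0 = 4 * d := by
    have := momentDefect_degree (n := 2) h hK hsup
    norm_num at this
    exact this
  have d22 : momentDefect (n := 2) θ 2 2 = 0 := momentDefect_eq_zero h hK (by omega) (by omega)
  have d12 : momentDefect (n := 2) θ 1 2 = 0 := momentDefect_eq_zero h hK (by omega) (by omega)
  have d21 : momentDefect (n := 2) θ 2 1 = 0 := momentDefect_eq_zero h hK (by omega) (by omega)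
  have d13 : momentDefect (n := 2) θ 1 3 = 0 := momentDefect_eq_zero h hK (by omega) (by omega)
  have d30 : momentDefect (n := 2) θ 3 0 = 0 := momentDefect_zero_right (n := 2) h hK hsup
  simp only [momentDefect, ← hF] at d40 d22 d12 d21 d13 d30
  simp only [momentDefect, ← hF] at hd
  norm_num at d40 d22 d12 d21 d13 d30 hd
  have a2 : F (fun x y => (y - 1 - x) ^ 2) = 0 := by
    have e : (fun x y : ℝ => (y - 1 - x) ^ 2) =
        ((fun x y : ℝ => (x + 1) * y ^ 2) - fun x y : ℝ => x * (y - 1) ^ 2) -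
        (2 : ℝ) • ((fun x y : ℝ => (x + 1) ^ 2 * y) - fun x y : ℝ => x ^ 2 * (y - 1)) +
        ((fun x _ : ℝ => (x + 1) ^ 3) - fun x _ : ℝ => x ^ 3) := by
      funext x y
      simp only [Pi.sub_apply, Pi.add_apply, Pi.smul_apply, smul_eq_mul]
      ring
    rw [e]
    simp only [map_add, map_sub, map_smul, smul_eq_mul]
    linarith
  have a3 : F (fun x y => x * (y - 1 - x) ^ 2) = -d := by
    have e : (2 : ℝ) • (fun x y : ℝ => x * (y - 1 - x) ^ 2) =
        ((fun x y : ℝ => (x + 1) ^ 2 * y ^ 2) - fun x y : ℝ => x ^ 2 * (y - 1) ^ 2) -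
        (2 : ℝ) • ((fun x y : ℝ => (x + 1) ^ 3 * y) - fun x y : ℝ => x ^ 3 * (y - 1)) +
        ((fun x _ : ℝ => (x + 1) ^ 4) - fun x _ : ℝ => x ^ 4) -
        fun x y : ℝ => (y - 1 - x) ^ 2 := by
      funext x y
      simp only [Pi.sub_apply, Pi.add_apply, Pi.smul_apply, smul_eq_mul]
      ring
    have e' := congrArg F e
    simp only [map_add, map_sub, map_smul, smul_eq_mul] at e'
    linarith
  have a4 : F (fun x y => (y - 1 - x) ^ 3) = d := by
    have e : (fun x y : ℝ => (y - 1 - x) ^ 3) =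
        ((fun x y : ℝ => (x + 1) * y ^ 3) - fun x y : ℝ => x * (y - 1) ^ 3) -
        (3 : ℝ) • ((fun x y : ℝ => (x + 1) ^ 2 * y ^ 2) - fun x y : ℝ => x ^ 2 * (y - 1) ^ 2) +
        (3 : ℝ) • ((fun x y : ℝ => (x + 1) ^ 3 * y) - fun x y : ℝ => x ^ 3 * (y - 1)) -
        ((fun x _ : ℝ => (x + 1) ^ 4) - fun x _ : ℝ => x ^ 4) := by
      funext x y
      simp only [Pi.sub_apply, Pi.add_apply, Pi.smul_apply, smul_eq_mul]
      ring
    rw [e]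
    simp only [map_add, map_sub, map_smul, smul_eq_mul]
    linarith
  have b1 := form_AN_right (n := 2) h (fun x => x ^ 2) (j := 1) (by omega)
  have b2 := form_AN_left (n := 2) h (fun y => y ^ 1) (i := 2) (by omega)
  have b3 := form_AN_right (n := 2) h (fun _ => 1) (j := 3) (by omega)
  have b4 := form_AN_left (n := 2) h (fun y => y ^ 3) (i := 0) (by omega)
  have b5 := form_BN_left (n := 2) h (fun y => (y - 1) ^ 1) (i := 2) (by omega)
  have b6 := form_BN_left (n := 2) h (fun y => (y - 1) ^ 3) (i := 0) (by omega)
  have b7 := h.fwd_end_moment (k := 1) (by omega)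
  have b8 := h.fwd_end_moment (k := 3) (by omega)
  have b7' : (θ.w ⬝ᵥ fun j => θ.c j ^ 1) = 1 := b7
  have b8' : (θ.w ⬝ᵥ fun j => θ.c j ^ 3) = 1 := b8
  have b9 := form_KN_oneleg (n := 2) h (fun y => y)
  have b10 : (fun _ y : ℝ => y * y) = fun _ y : ℝ => y ^ 2 := by funext x y; ring
  rw [b7'] at b2
  rw [b8'] at b4
  rw [b10] at b9
  simp only [pow_zero, one_mul, pow_one] at b1 b2 b3 b4 b5 b6
  norm_num at b1 b2 b3 b4
  have e : (fun _ y : ℝ => (y - 1) ^ 3) = (fun x y : ℝ => x ^ 2 * (y - 1)) +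
      ((fun x y : ℝ => (y - 1 - x) ^ 3) + (3 : ℝ) • (fun x y : ℝ => x * (y - 1 - x) ^ 2) +
      (2 : ℝ) • fun x y : ℝ => x ^ 2 * (y - 1 - x)) := by
    funext x y
    simp only [Pi.add_apply, Pi.smul_apply, smul_eq_mul]
    ring
  have e' := congrArg F e
  simp only [map_add, map_smul, smul_eq_mul] at e'
  linarith

section Superconvergence

variable {n : ℕ} {θ : PeerTriplet (n + 2)}

/-- The moment of `K_N` that enters the mean local error of the last adjoint equation. -/
lemma form_KN_pow (h : θ.OrderConditions) (hK : θ.K.IsDiag) (hsup : θ.Superconvergence)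
    (hfull : n + 2 ≤ 4 ∨ θ.KN.IsDiag) :
    ((n : ℝ) + 1) * nodeForm θ.KN θ.c (fun x _ => x ^ n) =
      1 - nodeForm θ.B θ.c (fun x y => x ^ n * (y - 1)) := by
  have b1 := form_AN_right h (fun x => x ^ n) (j := 1) (by omega)
  have b2 := form_AN_left h (fun y => y ^ 1) (i := n) (by omega)
  have b5 := form_BN_left h (fun y => (y - 1) ^ 1) (i := n) (by omega)
  have b7 : (θ.w ⬝ᵥ fun j => θ.c j ^ 1) = 1 := h.fwd_end_moment (k := 1) (by omega)
  rw [b7] at b2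
  have hsym : (n : ℝ) * nodeForm θ.KN θ.c (fun x y => x ^ (n - 1) * y ^ 1) =
      n * nodeForm θ.KN θ.c (fun x _ => x ^ n) := by
    rcases hfull with h4 | hd
    · have hn : n = 0 ∨ n = 1 ∨ n = 2 := by omega
      rcases hn with rfl | rfl | rfl
      · simp
      · have := form_KN_oneleg h (fun _ => 1)
        simp only [mul_one] at this
        simp [this]
      · have h1 := form_KN_oneleg h (fun y => y)
        have h2 := form_KN_sq h hK hsup
        have h3 : (fun _ y : ℝ => y * y) = fun _ y : ℝ => y ^ 2 := by funext x y; ring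
        rw [h3] at h1
        simp only [Nat.add_one_sub_one, pow_one]
        rw [h1, h2]
    · rcases Nat.eq_zero_or_pos n with rfl | hn
      · simp
      · congr 1
        refine nodeForm_congr_of_isDiag hd θ.c fun x => ?_
        rw [← pow_add, Nat.sub_add_cancel hn]
  rw [hsym] at b2
  rw [b5] at b1
  simp only [pow_one, Nat.cast_one, one_mul, Nat.sub_self, pow_zero, mul_one] at b1 b2
  linarith

/-- The singular system `(A - B) ρ = η` is solvable for `𝟙ᵀ η = 0`. -/
lemma _root_.StrictlyStable.exists_sub_mulVec_eq {s : ℕ} {A B : Matrix (Fin s) (Fin s) ℝ}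
    (h : StrictlyStable A B) {η : Fin s → ℝ} (hη : (1 : Fin s → ℝ) ⬝ᵥ η = 0) :
    ∃ ρ : Fin s → ℝ, (A - B) *ᵥ ρ = η := by
  obtain ⟨C, q, hC, hq0, hq1, hd⟩ := h.decay
  set M := complPart A B with hM
  have hinj : Function.Injective (1 - M).mulVec := by
    refine (injective_iff_map_eq_zero (1 - M).mulVecLin).2 fun x hx => ?_
    have hx' : M *ᵥ x = x := by
      have h1 : (1 - M) *ᵥ x = 0 := hx
      rw [sub_mulVec, one_mulVec, sub_eq_zero] at h1
      exact h1.symm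
    have hk : ∀ k : ℕ, (M ^ k) *ᵥ x = x := by
      intro k
      induction k with
      | zero => simp
      | succ k ih => rw [pow_succ, ← mulVec_mulVec, hx', ih]
    funext i
    have hlim : Filter.Tendsto (fun k : ℕ => ∑ j, C * q ^ k * |x j|) Filter.atTop (𝓝 0) := by
      have h1 := (tendsto_pow_atTop_nhds_zero_of_lt_one hq0 hq1).mul_const (C * ∑ j, |x j|)
      rw [zero_mul] at h1
      refine h1.congr fun k => ?_
      rw [Finset.mul_sum, Finset.mul_sum]
      exact Finset.sum_congr rfl fun j _ => by ring
    have hle : |x i| ≤ 0 := by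
      refine ge_of_tendsto' hlim fun k => ?_
      have h1 := congrFun (hk k) i
      rw [← h1]
      simp only [mulVec, dotProduct]
      refine (Finset.abs_sum_le_sum_abs _ _).trans (Finset.sum_le_sum fun j _ => ?_)
      rw [abs_mul]
      gcongr
      exact hd k i j
    exact abs_nonpos_iff.1 hle
  have hunit : IsUnit (1 - M) := mulVec_injective_iff_isUnit.1 hinj
  have hdet := (isUnit_iff_isUnit_det _).1 hunit
  refine ⟨(1 - M)⁻¹ *ᵥ (A⁻¹ *ᵥ η), ?_⟩
  set ρ := (1 - M)⁻¹ *ᵥ (A⁻¹ *ᵥ η) with hρ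
  have h1 : (A - B) *ᵥ ρ + ((1 ᵥ* A) ⬝ᵥ ρ) • (A *ᵥ 1) = η := by
    have h0 : (1 - M) *ᵥ ρ = A⁻¹ *ᵥ η := by
      rw [hρ, mulVec_mulVec _ (1 - M), mul_nonsing_inv _ hdet, one_mulVec]
    have h2 : (A * (1 - M)) *ᵥ ρ = η := by
      rw [← mulVec_mulVec, h0, mulVec_mulVec, mul_nonsing_inv _ h.unit, one_mulVec]
    rw [hM, complPart, mul_sub, mul_one, mul_sub, ← Matrix.mul_assoc, mul_nonsing_inv _ h.unit,
      one_mul, mul_vecMulVec, sub_mulVec, sub_mulVec, vecMulVec_mulVec, op_smul_eq_smul] at h2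
    rw [← h2, sub_mulVec]
    abel
  have h3 := congrArg ((1 : Fin s → ℝ) ⬝ᵥ ·) h1
  simp only [dotProduct_add, dotProduct_smul, h.total, hη, dotProduct_mulVec, vecMul_sub, h.row,
    sub_self, zero_dotProduct, zero_add, smul_eq_mul, mul_one] at h3
  rw [h.row, h3, zero_smul, add_zero] at h1
  exact h1

end Superconvergence

section Corrector

variable {n : ℕ} {θ : PeerTriplet (n + 2)}

/-- The properties of the coefficient vector `ρ` of the term of order `s - 1` in the adjoint error:
with it the local errors of the standard method gain one order, and the effect of the error term on
the state cancels in the mean. -/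
structure IsCorrector (θ : PeerTriplet (n + 2)) (ρ : Fin (n + 2) → ℝ) : Prop where
  solves : (θ.A - θ.B)ᵀ *ᵥ ρ = -adjDefect θ.A θ.B θ.K θ.c (n + 1)
  mean_K : (1 : Fin (n + 2) → ℝ) ⬝ᵥ (θ.K *ᵥ ρ) = 0

/-- Preconsistency of order one: the right-hand side enters the means with weight one. -/
lemma one_dotProduct_K_one (h : θ.OrderConditions) :
    (1 : Fin (n + 2) → ℝ) ⬝ᵥ (θ.K *ᵥ 1) = 1 := by
  have h1 := h.fwd_standard_moment (k := 1) (by omega)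
  have h2 := congrArg ((1 : Fin (n + 2) → ℝ) ⬝ᵥ ·) h1
  simp only [pow_one, Nat.cast_one, one_smul, Nat.sub_self, pow_zero, dotProduct_add,
    mulVec_sub, dotProduct_sub, h.compat_zero] at h2
  rw [dotProduct_mulVec _ θ.A, one_vecMul_A h (by omega), ← dotProduct_mulVec] at h2
  linarith

/-- The singular system for the corrector is solvable by the superconvergence condition of the adjoint;
its kernel, spanned by `𝟙`, leaves room for the normalization. -/
lemma exists_isCorrector (h : θ.OrderConditions) (hadm : θ.Admissible)
    (hsup : θ.Superconvergence) (hst : StrictlyStable θ.A θ.B) : ∃ ρ, θ.IsCorrector ρ := by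
  obtain ⟨ρ, hρ⟩ := hst.transpose.exists_sub_mulVec_eq
    (η := -adjDefect θ.A θ.B θ.K θ.c (n + 1))
    (by rw [dotProduct_neg, one_dotProduct_adjDefect hadm.K_diag hsup, neg_zero])
  -- the normalization is possible since `𝟙ᵀ K 𝟙 = 1`
  refine ⟨ρ - ((1 : Fin (n + 2) → ℝ) ⬝ᵥ (θ.K *ᵥ ρ)) • 1, ?_, ?_⟩
  · rw [mulVec_sub, mulVec_smul, transpose_sub, hρ, sub_mulVec, hst.transpose.col, sub_self,
      smul_zero, sub_zero]
  · rw [mulVec_sub, mulVec_smul, dotProduct_sub, dotProduct_smul, one_dotProduct_K_one h, smul_eq_mul, mul_one,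
      sub_self]

/-- The mean transported by the corrector is the moment defect left open by superconvergence. -/
lemma IsCorrector.mean_B {ρ : Fin (n + 2) → ℝ} (hρ : θ.IsCorrector ρ) (h : θ.OrderConditions)
    (hK : θ.K.IsDiag) :
    (1 : Fin (n + 2) → ℝ) ⬝ᵥ (θ.Bᵀ *ᵥ ρ) = momentDefect θ (n + 1) 1 := by
  have h1 := h.fwd_standard_moment (k := 1) (by omega)
  simp only [pow_one, Nat.cast_one, one_smul, Nat.sub_self, pow_zero] at h1
  have h2 := hρ.mean_K
  have h3 : θ.Kᵀ = θ.K := hK.isSymm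
  have h4 := dotProduct_adjDefect_standard h hK (n + 1) (j := 1) (by omega)
  have h5 := congrArg (θ.c ⬝ᵥ ·) hρ.solves
  simp only [dotProduct_neg] at h5
  rw [pow_one] at h4
  rw [h4, mulVec_transpose, dotProduct_comm, ← dotProduct_mulVec, sub_mulVec] at h5
  rw [dotProduct_mulVec, ← mulVec_transpose, h3, dotProduct_comm] at h2
  rw [mulVec_transpose, dotProduct_comm, ← dotProduct_mulVec]
  have h6 := congrArg (ρ ⬝ᵥ ·) h1
  simp only [dotProduct_add, mulVec_sub, dotProduct_sub] at h6 h5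
  linarith

/-- The mean of the local adjoint error of order `s` of the standard method. -/
lemma IsCorrector.mean_adjDefect_succ {ρ : Fin (n + 2) → ℝ} (hρ : θ.IsCorrector ρ)
    (h : θ.OrderConditions) (hK : θ.K.IsDiag) (hsup : θ.Superconvergence) :
    (1 : Fin (n + 2) → ℝ) ⬝ᵥ adjDefect θ.A θ.B θ.K θ.c (n + 2) =
      ((n : ℝ) + 2) * ((1 : Fin (n + 2) → ℝ) ⬝ᵥ (θ.Bᵀ *ᵥ ρ)) := by
  rw [hρ.mean_B h hK, ← momentDefect_degree h hK hsup,
    ← dotProduct_adjDefect_standard h hK (n + 2) (j := 0) (by omega), pow_zero]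

/-- The mean of the local adjoint errors of order `s - 1` in the last two intervals is cancelled by
the correction term. -/
lemma IsCorrector.mean_adjDefect_end {ρ : Fin (n + 2) → ℝ} (hρ : θ.IsCorrector ρ)
    (h : θ.OrderConditions) (hK : θ.K.IsDiag) (hsup : θ.Superconvergence)
    (hfull : n + 2 ≤ 4 ∨ θ.KN.IsDiag) :
    (1 : Fin (n + 2) → ℝ) ⬝ᵥ adjDefect θ.A θ.BN θ.K θ.c (n + 1) +
      (1 : Fin (n + 2) → ℝ) ⬝ᵥ (θ.ANᵀ *ᵥ (θ.c ^ (n + 1)) - θ.w +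
        ((n : ℝ) + 1) • (θ.KNᵀ *ᵥ (θ.c ^ n))) +
      (1 : Fin (n + 2) → ℝ) ⬝ᵥ (θ.Aᵀ *ᵥ ρ) = 0 := by
  have h1 := dotProduct_adjDefect θ.A θ.BN θ.K θ.c (n + 1) 0
  have h2 : (1 : Fin (n + 2) → ℝ) ⬝ᵥ (θ.Aᵀ *ᵥ ρ) = momentDefect θ (n + 1) 1 := by
    rw [← hρ.mean_B h hK, mulVec_transpose, mulVec_transpose, dotProduct_comm,
      ← dotProduct_mulVec, dotProduct_comm _ (_ ᵥ* _), ← dotProduct_mulVec,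
      A_mulVec_one h (by omega)]
  have h3 : (1 : Fin (n + 2) → ℝ) ⬝ᵥ (θ.ANᵀ *ᵥ (θ.c ^ (n + 1))) =
      nodeForm θ.BN θ.c (fun x _ => x ^ (n + 1)) := by
    have e1 := nodeForm_mul' θ.AN θ.c (fun x => x ^ (n + 1)) (fun _ => 1)
    have e2 := form_AN_right h (fun x => x ^ (n + 1)) (j := 0) (by omega)
    simp only [mul_one, pow_zero, Nat.cast_zero, zero_mul, add_zero] at e1 e2
    rw [← e2, e1]
    rfl
  have h4 : (1 : Fin (n + 2) → ℝ) ⬝ᵥ (θ.KNᵀ *ᵥ (θ.c ^ n)) =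
      nodeForm θ.KN θ.c (fun x _ => x ^ n) := by
    have e1 := nodeForm_mul' θ.KN θ.c (fun x => x ^ n) (fun _ => 1)
    simp only [mul_one] at e1
    rw [e1]
    rfl
  have h5 : (1 : Fin (n + 2) → ℝ) ⬝ᵥ θ.w = 1 := by
    have := h.fwd_end_moment (k := 0) (by omega)
    rwa [pow_zero, dotProduct_comm] at this
  -- The forms of `B` and `B_N` agree on the polynomial `(x + 1)^(s-1) - x^(s-1)` of lower degree.
  have h6 : nodeForm θ.BN θ.c (fun x _ => (x + 1) ^ (n + 1)) -
      nodeForm θ.BN θ.c (fun x _ => x ^ (n + 1)) =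
      nodeForm θ.B θ.c (fun x _ => (x + 1) ^ (n + 1)) -
      nodeForm θ.B θ.c (fun x _ => x ^ (n + 1)) := by
    have e : (fun x _ : ℝ => (x + 1) ^ (n + 1)) - (fun x _ : ℝ => x ^ (n + 1)) =
        ∑ l ∈ Finset.range (n + 1), ((n + 1).choose l : ℝ) • fun x _ : ℝ => x ^ l * 1 := by
      funext x y
      simp only [Pi.sub_apply, Finset.sum_apply, Pi.smul_apply, smul_eq_mul]
      rw [add_pow, Finset.sum_range_succ]
      simp only [one_pow, mul_one, Nat.choose_self, Nat.cast_one, add_sub_cancel_right]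
      exact Finset.sum_congr rfl fun l _ => by ring
    rw [← map_sub, ← map_sub, e, map_sum, map_sum]
    refine Finset.sum_congr rfl fun l hl => ?_
    rw [map_smul, map_smul, form_BN_left h (fun _ => 1) (Finset.mem_range.1 hl)]
  have h7 := momentDefect_zero_right h hK hsup
  have h8 := form_KN_pow h hK hsup hfull
  have h9 := form_pow_mul_linear h hK hsup
  have h10 := form_A_const_right h (fun x => x ^ (n + 1))
  have h11 : nodeForm θ.B θ.c (fun x y => x ^ n * (y - 1 - x)) =
      nodeForm θ.B θ.c (fun x y => x ^ n * (y - 1)) -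
      nodeForm θ.B θ.c (fun x _ => x ^ (n + 1)) := by
    rw [← map_sub]
    congr 1
    funext x y
    simp only [Pi.sub_apply]
    ring
  simp only [momentDefect, pow_zero, mul_one, Nat.add_sub_cancel,
    Nat.cast_zero, add_zero] at h7 h1
  rw [h1, h2, dotProduct_add, dotProduct_sub, dotProduct_smul, h3, h4, h5, h10, ← h9, h11,
    smul_eq_mul, h8]
  linarith

end Corrector

end PeerTriplet

/-! ### Linear differential equations and discrete perturbations of boundary value problems -/

section LinearODE

variable {E : Type*} [NormedAddCommGroup E] [NormedSpace ℝ E] {T : ℝ} {J : ℝ → E →L[ℝ] E}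

lemma exists_norm_le_of_continuousOn_Icc {F : Type*} [NormedAddCommGroup F] {f : ℝ → F} {a b : ℝ}
    (hf : ContinuousOn f (Icc a b)) : ∃ K : ℝ, 0 ≤ K ∧ ∀ t ∈ Icc a b, ‖f t‖ ≤ K := by
  obtain ⟨K, hK⟩ := isCompact_Icc.exists_bound_of_continuousOn hf
  exact ⟨max K 0, le_max_right _ _, fun t ht => (hK t ht).trans (le_max_left _ _)⟩

lemma norm_le_exp_of_deriv_le {x x' : ℝ → E} {K : ℝ}
    (hx : ∀ t ∈ Icc 0 T, HasDerivWithinAt x (x' t) (Icc 0 T) t)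
    (hb : ∀ t ∈ Icc 0 T, ‖x' t‖ ≤ K * ‖x t‖) {t : ℝ} (ht : t ∈ Icc 0 T) :
    ‖x t‖ ≤ ‖x 0‖ * Real.exp (K * t) := by
  have h := norm_le_gronwallBound_of_norm_deriv_right_le (f := x) (f' := x') (δ := ‖x 0‖)
    (K := K) (ε := 0) (a := 0) (b := T) (fun t ht => (hx t ht).continuousWithinAt)
    (fun t ht => (hx t ⟨ht.1, ht.2.le⟩).mono_of_mem_nhdsWithin
      (Icc_mem_nhdsGE_of_mem ht)) le_rfl
    (fun t ht => by simpa using hb t ⟨ht.1, ht.2.le⟩) t ht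
  simpa [gronwallBound_ε0] using h

lemma norm_le_exp_of_isIntegralCurveOn {x : ℝ → E} {K : ℝ}
    (hx : IsIntegralCurveOn x (fun t z => J t z) (Icc 0 T)) (hK0 : 0 ≤ K)
    (hK : ∀ t ∈ Icc 0 T, ‖J t‖ ≤ K) {t : ℝ} (ht : t ∈ Icc 0 T) :
    ‖x t‖ ≤ Real.exp (K * T) * ‖x 0‖ := by
  have h := norm_le_exp_of_deriv_le hx (K := K)
    (fun t ht => ((J t).le_opNorm _).trans (by gcongr; exact hK t ht)) ht
  refine h.trans ?_
  rw [mul_comm]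
  gcongr
  exact ht.2

/-- A linear differential equation with continuous coefficients has a solution on the whole
interval: the vector field is cut off outside a ball that no solution can leave. -/
lemma exists_isIntegralCurveOn_linear [FiniteDimensional ℝ E] (hT : 0 ≤ T)
    (hJ : ContinuousOn J (Icc 0 T)) (x0 : E) :
    ∃ x : ℝ → E, x 0 = x0 ∧ IsIntegralCurveOn x (fun t z => J t z) (Icc 0 T) := by
  have : CompleteSpace E := FiniteDimensional.complete ℝ E
  obtain ⟨K, hK0, hK⟩ := exists_norm_le_of_continuousOn_Icc hJ
  set R := Real.exp (K * T) * ‖x0‖ + 1 with hR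
  have hRpos : 0 < R := by positivity
  let χ : ContDiffBump (0 : E) := ⟨R, R + 1, hRpos, by linarith⟩
  set τ : E → E := fun z => χ z • z with hτ
  obtain ⟨Cl, hCl⟩ : ∃ C, LipschitzWith C τ :=
    ContDiff.lipschitzWith_of_hasCompactSupport (n := 1) (𝕂 := ℝ) (χ.hasCompactSupport.smul_right)
      (χ.contDiff.smul contDiff_id) one_ne_zero
  have hτle : ∀ z, ‖τ z‖ ≤ ‖z‖ := fun z => by
    rw [hτ]
    simp only [norm_smul, Real.norm_eq_abs, abs_of_nonneg (χ.nonneg)]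
    exact mul_le_of_le_one_left (norm_nonneg _) χ.le_one
  have hτbd : ∀ z, ‖τ z‖ ≤ R + 1 := fun z => by
    by_cases hz : ‖z‖ ≤ R + 1
    · exact (hτle z).trans hz
    · have : χ z = 0 := χ.zero_of_le_dist (by simpa using (not_le.1 hz).le)
      simp only [hτ, this, zero_smul, norm_zero]
      positivity
  have hpl : IsPicardLindelof (fun t z => J t (τ z)) (tmin := 0) (tmax := T) ⟨0, le_rfl, hT⟩ x0
      (NNReal.mk (K * (R + 1) * T) (by positivity)) 0 (NNReal.mk (K * (R + 1)) (by positivity))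
      (NNReal.mk K hK0 * Cl) := by
    refine ⟨fun t ht => LipschitzWith.lipschitzOnWith ?_, fun z _ => ?_, fun t ht z _ => ?_, ?_⟩
    · exact ((J t).lipschitz.weaken (show ‖J t‖₊ ≤ NNReal.mk K hK0 from hK t ht)).comp hCl
    · exact hJ.clm_apply continuousOn_const
    · exact ((J t).le_opNorm _).trans (mul_le_mul (hK t ht) (hτbd z) (norm_nonneg _) hK0)
    · simp [max_eq_left hT]
  obtain ⟨x, hx0, hx⟩ := hpl.exists_eq_forall_mem_Icc_hasDerivWithinAt₀
  refine ⟨x, hx0, fun t ht => ?_⟩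
  have hxR : ‖x t‖ ≤ R := by
    have h := norm_le_exp_of_deriv_le hx (K := K)
      (fun t ht => ((J t).le_opNorm _).trans
        (mul_le_mul (hK t ht) (hτle _) (norm_nonneg _) hK0)) ht
    have hx0' : x 0 = x0 := hx0
    rw [hx0'] at h
    refine h.trans ?_
    rw [hR, mul_comm]
    have : Real.exp (K * t) ≤ Real.exp (K * T) := by gcongr; exact ht.2
    nlinarith [norm_nonneg x0]
  have h := hx t ht
  have h1 : τ (x t) = x t := by
    have : χ (x t) = 1 := χ.one_of_mem_closedBall (by simpa using hxR)
    simp only [hτ, this, one_smul]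
  simpa only [h1] using h

lemma IsIntegralCurveOn.linear_eq {x x' : ℝ → E} (hJ : ContinuousOn J (Icc 0 T))
    (hx : IsIntegralCurveOn x (fun t z => J t z) (Icc 0 T))
    (hx' : IsIntegralCurveOn x' (fun t z => J t z) (Icc 0 T)) (h0 : x 0 = x' 0) {t : ℝ}
    (ht : t ∈ Icc 0 T) : x t = x' t := by
  obtain ⟨K, hK0, hK⟩ := exists_norm_le_of_continuousOn_Icc hJ
  have hd : IsIntegralCurveOn (x - x') (fun t z => J t z) (Icc 0 T) := fun t ht => by
    have := (hx t ht).sub (hx' t ht)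
    simpa using this
  have h := norm_le_exp_of_isIntegralCurveOn hd hK0 hK ht
  rw [Pi.sub_apply, Pi.sub_apply, h0, sub_self, norm_zero, mul_zero] at h
  exact sub_eq_zero.1 (norm_le_zero_iff.1 h)

/-- The one-step error of the explicit Euler method on the solutions of a linear differential
equation, uniformly in the initial value. -/
lemma exists_euler_consistent (hJ : ContinuousOn J (Icc 0 T)) {ε : ℝ} (hε : 0 < ε) :
    ∃ h₀ > 0, ∀ x : ℝ → E, IsIntegralCurveOn x (fun t z => J t z) (Icc 0 T) →
      ∀ t h : ℝ, 0 ≤ t → 0 < h → h ≤ h₀ → t + h ≤ T →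
        ‖x (t + h) - x t - h • J t (x t)‖ ≤ h * (ε * ‖x 0‖) := by
  obtain ⟨K, hK0, hK⟩ := exists_norm_le_of_continuousOn_Icc hJ
  set G := Real.exp (K * T) with hG
  have hGpos : 0 < G := Real.exp_pos _
  have huc := isCompact_Icc.uniformContinuousOn_of_continuous hJ
  obtain ⟨d, hd, hdJ⟩ := Metric.uniformContinuousOn_iff.1 huc (ε / (2 * G)) (by positivity)
  refine ⟨min (d / 2) (ε / (2 * (K * K * G + 1))), by positivity, fun x hx t h ht hh hh0 hth => ?_⟩
  have hsub : Icc t (t + h) ⊆ Icc 0 T := Icc_subset_Icc ht hth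
  have hxb : ∀ τ ∈ Icc 0 T, ‖x τ‖ ≤ G * ‖x 0‖ := fun τ hτ =>
    norm_le_exp_of_isIntegralCurveOn hx hK0 hK hτ
  have hJx : ∀ τ ∈ Icc 0 T, ‖J τ (x τ)‖ ≤ K * (G * ‖x 0‖) := fun τ hτ =>
    ((J τ).le_opNorm _).trans (mul_le_mul (hK τ hτ) (hxb τ hτ) (norm_nonneg _) hK0)
  have htm : t ∈ Icc t (t + h) := ⟨le_rfl, by linarith⟩
  have hdiff : ∀ τ ∈ Icc t (t + h), ‖x τ - x t‖ ≤ K * (G * ‖x 0‖) * h := by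
    intro τ hτ
    have h1 := (convex_Icc t (t + h)).norm_image_sub_le_of_norm_hasDerivWithin_le
      (fun τ hτ => (hx τ (hsub hτ)).mono hsub) (fun τ hτ => hJx τ (hsub hτ)) htm hτ
    refine h1.trans ?_
    gcongr
    rw [Real.norm_eq_abs, abs_le]
    constructor <;> linarith [hτ.1, hτ.2]
  have hderiv : ∀ τ ∈ Icc t (t + h), HasDerivWithinAt (fun τ => x τ - τ • J t (x t))
      (J τ (x τ) - J t (x t)) (Icc t (t + h)) τ := by
    intro τ hτ
    have h1 := ((hx τ (hsub hτ)).mono hsub).sub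
      ((hasDerivWithinAt_id τ (Icc t (t + h))).smul_const (J t (x t)))
    simpa using! h1
  have hbound : ∀ τ ∈ Icc t (t + h), ‖J τ (x τ) - J t (x t)‖ ≤ ε * ‖x 0‖ := by
    intro τ hτ
    have e : J τ (x τ) - J t (x t) = (J τ - J t) (x τ) + J t (x τ - x t) := by
      simp
    have h1 : ‖J τ - J t‖ ≤ ε / (2 * G) := by
      rw [← dist_eq_norm]
      refine (hdJ τ (hsub hτ) t (hsub htm) ?_).le
      rw [Real.dist_eq, abs_lt]
      have h2 : h ≤ d / 2 := hh0.trans (min_le_left _ _)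
      constructor <;> linarith [hτ.1, hτ.2]
    have h2 : h * (2 * (K * K * G + 1)) ≤ ε := by
      rw [← le_div_iff₀ (by positivity)]
      exact hh0.trans (min_le_right _ _)
    rw [e]
    calc _ ≤ ‖J τ - J t‖ * ‖x τ‖ + ‖J t‖ * ‖x τ - x t‖ :=
          (norm_add_le _ _).trans (add_le_add ((J τ - J t).le_opNorm _) ((J t).le_opNorm _))
      _ ≤ ε / (2 * G) * (G * ‖x 0‖) + K * (K * (G * ‖x 0‖) * h) := by
          gcongr
          · exact hxb τ (hsub hτ)
          · exact hK t (hsub htm)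
          · exact hdiff τ hτ
      _ = (ε / 2 + (K * K * G) * h) * ‖x 0‖ := by field_simp
      _ ≤ ε * ‖x 0‖ := by
          gcongr
          linarith
  have h1 := (convex_Icc t (t + h)).norm_image_sub_le_of_norm_hasDerivWithin_le hderiv hbound htm
    (⟨by linarith, le_rfl⟩ : t + h ∈ Icc t (t + h))
  rw [Real.norm_eq_abs, add_sub_cancel_left, abs_of_pos hh] at h1
  calc _ = ‖x (t + h) - (t + h) • J t (x t) - (x t - t • J t (x t))‖ := by
        congr 1
        rw [add_smul]
        abel
    _ ≤ _ := h1
    _ = _ := by ring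

end LinearODE

section BoundaryValueProblem

variable {V : Type*} [NormedAddCommGroup V] [NormedSpace ℝ V] [FiniteDimensional ℝ V] {T : ℝ}
  {J : ℝ → (V × V) →L[ℝ] (V × V)} {Q : V →L[ℝ] V}

/-- The homogeneous linear boundary value problem `x' = J x` with the boundary conditions
`x₁(0) = 0` and `x₂(T) = Q x₁(T)` has only the trivial solution. -/
def UniquelySolvable (T : ℝ) (J : ℝ → (V × V) →L[ℝ] (V × V)) (Q : V →L[ℝ] V) : Prop :=
  ∀ x : ℝ → V × V, IsIntegralCurveOn x (fun t z => J t z) (Icc 0 T) → (x 0).1 = 0 →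
    (x T).2 = Q (x T).1 → x 0 = 0

/-- The linear map from initial to boundary values is injective, hence boundedly invertible. -/
lemma UniquelySolvable.exists_bound (h : UniquelySolvable T J Q) (hT : 0 ≤ T)
    (hJ : ContinuousOn J (Icc 0 T)) :
    ∃ κ : ℝ, 0 ≤ κ ∧ ∀ x : ℝ → V × V, IsIntegralCurveOn x (fun t z => J t z) (Icc 0 T) →
      ‖x 0‖ ≤ κ * (‖(x 0).1‖ + ‖(x T).2 - Q (x T).1‖) := by
  choose sol hsol0 hsol using fun x0 : V × V => exists_isIntegralCurveOn_linear hT hJ x0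
  have h0 : (0 : ℝ) ∈ Icc 0 T := ⟨le_rfl, hT⟩
  have hTm : T ∈ Icc 0 T := ⟨hT, le_rfl⟩
  -- The boundary values depend linearly on the initial value.
  let S : (V × V) →ₗ[ℝ] (V × V) :=
    { toFun := fun x0 => (x0.1, (sol x0 T).2 - Q (sol x0 T).1)
      map_add' := fun a b => by
        have h1 : IsIntegralCurveOn (sol a + sol b) (fun t z => J t z) (Icc 0 T) := fun t ht => by
          simpa using (hsol a t ht).add (hsol b t ht)
        have h2 := IsIntegralCurveOn.linear_eq hJ (hsol (a + b)) h1
          (by simp [hsol0]) hTm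
        rw [h2]
        ext1
        · simp
        · simp only [Pi.add_apply, Prod.snd_add, Prod.fst_add, map_add]
          abel
      map_smul' := fun r a => by
        have h1 : IsIntegralCurveOn (r • sol a) (fun t z => J t z) (Icc 0 T) := fun t ht => by
          simpa using (hsol a t ht).const_smul r
        have h2 := IsIntegralCurveOn.linear_eq hJ (hsol (r • a)) h1
          (by simp [hsol0]) hTm
        rw [h2]
        ext1
        · simp
        · simp [smul_sub] }
  have hker : LinearMap.ker S = ⊥ := by
    refine LinearMap.ker_eq_bot'.2 fun x0 hx0 => ?_
    have h1 : x0.1 = 0 := congrArg Prod.fst hx0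
    have h2 : (sol x0 T).2 - Q (sol x0 T).1 = 0 := congrArg Prod.snd hx0
    have h3 := h (sol x0) (hsol x0) (by rw [hsol0, h1]) (sub_eq_zero.1 h2)
    rwa [hsol0] at h3
  obtain ⟨κ, hκ, hS⟩ := S.exists_antilipschitzWith hker
  refine ⟨κ, κ.2, fun x hx => ?_⟩
  have h1 : ‖x 0‖ ≤ κ * ‖S (x 0)‖ := by
    have := hS.le_mul_dist (x 0) 0
    simpa using this
  have h2 : sol (x 0) T = x T := IsIntegralCurveOn.linear_eq hJ (hsol _) hx (hsol0 _) hTm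
  refine h1.trans (mul_le_mul_of_nonneg_left ?_ κ.2)
  have h3 : S (x 0) = ((x 0).1, (x T).2 - Q (x T).1) := by
    rw [← h2]
    rfl
  rw [h3]
  exact max_le_add_of_nonneg (norm_nonneg _) (norm_nonneg _)

set_option maxHeartbeats 1000000 in
/-- Stability of one-step discretizations of a uniquely solvable linear boundary value problem. -/
lemma UniquelySolvable.exists_discrete_bound (hJQ : UniquelySolvable T J Q) (hT : 0 < T)
    (hJ : ContinuousOn J (Icc 0 T)) :
    ∃ κ : ℝ, 0 ≤ κ ∧ ∃ h₀ > 0, ∀ (N : ℕ) (h : ℝ), h = T / (N + 1) → h ≤ h₀ → 2 ≤ N →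
      ∀ z : ℕ → V × V, ∀ n, 1 ≤ n → n < N →
        ‖z n‖ ≤ κ * (‖(z 1).1‖ + ‖(z (N - 1)).2 - Q (z (N - 1)).1‖ +
          ∑ k ∈ Finset.Ico 1 (N - 1), ‖z (k + 1) - z k - h • J (k * h) (z k)‖) := by
  obtain ⟨κ, hκ0, hκ⟩ := hJQ.exists_bound hT.le hJ
  obtain ⟨K, hK0, hK⟩ := exists_norm_le_of_continuousOn_Icc hJ
  set G := Real.exp (K * T) with hG
  have hGpos : 0 < G := Real.exp_pos _
  have hG1 : 1 ≤ G := Real.one_le_exp (by positivity)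
  set q := 1 + ‖Q‖ with hq
  have hqpos : 0 < q := by positivity
  -- `Λ` bounds all factors with which the small quantities `ε` and `h` enter.
  set Λ := κ * q * G * (T + 3 * K * G) + (T + K * G) + 1 with hΛ
  have hΛpos : 0 < Λ := by positivity
  set ε := 1 / (2 * Λ) with hε
  have hεpos : 0 < ε := by positivity
  obtain ⟨h₀, hh₀, hcons⟩ := exists_euler_consistent hJ hεpos
  refine ⟨G * (2 * κ * (q * G)) + G * (1 + 2 * κ * (q * G)), by positivity, min h₀ ε,
    by positivity, fun N h hN hh hN2 z => ?_⟩
  have hNpos : (0 : ℝ) < (N : ℝ) + 1 := by positivity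
  have hhpos : 0 < h := by rw [hN]; positivity
  have hNh : (N : ℝ) * h + h = T := by rw [hN]; field_simp
  have hhε : h ≤ ε := hh.trans (min_le_right _ _)
  obtain ⟨x, hx0, hx⟩ := exists_isIntegralCurveOn_linear hT.le hJ (z 1)
  have hmem : ∀ n : ℕ, n ≤ N + 1 → (n : ℝ) * h ∈ Icc 0 T := by
    intro n hn
    have : (n : ℝ) ≤ (N : ℝ) + 1 := by exact_mod_cast hn
    exact ⟨by positivity, by nlinarith⟩
  have hxb : ∀ t ∈ Icc 0 T, ‖x t‖ ≤ G * ‖z 1‖ := fun t ht => by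
    rw [← hx0]
    exact norm_le_exp_of_isIntegralCurveOn hx hK0 hK ht
  have hJx : ∀ t ∈ Icc 0 T, ‖J t (x t)‖ ≤ K * (G * ‖z 1‖) := fun t ht =>
    ((J t).le_opNorm _).trans (mul_le_mul (hK t ht) (hxb t ht) (norm_nonneg _) hK0)
  have hxlip : ∀ t ∈ Icc 0 T, ∀ t' ∈ Icc 0 T, ‖x t' - x t‖ ≤ K * (G * ‖z 1‖) * |t' - t| := by
    intro t ht t' ht'
    exact (convex_Icc 0 T).norm_image_sub_le_of_norm_hasDerivWithin_le hx hJx ht ht'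
  set d : ℕ → ℝ := fun k => ‖z (k + 1) - z k - h • J (k * h) (z k)‖ with hd
  set D := ∑ k ∈ Finset.Ico 1 (N - 1), d k with hD
  have hD0 : 0 ≤ D := Finset.sum_nonneg fun k _ => norm_nonneg _
  -- The distance of the discrete sequence and the solution with the same initial value.
  have hstep : ∀ n, 1 ≤ n → n < N - 1 → ‖z (n + 1) - x ((n + 1 : ℕ) * h)‖ ≤
      Real.exp (K * h) * ‖z n - x (n * h)‖ + (d n + h * (ε * ‖z 1‖)) := by
    intro n hn1 hn2
    have hn : (n : ℝ) * h ∈ Icc 0 T := hmem n (by omega)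
    have hn' := hmem (n + 1) (by omega)
    have e1 : ((n + 1 : ℕ) : ℝ) * h = n * h + h := by push_cast; ring
    have h1 := hcons x hx (n * h) h hn.1 hhpos (hh.trans (min_le_left _ _))
      (by rw [← e1]; exact hn'.2)
    rw [hx0, ← e1] at h1
    have e2 : z (n + 1) - x ((n + 1 : ℕ) * h) = (z n - x (n * h)) +
        h • J (n * h) (z n - x (n * h)) + (z (n + 1) - z n - h • J (n * h) (z n)) -
        (x ((n + 1 : ℕ) * h) - x (n * h) - h • J (n * h) (x (n * h))) := by
      rw [map_sub, smul_sub]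
      abel
    have h2 : ‖h • J (n * h) (z n - x (n * h))‖ ≤ h * (K * ‖z n - x (n * h)‖) := by
      rw [norm_smul, Real.norm_eq_abs, abs_of_pos hhpos]
      gcongr
      exact ((J _).le_opNorm _).trans (by gcongr; exact hK _ hn)
    have h3 : 1 + K * h ≤ Real.exp (K * h) := by
      linarith [Real.add_one_le_exp (K * h)]
    have h4 := mul_le_mul_of_nonneg_right h3 (norm_nonneg (z n - x (n * h)))
    rw [e2]
    calc _ ≤ ‖z n - x (n * h)‖ + h * (K * ‖z n - x (n * h)‖) + d n + h * (ε * ‖z 1‖) := by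
          refine (norm_sub_le _ _).trans (add_le_add ((norm_add_le _ _).trans
            (add_le_add ((norm_add_le _ _).trans (add_le_add le_rfl h2)) le_rfl)) h1)
      _ ≤ _ := by linarith
  have hw : ∀ n, 1 ≤ n → n ≤ N - 1 → ‖z n - x (n * h)‖ ≤ Real.exp (K * (n * h)) *
      (h * (K * G * ‖z 1‖) + ∑ k ∈ Finset.Ico 1 n, d k + (n * h) * (ε * ‖z 1‖)) := by
    intro n hn1
    induction n, hn1 using Nat.le_induction with
    | base =>
      intro _
      have h1 := hxlip 0 (by simpa using hmem 0 (by omega)) (1 * h)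
        (by simpa using hmem 1 (by omega))
      rw [hx0, sub_zero, one_mul, abs_of_pos hhpos, norm_sub_rev] at h1
      have h2 : 1 ≤ Real.exp (K * (1 * h)) := Real.one_le_exp (by positivity)
      have h3 : 0 ≤ h * (K * G * ‖z 1‖) + (1 * h) * (ε * ‖z 1‖) := by positivity
      simp only [Nat.cast_one, Finset.Ico_self, Finset.sum_empty, add_zero, one_mul] at h2 h3 ⊢
      calc _ ≤ h * (K * G * ‖z 1‖) + h * (ε * ‖z 1‖) := by
            have : 0 ≤ h * (ε * ‖z 1‖) := by positivity
            linarith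
        _ ≤ _ := le_mul_of_one_le_left h3 h2
    | succ n hn1 ih =>
      intro hn2
      have h1 := ih (by omega)
      have h2 := hstep n hn1 (by omega)
      have e1 : Real.exp (K * ((n + 1 : ℕ) * h)) =
          Real.exp (K * h) * Real.exp (K * (n * h)) := by
        rw [← Real.exp_add]
        congr 1
        push_cast
        ring
      have h3 : 1 ≤ Real.exp (K * h) * Real.exp (K * (n * h)) :=
        one_le_mul_of_one_le_of_one_le (Real.one_le_exp (by positivity))
          (Real.one_le_exp (by positivity))
      have h4 : 0 ≤ d n + h * (ε * ‖z 1‖) := by positivity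
      rw [e1, Finset.sum_Ico_succ_top hn1]
      calc _ ≤ _ := h2
        _ ≤ Real.exp (K * h) * (Real.exp (K * (n * h)) *
            (h * (K * G * ‖z 1‖) + ∑ k ∈ Finset.Ico 1 n, d k + (n * h) * (ε * ‖z 1‖))) +
            Real.exp (K * h) * Real.exp (K * (n * h)) * (d n + h * (ε * ‖z 1‖)) := by
          gcongr
          exact le_mul_of_one_le_left h4 h3
        _ = _ := by push_cast; ring
  have hw' : ∀ n, 1 ≤ n → n ≤ N - 1 → ‖z n - x (n * h)‖ ≤
      G * (D + (T + K * G) * (ε * ‖z 1‖)) := by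
    intro n hn1 hn2
    have hn := hmem n (by omega)
    refine (hw n hn1 hn2).trans ?_
    have h1 : ∑ k ∈ Finset.Ico 1 n, d k ≤ D :=
      Finset.sum_le_sum_of_subset_of_nonneg (Finset.Ico_subset_Ico le_rfl hn2)
        fun k _ _ => norm_nonneg _
    have h2 : 0 ≤ ∑ k ∈ Finset.Ico 1 n, d k := Finset.sum_nonneg fun k _ => norm_nonneg _
    calc _ ≤ G * (ε * (K * G * ‖z 1‖) + D + T * (ε * ‖z 1‖)) := by
          gcongr
          · rw [hG]
            gcongr
            exact hn.2
          · exact hn.2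
      _ = _ := by ring
  -- The boundary values of the solution.
  have hN1 : ((N - 1 : ℕ) : ℝ) = N - 1 := by
    rw [Nat.cast_sub (by omega)]; simp
  have hend : ‖(x T).2 - Q (x T).1‖ ≤ ‖(z (N - 1)).2 - Q (z (N - 1)).1‖ +
      q * (G * D + G * (T + 3 * K * G) * (ε * ‖z 1‖)) := by
    set v := x T - z (N - 1) with hv
    have h1 : ‖v‖ ≤ G * D + G * (T + 3 * K * G) * (ε * ‖z 1‖) := by
      have h2 := hw' (N - 1) (by omega) le_rfl
      have h3 := hxlip ((N - 1 : ℕ) * h) (hmem _ (by omega)) T ⟨hT.le, le_rfl⟩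
      have h4 : |T - (N - 1 : ℕ) * h| = 2 * h := by
        rw [hN1, abs_of_nonneg] <;> nlinarith
      rw [h4] at h3
      have e : v = (x T - x ((N - 1 : ℕ) * h)) - (z (N - 1) - x ((N - 1 : ℕ) * h)) := by
        rw [hv]; abel
      have h5 : K * (G * ‖z 1‖) * (2 * h) ≤ 2 * K * G * (ε * ‖z 1‖) := by
        calc K * (G * ‖z 1‖) * (2 * h) ≤ K * (G * ‖z 1‖) * (2 * ε) := by gcongr
          _ = _ := by ring
      have h6 : 2 * K * G * (ε * ‖z 1‖) ≤ G * (2 * K * G * (ε * ‖z 1‖)) :=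
        le_mul_of_one_le_left (by positivity) hG1
      rw [e]
      refine (norm_sub_le _ _).trans ?_
      nlinarith
    have e : (x T).2 - Q (x T).1 = ((z (N - 1)).2 - Q (z (N - 1)).1) + (v.2 - Q v.1) := by
      simp only [hv, Prod.snd_sub, Prod.fst_sub, map_sub]
      abel
    have h2 : ‖v.2 - Q v.1‖ ≤ q * ‖v‖ := by
      refine (norm_sub_le _ _).trans ?_
      have h3 := (Q.le_opNorm v.1).trans
        (mul_le_mul_of_nonneg_left (norm_fst_le v) (norm_nonneg Q))
      have h4 := norm_snd_le v
      rw [hq]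
      linarith
    rw [e]
    refine (norm_add_le _ _).trans (add_le_add le_rfl (h2.trans ?_))
    gcongr
  set P := ‖(z 1).1‖ + ‖(z (N - 1)).2 - Q (z (N - 1)).1‖ + D with hP
  have hP0 : 0 ≤ P := by positivity
  have hΛε : Λ * ε = 1 / 2 := by rw [hε]; field_simp
  have hz1 : ‖z 1‖ ≤ 2 * κ * (q * G) * P := by
    have h1 := hκ x hx
    rw [hx0] at h1
    have hqG : 1 ≤ q * G := one_le_mul_of_one_le_of_one_le (by rw [hq]; simp) hG1
    have h2 : κ * (‖(z 1).1‖ + ‖(x T).2 - Q (x T).1‖) ≤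
        κ * (q * G) * P + κ * q * G * (T + 3 * K * G) * (ε * ‖z 1‖) := by
      have h3 : ‖(z 1).1‖ + ‖(z (N - 1)).2 - Q (z (N - 1)).1‖ ≤
          (q * G) * (‖(z 1).1‖ + ‖(z (N - 1)).2 - Q (z (N - 1)).1‖) :=
        le_mul_of_one_le_left (by positivity) hqG
      calc _ ≤ κ * (‖(z 1).1‖ + (‖(z (N - 1)).2 - Q (z (N - 1)).1‖ +
            q * (G * D + G * (T + 3 * K * G) * (ε * ‖z 1‖)))) := by gcongr
        _ ≤ κ * ((q * G) * (‖(z 1).1‖ + ‖(z (N - 1)).2 - Q (z (N - 1)).1‖) +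
            q * (G * D + G * (T + 3 * K * G) * (ε * ‖z 1‖))) := by
          refine mul_le_mul_of_nonneg_left ?_ hκ0
          linarith
        _ = _ := by rw [hP]; ring
    have h4 : κ * q * G * (T + 3 * K * G) * (ε * ‖z 1‖) ≤ Λ * (ε * ‖z 1‖) := by
      gcongr
      rw [hΛ]
      have : 0 ≤ T + K * G := by positivity
      linarith
    have h5 : Λ * (ε * ‖z 1‖) = ‖z 1‖ / 2 := by rw [← mul_assoc, hΛε]; ring
    linarith
  intro n hn1 hn2
  have h1 := hw' n hn1 (by omega)
  have h2 := hxb (n * h) (hmem n (by omega))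
  have h3 : (T + K * G) * (ε * ‖z 1‖) ≤ ‖z 1‖ := by
    have h4 : (T + K * G) * (ε * ‖z 1‖) ≤ Λ * (ε * ‖z 1‖) := by
      gcongr
      rw [hΛ]
      have : 0 ≤ κ * q * G * (T + 3 * K * G) := by positivity
      linarith
    have h5 : Λ * (ε * ‖z 1‖) = ‖z 1‖ / 2 := by rw [← mul_assoc, hΛε]; ring
    linarith [norm_nonneg (z 1)]
  have h4 : D ≤ P := by
    rw [hP]
    have := norm_nonneg (z 1).1
    have := norm_nonneg ((z (N - 1)).2 - Q (z (N - 1)).1)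
    linarith
  calc ‖z n‖ = ‖x (n * h) + (z n - x (n * h))‖ := by congr 1; abel
    _ ≤ G * ‖z 1‖ + G * (D + (T + K * G) * (ε * ‖z 1‖)) :=
        (norm_add_le _ _).trans (add_le_add h2 h1)
    _ ≤ G * (2 * κ * (q * G) * P) + G * (P + 2 * κ * (q * G) * P) :=
        add_le_add (mul_le_mul_of_nonneg_left hz1 hGpos.le)
          (mul_le_mul_of_nonneg_left (add_le_add h4 (h3.trans hz1)) hGpos.le)
    _ = _ := by ring

end BoundaryValueProblem

/-! ### Stability of the linearized discrete boundary value problem -/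

section DiscreteStability

variable {s m : ℕ}

/-- The `ℓ¹` bound for the parasitic components of the adjoint recursion, which runs from the interval
`N - 1` down to `1`. -/
lemma StrictlyStable.exists_backward_parasitic_bound {A B : Matrix (Fin s) (Fin s) ℝ}
    (h : StrictlyStable A B) (m : ℕ) :
    ∃ C : ℝ, 0 ≤ C ∧ ∀ (N : ℕ), 2 ≤ N → ∀ e : ℕ → Fin s → Fin m → ℝ,
      ∑ n ∈ Finset.Ico 1 N, ‖parasitic Aᵀ (e n)‖ ≤
        C * (‖e (N - 1)‖ + ∑ n ∈ Finset.Ico 1 (N - 1),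
          ‖stageMul Aᵀ (e n) - stageMul Bᵀ (e (n + 1))‖) := by
  obtain ⟨C, hC, hb⟩ := h.transpose.exists_parasitic_bound m
  refine ⟨C, hC, fun N hN e => ?_⟩
  have h1 := (hb (N - 2) (fun k => e (N - 1 - k))).2
  have e1 : ∑ n ∈ Finset.Ico 1 N, ‖parasitic Aᵀ (e n)‖ =
      ∑ k ∈ Finset.range (N - 2 + 1), ‖parasitic Aᵀ (e (N - 1 - k))‖ := by
    refine Finset.sum_nbij' (fun n => N - 1 - n) (fun k => N - 1 - k) ?_ ?_ ?_ ?_ ?_ <;>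
      intro n hn <;> simp only [Finset.mem_Ico, Finset.mem_range] at hn ⊢ <;> try omega
    congr 3
    omega
  have e2 : ∑ n ∈ Finset.Ico 1 (N - 1), ‖stageMul Aᵀ (e n) - stageMul Bᵀ (e (n + 1))‖ =
      ∑ k ∈ Finset.range (N - 2),
        ‖stageMul Aᵀ (e (N - 1 - (k + 1))) - stageMul Bᵀ (e (N - 1 - k))‖ := by
    refine Finset.sum_nbij' (fun n => N - 2 - n) (fun k => N - 2 - k) ?_ ?_ ?_ ?_ ?_ <;>
      intro n hn <;> simp only [Finset.mem_Ico, Finset.mem_range] at hn ⊢ <;> try omega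
    have e3 : N - 1 - (N - 2 - n + 1) = n := by omega
    have e4 : N - 1 - (N - 2 - n) = n + 1 := by omega
    rw [e3, e4]
  rw [e1, e2]
  simpa using h1

/-- The stagewise application of a linear map to the pairs `(Eᵢ, eᵢ)`, first component. -/
def stageFst (L : ((Fin m → ℝ) × (Fin m → ℝ)) →L[ℝ] ((Fin m → ℝ) × (Fin m → ℝ)))
    (E e : Fin s → Fin m → ℝ) : Fin s → Fin m → ℝ := fun i => (L (E i, e i)).1

/-- The stagewise application of a linear map to the pairs `(Eᵢ, eᵢ)`, second component. -/
def stageSnd (L : ((Fin m → ℝ) × (Fin m → ℝ)) →L[ℝ] ((Fin m → ℝ) × (Fin m → ℝ)))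
    (E e : Fin s → Fin m → ℝ) : Fin s → Fin m → ℝ := fun i => (L (E i, e i)).2

lemma norm_pair_le {L : ((Fin m → ℝ) × (Fin m → ℝ)) →L[ℝ] ((Fin m → ℝ) × (Fin m → ℝ))}
    {c : ℝ} (hL : ‖L‖ ≤ c) (E e : Fin s → Fin m → ℝ) (i : Fin s) :
    ‖L (E i, e i)‖ ≤ c * (‖E‖ + ‖e‖) := by
  have hc : 0 ≤ c := (norm_nonneg L).trans hL
  refine (L.le_opNorm _).trans (mul_le_mul hL ?_ (norm_nonneg _) hc)
  refine (max_le_add_of_nonneg (norm_nonneg _) (norm_nonneg _)).trans ?_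
  exact add_le_add (norm_le_pi_norm E i) (norm_le_pi_norm e i)

lemma stageFst_norm_le {L : ((Fin m → ℝ) × (Fin m → ℝ)) →L[ℝ] ((Fin m → ℝ) × (Fin m → ℝ))}
    {c : ℝ} (hL : ‖L‖ ≤ c) (E e : Fin s → Fin m → ℝ) :
    ‖stageFst L E e‖ ≤ c * (‖E‖ + ‖e‖) := by
  have hc : 0 ≤ c := (norm_nonneg L).trans hL
  exact (pi_norm_le_iff_of_nonneg (by positivity)).2 fun i =>
    (norm_fst_le _).trans (norm_pair_le hL E e i)

lemma stageSnd_norm_le {L : ((Fin m → ℝ) × (Fin m → ℝ)) →L[ℝ] ((Fin m → ℝ) × (Fin m → ℝ))}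
    {c : ℝ} (hL : ‖L‖ ≤ c) (E e : Fin s → Fin m → ℝ) :
    ‖stageSnd L E e‖ ≤ c * (‖E‖ + ‖e‖) := by
  have hc : 0 ≤ c := (norm_nonneg L).trans hL
  exact (pi_norm_le_iff_of_nonneg (by positivity)).2 fun i =>
    (norm_snd_le _).trans (norm_pair_le hL E e i)

lemma stageFst_parasitic (L : ((Fin m → ℝ) × (Fin m → ℝ)) →L[ℝ] ((Fin m → ℝ) × (Fin m → ℝ)))
    (A A' : Matrix (Fin s) (Fin s) ℝ) (E e : Fin s → Fin m → ℝ) :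
    stageFst L E e = stageTensor 1 (L (stageDot (1 ᵥ* A) E, stageDot (1 ᵥ* A') e)).1 +
      stageFst L (parasitic A E) (parasitic A' e) := by
  funext i
  simp only [stageFst, stageTensor, parasitic, Pi.add_apply, Pi.sub_apply, Pi.one_apply, one_smul]
  rw [← Prod.fst_add, ← map_add]
  simp

lemma stageSnd_parasitic (L : ((Fin m → ℝ) × (Fin m → ℝ)) →L[ℝ] ((Fin m → ℝ) × (Fin m → ℝ)))
    (A A' : Matrix (Fin s) (Fin s) ℝ) (E e : Fin s → Fin m → ℝ) :
    stageSnd L E e = stageTensor 1 (L (stageDot (1 ᵥ* A) E, stageDot (1 ᵥ* A') e)).2 +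
      stageSnd L (parasitic A E) (parasitic A' e) := by
  funext i
  simp only [stageSnd, stageTensor, parasitic, Pi.add_apply, Pi.sub_apply, Pi.one_apply, one_smul]
  rw [← Prod.snd_add, ← map_add]
  simp

/-- The errors `(E, e)` satisfy the Peer equations linearized at `t_n` (in the intervals away from
the boundary), up to the relative perturbation `ε` and up to defects of size `D`, with means of size
`h D`. In the boundary intervals the equations are required only up to terms of size `h`. The
defects of the adjoint equations there may be of size `D / h`, except in the mean
of the last two equations. -/
structure PerturbedLinearization (θ : PeerTriplet s)
    (J : ℝ → ((Fin m → ℝ) × (Fin m → ℝ)) →L[ℝ] ((Fin m → ℝ) × (Fin m → ℝ)))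
    (Q : (Fin m → ℝ) →L[ℝ] (Fin m → ℝ)) (N : ℕ) (h ε c D : ℝ)
    (E e : ℕ → Fin s → Fin m → ℝ) : Prop where
  start : ‖stageMul θ.A0 (E 0)‖ ≤ c * h * (‖E 0‖ + ‖e 0‖) + D
  step : ∀ n, 1 ≤ n → n < N → ∃ σ : Fin s → Fin m → ℝ, ‖σ‖ ≤ D ∧ ‖stageDot 1 σ‖ ≤ h * D ∧
    ‖stageMul θ.A (E n) - stageMul θ.B (E (n - 1)) -
      h • stageMul θ.K (stageFst (J (n * h)) (E n) (e n)) - σ‖ ≤ ε * h * (‖E n‖ + ‖e n‖)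
  last : ‖stageMul θ.AN (E N) - stageMul θ.BN (E (N - 1))‖ ≤ c * h * (‖E N‖ + ‖e N‖) + D
  adj_start : h * ‖stageMul θ.A0ᵀ (e 0) - stageMul θ.Bᵀ (e 1)‖ ≤
    h * (c * h * (‖E 0‖ + ‖e 0‖)) + D
  adj_step : ∀ n, 1 ≤ n → n < N - 1 → ∃ σ : Fin s → Fin m → ℝ, ‖σ‖ ≤ D ∧
    ‖stageDot 1 σ‖ ≤ h * D ∧
    ‖stageMul θ.Aᵀ (e n) - stageMul θ.Bᵀ (e (n + 1)) +
      h • stageMul θ.K (stageSnd (J (n * h)) (E n) (e n)) - σ‖ ≤ ε * h * (‖E n‖ + ‖e n‖)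
  adj_last : h * ‖stageMul θ.Aᵀ (e (N - 1)) - stageMul θ.BNᵀ (e N)‖ ≤
    h * (c * h * (‖E (N - 1)‖ + ‖e (N - 1)‖)) + D
  adj_end : h * ‖stageMul θ.ANᵀ (e N)‖ ≤ c * h * (‖E N‖ + h * ‖e N‖) + D
  mean_end : ‖stageDot 1 (stageMul θ.Aᵀ (e (N - 1)) - stageMul θ.BNᵀ (e N)) +
      stageDot 1 (stageMul θ.ANᵀ (e N) - stageTensor θ.w (Q (stageDot θ.w (E N))))‖ ≤
    c * h * (‖E (N - 1)‖ + ‖e (N - 1)‖ + ‖E N‖ + ‖e N‖) + ε * ‖E N‖ + D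

/-- The elimination of the fast quantities: `U` and `X` stand for the parasitic components of
adjoint and state, `S` for the state and `W` for the means. -/
lemma absorb_parasitic {c : ℝ} (hc : 1 ≤ c) {h S W U X D : ℝ} (hh : 0 ≤ h) (hh1 : 16 * c ^ 2 * h ≤ 1)
    (hS : 0 ≤ S) (hW : 0 ≤ W) (hU : 0 ≤ U) (hD : 0 ≤ D)
    (hUb : U ≤ c * (h * (S + W + U) + D)) (hXb : X ≤ c * (h * (S + W) + U + D))
    (hSb : S ≤ W + X) :
    S ≤ 2 * W + 8 * c ^ 2 * D ∧ U ≤ 8 * c ^ 2 * (h * W + D) ∧ X ≤ 32 * c ^ 3 * (h * W + D) := by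
  have hc2 : c ≤ c ^ 2 := by nlinarith
  have hch : 16 * c * h ≤ 1 := le_trans (by nlinarith) hh1
  have hU1 : U ≤ 2 * c * (h * (S + W) + D) := by
    have h1 : c * h * U ≤ U / 16 := by nlinarith
    have h2 : 0 ≤ c * (h * (S + W) + D) := by positivity
    nlinarith
  have hX1 : X ≤ 3 * c ^ 2 * (h * (S + W) + D) := by
    have h1 : c * U ≤ 2 * c ^ 2 * (h * (S + W) + D) := by nlinarith
    have h2 : c * (h * (S + W) + D) ≤ c ^ 2 * (h * (S + W) + D) := by
      have : 0 ≤ h * (S + W) + D := by positivity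
      nlinarith
    nlinarith
  have hS1 : S ≤ 2 * W + 8 * c ^ 2 * D := by
    have h1 : c ^ 2 * (h * S) ≤ S / 16 := by nlinarith
    have h2 : c ^ 2 * (h * W) ≤ W / 16 := by nlinarith
    have h3 : 0 ≤ c ^ 2 * D := by positivity
    nlinarith
  have hS2 : h * (S + W) + D ≤ 4 * (h * W + D) := by
    have h1 : h * S ≤ h * (2 * W + 8 * c ^ 2 * D) := by gcongr
    have h2 : h * (8 * c ^ 2 * D) ≤ D := by nlinarith
    nlinarith [mul_nonneg hh hW]
  have h4 : 0 ≤ h * W + D := by positivity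
  refine ⟨hS1, ?_, ?_⟩
  · calc U ≤ 2 * c * (h * (S + W) + D) := hU1
      _ ≤ 2 * c * (4 * (h * W + D)) := by gcongr
      _ = 8 * c * (h * W + D) := by ring
      _ ≤ _ := by gcongr
  · calc X ≤ 3 * c ^ 2 * (h * (S + W) + D) := hX1
      _ ≤ 3 * c ^ 2 * (4 * (h * W + D)) := by gcongr
      _ = 12 * c ^ 2 * (h * W + D) := by ring
      _ ≤ 32 * c ^ 3 * (h * W + D) := by
        refine mul_le_mul_of_nonneg_right ?_ h4
        nlinarith [sq_nonneg c]

/-- One constant `c` that bounds all operators occurring in the linearized equations, the inverses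
of the coefficient matrices and the growth of the parasitic components. -/
structure OperatorBounds (θ : PeerTriplet s)
    (J : ℝ → ((Fin m → ℝ) × (Fin m → ℝ)) →L[ℝ] ((Fin m → ℝ) × (Fin m → ℝ)))
    (Q : (Fin m → ℝ) →L[ℝ] (Fin m → ℝ)) (T c : ℝ) : Prop where
  one_le : 1 ≤ c
  T_le : T ≤ c
  J_le : ∀ t ∈ Icc (0 : ℝ) T, ‖J t‖ ≤ c
  Q_le : ‖Q‖ ≤ c
  K_le : ∀ Z : Fin s → Fin m → ℝ, ‖stageMul θ.K Z‖ ≤ c * ‖Z‖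
  BT_le : ∀ Z : Fin s → Fin m → ℝ, ‖stageMul θ.Bᵀ Z‖ ≤ c * ‖Z‖
  BN_le : ∀ Z : Fin s → Fin m → ℝ, ‖stageMul θ.BN Z‖ ≤ c * ‖Z‖
  BNT_le : ∀ Z : Fin s → Fin m → ℝ, ‖stageMul θ.BNᵀ Z‖ ≤ c * ‖Z‖
  le_A0 : ∀ Z : Fin s → Fin m → ℝ, ‖Z‖ ≤ c * ‖stageMul θ.A0 Z‖
  le_A0T : ∀ Z : Fin s → Fin m → ℝ, ‖Z‖ ≤ c * ‖stageMul θ.A0ᵀ Z‖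
  le_AT : ∀ Z : Fin s → Fin m → ℝ, ‖Z‖ ≤ c * ‖stageMul θ.Aᵀ Z‖
  le_AN : ∀ Z : Fin s → Fin m → ℝ, ‖Z‖ ≤ c * ‖stageMul θ.AN Z‖
  le_ANT : ∀ Z : Fin s → Fin m → ℝ, ‖Z‖ ≤ c * ‖stageMul θ.ANᵀ Z‖
  one_le_dot : ∀ Z : Fin s → Fin m → ℝ, ‖stageDot 1 Z‖ ≤ c * ‖Z‖
  w_le_dot : ∀ Z : Fin s → Fin m → ℝ, ‖stageDot θ.w Z‖ ≤ c * ‖Z‖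
  A_le_dot : ∀ Z : Fin s → Fin m → ℝ, ‖stageDot (1 ᵥ* θ.A) Z‖ ≤ c * ‖Z‖
  fwd : ∀ (L : ℕ) (Z : ℕ → Fin s → Fin m → ℝ) (ρ : ℝ), 0 ≤ ρ →
    (∀ n < L, ‖stageMul θ.A (Z (n + 1)) - stageMul θ.B (Z n)‖ ≤ ρ) →
    ∀ n ≤ L, ‖parasitic θ.A (Z n)‖ ≤ c * (‖Z 0‖ + ρ)
  bwd : ∀ (N : ℕ), 2 ≤ N → ∀ e : ℕ → Fin s → Fin m → ℝ,
    ∑ n ∈ Finset.Ico 1 N, ‖parasitic θ.Aᵀ (e n)‖ ≤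
      c * (‖e (N - 1)‖ + ∑ n ∈ Finset.Ico 1 (N - 1),
        ‖stageMul θ.Aᵀ (e n) - stageMul θ.Bᵀ (e (n + 1))‖)

/-- All operators that occur can be bounded by one constant, chosen above any prescribed `c₀`. -/
lemma exists_operatorBounds {θ : PeerTriplet s} (hst : StrictlyStable θ.A θ.B)
    (hA0 : IsUnit θ.A0.det) (hAN : IsUnit θ.AN.det)
    {J : ℝ → ((Fin m → ℝ) × (Fin m → ℝ)) →L[ℝ] ((Fin m → ℝ) × (Fin m → ℝ))}
    (Q : (Fin m → ℝ) →L[ℝ] (Fin m → ℝ)) {T : ℝ} (hJ : ContinuousOn J (Icc 0 T)) (c₀ : ℝ) :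
    ∃ c, c₀ ≤ c ∧ OperatorBounds θ J Q T c := by
  obtain ⟨cJ, hcJ⟩ := isCompact_Icc.exists_bound_of_continuousOn hJ
  obtain ⟨cf, hcf0, hcf⟩ := hst.exists_parasitic_bound m
  obtain ⟨cb, hcb0, hcb⟩ := hst.exists_backward_parasitic_bound m
  have hup : ∀ l : List ℝ, ∃ c, ∀ x ∈ l, x ≤ c := fun l =>
    (l.toFinset.bddAbove).imp fun c hc x hx => hc (by simpa using hx)
  obtain ⟨c, hc⟩ := hup [1, c₀, T, cJ, cf, cb, ‖Q‖, ‖stageMulL (m := m) θ.K‖,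
    ‖stageMulL (m := m) θ.Bᵀ‖, ‖stageMulL (m := m) θ.BN‖, ‖stageMulL (m := m) θ.BNᵀ‖,
    ‖stageMulL (m := m) θ.A0⁻¹‖, ‖stageMulL (m := m) θ.A0ᵀ⁻¹‖, ‖stageMulL (m := m) θ.Aᵀ⁻¹‖,
    ‖stageMulL (m := m) θ.AN⁻¹‖, ‖stageMulL (m := m) θ.ANᵀ⁻¹‖,
    ‖stageDotL (m := m) (1 : Fin s → ℝ)‖, ‖stageDotL (m := m) θ.w‖,
    ‖stageDotL (m := m) (1 ᵥ* θ.A)‖]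
  simp only [List.forall_mem_cons, List.not_mem_nil, false_imp_iff, implies_true, and_true] at hc
  obtain ⟨h1, h2, h3, h4, h5, h6, h7, h8, h9, h10, h11, h12, h13, h14, h15, h16, h17, h18, h19⟩ := hc
  have hmul : ∀ M : Matrix (Fin s) (Fin s) ℝ, ‖stageMulL (m := m) M‖ ≤ c →
      ∀ Z : Fin s → Fin m → ℝ, ‖stageMul M Z‖ ≤ c * ‖Z‖ := fun M hM Z =>
    (stageMul_norm_le M Z).trans (mul_le_mul_of_nonneg_right hM (norm_nonneg _))
  have hinv : ∀ M : Matrix (Fin s) (Fin s) ℝ, IsUnit M.det → ‖stageMulL (m := m) M⁻¹‖ ≤ c →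
      ∀ Z : Fin s → Fin m → ℝ, ‖Z‖ ≤ c * ‖stageMul M Z‖ := fun M hM hc Z =>
    (norm_le_of_isUnit_det hM Z).trans (mul_le_mul_of_nonneg_right hc (norm_nonneg _))
  have hdot : ∀ r : Fin s → ℝ, ‖stageDotL (m := m) r‖ ≤ c →
      ∀ Z : Fin s → Fin m → ℝ, ‖stageDot r Z‖ ≤ c * ‖Z‖ := fun r hr Z =>
    (stageDot_norm_le r Z).trans (mul_le_mul_of_nonneg_right hr (norm_nonneg _))
  refine ⟨c, h2, h1, h3, fun t ht => (hcJ t ht).trans h4, h7, hmul _ h8, hmul _ h9, hmul _ h10,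
    hmul _ h11, hinv _ hA0 h12, hinv _ (by rwa [det_transpose]) h13,
    hinv _ (by rw [det_transpose]; exact hst.unit) h14, hinv _ hAN h15,
    hinv _ (by rwa [det_transpose]) h16, hdot _ h17, hdot _ h18, hdot _ h19, ?_, ?_⟩
  · intro L Z ρ hρ hZ n hn
    exact ((hcf L Z).1 ρ hρ hZ n hn).trans (mul_le_mul_of_nonneg_right h5 (by positivity))
  · intro N hN e
    exact (hcb N hN e).trans (mul_le_mul_of_nonneg_right h6 (by positivity))

end DiscreteStability

/-! ### Bounds for parasitic components -/

section DiscreteStability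

variable {s m : ℕ} {θ : PeerTriplet s}
  {J : ℝ → ((Fin m → ℝ) × (Fin m → ℝ)) →L[ℝ] ((Fin m → ℝ) × (Fin m → ℝ))}
  {Q : (Fin m → ℝ) →L[ℝ] (Fin m → ℝ)} {T c h ε D : ℝ} {N : ℕ} {E e : ℕ → Fin s → Fin m → ℝ}

lemma norm_le_of_norm_sub_sub_le {V : Type*} [SeminormedAddCommGroup V] {x y σ : V} {δ : ℝ}
    (hx : ‖x - y - σ‖ ≤ δ) : ‖x‖ ≤ ‖y‖ + ‖σ‖ + δ := by
  have h1 : x = y + σ + (x - y - σ) := by abel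
  calc ‖x‖ = ‖y + σ + (x - y - σ)‖ := by rw [← h1]
    _ ≤ ‖y‖ + ‖σ‖ + ‖x - y - σ‖ := norm_add₃_le
    _ ≤ _ := by gcongr

lemma PerturbedLinearization.mul_mem_Icc (hh : 0 ≤ h) (hN : h * N ≤ T) {n : ℕ} (hn : n ≤ N) :
    (n : ℝ) * h ∈ Icc 0 T := by
  refine ⟨by positivity, le_trans ?_ hN⟩
  rw [mul_comm]
  gcongr

lemma OperatorBounds.norm_K_stageFst_le (hb : OperatorBounds θ J Q T c) {t : ℝ}
    (ht : t ∈ Icc 0 T) (hh : 0 ≤ h) (Z Z' : Fin s → Fin m → ℝ) :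
    ‖h • stageMul θ.K (stageFst (J t) Z Z')‖ ≤ h * (c ^ 2 * (‖Z‖ + ‖Z'‖)) := by
  have hc : 0 ≤ c := zero_le_one.trans hb.one_le
  rw [norm_smul, Real.norm_of_nonneg hh]
  refine mul_le_mul_of_nonneg_left ((hb.K_le _).trans ?_) hh
  calc c * ‖stageFst (J t) Z Z'‖ ≤ c * (c * (‖Z‖ + ‖Z'‖)) :=
        mul_le_mul_of_nonneg_left (stageFst_norm_le (hb.J_le t ht) _ _) hc
    _ = _ := by ring

lemma OperatorBounds.norm_K_stageSnd_le (hb : OperatorBounds θ J Q T c) {t : ℝ}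
    (ht : t ∈ Icc 0 T) (hh : 0 ≤ h) (Z Z' : Fin s → Fin m → ℝ) :
    ‖h • stageMul θ.K (stageSnd (J t) Z Z')‖ ≤ h * (c ^ 2 * (‖Z‖ + ‖Z'‖)) := by
  have hc : 0 ≤ c := zero_le_one.trans hb.one_le
  rw [norm_smul, Real.norm_of_nonneg hh]
  refine mul_le_mul_of_nonneg_left ((hb.K_le _).trans ?_) hh
  calc c * ‖stageSnd (J t) Z Z'‖ ≤ c * (c * (‖Z‖ + ‖Z'‖)) :=
        mul_le_mul_of_nonneg_left (stageSnd_norm_le (hb.J_le t ht) _ _) hc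
    _ = _ := by ring

lemma PerturbedLinearization.norm_state_residual_le
    (hp : PerturbedLinearization θ J Q N h ε c D E e) (hb : OperatorBounds θ J Q T c)
    (hε : ε ≤ 1) (hh : 0 ≤ h) (hN : h * N ≤ T) {n : ℕ} (hn : 1 ≤ n) (hnN : n < N) :
    ‖stageMul θ.A (E n) - stageMul θ.B (E (n - 1))‖ ≤
      D + 2 * c ^ 2 * (h * (‖E n‖ + ‖e n‖)) := by
  obtain ⟨σ, h1, -, h3⟩ := hp.step n hn hnN
  have h4 := norm_le_of_norm_sub_sub_le h3
  have h5 := hb.norm_K_stageFst_le (mul_mem_Icc hh hN hnN.le) hh (E n) (e n)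
  have h6 : 0 ≤ h * (‖E n‖ + ‖e n‖) := by positivity
  have h7 : ε * h * (‖E n‖ + ‖e n‖) ≤ c ^ 2 * (h * (‖E n‖ + ‖e n‖)) := by
    rw [mul_assoc]
    exact mul_le_mul_of_nonneg_right (hε.trans (one_le_pow₀ hb.one_le)) h6
  linarith

lemma PerturbedLinearization.norm_adjoint_residual_le
    (hp : PerturbedLinearization θ J Q N h ε c D E e) (hb : OperatorBounds θ J Q T c)
    (hε : ε ≤ 1) (hh : 0 ≤ h) (hN : h * N ≤ T) {n : ℕ} (hn : 1 ≤ n) (hnN : n < N - 1) :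
    ‖stageMul θ.Aᵀ (e n) - stageMul θ.Bᵀ (e (n + 1))‖ ≤
      D + 2 * c ^ 2 * (h * (‖E n‖ + ‖e n‖)) := by
  obtain ⟨σ, h1, -, h3⟩ := hp.adj_step n hn hnN
  rw [← sub_neg_eq_add] at h3
  have h4 := norm_le_of_norm_sub_sub_le h3
  rw [norm_neg] at h4
  have h5 := hb.norm_K_stageSnd_le (mul_mem_Icc hh hN (by omega : n ≤ N)) hh (E n) (e n)
  have h6 : 0 ≤ h * (‖E n‖ + ‖e n‖) := by positivity
  have h7 : ε * h * (‖E n‖ + ‖e n‖) ≤ c ^ 2 * (h * (‖E n‖ + ‖e n‖)) := by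
    rw [mul_assoc]
    exact mul_le_mul_of_nonneg_right (hε.trans (one_le_pow₀ hb.one_le)) h6
  linarith

lemma norm_le_parasitic_add {A : Matrix (Fin s) (Fin s) ℝ} (Z : Fin s → Fin m → ℝ) :
    ‖Z‖ ≤ ‖parasitic A Z‖ + ‖stageDot (1 ᵥ* A) Z‖ := by
  have h1 : Z = parasitic A Z + stageTensor 1 (stageDot (1 ᵥ* A) Z) := by simp [parasitic]
  calc ‖Z‖ = ‖parasitic A Z + stageTensor 1 (stageDot (1 ᵥ* A) Z)‖ := by rw [← h1]
    _ ≤ _ := (norm_add_le _ _).trans (add_le_add le_rfl (stageTensor_one_norm_le _))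

/-- The parasitic part of the adjoint errors, summed over the grid, together with the adjoint
errors of the two boundary intervals. The factor `h` makes up for the loss of one order there. -/
def adjointFast (θ : PeerTriplet s) (N : ℕ) (h : ℝ) (e : ℕ → Fin s → Fin m → ℝ) : ℝ :=
  h * ∑ n ∈ Finset.Ico 1 N, ‖parasitic θ.Aᵀ (e n)‖ + h * ‖e 0‖ + h * ‖e N‖

lemma adjointFast_nonneg (hh : 0 ≤ h) : 0 ≤ adjointFast θ N h e := by
  unfold adjointFast; positivity

lemma mul_norm_parasitic_le_adjointFast (hh : 0 ≤ h) {n : ℕ} (hn : 1 ≤ n) (hnN : n < N) :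
    h * ‖parasitic θ.Aᵀ (e n)‖ ≤ adjointFast θ N h e := by
  have h1 : ‖parasitic θ.Aᵀ (e n)‖ ≤ ∑ n ∈ Finset.Ico 1 N, ‖parasitic θ.Aᵀ (e n)‖ :=
    Finset.single_le_sum (f := fun n => ‖parasitic θ.Aᵀ (e n)‖) (fun _ _ => norm_nonneg _)
      (Finset.mem_Ico.2 ⟨hn, hnN⟩)
  have h2 := mul_le_mul_of_nonneg_left h1 hh
  have h3 : 0 ≤ h * ‖e 0‖ := by positivity
  have h4 : 0 ≤ h * ‖e N‖ := by positivity
  unfold adjointFast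
  linarith

lemma mul_norm_adjoint_le {W : ℝ} (hh : 0 ≤ h) (hW : 0 ≤ W)
    (hWn : ∀ n, 1 ≤ n → n < N → ‖stageDot (1 ᵥ* θ.Aᵀ) (e n)‖ ≤ W) {n : ℕ} (hn : n ≤ N) :
    h * ‖e n‖ ≤ h * W + adjointFast θ N h e := by
  have hS : 0 ≤ h * ∑ n ∈ Finset.Ico 1 N, ‖parasitic θ.Aᵀ (e n)‖ := by positivity
  have h3 : 0 ≤ h * ‖e 0‖ := by positivity
  have h4 : 0 ≤ h * ‖e N‖ := by positivity
  have h5 : 0 ≤ h * W := by positivity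
  rcases Nat.eq_zero_or_pos n with rfl | h0
  · unfold adjointFast; linarith
  rcases hn.eq_or_lt with rfl | hN
  · unfold adjointFast; linarith
  have h1 := mul_norm_parasitic_le_adjointFast (θ := θ) (e := e) hh h0 hN
  have h2 := mul_le_mul_of_nonneg_left (norm_le_parasitic_add (A := θ.Aᵀ) (e n)) hh
  have h6 := mul_le_mul_of_nonneg_left (hWn n h0 hN) hh
  linarith

lemma sum_mul_norm_adjoint_le {W : ℝ} (hh : 0 ≤ h) (hN : h * N ≤ c) (hW : 0 ≤ W)
    (hWn : ∀ n, 1 ≤ n → n < N → ‖stageDot (1 ᵥ* θ.Aᵀ) (e n)‖ ≤ W) :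
    ∑ n ∈ Finset.Ico 1 N, h * ‖e n‖ ≤ c * W + adjointFast θ N h e := by
  have h3 : 0 ≤ h * ‖e 0‖ := by positivity
  have h4 : 0 ≤ h * ‖e N‖ := by positivity
  have h1 : ∑ n ∈ Finset.Ico 1 N, h * ‖e n‖ ≤
      ∑ n ∈ Finset.Ico 1 N, (h * ‖parasitic θ.Aᵀ (e n)‖ + h * W) := by
    refine Finset.sum_le_sum fun n hn => ?_
    rw [Finset.mem_Ico] at hn
    rw [← mul_add]
    exact mul_le_mul_of_nonneg_left ((norm_le_parasitic_add (A := θ.Aᵀ) (e n)).trans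
      (add_le_add le_rfl (hWn n hn.1 hn.2))) hh
  rw [Finset.sum_add_distrib, ← Finset.mul_sum, ← Finset.mul_sum, Finset.sum_const, Nat.card_Ico,
    nsmul_eq_mul] at h1
  have h2 : ((N - 1 : ℕ) : ℝ) * (h * W) ≤ c * W := by
    rw [← mul_assoc]
    refine mul_le_mul_of_nonneg_right (le_trans ?_ hN) hW
    rw [mul_comm]
    have : ((N - 1 : ℕ) : ℝ) ≤ N := by exact_mod_cast Nat.sub_le N 1
    gcongr
  rw [← Finset.mul_sum]
  unfold adjointFast
  linarith

lemma sum_mul_norm_state_le {S : ℝ} (hh : 0 ≤ h) (hN : h * N ≤ c) (hS : 0 ≤ S)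
    (hSn : ∀ n ≤ N, ‖E n‖ ≤ S) : ∑ n ∈ Finset.Ico 1 N, h * ‖E n‖ ≤ c * S := by
  have h1 : ∑ n ∈ Finset.Ico 1 N, h * ‖E n‖ ≤ ∑ n ∈ Finset.Ico 1 N, h * S := by
    refine Finset.sum_le_sum fun n hn => mul_le_mul_of_nonneg_left (hSn n ?_) hh
    exact (Finset.mem_Ico.1 hn).2.le
  refine h1.trans ?_
  rw [Finset.sum_const, Nat.card_Ico, nsmul_eq_mul, ← mul_assoc]
  refine mul_le_mul_of_nonneg_right (le_trans ?_ hN) hS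
  rw [mul_comm]
  have : ((N - 1 : ℕ) : ℝ) ≤ N := by exact_mod_cast Nat.sub_le N 1
  gcongr

/-- The fast adjoint quantities are controlled by state, mean values and `h` times themselves. -/
lemma PerturbedLinearization.adjointFast_le
    (hp : PerturbedLinearization θ J Q N h ε c D E e) (hb : OperatorBounds θ J Q T c)
    (hε : ε ≤ 1) (hh : 0 ≤ h) (hh1 : h ≤ 1) (hN : h * N ≤ T) (hN2 : 2 ≤ N) (hD : 0 ≤ D)
    {S W : ℝ} (hS : 0 ≤ S) (hW : 0 ≤ W) (hSn : ∀ n ≤ N, ‖E n‖ ≤ S)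
    (hWn : ∀ n, 1 ≤ n → n < N → ‖stageDot (1 ᵥ* θ.Aᵀ) (e n)‖ ≤ W) :
    adjointFast θ N h e ≤ 13 * c ^ 7 * (h * (S + W + adjointFast θ N h e) + D) := by
  have hc := hb.one_le
  have hc0 : 0 ≤ c := zero_le_one.trans hc
  set U := adjointFast θ N h e with hU
  have hU0 : 0 ≤ U := adjointFast_nonneg hh
  set F := h * (S + W + U) + D with hF
  have hF0 : 0 ≤ F := by positivity
  have hNc : h * N ≤ c := hN.trans hb.T_le
  have he : ∀ n ≤ N, h * ‖e n‖ ≤ h * W + U := fun n hn => mul_norm_adjoint_le hh hW hWn hn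
  have hhW : h * (h * W) ≤ h * W := mul_le_of_le_one_left (by positivity) hh1
  have hhe : ∀ n ≤ N, h * (h * ‖e n‖) ≤ h * (W + U) := fun n hn => by
    have := mul_le_mul_of_nonneg_left (he n hn) hh
    linarith
  have hhE : ∀ n ≤ N, h * (h * ‖E n‖) ≤ h * S := fun n hn => by
    have h1 : h * ‖E n‖ ≤ S := (mul_le_of_le_one_left (norm_nonneg _) hh1).trans (hSn n hn)
    exact mul_le_mul_of_nonneg_left h1 hh
  have hres : ∀ n ≤ N, h * (c * h * (‖E n‖ + ‖e n‖)) + D ≤ c * F := fun n hn => by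
    have h1 : h * (h * (‖E n‖ + ‖e n‖)) ≤ h * (S + W + U) := by
      have := hhe n hn; have := hhE n hn; linarith
    have h2 := mul_le_mul_of_nonneg_left h1 hc0
    have h3 : D ≤ c * D := le_mul_of_one_le_left hD hc
    rw [hF, mul_add]
    linarith
  -- the last stages
  have h1 : h * ‖e N‖ ≤ c ^ 2 * F := by
    have h2 := mul_le_mul_of_nonneg_left (hb.le_ANT (e N)) hh
    have h3 : c * h * (‖E N‖ + h * ‖e N‖) + D ≤ c * F := by
      have h4 : h * (h * ‖e N‖) ≤ h * (W + U) := hhe N le_rfl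
      have h5 : h * ‖E N‖ ≤ h * S := mul_le_mul_of_nonneg_left (hSn N le_rfl) hh
      have h6 := mul_le_mul_of_nonneg_left (add_le_add h5 h4) hc0
      have h3 : D ≤ c * D := le_mul_of_one_le_left hD hc
      rw [hF, mul_add]
      linarith
    have h4 := mul_le_mul_of_nonneg_left (hp.adj_end.trans h3) hc0
    linarith
  have h2 : h * ‖e (N - 1)‖ ≤ 2 * c ^ 4 * F := by
    have h2 := mul_le_mul_of_nonneg_left (hb.le_AT (e (N - 1))) hh
    have h3 := hp.adj_last.trans (hres (N - 1) (by omega))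
    have h4 : ‖stageMul θ.Aᵀ (e (N - 1))‖ ≤
        ‖stageMul θ.Aᵀ (e (N - 1)) - stageMul θ.BNᵀ (e N)‖ + c * ‖e N‖ := by
      have := norm_le_norm_sub_add (stageMul θ.Aᵀ (e (N - 1))) (stageMul θ.BNᵀ (e N))
      linarith [hb.BNT_le (e N)]
    have h5 := mul_le_mul_of_nonneg_left h4 hh
    have h6 : h * ‖stageMul θ.Aᵀ (e (N - 1))‖ ≤ c * F + c * (c ^ 2 * F) := by
      have := mul_le_mul_of_nonneg_left h1 hc0
      linarith
    have h7 := mul_le_mul_of_nonneg_left h6 hc0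
    have h8 : c * (c * F) ≤ c ^ 4 * F := by
      rw [← mul_assoc, ← pow_two]
      exact mul_le_mul_of_nonneg_right (pow_le_pow_right₀ hc (by norm_num)) hF0
    linarith
  -- the interior stages
  have h3 : h * ∑ n ∈ Finset.Ico 1 (N - 1),
      ‖stageMul θ.Aᵀ (e n) - stageMul θ.Bᵀ (e (n + 1))‖ ≤ 3 * c ^ 3 * F := by
    have a1 : ∑ n ∈ Finset.Ico 1 (N - 1), ‖stageMul θ.Aᵀ (e n) - stageMul θ.Bᵀ (e (n + 1))‖ ≤
        ∑ n ∈ Finset.Ico 1 N, (D + 2 * c ^ 2 * (h * (‖E n‖ + ‖e n‖))) := by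
      refine (Finset.sum_le_sum fun n hn => ?_).trans
        (Finset.sum_le_sum_of_subset_of_nonneg (Finset.Ico_subset_Ico_right (Nat.sub_le N 1))
          fun n _ _ => by positivity)
      rw [Finset.mem_Ico] at hn
      exact hp.norm_adjoint_residual_le hb hε hh hN hn.1 hn.2
    rw [Finset.sum_add_distrib, ← Finset.mul_sum, Finset.sum_const, Nat.card_Ico,
      nsmul_eq_mul] at a1
    simp only [mul_add] at a1
    rw [Finset.sum_add_distrib] at a1
    have a2 := sum_mul_norm_state_le hh hNc hS hSn
    have a3 := sum_mul_norm_adjoint_le hh hNc hW hWn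
    rw [← hU] at a3
    have a4 : h * (((N - 1 : ℕ) : ℝ) * D) ≤ c * D := by
      rw [← mul_assoc]
      refine mul_le_mul_of_nonneg_right (le_trans ?_ hNc) hD
      have : ((N - 1 : ℕ) : ℝ) ≤ N := by exact_mod_cast Nat.sub_le N 1
      gcongr
    have a5 : c * S + (c * W + U) ≤ c * (S + W + U) := by
      have : U ≤ c * U := le_mul_of_one_le_left hU0 hc
      linarith
    have a6 := mul_le_mul_of_nonneg_left a1 hh
    have a7 := mul_le_mul_of_nonneg_left
      (mul_le_mul_of_nonneg_left ((add_le_add a2 a3).trans a5) hh) (by positivity : 0 ≤ 2 * c ^ 2)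
    have a8 : c * D ≤ c ^ 3 * D :=
      mul_le_mul_of_nonneg_right (by simpa using pow_le_pow_right₀ hc (by norm_num : 1 ≤ 3)) hD
    have a9 : 0 ≤ c ^ 3 * D := by positivity
    have a10 : 0 ≤ c ^ 3 * (h * (S + W + U)) := by positivity
    rw [hF]
    linarith
  have h4 : h * ∑ n ∈ Finset.Ico 1 N, ‖parasitic θ.Aᵀ (e n)‖ ≤ 5 * c ^ 5 * F := by
    have a1 := mul_le_mul_of_nonneg_left (hb.bwd N hN2 e) hh
    have a2 := mul_le_mul_of_nonneg_left (add_le_add h2 h3) hc0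
    have a3 : c * (3 * c ^ 3 * F) ≤ 3 * c ^ 5 * F := by
      have : c ^ 4 * F ≤ c ^ 5 * F :=
        mul_le_mul_of_nonneg_right (pow_le_pow_right₀ hc (by norm_num)) hF0
      linarith
    linarith
  -- the initial stages
  have h5 : h * ‖e 1‖ ≤ 6 * c ^ 5 * F := by
    have a1 : ‖parasitic θ.Aᵀ (e 1)‖ ≤ ∑ n ∈ Finset.Ico 1 N, ‖parasitic θ.Aᵀ (e n)‖ :=
      Finset.single_le_sum (f := fun n => ‖parasitic θ.Aᵀ (e n)‖) (fun _ _ => norm_nonneg _)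
        (Finset.mem_Ico.2 ⟨le_rfl, by omega⟩)
    have a2 := mul_le_mul_of_nonneg_left a1 hh
    have a3 := mul_le_mul_of_nonneg_left (norm_le_parasitic_add (A := θ.Aᵀ) (e 1)) hh
    have a4 := mul_le_mul_of_nonneg_left (hWn 1 le_rfl (by omega)) hh
    have a5 : h * W ≤ F := by
      have : 0 ≤ h * (S + U) + D := by positivity
      rw [hF]; linarith
    have a6 : F ≤ c ^ 5 * F := le_mul_of_one_le_left hF0 (one_le_pow₀ hc)
    linarith
  have h6 : h * ‖e 0‖ ≤ 7 * c ^ 7 * F := by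
    have a1 := mul_le_mul_of_nonneg_left (hb.le_A0T (e 0)) hh
    have a2 : ‖stageMul θ.A0ᵀ (e 0)‖ ≤
        ‖stageMul θ.A0ᵀ (e 0) - stageMul θ.Bᵀ (e 1)‖ + c * ‖e 1‖ := by
      have := norm_le_norm_sub_add (stageMul θ.A0ᵀ (e 0)) (stageMul θ.Bᵀ (e 1))
      linarith [hb.BT_le (e 1)]
    have a3 := hp.adj_start.trans (hres 0 (by omega))
    have a4 := mul_le_mul_of_nonneg_left a2 hh
    have a5 := mul_le_mul_of_nonneg_left h5 hc0
    have a6 : h * ‖stageMul θ.A0ᵀ (e 0)‖ ≤ c * F + c * (6 * c ^ 5 * F) := by linarith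
    have a7 := mul_le_mul_of_nonneg_left a6 hc0
    have a8 : c * (c * F) ≤ c ^ 7 * F := by
      rw [← mul_assoc, ← pow_two]
      exact mul_le_mul_of_nonneg_right (pow_le_pow_right₀ hc (by norm_num)) hF0
    linarith
  have h7 : U = h * ∑ n ∈ Finset.Ico 1 N, ‖parasitic θ.Aᵀ (e n)‖ + h * ‖e 0‖ + h * ‖e N‖ := rfl
  have h8 : c ^ 5 * F ≤ c ^ 7 * F :=
    mul_le_mul_of_nonneg_right (pow_le_pow_right₀ hc (by norm_num)) hF0
  have h9 : c ^ 2 * F ≤ c ^ 7 * F :=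
    mul_le_mul_of_nonneg_right (pow_le_pow_right₀ hc (by norm_num)) hF0
  linarith

end DiscreteStability

section DiscreteStability

variable {s m : ℕ} {θ : PeerTriplet s}
  {J : ℝ → ((Fin m → ℝ) × (Fin m → ℝ)) →L[ℝ] ((Fin m → ℝ) × (Fin m → ℝ))}
  {Q : (Fin m → ℝ) →L[ℝ] (Fin m → ℝ)} {T c h ε D : ℝ} {N : ℕ} {E e : ℕ → Fin s → Fin m → ℝ}

/-- The state errors away from their mean values. In the last interval the mean value of the
preceding one is used, since the end method need not satisfy the adjoint preconsistency condition. -/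
lemma PerturbedLinearization.stateFast_le
    (hp : PerturbedLinearization θ J Q N h ε c D E e) (hb : OperatorBounds θ J Q T c)
    (hst : StrictlyStable θ.A θ.B) (hN1 : θ.AN *ᵥ 1 = θ.BN *ᵥ 1)
    (hε : ε ≤ 1) (hh : 0 ≤ h) (hN : h * N ≤ T) (hN2 : 2 ≤ N) (hD : 0 ≤ D)
    {S W : ℝ} (hS : 0 ≤ S) (hW : 0 ≤ W) (hSn : ∀ n ≤ N, ‖E n‖ ≤ S)
    (hWn : ∀ n, 1 ≤ n → n < N → ‖stageDot (1 ᵥ* θ.Aᵀ) (e n)‖ ≤ W) :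
    ‖E 0‖ ≤ 4 * c ^ 5 * (h * (S + W) + adjointFast θ N h e + D) ∧
    ‖stageDot (1 ᵥ* θ.A) (E 1)‖ ≤ 4 * c ^ 5 * (h * (S + W) + adjointFast θ N h e + D) ∧
    (∀ n < N, ‖parasitic θ.A (E n)‖ ≤ 4 * c ^ 5 * (h * (S + W) + adjointFast θ N h e + D)) ∧
    ‖E N - stageTensor 1 (stageDot (1 ᵥ* θ.A) (E (N - 1)))‖ ≤
      4 * c ^ 5 * (h * (S + W) + adjointFast θ N h e + D) := by
  have hc := hb.one_le
  have hc0 : 0 ≤ c := zero_le_one.trans hc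
  set U := adjointFast θ N h e with hU
  have hU0 : 0 ≤ U := adjointFast_nonneg hh
  set F := h * (S + W) + U + D with hF
  have hF0 : 0 ≤ F := by positivity
  have he : ∀ n ≤ N, h * ‖e n‖ ≤ h * W + U := fun n hn => mul_norm_adjoint_le hh hW hWn hn
  have hE : ∀ n ≤ N, h * ‖E n‖ ≤ h * S := fun n hn => mul_le_mul_of_nonneg_left (hSn n hn) hh
  have hres : ∀ n ≤ N, c * h * (‖E n‖ + ‖e n‖) + D ≤ c * F := fun n hn => by
    have h1 := mul_le_mul_of_nonneg_left (add_le_add (hE n hn) (he n hn)) hc0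
    have h3 : D ≤ c * D := le_mul_of_one_le_left hD hc
    rw [hF]
    linarith
  have hpow : ∀ {i j : ℕ}, i ≤ j → c ^ i * F ≤ c ^ j * F := fun hij =>
    mul_le_mul_of_nonneg_right (pow_le_pow_right₀ hc hij) hF0
  have h0 : ‖E 0‖ ≤ c ^ 2 * F := by
    have h1 := hb.le_A0 (E 0)
    have h2 := mul_le_mul_of_nonneg_left (hp.start.trans (hres 0 (by omega))) hc0
    linarith
  have hint : ∀ n, 1 ≤ n → n < N →
      ‖stageMul θ.A (E n) - stageMul θ.B (E (n - 1))‖ ≤ 2 * c ^ 2 * F := fun n hn hnN => by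
    refine (hp.norm_state_residual_le hb hε hh hN hn hnN).trans ?_
    have h1 : h * (‖E n‖ + ‖e n‖) ≤ h * (S + W) + U := by
      have := hE n hnN.le; have := he n hnN.le; linarith
    have h2 := mul_le_mul_of_nonneg_left h1 (by positivity : 0 ≤ 2 * c ^ 2)
    have h3 : D ≤ c ^ 2 * D := le_mul_of_one_le_left hD (one_le_pow₀ hc)
    have h4 : 0 ≤ c ^ 2 * D := by positivity
    rw [hF]
    linarith
  have hX : ∀ n < N, ‖parasitic θ.A (E n)‖ ≤ 3 * c ^ 3 * F := fun n hn => by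
    have h1 := hb.fwd (N - 1) E (2 * c ^ 2 * F) (by positivity)
      (fun k hk => by simpa using hint (k + 1) (by omega) (by omega)) n (by omega)
    have h2 := mul_le_mul_of_nonneg_left (add_le_add h0 (le_refl (2 * c ^ 2 * F))) hc0
    linarith
  refine ⟨?_, ?_, fun n hn => ?_, ?_⟩
  · have := hpow (show 2 ≤ 5 by norm_num)
    have h1 : 0 ≤ c ^ 5 * F := by positivity
    linarith
  · rw [hst.mean_eq (E 0) (E 1)]
    have h1 := hb.A_le_dot (E 0)
    have h2 := hb.one_le_dot (stageMul θ.A (E 1) - stageMul θ.B (E 0))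
    have h3 := mul_le_mul_of_nonneg_left (hint 1 le_rfl (by omega)) hc0
    have h4 := mul_le_mul_of_nonneg_left h0 hc0
    have h5 := norm_add_le (stageDot (1 ᵥ* θ.A) (E 0))
      (stageDot 1 (stageMul θ.A (E 1) - stageMul θ.B (E 0)))
    have h6 := hpow (show 3 ≤ 5 by norm_num)
    have h7 : 0 ≤ c ^ 5 * F := by positivity
    rw [Nat.sub_self] at h3
    linarith
  · have := hpow (show 3 ≤ 5 by norm_num)
    have h1 : 0 ≤ c ^ 5 * F := by positivity
    linarith [hX n hn]
  · have h1 := hb.le_AN (E N - stageTensor 1 (stageDot (1 ᵥ* θ.A) (E (N - 1))))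
    have h2 : stageMul θ.AN (E N - stageTensor 1 (stageDot (1 ᵥ* θ.A) (E (N - 1)))) =
        (stageMul θ.AN (E N) - stageMul θ.BN (E (N - 1))) +
          stageMul θ.BN (parasitic θ.A (E (N - 1))) := by
      rw [parasitic, stageMul_sub, stageMul_sub, stageMul_stageTensor, stageMul_stageTensor, hN1]
      abel
    rw [h2] at h1
    have h3 := norm_add_le (stageMul θ.AN (E N) - stageMul θ.BN (E (N - 1)))
      (stageMul θ.BN (parasitic θ.A (E (N - 1))))
    have h4 := hp.last.trans (hres N le_rfl)
    have h5 := hb.BN_le (parasitic θ.A (E (N - 1)))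
    have h6 := mul_le_mul_of_nonneg_left (hX (N - 1) (by omega)) hc0
    have h7 := mul_le_mul_of_nonneg_left (h3.trans (add_le_add h4 (h5.trans h6))) hc0
    have h8 := hpow (show 2 ≤ 5 by norm_num)
    linarith

/-- All fast quantities in terms of the mean values. -/
lemma PerturbedLinearization.fast_le
    (hp : PerturbedLinearization θ J Q N h ε c D E e) (hb : OperatorBounds θ J Q T c)
    (hst : StrictlyStable θ.A θ.B) (hN1 : θ.AN *ᵥ 1 = θ.BN *ᵥ 1)
    (hε : ε ≤ 1) (hh : 0 ≤ h) (hN : h * N ≤ T) (hN2 : 2 ≤ N) (hD : 0 ≤ D)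
    (hhc : 16 * (13 * c ^ 7) ^ 2 * h ≤ 1) {W : ℝ} (hW : 0 ≤ W)
    (hWn : ∀ n, 1 ≤ n → n < N → ‖(stageDot (1 ᵥ* θ.A) (E n), stageDot (1 ᵥ* θ.Aᵀ) (e n))‖ ≤ W) :
    ∀ c', c' = 32 * (13 * c ^ 7) ^ 3 →
    (∀ n ≤ N, ‖E n‖ ≤ 2 * W + c' * D) ∧ adjointFast θ N h e ≤ c' * (h * W + D) ∧
    ‖stageDot (1 ᵥ* θ.A) (E 1)‖ ≤ c' * (h * W + D) ∧
    (∀ n < N, ‖parasitic θ.A (E n)‖ ≤ c' * (h * W + D)) ∧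
    ‖E N - stageTensor 1 (stageDot (1 ᵥ* θ.A) (E (N - 1)))‖ ≤ c' * (h * W + D) := by
  rintro c' rfl
  have hc := hb.one_le
  have hc0 : 0 ≤ c := zero_le_one.trans hc
  have hc7 : 1 ≤ c ^ 7 := one_le_pow₀ hc
  have hh1 : h ≤ 1 := by
    have : 1 ≤ 16 * (13 * c ^ 7) ^ 2 := by nlinarith
    nlinarith
  obtain ⟨k, hk, hkm⟩ := Finset.exists_max_image (Finset.range (N + 1)) (fun n => ‖E n‖)
    ⟨0, by simp⟩
  have hSn : ∀ n ≤ N, ‖E n‖ ≤ ‖E k‖ := fun n hn => hkm n (Finset.mem_range.2 (by omega))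
  have hkN : k ≤ N := by rw [Finset.mem_range] at hk; omega
  have hWe : ∀ n, 1 ≤ n → n < N → ‖stageDot (1 ᵥ* θ.Aᵀ) (e n)‖ ≤ W := fun n h1 h2 =>
    (norm_snd_le _).trans (hWn n h1 h2)
  have hWE : ∀ n, 1 ≤ n → n < N → ‖stageDot (1 ᵥ* θ.A) (E n)‖ ≤ W := fun n h1 h2 =>
    (norm_fst_le _).trans (hWn n h1 h2)
  have hU := hp.adjointFast_le hb hε hh hh1 hN hN2 hD (norm_nonneg (E k)) hW hSn hWe
  obtain ⟨hx0, hx1, hx2, hx3⟩ :=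
    hp.stateFast_le hb hst hN1 hε hh hN hN2 hD (norm_nonneg (E k)) hW hSn hWe
  have hU0 : 0 ≤ adjointFast θ N h e := adjointFast_nonneg hh
  generalize adjointFast θ N h e = U at *
  generalize hXd : 4 * c ^ 5 * (h * (‖E k‖ + W) + U + D) = X at *
  have hX : X ≤ 13 * c ^ 7 * (h * (‖E k‖ + W) + U + D) := by
    rw [← hXd]
    refine mul_le_mul_of_nonneg_right ?_ (by positivity)
    have : c ^ 5 ≤ c ^ 7 := pow_le_pow_right₀ hc (by norm_num)
    have : 0 ≤ c ^ 7 := by positivity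
    linarith
  have hX0 : 0 ≤ X := (norm_nonneg _).trans hx0
  have hS : ‖E k‖ ≤ W + X := by
    rcases Nat.eq_zero_or_pos k with rfl | h0
    · linarith
    rcases hkN.eq_or_lt with rfl | hkN
    · have h1 : E k = stageTensor 1 (stageDot (1 ᵥ* θ.A) (E (k - 1))) +
        (E k - stageTensor 1 (stageDot (1 ᵥ* θ.A) (E (k - 1)))) := by abel
      rw [h1]
      exact (norm_add_le _ _).trans (add_le_add ((stageTensor_one_norm_le _).trans
        (hWE (k - 1) (by omega) (by omega))) hx3)
    · have := norm_le_parasitic_add (A := θ.A) (E k)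
      linarith [hWE k h0 hkN, hx2 k hkN]
  obtain ⟨r1, r2, r3⟩ := absorb_parasitic (c := 13 * c ^ 7) (by linarith) hh hhc (norm_nonneg (E k))
    hW hU0 hD hU hX hS
  have hcc : 8 * (13 * c ^ 7) ^ 2 ≤ 32 * (13 * c ^ 7) ^ 3 := by
    have h1 : (13 * c ^ 7) ^ 2 ≤ (13 * c ^ 7) ^ 3 := pow_le_pow_right₀ (by linarith) (by norm_num)
    have h2 : 0 ≤ (13 * c ^ 7) ^ 2 := by positivity
    linarith
  have hWD : 0 ≤ h * W + D := by positivity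
  refine ⟨fun n hn => (hSn n hn).trans (r1.trans ?_),
    r2.trans (mul_le_mul_of_nonneg_right hcc hWD), hx1.trans r3, fun n hn => (hx2 n hn).trans r3,
    hx3.trans r3⟩
  have := mul_le_mul_of_nonneg_right hcc hD
  linarith

end DiscreteStability

/-! ### Bounds for the means -/

section DiscreteStability

variable {s m : ℕ} {θ : PeerTriplet s}
  {J : ℝ → ((Fin m → ℝ) × (Fin m → ℝ)) →L[ℝ] ((Fin m → ℝ) × (Fin m → ℝ))}
  {Q : (Fin m → ℝ) →L[ℝ] (Fin m → ℝ)} {T c h ε D : ℝ} {N : ℕ} {E e : ℕ → Fin s → Fin m → ℝ}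

/-- The weighted means of state and adjoint errors, in which the constant modes of the standard
method and of its adjoint live. -/
def meanPair (θ : PeerTriplet s) (E e : Fin s → Fin m → ℝ) : (Fin m → ℝ) × (Fin m → ℝ) :=
  (stageDot (1 ᵥ* θ.A) E, stageDot (1 ᵥ* θ.Aᵀ) e)

/-- The defect of the mean values in one step of the Euler discretization of the linearized
equations. -/
def meanDefect (θ : PeerTriplet s) (c h ε D : ℝ) (E e : Fin s → Fin m → ℝ) : ℝ :=
  c ^ 3 * (h * (‖parasitic θ.A E‖ + ‖parasitic θ.Aᵀ e‖)) + h * D +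
    c * (ε * (h * (‖E‖ + ‖e‖)))

lemma meanDefect_nonneg (hc : 0 ≤ c) (hh : 0 ≤ h) (hε : 0 ≤ ε) (hD : 0 ≤ D)
    (E e : Fin s → Fin m → ℝ) : 0 ≤ meanDefect θ c h ε D E e := by
  unfold meanDefect; positivity

/-- Multiplied by `𝟙ᵀ`, a forward step becomes an implicit Euler step for the mean of the state, since
`𝟙ᵀ A = 𝟙ᵀ B` and `𝟙ᵀ K 𝟙 = 1`; the parasitic components enter with a factor `h` only. -/
lemma PerturbedLinearization.norm_mean_state_step_le
    (hp : PerturbedLinearization θ J Q N h ε c D E e) (hb : OperatorBounds θ J Q T c)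
    (hst : StrictlyStable θ.A θ.B) (hK : (1 : Fin s → ℝ) ⬝ᵥ (θ.K *ᵥ 1) = 1)
    (hh : 0 ≤ h) (hN : h * N ≤ T) {n : ℕ} (hn : 1 ≤ n) (hnN : n < N) :
    ‖(meanPair θ (E n) (e n)).1 - (meanPair θ (E (n - 1)) (e (n - 1))).1 -
      h • (J (n * h) (meanPair θ (E n) (e n))).1‖ ≤ meanDefect θ c h ε D (E n) (e n) := by
  have hc := hb.one_le
  have hc0 : 0 ≤ c := zero_le_one.trans hc
  obtain ⟨σ, -, h2, h3⟩ := hp.step n hn hnN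
  generalize hR : stageMul θ.A (E n) - stageMul θ.B (E (n - 1)) = R at h3
  have e1 : (meanPair θ (E n) (e n)).1 - (meanPair θ (E (n - 1)) (e (n - 1))).1 = stageDot 1 R := by
    rw [← hR]
    simp only [meanPair]
    rw [hst.mean_eq (E (n - 1)) (E n)]
    abel
  have e2 : stageDot 1 (h • stageMul θ.K (stageFst (J (n * h)) (E n) (e n))) =
      h • (J (n * h) (meanPair θ (E n) (e n))).1 + stageDot 1 (h • stageMul θ.K
        (stageFst (J (n * h)) (parasitic θ.A (E n)) (parasitic θ.Aᵀ (e n)))) := by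
    rw [stageFst_parasitic _ θ.A θ.Aᵀ, stageMul_add, smul_add, stageDot_add, stageMul_stageTensor,
      stageDot_smul, stageDot_stageTensor, hK, one_smul]
    rfl
  have e3 : stageDot 1 R - h • (J (n * h) (meanPair θ (E n) (e n))).1 =
      stageDot 1 (R - h • stageMul θ.K (stageFst (J (n * h)) (E n) (e n)) - σ) + stageDot 1 σ +
      stageDot 1 (h • stageMul θ.K
        (stageFst (J (n * h)) (parasitic θ.A (E n)) (parasitic θ.Aᵀ (e n)))) := by
    rw [stageDot_sub, stageDot_sub, e2]
    abel
  rw [e1, e3]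
  refine (norm_add₃_le).trans ?_
  have f1 := (hb.one_le_dot _).trans (mul_le_mul_of_nonneg_left h3 hc0)
  have f2 := (hb.one_le_dot _).trans (mul_le_mul_of_nonneg_left
    (hb.norm_K_stageFst_le (mul_mem_Icc hh hN hnN.le) hh (parasitic θ.A (E n))
      (parasitic θ.Aᵀ (e n))) hc0)
  unfold meanDefect
  linarith

/-- The counterpart of `norm_mean_state_step_le` for the adjoint: with respect to the forward direction
of time it is an explicit Euler step. -/
lemma PerturbedLinearization.norm_mean_adjoint_step_le
    (hp : PerturbedLinearization θ J Q N h ε c D E e) (hb : OperatorBounds θ J Q T c)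
    (hst : StrictlyStable θ.A θ.B) (hK : (1 : Fin s → ℝ) ⬝ᵥ (θ.K *ᵥ 1) = 1)
    (hh : 0 ≤ h) (hN : h * N ≤ T) {n : ℕ} (hn : 1 ≤ n) (hnN : n < N - 1) :
    ‖(meanPair θ (E (n + 1)) (e (n + 1))).2 - (meanPair θ (E n) (e n)).2 -
      h • (J (n * h) (meanPair θ (E n) (e n))).2‖ ≤ meanDefect θ c h ε D (E n) (e n) := by
  have hc := hb.one_le
  have hc0 : 0 ≤ c := zero_le_one.trans hc
  obtain ⟨σ, -, h2, h3⟩ := hp.adj_step n hn hnN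
  generalize hR : stageMul θ.Aᵀ (e n) - stageMul θ.Bᵀ (e (n + 1)) = R at h3
  have e1 : (meanPair θ (E (n + 1)) (e (n + 1))).2 - (meanPair θ (E n) (e n)).2 =
      -stageDot 1 R := by
    rw [← hR]
    simp only [meanPair]
    rw [hst.transpose.mean_eq (e (n + 1)) (e n)]
    abel
  have e2 : stageDot 1 (h • stageMul θ.K (stageSnd (J (n * h)) (E n) (e n))) =
      h • (J (n * h) (meanPair θ (E n) (e n))).2 + stageDot 1 (h • stageMul θ.K
        (stageSnd (J (n * h)) (parasitic θ.A (E n)) (parasitic θ.Aᵀ (e n)))) := by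
    rw [stageSnd_parasitic _ θ.A θ.Aᵀ, stageMul_add, smul_add, stageDot_add, stageMul_stageTensor,
      stageDot_smul, stageDot_stageTensor, hK, one_smul]
    rfl
  have e3 : -stageDot 1 R - h • (J (n * h) (meanPair θ (E n) (e n))).2 =
      -(stageDot 1 (R + h • stageMul θ.K (stageSnd (J (n * h)) (E n) (e n)) - σ) + stageDot 1 σ -
      stageDot 1 (h • stageMul θ.K
        (stageSnd (J (n * h)) (parasitic θ.A (E n)) (parasitic θ.Aᵀ (e n))))) := by
    rw [stageDot_sub, stageDot_add, e2]
    abel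
  rw [e1, e3, norm_neg]
  refine (norm_sub_le _ _).trans ((add_le_add (norm_add_le _ _) le_rfl).trans ?_)
  have f1 := (hb.one_le_dot _).trans (mul_le_mul_of_nonneg_left h3 hc0)
  have f2 := (hb.one_le_dot _).trans (mul_le_mul_of_nonneg_left
    (hb.norm_K_stageSnd_le (mul_mem_Icc hh hN (by omega : n ≤ N)) hh (parasitic θ.A (E n))
      (parasitic θ.Aᵀ (e n))) hc0)
  unfold meanDefect
  linarith

/-- The mean values satisfy the Euler equations of the linearized problem. The state equation is
implicit; moving it to the left end point of the interval costs the modulus of continuity of `J`. -/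
lemma PerturbedLinearization.norm_mean_step_le
    (hp : PerturbedLinearization θ J Q N h ε c D E e) (hb : OperatorBounds θ J Q T c)
    (hst : StrictlyStable θ.A θ.B) (hK : (1 : Fin s → ℝ) ⬝ᵥ (θ.K *ᵥ 1) = 1)
    (hε : 0 ≤ ε) (hh : 0 ≤ h) (hhc : c * h ≤ 1) (hN : h * N ≤ T) (hD : 0 ≤ D)
    (hJh : ∀ n < N, ‖J ((n + 1 : ℕ) * h) - J (n * h)‖ ≤ ε) {W : ℝ} (hW : 0 ≤ W)
    (hWn : ∀ n, 1 ≤ n → n < N → ‖meanPair θ (E n) (e n)‖ ≤ W) {n : ℕ} (hn : 1 ≤ n)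
    (hnN : n < N - 1) :
    ‖meanPair θ (E (n + 1)) (e (n + 1)) - meanPair θ (E n) (e n) -
      h • J (n * h) (meanPair θ (E n) (e n))‖ ≤
    2 * (meanDefect θ c h ε D (E n) (e n) + meanDefect θ c h ε D (E (n + 1)) (e (n + 1))) +
      h * (ε * W) + 2 * (c ^ 2 * (h * (h * W))) := by
  have hc := hb.one_le
  have hc0 : 0 ≤ c := zero_le_one.trans hc
  have h1 := hp.norm_mean_state_step_le hb hst hK hh hN (n := n + 1) (by omega) (by omega)
  have h2 := hp.norm_mean_adjoint_step_le hb hst hK hh hN hn hnN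
  rw [Nat.add_sub_cancel] at h1
  have hz := hWn n hn (by omega)
  have hz' := hWn (n + 1) (by omega) (by omega)
  have hβ := meanDefect_nonneg (θ := θ) hc0 hh hε hD (E n) (e n)
  have hβ' := meanDefect_nonneg (θ := θ) hc0 hh hε hD (E (n + 1)) (e (n + 1))
  generalize meanDefect θ c h ε D (E n) (e n) = β at *
  generalize meanDefect θ c h ε D (E (n + 1)) (e (n + 1)) = β' at *
  generalize meanPair θ (E n) (e n) = z at *
  generalize meanPair θ (E (n + 1)) (e (n + 1)) = z' at *
  have hJn : ‖J (n * h)‖ ≤ c := hb.J_le _ (mul_mem_Icc hh hN (by omega))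
  have hJn' : ‖J ((n + 1 : ℕ) * h)‖ ≤ c := hb.J_le _ (mul_mem_Icc hh hN (by omega))
  have hJz : ‖h • J (n * h) z‖ ≤ c * (h * W) := by
    rw [norm_smul, Real.norm_of_nonneg hh]
    have := (J (n * h)).le_of_opNorm_le_of_le hJn hz
    linarith [mul_le_mul_of_nonneg_left this hh]
  have hJz' : ‖h • J ((n + 1 : ℕ) * h) z'‖ ≤ c * (h * W) := by
    rw [norm_smul, Real.norm_of_nonneg hh]
    have := (J ((n + 1 : ℕ) * h)).le_of_opNorm_le_of_le hJn' hz'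
    linarith [mul_le_mul_of_nonneg_left this hh]
  have hinc : ‖z' - z‖ ≤ c * (h * W) + β + β' := by
    have a1 : ‖(z' - z).1‖ ≤ c * (h * W) + β' := by
      have := norm_le_norm_sub_add (z'.1 - z.1) (h • (J ((n + 1 : ℕ) * h) z').1)
      have := (norm_fst_le (h • J ((n + 1 : ℕ) * h) z')).trans hJz'
      rw [Prod.smul_fst] at this
      rw [Prod.fst_sub]
      linarith
    have a2 : ‖(z' - z).2‖ ≤ c * (h * W) + β := by
      have := norm_le_norm_sub_add (z'.2 - z.2) (h • (J (n * h) z).2)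
      have := (norm_snd_le (h • J (n * h) z)).trans hJz
      rw [Prod.smul_snd] at this
      rw [Prod.snd_sub]
      linarith
    exact max_le (by linarith) (by linarith)
  have hd : ‖J ((n + 1 : ℕ) * h) z' - J (n * h) z‖ ≤ ε * W + c * (c * (h * W) + β + β') := by
    have a1 : J ((n + 1 : ℕ) * h) z' - J (n * h) z =
        (J ((n + 1 : ℕ) * h) - J (n * h)) z' + J (n * h) (z' - z) := by
      rw [_root_.sub_apply, map_sub]; abel
    rw [a1]
    exact (norm_add_le _ _).trans (add_le_add
      ((J ((n + 1 : ℕ) * h) - J (n * h)).le_of_opNorm_le_of_le (hJh n (by omega)) hz')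
      ((J (n * h)).le_of_opNorm_le_of_le hJn hinc))
  have hβc : c * h * (β + β') ≤ β + β' := mul_le_of_le_one_left (by positivity) hhc
  have p1 : 0 ≤ h * (ε * W) := by positivity
  have p2 : 0 ≤ c ^ 2 * (h * (h * W)) := by positivity
  refine max_le ?_ ?_
  · have a1 : (z' - z - h • J (n * h) z).1 = (z'.1 - z.1 - h • (J ((n + 1 : ℕ) * h) z').1) +
        h • (J ((n + 1 : ℕ) * h) z' - J (n * h) z).1 := by
      simp only [Prod.fst_sub, Prod.smul_fst, smul_sub]; abel
    rw [a1]
    refine (norm_add_le _ _).trans ?_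
    rw [norm_smul, Real.norm_of_nonneg hh]
    have a2 := mul_le_mul_of_nonneg_left ((norm_fst_le _).trans hd) hh
    linarith
  · have a1 : (z' - z - h • J (n * h) z).2 = z'.2 - z.2 - h • (J (n * h) z).2 := rfl
    rw [a1]
    linarith

lemma sum_Ico_succ_le {f : ℕ → ℝ} (hf : ∀ n, 0 ≤ f n) (N : ℕ) :
    ∑ n ∈ Finset.Ico 1 (N - 1), f (n + 1) ≤ ∑ n ∈ Finset.Ico 1 N, f n := by
  rw [Finset.sum_Ico_add' f 1 (N - 1) 1]
  refine Finset.sum_le_sum_of_subset_of_nonneg (fun n hn => ?_) fun n _ _ => hf n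
  rw [Finset.mem_Ico] at hn ⊢
  omega

lemma sum_Ico_pred_le {f : ℕ → ℝ} (hf : ∀ n, 0 ≤ f n) (N : ℕ) :
    ∑ n ∈ Finset.Ico 1 (N - 1), f n ≤ ∑ n ∈ Finset.Ico 1 N, f n :=
  Finset.sum_le_sum_of_subset_of_nonneg (Finset.Ico_subset_Ico_right (Nat.sub_le N 1))
    fun n _ _ => hf n

lemma sum_Ico_const_le {x c : ℝ} (hx : 0 ≤ x) (hh : 0 ≤ h) (hN : h * N ≤ c) {M : ℕ} (hM : M ≤ N) :
    ∑ _n ∈ Finset.Ico 1 M, h * x ≤ c * x := by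
  rw [Finset.sum_const, Nat.card_Ico, nsmul_eq_mul, ← mul_assoc]
  refine mul_le_mul_of_nonneg_right (le_trans ?_ hN) hx
  rw [mul_comm]
  have : ((M - 1 : ℕ) : ℝ) ≤ N := by exact_mod_cast (Nat.sub_le M 1).trans hM
  gcongr

/-- The accumulated defect of the mean values. -/
lemma PerturbedLinearization.sum_norm_mean_step_le
    (hp : PerturbedLinearization θ J Q N h ε c D E e) (hb : OperatorBounds θ J Q T c)
    (hst : StrictlyStable θ.A θ.B) (hN1 : θ.AN *ᵥ 1 = θ.BN *ᵥ 1)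
    (hK : (1 : Fin s → ℝ) ⬝ᵥ (θ.K *ᵥ 1) = 1) (hw : θ.w ⬝ᵥ 1 = 1)
    (hε : 0 ≤ ε) (hε1 : ε ≤ 1) (hh : 0 ≤ h) (hhc : 16 * (13 * c ^ 7) ^ 2 * h ≤ 1) (hN : h * N ≤ T)
    (hN2 : 2 ≤ N) (hD : 0 ≤ D)
    (hJh : ∀ n < N, ‖J ((n + 1 : ℕ) * h) - J (n * h)‖ ≤ ε) {W : ℝ} (hW : 0 ≤ W)
    (hWn : ∀ n, 1 ≤ n → n < N → ‖meanPair θ (E n) (e n)‖ ≤ W) :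
    ∀ C, C = 32 * (13 * c ^ 7) ^ 3 * c ^ 5 →
    ‖(meanPair θ (E 1) (e 1)).1‖ +
      ‖(meanPair θ (E (N - 1)) (e (N - 1))).2 - Q (meanPair θ (E (N - 1)) (e (N - 1))).1‖ +
    ∑ n ∈ Finset.Ico 1 (N - 1), ‖meanPair θ (E (n + 1)) (e (n + 1)) - meanPair θ (E n) (e n) -
      h • J (n * h) (meanPair θ (E n) (e n))‖ ≤ 60 * C * ((ε + h) * W + D) := by
  rintro C hC
  have hc := hb.one_le
  have hc0 : 0 ≤ c := zero_le_one.trans hc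
  have hNc : h * N ≤ c := hN.trans hb.T_le
  have hc7 : 1 ≤ c ^ 7 := one_le_pow₀ hc
  have hch : c * h ≤ 1 := by
    refine le_trans (mul_le_mul_of_nonneg_right ?_ hh) hhc
    have : c ≤ c ^ 7 := by simpa using pow_le_pow_right₀ hc (by norm_num : 1 ≤ 7)
    nlinarith
  have hh1 : h ≤ 1 := le_trans (le_mul_of_one_le_left hh hc) hch
  obtain ⟨hS, hU, hη, hX, hEN⟩ := hp.fast_le hb hst hN1 hε1 hh hN hN2 hD hhc hW hWn _ rfl
  have hc1' : 1 ≤ 32 * (13 * c ^ 7) ^ 3 := by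
    have : 1 ≤ (13 * c ^ 7) ^ 3 := one_le_pow₀ (by linarith)
    linarith
  generalize 32 * (13 * c ^ 7) ^ 3 = c' at *
  have hc0' : 0 ≤ c' := zero_le_one.trans hc1'
  set F := (ε + h) * W + D with hF
  have hεW : 0 ≤ ε * W := by positivity
  have hhW : 0 ≤ h * W := by positivity
  have hF0 : 0 ≤ F := by positivity
  have hWF : h * W + D ≤ F := by rw [hF]; linarith
  have hDF : D ≤ F := by linarith
  have hεF : ε * W ≤ F := by rw [hF]; linarith
  have hhF : h * W ≤ F := by linarith
  have hcF : c' * (h * W + D) ≤ c' * F := mul_le_mul_of_nonneg_left hWF hc0'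
  -- every monomial in `c` and `c'` that occurs is dominated by `C = c' c⁵`
  have hmono : ∀ i ≤ 5, c ^ i * (c' * F) ≤ C * F := fun i hi => by
    rw [hC]
    have := mul_le_mul_of_nonneg_right (pow_le_pow_right₀ hc hi) (mul_nonneg hc0' hF0)
    linarith
  have hmono' : ∀ i ≤ 5, c ^ i * F ≤ C * F := fun i hi =>
    (mul_le_mul_of_nonneg_left (le_mul_of_one_le_left hF0 hc1') (by positivity)).trans (hmono i hi)
  have k0 := hmono 0 (by norm_num)
  have k1 := hmono 1 (by norm_num)
  have k2 := hmono 2 (by norm_num)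
  have k3 := hmono 3 (by norm_num)
  have k4 := hmono 4 (by norm_num)
  have l0 := hmono' 0 (by norm_num)
  have l1 := hmono' 1 (by norm_num)
  have l2 := hmono' 2 (by norm_num)
  have l3 := hmono' 3 (by norm_num)
  have hU' := hU.trans hcF
  have hWe : ∀ n, 1 ≤ n → n < N → ‖stageDot (1 ᵥ* θ.Aᵀ) (e n)‖ ≤ W := fun n h1 h2 =>
    (norm_snd_le _).trans (hWn n h1 h2)
  have hcD : c' * D ≤ c' * F := mul_le_mul_of_nonneg_left hDF hc0'
  have hSn0 : 0 ≤ 2 * W + c' * D := by positivity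
  have hεS : ε * (2 * W + c' * D) ≤ 2 * F + c' * F := by
    have : ε * (c' * D) ≤ c' * D := mul_le_of_le_one_left (by positivity) hε1
    linarith
  have hhS : h * (2 * W + c' * D) ≤ 2 * F + c' * F := by
    have : h * (c' * D) ≤ c' * D := mul_le_of_le_one_left (by positivity) hh1
    linarith
  have hβ : ∑ n ∈ Finset.Ico 1 N, meanDefect θ c h ε D (E n) (e n) ≤ 9 * (C * F) := by
    have s1 : ∑ n ∈ Finset.Ico 1 N, h * ‖parasitic θ.A (E n)‖ ≤ c * (c' * F) :=
      (Finset.sum_le_sum fun n hn => mul_le_mul_of_nonneg_left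
        ((hX n (Finset.mem_Ico.1 hn).2).trans hcF) hh).trans
        (sum_Ico_const_le (by positivity) hh hNc le_rfl)
    have s2 : ∑ n ∈ Finset.Ico 1 N, h * ‖parasitic θ.Aᵀ (e n)‖ ≤ c' * F := by
      refine le_trans ?_ hU'
      rw [← Finset.mul_sum, adjointFast]
      have : 0 ≤ h * ‖e 0‖ := by positivity
      have : 0 ≤ h * ‖e N‖ := by positivity
      linarith
    have s3 : ∑ n ∈ Finset.Ico 1 N, h * D ≤ c * F :=
      (sum_Ico_const_le hD hh hNc le_rfl).trans (mul_le_mul_of_nonneg_left hDF hc0)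
    have s4 := sum_mul_norm_state_le hh hNc hSn0 hS
    have s5 := (sum_mul_norm_adjoint_le hh hNc hW hWe).trans (add_le_add le_rfl hU')
    simp only [meanDefect, Finset.sum_add_distrib, ← Finset.mul_sum] at s1 s2 s3 s4 s5 ⊢
    have s6 : ε * (h * (∑ n ∈ Finset.Ico 1 N, ‖E n‖ + ∑ n ∈ Finset.Ico 1 N, ‖e n‖)) ≤
        c * (2 * F + c' * F) + c * F + c' * F := by
      have a1 : h * (∑ n ∈ Finset.Ico 1 N, ‖E n‖ + ∑ n ∈ Finset.Ico 1 N, ‖e n‖) ≤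
        c * (2 * W + c' * D) + (c * W + c' * F) := by linarith
      have a2 := mul_le_mul_of_nonneg_left a1 hε
      have a3 := mul_le_mul_of_nonneg_left hεS hc0
      have a4 := mul_le_mul_of_nonneg_left hεF hc0
      have a5 : ε * (c' * F) ≤ c' * F := mul_le_of_le_one_left (by positivity) hε1
      linarith
    have s7 := mul_le_mul_of_nonneg_left s6 hc0
    have s8 := mul_le_mul_of_nonneg_left (add_le_add s1 s2) (by positivity : 0 ≤ c ^ 3)
    linarith
  have hβ0 : ∀ n, 0 ≤ meanDefect θ c h ε D (E n) (e n) := fun n =>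
    meanDefect_nonneg hc0 hh hε hD _ _
  have hsum : ∑ n ∈ Finset.Ico 1 (N - 1),
      ‖meanPair θ (E (n + 1)) (e (n + 1)) - meanPair θ (E n) (e n) -
        h • J (n * h) (meanPair θ (E n) (e n))‖ ≤ 39 * (C * F) := by
    have a1 := Finset.sum_le_sum fun n (hn : n ∈ Finset.Ico 1 (N - 1)) =>
      hp.norm_mean_step_le hb hst hK hε hh hch hN hD hJh hW hWn (Finset.mem_Ico.1 hn).1
        (Finset.mem_Ico.1 hn).2
    refine a1.trans ?_
    rw [Finset.sum_add_distrib, Finset.sum_add_distrib, ← Finset.mul_sum, Finset.sum_add_distrib]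
    have a2 := sum_Ico_pred_le hβ0 N
    have a3 := sum_Ico_succ_le hβ0 N
    have a4 : ∑ n ∈ Finset.Ico 1 (N - 1), h * (ε * W) ≤ c * F :=
      (sum_Ico_const_le hεW hh hNc (Nat.sub_le N 1)).trans (mul_le_mul_of_nonneg_left hεF hc0)
    have a5 : ∑ n ∈ Finset.Ico 1 (N - 1), 2 * (c ^ 2 * (h * (h * W))) ≤ 2 * (c ^ 2 * (c * F)) := by
      rw [← Finset.mul_sum, ← Finset.mul_sum]
      have := (sum_Ico_const_le hhW hh hNc (Nat.sub_le N 1)).trans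
        (mul_le_mul_of_nonneg_left hhF hc0)
      exact mul_le_mul_of_nonneg_left (mul_le_mul_of_nonneg_left this (by positivity)) (by norm_num)
    linarith
  have hbd : ‖(meanPair θ (E (N - 1)) (e (N - 1))).2 -
      Q (meanPair θ (E (N - 1)) (e (N - 1))).1‖ ≤ 20 * (C * F) := by
    have b1 : (meanPair θ (E (N - 1)) (e (N - 1))).2 - Q (meanPair θ (E (N - 1)) (e (N - 1))).1 =
        stageDot 1 (stageMul θ.Aᵀ (e (N - 1)) - stageMul θ.BNᵀ (e N)) +
        stageDot 1 (stageMul θ.ANᵀ (e N) - stageTensor θ.w (Q (stageDot θ.w (E N)))) +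
        Q (stageDot θ.w (E N - stageTensor 1 (stageDot (1 ᵥ* θ.A) (E (N - 1))))) := by
      have hw' : (1 : Fin s → ℝ) ⬝ᵥ θ.w = 1 := by rw [dotProduct_comm, hw]
      rw [stageDot_sub, stageDot_sub, stageDot_sub, stageDot_stageMul, stageDot_stageMul,
        stageDot_stageMul, stageDot_stageTensor, stageDot_stageTensor, vecMul_transpose θ.AN,
        vecMul_transpose θ.BN, hN1, hw, hw', one_smul, one_smul, map_sub]
      simp only [meanPair]
      abel
    rw [b1]
    refine (norm_add_le _ _).trans ?_
    have b2 := (hb.w_le_dot (E N - stageTensor 1 (stageDot (1 ᵥ* θ.A) (E (N - 1))))).trans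
      (mul_le_mul_of_nonneg_left (hEN.trans hcF) hc0)
    have b3 := Q.le_of_opNorm_le_of_le hb.Q_le b2
    have b4 := hp.mean_end
    have b5 : ε * ‖E N‖ ≤ 2 * F + c' * F := (mul_le_mul_of_nonneg_left (hS N le_rfl) hε).trans hεS
    have b6 : ∀ n ≤ N, h * ‖E n‖ ≤ 2 * F + c' * F := fun n hn =>
      (mul_le_mul_of_nonneg_left (hS n hn) hh).trans hhS
    have b7 : ∀ n ≤ N, h * ‖e n‖ ≤ F + c' * F := fun n hn =>
      (mul_norm_adjoint_le hh hW hWe hn).trans (add_le_add hhF hU')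
    have b8 := mul_le_mul_of_nonneg_left (add_le_add (add_le_add (b6 (N - 1) (Nat.sub_le N 1))
      (b7 (N - 1) (Nat.sub_le N 1))) (add_le_add (b6 N le_rfl) (b7 N le_rfl))) hc0
    linarith
  have hη' : ‖(meanPair θ (E 1) (e 1)).1‖ ≤ c' * F := hη.trans hcF
  linarith

/-- Stability of the linearized discrete boundary value problem: state errors are bounded by the
defects, adjoint errors by `1 / h` times the defects. -/
theorem StrictlyStable.exists_discrete_bound
    (hst : StrictlyStable θ.A θ.B) (hA0 : IsUnit θ.A0.det) (hAN : IsUnit θ.AN.det)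
    (hN1 : θ.AN *ᵥ 1 = θ.BN *ᵥ 1) (hK : (1 : Fin s → ℝ) ⬝ᵥ (θ.K *ᵥ 1) = 1) (hw : θ.w ⬝ᵥ 1 = 1)
    (hJQ : UniquelySolvable T J Q) (hT : 0 < T) (hJ : ContinuousOn J (Icc 0 T)) (c₀ : ℝ) :
    ∃ ε > 0, ∃ h₀ > 0, ∃ κ, ∀ (N : ℕ) (h : ℝ), h = T / (N + 1) → h ≤ h₀ →
      ∀ (D : ℝ) (E e : ℕ → Fin s → Fin m → ℝ), 0 ≤ D →
        PerturbedLinearization θ J Q N h ε c₀ D E e →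
        ∀ n ≤ N, ‖E n‖ + h * ‖e n‖ ≤ κ * D := by
  obtain ⟨c, hcc, hb⟩ := exists_operatorBounds hst hA0 hAN Q hJ c₀
  obtain ⟨κ, hκ0, h₁, hh₁, hκ⟩ := hJQ.exists_discrete_bound hT hJ
  have hc := hb.one_le
  have hc0 : 0 ≤ c := zero_le_one.trans hc
  obtain ⟨C, hC⟩ : ∃ C, C = 32 * (13 * c ^ 7) ^ 3 * c ^ 5 := ⟨_, rfl⟩
  have hC0 : 0 ≤ C := by rw [hC]; positivity
  set L := κ * (60 * C) with hL
  have hL0 : 0 ≤ L := by positivity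
  -- `ε` and `h` are so small that the means on the right-hand side can be absorbed
  set ε := 1 / (4 * (L + 1)) with hε
  have hε0 : 0 < ε := by positivity
  have hεL : L * ε ≤ 1 / 4 := by
    rw [hε, mul_one_div, div_le_div_iff₀ (by positivity) (by norm_num)]
    linarith
  have hε1 : ε ≤ 1 := by
    rw [hε, div_le_one (by positivity)]
    linarith
  obtain ⟨h₂, hh₂, hω⟩ : ∃ h₂ > 0, ∀ t ∈ Icc (0 : ℝ) T, ∀ t' ∈ Icc (0 : ℝ) T, |t - t'| ≤ h₂ →
      ‖J t - J t'‖ ≤ ε := by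
    have huc := isCompact_Icc.uniformContinuousOn_of_continuous hJ
    rw [Metric.uniformContinuousOn_iff_le] at huc
    obtain ⟨δ, hδ, h⟩ := huc ε hε0
    exact ⟨δ, hδ, fun t ht t' ht' htt => by
      simpa [dist_eq_norm] using h t ht t' ht' (by simpa [Real.dist_eq] using htt)⟩
  set h₃ := 1 / (16 * (13 * c ^ 7) ^ 2) with hh₃
  have hc7 : 0 < c ^ 7 := by positivity
  refine ⟨ε, hε0, min (min h₁ h₂) (min (min h₃ ε) (T / 3)),
    by positivity, 2 + (32 * (13 * c ^ 7) ^ 3) * 6 + (6 + (32 * (13 * c ^ 7) ^ 3) * 6) * (2 * L),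
    fun N h hh hle D E e hD hp => ?_⟩
  simp only [le_min_iff] at hle
  obtain ⟨⟨hle1, hle2⟩, ⟨hle3, hle4⟩, hle5⟩ := hle
  have hN0 : (0 : ℝ) < N + 1 := by positivity
  have hh0 : 0 < h := by rw [hh]; positivity
  have hNT : h * N ≤ T := by
    have : h * (N + 1) = T := by rw [hh]; field_simp
    linarith
  have hN2 : 2 ≤ N := by
    have h1 : T / (N + 1) ≤ T / 3 := hh ▸ hle5
    rw [div_le_div_iff_of_pos_left hT hN0 (by norm_num)] at h1
    have : (2 : ℝ) ≤ N := by linarith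
    exact_mod_cast this
  have hhc : 16 * (13 * c ^ 7) ^ 2 * h ≤ 1 := by
    rw [hh₃, le_div_iff₀ (by positivity)] at hle3
    linarith
  have hp' : PerturbedLinearization θ J Q N h ε c D E e := by
    have hmul : ∀ x : ℝ, 0 ≤ x → c₀ * x ≤ c * x := fun x hx => mul_le_mul_of_nonneg_right hcc hx
    refine ⟨?_, hp.step, ?_, ?_, hp.adj_step, ?_, ?_, ?_⟩
    · have := hmul (h * (‖E 0‖ + ‖e 0‖)) (by positivity)
      linarith [hp.start]
    · have := hmul (h * (‖E N‖ + ‖e N‖)) (by positivity)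
      linarith [hp.last]
    · have := hmul (h * (h * (‖E 0‖ + ‖e 0‖))) (by positivity)
      linarith [hp.adj_start]
    · have := hmul (h * (h * (‖E (N - 1)‖ + ‖e (N - 1)‖))) (by positivity)
      linarith [hp.adj_last]
    · have := hmul (h * (‖E N‖ + h * ‖e N‖)) (by positivity)
      linarith [hp.adj_end]
    · have := hmul (h * (‖E (N - 1)‖ + ‖e (N - 1)‖ + ‖E N‖ + ‖e N‖)) (by positivity)
      linarith [hp.mean_end]
  have hJh : ∀ n < N, ‖J ((n + 1 : ℕ) * h) - J (n * h)‖ ≤ ε := fun n hn => by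
    refine hω _ (PerturbedLinearization.mul_mem_Icc hh0.le hNT (by omega)) _
      (PerturbedLinearization.mul_mem_Icc hh0.le hNT (by omega)) ?_
    have : ((n + 1 : ℕ) : ℝ) * h - n * h = h := by push_cast; ring
    rw [this, abs_of_pos hh0]
    exact hle2
  obtain ⟨k, hk, hkm⟩ := Finset.exists_max_image (Finset.Ico 1 N)
    (fun n => ‖meanPair θ (E n) (e n)‖) ⟨1, Finset.mem_Ico.2 ⟨le_rfl, by omega⟩⟩
  rw [Finset.mem_Ico] at hk
  set W := ‖meanPair θ (E k) (e k)‖ with hWdef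
  have hW : 0 ≤ W := norm_nonneg _
  have hWn : ∀ n, 1 ≤ n → n < N → ‖meanPair θ (E n) (e n)‖ ≤ W := fun n h1 h2 =>
    hkm n (Finset.mem_Ico.2 ⟨h1, h2⟩)
  have hsum := hp'.sum_norm_mean_step_le hb hst hN1 hK hw hε0.le hε1 hh0.le hhc hNT hN2 hD hJh hW hWn
    C hC
  have hWD : W ≤ 2 * L * D := by
    have h1 := hκ N h hh hle1 hN2 (fun n => meanPair θ (E n) (e n)) k hk.1 hk.2
    have h2 := h1.trans (mul_le_mul_of_nonneg_left hsum hκ0)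
    have h3 : L * h ≤ L * ε := mul_le_mul_of_nonneg_left hle4 hL0
    have h4 : (L * ε + L * h) * W ≤ 1 / 2 * W := mul_le_mul_of_nonneg_right (by linarith) hW
    have h5 : κ * (60 * C * ((ε + h) * W + D)) = (L * ε + L * h) * W + L * D := by
      rw [hL]; ring
    rw [h5] at h2
    linarith
  obtain ⟨hS, hU, -, -, -⟩ := hp'.fast_le hb hst hN1 hε1 hh0.le hNT hN2 hD hhc hW hWn _ rfl
  intro n hn
  have hWe : ∀ n, 1 ≤ n → n < N → ‖stageDot (1 ᵥ* θ.Aᵀ) (e n)‖ ≤ W := fun n h1 h2 =>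
    (norm_snd_le _).trans (hWn n h1 h2)
  have h1 := mul_norm_adjoint_le hh0.le hW hWe hn
  have h2 := hS n hn
  have hc0' : 0 ≤ 32 * (13 * c ^ 7) ^ 3 := by positivity
  generalize 32 * (13 * c ^ 7) ^ 3 = c' at *
  have h3 : h * W ≤ W := mul_le_of_le_one_left hW (hle4.trans hε1)
  have h4 := mul_le_mul_of_nonneg_left h3 hc0'
  have h5 : (3 + c') * W ≤ (3 + c') * (2 * L * D) := mul_le_mul_of_nonneg_left hWD (by positivity)
  have h6 : 0 ≤ c' * D := by positivity
  have h7 : 0 ≤ L * D := by positivity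
  have h8 : 0 ≤ c' * (L * D) := by positivity
  linarith

end DiscreteStability

/-! ### Taylor expansions -/

section Taylor

variable {E F V : Type*} [NormedAddCommGroup E] [NormedSpace ℝ E] [NormedAddCommGroup F]
  [NormedSpace ℝ F] [NormedAddCommGroup V] [NormedSpace ℝ V]

/-- The linearization error of a `C²` function, uniformly along a compact set. -/
lemma IsCompact.exists_quadratic_remainder {S : Set E} (hS : IsCompact S) {Φ : E → F}
    (hΦ : ∀ w ∈ S, ContDiffAt ℝ 2 Φ w) :
    ∃ r > 0, ∃ M, 0 ≤ M ∧ ∀ w ∈ S, ∀ x ∈ Metric.closedBall w r, ∀ x' ∈ Metric.closedBall w r,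
      ‖Φ x - Φ x' - fderiv ℝ Φ w (x - x')‖ ≤ M * (‖x - w‖ + ‖x' - w‖) * ‖x - x'‖ := by
  suffices h : ∀ S' ⊆ S, IsCompact S' → ∃ r > 0, ∃ M, 0 ≤ M ∧ ∀ w ∈ S',
      ∀ x ∈ Metric.closedBall w r, ∀ x' ∈ Metric.closedBall w r,
      ‖Φ x - Φ x' - fderiv ℝ Φ w (x - x')‖ ≤ M * (‖x - w‖ + ‖x' - w‖) * ‖x - x'‖ from
    h S Subset.rfl hS
  intro S' hS' hc
  refine hc.induction_on (p := fun S' => ∃ r > 0, ∃ M, 0 ≤ M ∧ ∀ w ∈ S',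
      ∀ x ∈ Metric.closedBall w r, ∀ x' ∈ Metric.closedBall w r,
      ‖Φ x - Φ x' - fderiv ℝ Φ w (x - x')‖ ≤ M * (‖x - w‖ + ‖x' - w‖) * ‖x - x'‖)
    ⟨1, one_pos, 0, le_rfl, by simp⟩ ?_ ?_ ?_
  · rintro s t hst ⟨r, hr, M, hM, h⟩
    exact ⟨r, hr, M, hM, fun w hw => h w (hst hw)⟩
  · rintro s t ⟨r, hr, M, hM, h⟩ ⟨r', hr', M', hM', h'⟩
    refine ⟨min r r', lt_min hr hr', max M M', hM.trans (le_max_left _ _), ?_⟩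
    intro w hw x hx x' hx'
    have hle : ∀ {ξ : E}, ξ ∈ Metric.closedBall w (min r r') →
        ξ ∈ Metric.closedBall w r ∧ ξ ∈ Metric.closedBall w r' := fun hξ =>
      ⟨Metric.closedBall_subset_closedBall (min_le_left _ _) hξ,
        Metric.closedBall_subset_closedBall (min_le_right _ _) hξ⟩
    rcases hw with hw | hw
    · exact (h w hw x (hle hx).1 x' (hle hx').1).trans (by gcongr; exact le_max_left _ _)
    · exact (h' w hw x (hle hx).2 x' (hle hx').2).trans (by gcongr; exact le_max_right _ _)
  · intro w hw
    have h2 := hΦ w (hS' hw)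
    obtain ⟨K, t, ht, hK⟩ :=
      (h2.fderiv_right (m := 1) (by norm_num)).exists_lipschitzOnWith
    have hd : ∀ᶠ ξ in 𝓝 w, DifferentiableAt ℝ Φ ξ :=
      ((h2.of_le (by norm_num : (1 : WithTop ℕ∞) ≤ 2)).eventually (by simp)).mono
        fun ξ hξ => hξ.differentiableAt (by norm_num)
    obtain ⟨r, hr, hball⟩ := Metric.mem_nhds_iff.1 (Filter.inter_mem ht hd)
    refine ⟨Metric.ball w (r / 2), mem_nhdsWithin_of_mem_nhds (Metric.ball_mem_nhds _ (half_pos hr)),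
      r / 4, by positivity, K, K.2, fun w' hw' x hx x' hx' => ?_⟩
    have hsub : Metric.closedBall w' (r / 4) ⊆ Metric.ball w r := fun ξ hξ => by
      rw [Metric.mem_ball, Metric.mem_closedBall] at *
      linarith [dist_triangle ξ w' w]
    have hseg : segment ℝ x' x ⊆ Metric.closedBall w' (r / 4) :=
      (convex_closedBall w' (r / 4)).segment_subset hx' hx
    have hw'' : w' ∈ Metric.closedBall w' (r / 4) := Metric.mem_closedBall_self (by positivity)
    refine (convex_segment x' x).norm_image_sub_le_of_norm_hasFDerivWithin_le'
      (f' := fderiv ℝ Φ) (fun ξ hξ => ((hball (hsub (hseg hξ))).2).hasFDerivAt.hasFDerivWithinAt)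
      (fun ξ hξ => ?_) (left_mem_segment ℝ x' x) (right_mem_segment ℝ x' x)
    refine (hK.norm_sub_le (hball (hsub (hseg hξ))).1 (hball (hsub hw'')).1).trans ?_
    refine mul_le_mul_of_nonneg_left ?_ K.2
    -- a point of the segment is no farther from `w'` than one of the end points
    have h3 : ξ ∈ Metric.closedBall w' (max ‖x - w'‖ ‖x' - w'‖) :=
      (convex_closedBall w' _).segment_subset
        (by rw [Metric.mem_closedBall, dist_eq_norm]; exact le_max_right _ _)
        (by rw [Metric.mem_closedBall, dist_eq_norm]; exact le_max_left _ _) hξ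
    rw [Metric.mem_closedBall, dist_eq_norm] at h3
    exact h3.trans (max_le_add_of_nonneg (norm_nonneg _) (norm_nonneg _))

/-- A Lipschitz bound for a `C²` function, uniformly along a compact set. -/
lemma IsCompact.exists_lipschitz_bound {S : Set E} (hS : IsCompact S) {Φ : E → F}
    (hΦ : ∀ w ∈ S, ContDiffAt ℝ 2 Φ w) :
    ∃ r > 0, ∃ L, 0 ≤ L ∧ ∀ w ∈ S, ∀ x ∈ Metric.closedBall w r, ∀ x' ∈ Metric.closedBall w r,
      ‖Φ x - Φ x'‖ ≤ L * ‖x - x'‖ := by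
  obtain ⟨r, hr, M, hM, h⟩ := hS.exists_quadratic_remainder hΦ
  obtain ⟨B, hB⟩ := hS.exists_bound_of_continuousOn (f := fderiv ℝ Φ) fun w hw =>
    ((hΦ w hw).fderiv_right (m := 1) (by norm_num)).continuousAt.continuousWithinAt
  refine ⟨r, hr, M * (r + r) + max B 0, by positivity, fun w hw x hx x' hx' => ?_⟩
  have h1 := h w hw x hx x' hx'
  have h2 := (fderiv ℝ Φ w).le_of_opNorm_le ((hB w hw).trans (le_max_left B 0)) (x - x')
  have h3 := norm_le_norm_sub_add (Φ x - Φ x') (fderiv ℝ Φ w (x - x'))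
  rw [Metric.mem_closedBall, dist_eq_norm] at hx hx'
  have h4 : M * (‖x - w‖ + ‖x' - w‖) * ‖x - x'‖ ≤ M * (r + r) * ‖x - x'‖ := by gcongr
  linarith

/-- `D 0` is `n` times differentiable on `I` with the bounded derivatives `D 1, …, D n`. -/
structure IsJet (I : Set ℝ) (n : ℕ) (D : ℕ → ℝ → V) : Prop where
  deriv : ∀ k < n, ∀ t ∈ I, HasDerivWithinAt (D k) (D (k + 1) t) I t
  bound : ∃ M, ∀ k ≤ n, ∀ t ∈ I, ‖D k t‖ ≤ M

lemma IsJet.mono {I : Set ℝ} {n n' : ℕ} {D : ℕ → ℝ → V} (h : IsJet I n D) (hn : n' ≤ n) :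
    IsJet I n' D :=
  ⟨fun k hk => h.deriv k (hk.trans_le hn), h.bound.imp fun _ hM k hk => hM k (hk.trans hn)⟩

lemma IsJet.shift {I : Set ℝ} {n : ℕ} {D : ℕ → ℝ → V} (h : IsJet I (n + 1) D) :
    IsJet I n (fun k => D (k + 1)) :=
  ⟨fun k hk => h.deriv (k + 1) (by omega), h.bound.imp fun _ hM k hk => hM (k + 1) (by omega)⟩

lemma IsJet.shift_add {I : Set ℝ} {n : ℕ} {D : ℕ → ℝ → V} (q : ℕ) (h : IsJet I (n + q) D) :
    IsJet I n (fun k => D (k + q)) :=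
  ⟨fun k hk => by simpa only [add_right_comm] using h.deriv (k + q) (by omega),
    h.bound.imp fun _ hM k hk => hM (k + q) (by omega)⟩

/-- The jet of iterated derivatives within a compact interval. -/
lemma ContDiffOn.isJet {a b : ℝ} (hab : a < b) {n : ℕ} {φ : ℝ → V}
    (hφ : ContDiffOn ℝ n φ (Icc a b)) :
    IsJet (Icc a b) n (fun k => iteratedDerivWithin k φ (Icc a b)) := by
  have hu := uniqueDiffOn_Icc hab
  refine ⟨fun k hk t ht => ?_, ?_⟩
  · have h1 : DifferentiableOn ℝ (iteratedDerivWithin k φ (Icc a b)) (Icc a b) :=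
      hφ.differentiableOn_iteratedDerivWithin (by exact_mod_cast hk) hu
    rw [iteratedDerivWithin_succ]
    exact (h1 t ht).hasDerivWithinAt
  · have h1 : ∀ k, ∃ M, k ≤ n → ∀ t ∈ Icc a b, ‖iteratedDerivWithin k φ (Icc a b) t‖ ≤ M := fun k => by
      by_cases hk : k ≤ n
      · obtain ⟨M, hM⟩ := isCompact_Icc.exists_bound_of_continuousOn
          (hφ.continuousOn_iteratedDerivWithin (m := k) (by exact_mod_cast hk) hu)
        exact ⟨M, fun _ => hM⟩
      · exact ⟨0, fun h => absurd h hk⟩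
    choose M hM using h1
    refine ⟨∑ k ∈ Finset.range (n + 1), |M k|, fun k hk t ht => (hM k hk t ht).trans ?_⟩
    exact (le_abs_self _).trans (Finset.single_le_sum (f := fun k => |M k|)
      (fun _ _ => abs_nonneg _) (Finset.mem_range.2 (by omega)))

/-- Taylor's formula, to both sides of the base point. -/
lemma norm_sub_taylor_le {I : Set ℝ} (hI : Convex ℝ I) {M : ℝ} (n : ℕ) :
    ∀ {D : ℕ → ℝ → V}, (∀ k < n, ∀ t ∈ I, HasDerivWithinAt (D k) (D (k + 1) t) I t) →
      (∀ t ∈ I, ‖D n t‖ ≤ M) → ∀ t ∈ I, ∀ x ∈ I,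
      ‖D 0 x - ∑ k ∈ Finset.range n, ((x - t) ^ k / (k.factorial : ℝ)) • D k t‖ ≤
        M * |x - t| ^ n := by
  induction n with
  | zero => intro D _ hM t _ x hx; simpa using hM x hx
  | succ n ih =>
    intro D hD hM t ht x hx
    have ih' := ih (D := fun k => D (k + 1)) (fun k hk => hD (k + 1) (by omega)) hM t ht
    have hsub : uIcc t x ⊆ I := by
      rw [← segment_eq_uIcc]; exact hI.segment_subset ht hx
    have hder : ∀ ξ ∈ uIcc t x, HasDerivWithinAt
        (fun ξ => D 0 ξ - ∑ k ∈ Finset.range (n + 1), ((ξ - t) ^ k / (k.factorial : ℝ)) • D k t)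
        (D 1 ξ - ∑ k ∈ Finset.range n, ((ξ - t) ^ k / (k.factorial : ℝ)) • D (k + 1) t)
        (uIcc t x) ξ := fun ξ hξ => by
      refine ((hD 0 (by omega) ξ (hsub hξ)).mono hsub).sub ?_
      have h1 : HasDerivAt (fun ξ => ∑ k ∈ Finset.range (n + 1),
          ((ξ - t) ^ k / (k.factorial : ℝ)) • D k t)
          (∑ k ∈ Finset.range (n + 1),
            (((k : ℝ) * (ξ - t) ^ (k - 1) * 1) / (k.factorial : ℝ)) • D k t) ξ :=
        HasDerivAt.fun_sum fun k _ =>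
          ((((hasDerivAt_id ξ).sub_const t).pow k).div_const _).smul_const _
      refine h1.hasDerivWithinAt.congr_deriv ?_
      rw [Finset.sum_range_succ']
      simp only [Nat.cast_zero, zero_mul, zero_div, zero_smul, add_zero, Nat.add_sub_cancel, mul_one]
      refine Finset.sum_congr rfl fun k _ => ?_
      congr 1
      rw [Nat.factorial_succ]
      push_cast
      field_simp
    have hbd : ∀ ξ ∈ uIcc t x,
        ‖D 1 ξ - ∑ k ∈ Finset.range n, ((ξ - t) ^ k / (k.factorial : ℝ)) • D (k + 1) t‖ ≤
          M * |x - t| ^ n := fun ξ hξ => by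
      refine (ih' ξ (hsub hξ)).trans ?_
      have hM0 : 0 ≤ M := (norm_nonneg _).trans (hM t ht)
      have : |ξ - t| ≤ |x - t| := abs_sub_left_of_mem_uIcc hξ
      gcongr
    have h1 := (convex_uIcc t x).norm_image_sub_le_of_norm_hasDerivWithin_le hder hbd
      left_mem_uIcc right_mem_uIcc
    have h2 : D 0 t - ∑ k ∈ Finset.range (n + 1), ((t - t) ^ k / (k.factorial : ℝ)) • D k t = 0 := by
      rw [Finset.sum_range_succ']
      simp
    rw [h2, sub_zero, Real.norm_eq_abs] at h1
    rw [pow_succ, ← mul_assoc]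
    exact h1

lemma IsJet.exists_taylor_bound {I : Set ℝ} (hI : Convex ℝ I) {n : ℕ} {D : ℕ → ℝ → V}
    (h : IsJet I n D) : ∃ M, 0 ≤ M ∧ ∀ t ∈ I, ∀ x ∈ I,
      ‖D 0 x - ∑ k ∈ Finset.range n, ((x - t) ^ k / (k.factorial : ℝ)) • D k t‖ ≤
        M * |x - t| ^ n := by
  obtain ⟨M, hM⟩ := h.bound
  refine ⟨max M 0, le_max_right _ _, fun t ht x hx => ?_⟩
  exact norm_sub_taylor_le hI n h.deriv (fun t ht => (hM n le_rfl t ht).trans (le_max_left _ _))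
    t ht x hx

end Taylor

section StageTaylor

variable {s m : ℕ}

/-- The values of a function at the nodes `t + c_j h`. -/
def stageVec (φ : ℝ → Fin m → ℝ) (c : Fin s → ℝ) (t h : ℝ) : Fin s → Fin m → ℝ :=
  fun j => φ (t + c j * h)

lemma IsJet.exists_stageVec_bound {I : Set ℝ} (hI : Convex ℝ I) {n : ℕ} {D : ℕ → ℝ → Fin m → ℝ}
    (hD : IsJet I n D) (c : Fin s → ℝ) : ∃ C, 0 ≤ C ∧ ∀ t ∈ I, ∀ h, 0 ≤ h →
      (∀ j, t + c j * h ∈ I) →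
      ‖stageVec (D 0) c t h - ∑ k ∈ Finset.range n,
        (h ^ k / (k.factorial : ℝ)) • stageTensor (c ^ k) (D k t)‖ ≤ C * h ^ n := by
  obtain ⟨M, hM, hT⟩ := hD.exists_taylor_bound hI
  refine ⟨M * ‖c‖ ^ n, by positivity, fun t ht h hh hc => ?_⟩
  refine (pi_norm_le_iff_of_nonneg (by positivity)).2 fun j => ?_
  have h1 := hT t ht _ (hc j)
  have h2 : (stageVec (D 0) c t h - ∑ k ∈ Finset.range n,
      (h ^ k / (k.factorial : ℝ)) • stageTensor (c ^ k) (D k t)) j =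
      D 0 (t + c j * h) - ∑ k ∈ Finset.range n,
        ((t + c j * h - t) ^ k / (k.factorial : ℝ)) • D k t := by
    rw [Pi.sub_apply, Finset.sum_apply]
    simp only [stageVec, stageTensor, Pi.smul_apply, Pi.pow_apply, smul_smul]
    congr 1
    refine Finset.sum_congr rfl fun k _ => ?_
    congr 1
    rw [add_sub_cancel_left, mul_pow]
    ring
  rw [h2]
  refine h1.trans ?_
  rw [add_sub_cancel_left, abs_mul, abs_of_nonneg hh, mul_pow, mul_assoc]
  have : |c j| ≤ ‖c‖ := norm_le_pi_norm c j
  gcongr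

/-- The expansion of the residual of a two-step scheme at an exact solution. -/
lemma IsJet.exists_residual_bound {I : Set ℝ} (hI : Convex ℝ I) {n : ℕ} {D : ℕ → ℝ → Fin m → ℝ}
    (hD : IsJet I (n + 1) D) (A B K : Matrix (Fin s) (Fin s) ℝ) (c c' c'' : Fin s → ℝ) :
    ∃ C, 0 ≤ C ∧ ∀ t ∈ I, ∀ h, 0 ≤ h → (∀ j, t + c j * h ∈ I) → (∀ j, t + c' j * h ∈ I) →
      (∀ j, t + c'' j * h ∈ I) →
      ‖stageMul A (stageVec (D 0) c t h) - stageMul B (stageVec (D 0) c' t h) -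
        h • stageMul K (stageVec (D 1) c'' t h) - ∑ k ∈ Finset.range (n + 1),
        (h ^ k / (k.factorial : ℝ)) • stageTensor
          (A *ᵥ c ^ k - B *ᵥ c' ^ k - (k : ℝ) • (K *ᵥ c'' ^ (k - 1))) (D k t)‖ ≤
        C * h ^ (n + 1) := by
  obtain ⟨C₁, hC₁, h₁⟩ := hD.exists_stageVec_bound hI c
  obtain ⟨C₂, hC₂, h₂⟩ := hD.exists_stageVec_bound hI c'
  obtain ⟨C₃, hC₃, h₃⟩ := hD.shift.exists_stageVec_bound hI c''
  refine ⟨‖stageMulL (m := m) A‖ * C₁ + ‖stageMulL (m := m) B‖ * C₂ +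
    ‖stageMulL (m := m) K‖ * C₃, by positivity, fun t ht h hh hc hc' hc'' => ?_⟩
  have r₁ := h₁ t ht h hh hc
  have r₂ := h₂ t ht h hh hc'
  have r₃ := h₃ t ht h hh hc''
  generalize hR₁ : stageVec (D 0) c t h - _ = R₁ at r₁
  generalize hR₂ : stageVec (D 0) c' t h - _ = R₂ at r₂
  generalize hR₃ : stageVec (D (0 + 1)) c'' t h - _ = R₃ at r₃
  have hK : h • ∑ k ∈ Finset.range n,
      (h ^ k / (k.factorial : ℝ)) • stageTensor (c'' ^ k) (D (k + 1) t) =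
      ∑ k ∈ Finset.range (n + 1), (h ^ k / (k.factorial : ℝ)) •
        stageTensor ((k : ℝ) • c'' ^ (k - 1)) (D k t) := by
    rw [Finset.sum_range_succ', Finset.smul_sum]
    simp only [Nat.cast_zero, zero_smul, Nat.add_sub_cancel]
    have h0 : (h ^ 0 / (Nat.factorial 0 : ℝ)) • stageTensor (0 : Fin s → ℝ) (D 0 t) = 0 := by
      funext i; simp [stageTensor]
    rw [h0, add_zero]
    refine Finset.sum_congr rfl fun k _ => ?_
    rw [smul_stageTensor, smul_smul, smul_smul]
    congr 1
    rw [Nat.factorial_succ]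
    push_cast
    field_simp
    ring
  have key : stageMul A (stageVec (D 0) c t h) - stageMul B (stageVec (D 0) c' t h) -
        h • stageMul K (stageVec (D 1) c'' t h) - ∑ k ∈ Finset.range (n + 1),
        (h ^ k / (k.factorial : ℝ)) • stageTensor
          (A *ᵥ c ^ k - B *ᵥ c' ^ k - (k : ℝ) • (K *ᵥ c'' ^ (k - 1))) (D k t) =
      stageMul A R₁ - stageMul B R₂ - h • stageMul K R₃ := by
    rw [← hR₁, ← hR₂, ← hR₃, stageMul_sub, stageMul_sub, stageMul_sub, smul_sub,
      ← stageMul_smul K h (∑ k ∈ Finset.range n, _), hK, stageMul_sum, stageMul_sum, stageMul_sum]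
    simp only [sub_stageTensor, smul_sub, Finset.sum_sub_distrib, stageMul_smul,
      stageMul_stageTensor, mulVec_smul]
    abel
  rw [key]
  refine (norm_sub_le _ _).trans ((add_le_add (norm_sub_le _ _) le_rfl).trans ?_)
  rw [norm_smul, Real.norm_of_nonneg hh, add_mul, add_mul]
  refine add_le_add (add_le_add ?_ ?_) ?_
  · rw [mul_assoc]; exact (stageMul_norm_le _ _).trans (by gcongr)
  · rw [mul_assoc]; exact (stageMul_norm_le _ _).trans (by gcongr)
  · have : ‖stageMulL (m := m) K‖ * C₃ * h ^ (n + 1) = h * (‖stageMulL (m := m) K‖ * (C₃ * h ^ n)) := by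
      ring
    rw [this]
    exact mul_le_mul_of_nonneg_left ((stageMul_norm_le _ _).trans (by gcongr)) hh

end StageTaylor

/-! ### Smoothness of the right-hand sides -/

section Smoothness

variable {m d : ℕ} {f : (Fin m → ℝ) → (Fin d → ℝ) → (Fin m → ℝ)} {C : (Fin m → ℝ) → ℝ}
  {u : (Fin m → ℝ) → (Fin m → ℝ) → (Fin d → ℝ)} {z : (Fin m → ℝ) × (Fin m → ℝ)}

/-- The linear map that assigns to a derivative `L` of `f` in state and control the operator
`q ↦ -(∂_y f)ᵀ q`. -/
def adjointPart (m d : ℕ) : ((Fin m → ℝ) × (Fin d → ℝ) →L[ℝ] (Fin m → ℝ)) →L[ℝ]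
    ((Fin m → ℝ) →L[ℝ] (Fin m → ℝ)) :=
  LinearMap.toContinuousLinearMap
    { toFun := fun L => LinearMap.toContinuousLinearMap
        { toFun := fun q i => -(q ⬝ᵥ L (Pi.single i 1, 0))
          map_add' := fun q q' => funext fun _ =>
            (congrArg Neg.neg (add_dotProduct q q' _)).trans (neg_add _ _)
          map_smul' := fun a q => funext fun _ =>
            (congrArg Neg.neg (smul_dotProduct a q _)).trans (smul_neg a _).symm }
      map_add' := fun L L' => ContinuousLinearMap.ext fun q => funext fun i =>
        (congrArg Neg.neg (dotProduct_add q (L (Pi.single i 1, 0)) (L' (Pi.single i 1, 0)))).trans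
          (neg_add _ _)
      map_smul' := fun a L => ContinuousLinearMap.ext fun q => funext fun i =>
        (congrArg Neg.neg (dotProduct_smul a q (L (Pi.single i 1, 0)))).trans
          (smul_neg a _).symm }

lemma adjointPart_apply (L : (Fin m → ℝ) × (Fin d → ℝ) →L[ℝ] (Fin m → ℝ)) (q : Fin m → ℝ)
    (i : Fin m) : adjointPart m d L q i = -(q ⬝ᵥ L (Pi.single i 1, 0)) := rfl

lemma adjointPart_dotProduct (L : (Fin m → ℝ) × (Fin d → ℝ) →L[ℝ] (Fin m → ℝ))
    (q x : Fin m → ℝ) : adjointPart m d L q ⬝ᵥ x = -(q ⬝ᵥ L (x, 0)) := by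
  have h1 : ((x, 0) : (Fin m → ℝ) × (Fin d → ℝ)) =
      ∑ i, x i • ((Pi.single i 1 : Fin m → ℝ), (0 : Fin d → ℝ)) := by
    refine Prod.ext ?_ ?_
    · rw [Prod.fst_sum]
      simp only [Prod.smul_fst]
      exact pi_eq_sum_univ' x
    · rw [Prod.snd_sum]; simp
  rw [h1, map_sum, dotProduct_sum, ← Finset.sum_neg_distrib]
  refine Finset.sum_congr rfl fun i _ => ?_
  rw [map_smul, dotProduct_smul, adjointPart_apply, smul_eq_mul]
  ring

/-- The operator `q ↦ -(∂_y f(y, u(y, p)))ᵀ q` of the adjoint equation at `z = (y, p)`. -/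
def adjOp (f : (Fin m → ℝ) → (Fin d → ℝ) → (Fin m → ℝ))
    (u : (Fin m → ℝ) → (Fin m → ℝ) → (Fin d → ℝ)) (z : (Fin m → ℝ) × (Fin m → ℝ)) :
    (Fin m → ℝ) →L[ℝ] (Fin m → ℝ) :=
  LinearMap.toContinuousLinearMap
    { toFun := fun q => -jacT f z.1 (u z.1 z.2) q
      map_add' := fun q q' => by funext i; simp [jacT, add_dotProduct, add_comm]
      map_smul' := fun a q => by funext i; simp [jacT, smul_dotProduct] }

lemma adjOp_apply (z : (Fin m → ℝ) × (Fin m → ℝ)) (q : Fin m → ℝ) :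
    adjOp f u z q = -jacT f z.1 (u z.1 z.2) q := rfl

lemma stagePhi_apply {s : ℕ} (M : Matrix (Fin s) (Fin s) ℝ) (Z Q : Fin s → Fin m → ℝ) (i : Fin s) :
    stagePhi f u M Z Q i = adjOp f u (Z i, Q i) (stageMul Mᵀ Q i) := rfl

lemma adjOp_eq_adjointPart
    (hf : DifferentiableAt ℝ (Function.uncurry f) (z.1, u z.1 z.2)) :
    adjOp f u z = adjointPart m d (fderiv ℝ (Function.uncurry f) (z.1, u z.1 z.2)) := by
  have h1 : HasFDerivAt (fun x' => f x' (u z.1 z.2))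
      ((fderiv ℝ (Function.uncurry f) (z.1, u z.1 z.2)).comp
        (ContinuousLinearMap.inl ℝ (Fin m → ℝ) (Fin d → ℝ))) z.1 :=
    HasFDerivAt.comp z.1 (f := fun x' => (x', u z.1 z.2)) hf.hasFDerivAt
      (hasFDerivAt_prodMk_left z.1 (u z.1 z.2))
  ext q i
  rw [adjOp_apply, adjointPart_apply, Pi.neg_apply, jacT, h1.fderiv]
  rfl

lemma ContDiffAt.control {n : WithTop ℕ∞} (hu : ContDiffAt ℝ n (Function.uncurry u) z) :
    ContDiffAt ℝ n (fun z : (Fin m → ℝ) × (Fin m → ℝ) => (z.1, u z.1 z.2)) z :=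
  contDiffAt_fst.prodMk hu

lemma ContDiffAt.srcG {n : WithTop ℕ∞}
    (hf : ContDiffAt ℝ n (Function.uncurry f) (z.1, u z.1 z.2))
    (hu : ContDiffAt ℝ n (Function.uncurry u) z) :
    ContDiffAt ℝ n (fun z : (Fin m → ℝ) × (Fin m → ℝ) => _root_.srcG f u z.1 z.2) z :=
  ContDiffAt.comp (g := Function.uncurry f) z hf hu.control

lemma eventually_adjOp_eq (hf : ContDiffAt ℝ 1 (Function.uncurry f) (z.1, u z.1 z.2))
    (hu : ContinuousAt (Function.uncurry u) z) :
    adjOp f u =ᶠ[𝓝 z]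
      fun z => adjointPart m d (fderiv ℝ (Function.uncurry f) (z.1, u z.1 z.2)) := by
  have h1 : ContinuousAt (fun z : (Fin m → ℝ) × (Fin m → ℝ) => (z.1, u z.1 z.2)) z :=
    continuousAt_fst.prodMk hu
  filter_upwards [h1.eventually (hf.eventually (by simp))] with z' hz'
  exact adjOp_eq_adjointPart (hz'.differentiableAt (by norm_num))

lemma ContDiffAt.adjOp {n : WithTop ℕ∞}
    (hf : ContDiffAt ℝ (n + 1) (Function.uncurry f) (z.1, u z.1 z.2))
    (hu : ContDiffAt ℝ n (Function.uncurry u) z) :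
    ContDiffAt ℝ n (_root_.adjOp f u) z := by
  refine ContDiffAt.congr_of_eventuallyEq ?_
    (eventually_adjOp_eq (hf.of_le (by simp)) hu.continuousAt)
  exact (adjointPart m d).contDiff.contDiffAt.comp z
    (ContDiffAt.comp (g := fderiv ℝ (Function.uncurry f)) z (hf.fderiv_right le_rfl) hu.control)

/-- The right-hand side of the system of state and adjoint equation. -/
def srcField (f : (Fin m → ℝ) → (Fin d → ℝ) → (Fin m → ℝ))
    (u : (Fin m → ℝ) → (Fin m → ℝ) → (Fin d → ℝ)) (z : (Fin m → ℝ) × (Fin m → ℝ)) :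
    (Fin m → ℝ) × (Fin m → ℝ) :=
  (srcG f u z.1 z.2, srcPhi f u z.1 z.2)

lemma ContDiffAt.srcField {n : WithTop ℕ∞}
    (hf : ContDiffAt ℝ (n + 1) (Function.uncurry f) (z.1, u z.1 z.2))
    (hu : ContDiffAt ℝ n (Function.uncurry u) z) :
    ContDiffAt ℝ n (_root_.srcField f u) z :=
  ((hf.of_le le_self_add).srcG hu).prodMk ((hf.adjOp hu).clm_apply contDiffAt_snd)

lemma ContDiffAt.gradC {x : Fin m → ℝ} (hC : ContDiffAt ℝ 2 C x) : ContDiffAt ℝ 1 (_root_.gradC C) x :=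
  contDiffAt_pi.2 fun _ => (hC.fderiv_right (m := 1) (by norm_num)).clm_apply contDiffAt_const

lemma fderiv_gradC_dotProduct {x : Fin m → ℝ} (hC : ContDiffAt ℝ 2 C x) (v : Fin m → ℝ) :
    fderiv ℝ (gradC C) x v ⬝ᵥ v = iteratedFDeriv ℝ 2 C x ![v, v] := by
  have h1 : DifferentiableAt ℝ (fderiv ℝ C) x :=
    (hC.fderiv_right (m := 1) (by norm_num)).differentiableAt (by norm_num)
  have h2 : ∀ i, fderiv ℝ (gradC C) x v i = fderiv ℝ (fderiv ℝ C) x v (Pi.single i 1) := fun i => by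
    have h3 : HasFDerivAt (gradC C) (ContinuousLinearMap.pi fun i =>
        (ContinuousLinearMap.apply ℝ ℝ (Pi.single i 1 : Fin m → ℝ)).comp
          (fderiv ℝ (fderiv ℝ C) x)) x :=
      hasFDerivAt_pi.2 fun i => (ContinuousLinearMap.apply ℝ ℝ
        (Pi.single i 1 : Fin m → ℝ)).hasFDerivAt.comp x h1.hasFDerivAt
    rw [h3.fderiv]
    rfl
  rw [iteratedFDeriv_two_apply]
  simp only [dotProduct, h2, Matrix.cons_val_zero, Matrix.cons_val_one]
  have h4 : v = ∑ i, v i • (Pi.single i 1 : Fin m → ℝ) := pi_eq_sum_univ' v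
  have h5 : fderiv ℝ (fderiv ℝ C) x v v =
      ∑ i, fderiv ℝ (fderiv ℝ C) x v (v i • (Pi.single i 1 : Fin m → ℝ)) := by
    rw [← map_sum, ← h4]
  rw [h5]
  exact Finset.sum_congr rfl fun i _ => by rw [map_smul, smul_eq_mul, mul_comm]

/-- The adjoint solution gains one order of smoothness from its differential equation. -/
lemma contDiffOn_adjoint_succ {n : ℕ} {a b : ℝ} (hab : a < b) {y p : ℝ → Fin m → ℝ}
    (hy : ContDiffOn ℝ n y (Icc a b)) (hp : ContDiffOn ℝ n p (Icc a b))
    (hode : ∀ t ∈ Icc a b, HasDerivWithinAt p (srcPhi f u (y t) (p t)) (Icc a b) t)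
    (hf : ∀ t ∈ Icc a b, ContDiffAt ℝ (n + 1) (Function.uncurry f) (y t, u (y t) (p t)))
    (hu : ∀ t ∈ Icc a b, ContDiffAt ℝ n (Function.uncurry u) (y t, p t)) :
    ContDiffOn ℝ (n + 1) p (Icc a b) := by
  have hun := uniqueDiffOn_Icc hab
  rw [contDiffOn_succ_iff_derivWithin hun]
  refine ⟨fun t ht => (hode t ht).differentiableWithinAt, fun h => by simp at h, ?_⟩
  have h1 : ContDiffOn ℝ n (fun t => srcPhi f u (y t) (p t)) (Icc a b) := fun t ht => by
    have h2 : ContDiffAt ℝ n (fun z : (Fin m → ℝ) × (Fin m → ℝ) => (srcField f u z).2) (y t, p t) :=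
      (ContDiffAt.srcField (z := (y t, p t)) (hf t ht) (hu t ht)).snd
    exact ContDiffAt.comp_contDiffWithinAt (f := fun t => (y t, p t)) t h2
      ((hy t ht).prodMk (hp t ht))
  exact h1.congr fun t ht => (hode t ht).derivWithin (hun t ht)

end Smoothness

/-! ### The second-order condition and the linearized boundary value problem -/

section Coercivity

variable {m d : ℕ} {f : (Fin m → ℝ) → (Fin d → ℝ) → (Fin m → ℝ)} {C : (Fin m → ℝ) → ℝ}
  {u : (Fin m → ℝ) → (Fin m → ℝ) → (Fin d → ℝ)} {z : (Fin m → ℝ) × (Fin m → ℝ)}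
  {Uad : Set (Fin d → ℝ)}

lemma continuous_uncurry_dotProduct (k : ℕ) :
    Continuous fun q : (Fin k → ℝ) × (Fin k → ℝ) => q.1 ⬝ᵥ q.2 :=
  Continuous.dotProduct continuous_fst continuous_snd

lemma ContinuousOn.dotProduct_fin {k : ℕ} {a b : ℝ → Fin k → ℝ} {S : Set ℝ}
    (ha : ContinuousOn a S) (hb : ContinuousOn b S) : ContinuousOn (fun t => a t ⬝ᵥ b t) S :=
  (continuous_uncurry_dotProduct k).comp_continuousOn (ha.prodMk hb)

lemma HasDerivWithinAt.dotProduct_fin {k : ℕ} {a b : ℝ → Fin k → ℝ} {a' b' : Fin k → ℝ} {S : Set ℝ}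
    {t : ℝ} (ha : HasDerivWithinAt a a' S t) (hb : HasDerivWithinAt b b' S t) :
    HasDerivWithinAt (fun t => a t ⬝ᵥ b t) (a' ⬝ᵥ b t + a t ⬝ᵥ b') S t := by
  rw [hasDerivWithinAt_pi] at ha hb
  simp only [dotProduct, ← Finset.sum_add_distrib]
  exact HasDerivWithinAt.fun_sum fun i _ => (ha i).mul (hb i)

lemma hasFDerivAt_control (hu : DifferentiableAt ℝ (Function.uncurry u) z) :
    HasFDerivAt (fun z : (Fin m → ℝ) × (Fin m → ℝ) => (z.1, u z.1 z.2))
      ((ContinuousLinearMap.fst ℝ _ _).prod (fderiv ℝ (Function.uncurry u) z)) z :=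
  hasFDerivAt_fst.prodMk hu.hasFDerivAt

lemma hasFDerivAt_fderiv_control (hf : ContDiffAt ℝ 2 (Function.uncurry f) (z.1, u z.1 z.2))
    (hu : DifferentiableAt ℝ (Function.uncurry u) z) :
    HasFDerivAt (fun z : (Fin m → ℝ) × (Fin m → ℝ) =>
        fderiv ℝ (Function.uncurry f) (z.1, u z.1 z.2))
      ((fderiv ℝ (fderiv ℝ (Function.uncurry f)) (z.1, u z.1 z.2)).comp
        ((ContinuousLinearMap.fst ℝ _ _).prod (fderiv ℝ (Function.uncurry u) z))) z :=
  HasFDerivAt.comp (g := fderiv ℝ (Function.uncurry f)) z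
    ((hf.fderiv_right (m := 1) (by norm_num)).differentiableAt (by norm_num)).hasFDerivAt
    (hasFDerivAt_control hu)

/-- The linearized state and adjoint equations, in terms of the first two derivatives of `f` and the
control direction `Du(y, p)(ω, π)`. -/
lemma fderiv_srcField_apply (hf : ContDiffAt ℝ 2 (Function.uncurry f) (z.1, u z.1 z.2))
    (hu : ContDiffAt ℝ 1 (Function.uncurry u) z) (x : (Fin m → ℝ) × (Fin m → ℝ)) :
    fderiv ℝ (srcField f u) z x =
      (fderiv ℝ (Function.uncurry f) (z.1, u z.1 z.2) (x.1, fderiv ℝ (Function.uncurry u) z x),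
        adjointPart m d (fderiv ℝ (Function.uncurry f) (z.1, u z.1 z.2)) x.2 +
        adjointPart m d (fderiv ℝ (fderiv ℝ (Function.uncurry f)) (z.1, u z.1 z.2)
          (x.1, fderiv ℝ (Function.uncurry u) z x)) z.2) := by
  have hu' := hu.differentiableAt (by norm_num)
  have hf' := (hf.of_le (by norm_num : (1 : WithTop ℕ∞) ≤ 2))
  have h1 : HasFDerivAt (fun z : (Fin m → ℝ) × (Fin m → ℝ) => srcG f u z.1 z.2) _ z :=
    HasFDerivAt.comp (g := Function.uncurry f) z
      (hf'.differentiableAt (by norm_num)).hasFDerivAt (hasFDerivAt_control hu')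
  have h2 := ((adjointPart m d).hasFDerivAt.comp z (hasFDerivAt_fderiv_control hf hu')).congr_of_eventuallyEq
    (eventually_adjOp_eq hf' hu.continuousAt)
  have h3 : HasFDerivAt (fun z : (Fin m → ℝ) × (Fin m → ℝ) => srcPhi f u z.1 z.2) _ z :=
    h2.clm_apply hasFDerivAt_snd
  have h4 : HasFDerivAt (srcField f u) _ z := h1.prodMk h3
  rw [h4.fderiv, adjOp_eq_adjointPart (hf'.differentiableAt (by norm_num))]
  rfl

lemma iteratedFDeriv_hamiltonian (q : Fin m → ℝ) {w : (Fin m → ℝ) × (Fin d → ℝ)}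
    (hf : ContDiffAt ℝ 2 (Function.uncurry f) w) (v : (Fin m → ℝ) × (Fin d → ℝ)) :
    iteratedFDeriv ℝ 2 (fun z : (Fin m → ℝ) × (Fin d → ℝ) => q ⬝ᵥ f z.1 z.2) w ![v, v] =
      q ⬝ᵥ fderiv ℝ (fderiv ℝ (Function.uncurry f)) w v v := by
  let L : (Fin m → ℝ) →L[ℝ] ℝ := LinearMap.toContinuousLinearMap
    { toFun := fun x => q ⬝ᵥ x
      map_add' := dotProduct_add q
      map_smul' := fun a x => dotProduct_smul a q x }
  have h1 : fderiv ℝ (fun z : (Fin m → ℝ) × (Fin d → ℝ) => q ⬝ᵥ f z.1 z.2) =ᶠ[𝓝 w]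
      fun z => L.comp (fderiv ℝ (Function.uncurry f) z) := by
    filter_upwards [(hf.of_le (by norm_num : (1 : WithTop ℕ∞) ≤ 2)).eventually (by simp)] with z hz
    exact (L.hasFDerivAt.comp z (hz.differentiableAt (by norm_num)).hasFDerivAt).fderiv
  have h2 : DifferentiableAt ℝ (fderiv ℝ (Function.uncurry f)) w :=
    (hf.fderiv_right (m := 1) (by norm_num)).differentiableAt (by norm_num)
  have h3 : HasFDerivAt (fun z => L.comp (fderiv ℝ (Function.uncurry f) z))
      ((ContinuousLinearMap.compL ℝ _ _ _ L).comp (fderiv ℝ (fderiv ℝ (Function.uncurry f)) w)) w :=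
    HasFDerivAt.comp (g := ContinuousLinearMap.compL ℝ _ _ _ L) w
      (ContinuousLinearMap.hasFDerivAt _) h2.hasFDerivAt
  rw [iteratedFDeriv_two_apply, h1.fderiv_eq, h3.fderiv]
  rfl

/-- The first-order necessary condition (minimum principle) at a minimizer over a convex set. -/
lemma IsLocallyUniqueMinimizer.variational_inequality {q x : Fin m → ℝ} {v₀ v : Fin d → ℝ}
    (hU : Convex ℝ Uad) (h : IsLocallyUniqueMinimizer Uad (fun v => q ⬝ᵥ f x v) v₀)
    (hf : DifferentiableAt ℝ (Function.uncurry f) (x, v₀)) (hv : v ∈ Uad) :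
    0 ≤ q ⬝ᵥ fderiv ℝ (Function.uncurry f) (x, v₀) (0, v - v₀) := by
  have hloc : IsLocalMinOn (fun v => q ⬝ᵥ f x v) Uad v₀ := by
    have h1 := h.2
    rw [eventually_nhdsWithin_iff] at h1
    have : ∀ᶠ v' in 𝓝[Uad] v₀, q ⬝ᵥ f x v₀ ≤ q ⬝ᵥ f x v' := by
      rw [eventually_nhdsWithin_iff]
      filter_upwards [h1] with v' hv' hv'U
      rcases eq_or_ne v' v₀ with rfl | hne
      · exact le_rfl
      · exact (hv' ⟨hv'U, hne⟩).le
    exact this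
  have h1 : HasFDerivAt (fun v' => f x v') ((fderiv ℝ (Function.uncurry f) (x, v₀)).comp
      (ContinuousLinearMap.inr ℝ (Fin m → ℝ) (Fin d → ℝ))) v₀ :=
    HasFDerivAt.comp v₀ (f := fun v' => (x, v')) hf.hasFDerivAt (hasFDerivAt_prodMk_right x v₀)
  let L : (Fin m → ℝ) →L[ℝ] ℝ := LinearMap.toContinuousLinearMap
    { toFun := fun x => q ⬝ᵥ x
      map_add' := dotProduct_add q
      map_smul' := fun a x => dotProduct_smul a q x }
  have h2 : HasFDerivAt (fun v' => q ⬝ᵥ f x v') _ v₀ := L.hasFDerivAt.comp v₀ h1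
  exact hloc.hasFDerivWithinAt_nonneg h2.hasFDerivWithinAt
    (sub_mem_posTangentConeAt_of_segment_subset (hU.segment_subset h.1 hv))

/-- The control map is monotone with respect to the control gradient of the Hamiltonian. -/
lemma fderiv_control_nonpos (hU : Convex ℝ Uad)
    (hf : ContDiffAt ℝ 2 (Function.uncurry f) (z.1, u z.1 z.2))
    (hu : ContDiffAt ℝ 1 (Function.uncurry u) z)
    (hmin : ∀ᶠ z in 𝓝 z, IsLocallyUniqueMinimizer Uad (fun v => z.2 ⬝ᵥ f z.1 v) (u z.1 z.2))
    (x : (Fin m → ℝ) × (Fin m → ℝ)) :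
    x.2 ⬝ᵥ fderiv ℝ (Function.uncurry f) (z.1, u z.1 z.2)
        (0, fderiv ℝ (Function.uncurry u) z x) +
      z.2 ⬝ᵥ fderiv ℝ (fderiv ℝ (Function.uncurry f)) (z.1, u z.1 z.2)
        (x.1, fderiv ℝ (Function.uncurry u) z x) (0, fderiv ℝ (Function.uncurry u) z x) ≤ 0 := by
  have hu' := hu.differentiableAt (by norm_num)
  have hline : Filter.Tendsto (fun ε : ℝ => z + ε • x) (𝓝[≠] 0) (𝓝 z) := by
    have : Continuous fun ε : ℝ => z + ε • x := by fun_prop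
    simpa using (this.tendsto 0).mono_left nhdsWithin_le_nhds
  have t1 := (hu'.hasFDerivAt.hasLineDerivAt x).tendsto_slope_zero
  have t2 := ((hasFDerivAt_fderiv_control hf hu').hasLineDerivAt x).tendsto_slope_zero
  have t3 : Filter.Tendsto (fun ε : ℝ => fderiv ℝ (Function.uncurry f)
      ((z + ε • x).1, u (z + ε • x).1 (z + ε • x).2)) (𝓝[≠] 0)
      (𝓝 (fderiv ℝ (Function.uncurry f) (z.1, u z.1 z.2))) :=
    (hasFDerivAt_fderiv_control hf hu').continuousAt.tendsto.comp hline
  have happ : Continuous fun q : ((Fin m → ℝ) × (Fin d → ℝ) →L[ℝ] (Fin m → ℝ)) × (Fin d → ℝ) =>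
      q.1 (0, q.2) :=
    isBoundedBilinearMap_apply.continuous.comp
      (continuous_fst.prodMk (continuous_const.prodMk continuous_snd))
  have hdot : ∀ a : Fin m → ℝ, Continuous fun b : Fin m → ℝ => a ⬝ᵥ b := fun a =>
    (continuous_uncurry_dotProduct m).comp (Continuous.prodMk_right a)
  have lim := (((hdot x.2).tendsto _).comp ((happ.tendsto _).comp (t3.prodMk_nhds t1))).add
    (((hdot z.2).tendsto _).comp ((happ.tendsto _).comp (t2.prodMk_nhds t1)))
  refine le_of_tendsto lim ?_
  have hfd : ∀ᶠ z' in 𝓝 z, DifferentiableAt ℝ (Function.uncurry f) (z'.1, u z'.1 z'.2) :=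
    (hasFDerivAt_control hu').continuousAt.eventually
      (((hf.of_le (by norm_num : (1 : WithTop ℕ∞) ≤ 2)).eventually (by simp)).mono
        fun ξ hξ => hξ.differentiableAt (by norm_num))
  filter_upwards [hline.eventually (hmin.and hfd), self_mem_nhdsWithin] with ε hε hε0
  have hε0 : ε ≠ 0 := hε0
  have a1 := hε.1.variational_inequality hU hε.2 hmin.self_of_nhds.1
  have a2 := hmin.self_of_nhds.variational_inequality hU hfd.self_of_nhds hε.1.1
  have hz2 : (z + ε • x).2 = z.2 + ε • x.2 := rfl
  simp only [Function.comp_apply]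
  have hu1 : Function.uncurry u (z + ε • x) = u (z + ε • x).1 (z + ε • x).2 := rfl
  have hu0 : Function.uncurry u z = u z.1 z.2 := rfl
  rw [hu1, hu0]
  generalize fderiv ℝ (Function.uncurry f) ((z + ε • x).1, u (z + ε • x).1 (z + ε • x).2) = F at *
  generalize fderiv ℝ (Function.uncurry f) (z.1, u z.1 z.2) = F₀ at *
  generalize u (z + ε • x).1 (z + ε • x).2 = v at *
  generalize u z.1 z.2 = v₀ at *
  have b1 : ((0 : Fin m → ℝ), v₀ - v) = -(0, v - v₀) := by simp
  have b2 : ((0 : Fin m → ℝ), ε⁻¹ • (v - v₀)) = ε⁻¹ • (0, v - v₀) := by simp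
  rw [b1, map_neg, dotProduct_neg, hz2, add_dotProduct, smul_dotProduct] at a1
  rw [b2, map_smul, map_smul, dotProduct_smul, dotProduct_smul, _root_.smul_apply,
    _root_.sub_apply, dotProduct_smul, dotProduct_sub]
  simp only [smul_eq_mul] at *
  generalize x.2 ⬝ᵥ F (0, v - v₀) = A at *
  have e1 : ε⁻¹ * A + ε⁻¹ * (ε⁻¹ * (z.2 ⬝ᵥ F (0, v - v₀) - z.2 ⬝ᵥ F₀ (0, v - v₀))) =
      ε⁻¹ ^ 2 * (z.2 ⬝ᵥ F (0, v - v₀) + ε * A - z.2 ⬝ᵥ F₀ (0, v - v₀)) := by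
    field_simp
    ring
  rw [e1]
  exact mul_nonpos_of_nonneg_of_nonpos (by positivity) (by linarith)

/-- Directions of variation of the control map are admissible up to scaling. -/
lemma fderiv_control_mem_vectorSpan (hu : DifferentiableAt ℝ (Function.uncurry u) z)
    (hmem : ∀ᶠ z in 𝓝 z, u z.1 z.2 ∈ Uad) (x : (Fin m → ℝ) × (Fin m → ℝ)) :
    fderiv ℝ (Function.uncurry u) z x ∈ vectorSpan ℝ Uad := by
  have hline : Filter.Tendsto (fun ε : ℝ => z + ε • x) (𝓝[≠] 0) (𝓝 z) := by
    have : Continuous fun ε : ℝ => z + ε • x := by fun_prop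
    simpa using (this.tendsto 0).mono_left nhdsWithin_le_nhds
  refine (Submodule.closed_of_finiteDimensional (vectorSpan ℝ Uad)).mem_of_tendsto
    (hu.hasFDerivAt.hasLineDerivAt x).tendsto_slope_zero ?_
  filter_upwards [hline.eventually hmem] with ε hε
  exact Submodule.smul_mem _ _ (vsub_mem_vectorSpan ℝ hε hmem.self_of_nhds)

/-- Small vectors of the direction space of a convex set are differences of its elements. -/
lemma Convex.exists_sub_of_mem_vectorSpan {k : ℕ} {K : Set (Fin k → ℝ)} (hK : Convex ℝ K)
    (hne : K.Nonempty) :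
    ∃ r > 0, ∀ w ∈ vectorSpan ℝ K, ‖w‖ ≤ r → ∃ v₁ ∈ K, ∃ v₂ ∈ K, w = v₁ - v₂ := by
  obtain ⟨v₀, hv₀⟩ := hne.intrinsicInterior hK
  have hv₀K : v₀ ∈ K := intrinsicInterior_subset hv₀
  obtain ⟨v, hv, rfl⟩ := mem_intrinsicInterior.1 hv₀
  obtain ⟨r, hr, hball⟩ := Metric.mem_nhds_iff.1 (mem_interior_iff_mem_nhds.1 hv)
  refine ⟨r / 2, half_pos hr, fun w hw hwr => ⟨v + w, ?_, v, hv₀K, by simp⟩⟩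
  have h1 : (v : Fin k → ℝ) + w ∈ affineSpan ℝ K := by
    rw [add_comm]
    exact AffineSubspace.vadd_mem_of_mem_direction (by rwa [direction_affineSpan]) v.2
  have h2 : (⟨v + w, h1⟩ : affineSpan ℝ K) ∈ Metric.ball v r := by
    rw [Metric.mem_ball, Subtype.dist_eq, dist_eq_norm]
    simp only [add_sub_cancel_left]
    linarith
  exact hball h2

end Coercivity

/-! ### Unique solvability from coercivity -/

section Coercivity

variable {m d : ℕ} {f : (Fin m → ℝ) → (Fin d → ℝ) → (Fin m → ℝ)} {C : (Fin m → ℝ) → ℝ}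
  {u : (Fin m → ℝ) → (Fin m → ℝ) → (Fin d → ℝ)} {Uad : Set (Fin d → ℝ)} {T : ℝ}
  {y p : ℝ → Fin m → ℝ}

lemma IsIntegralCurveOn.eq_zero_of_right {E : Type*} [NormedAddCommGroup E] [NormedSpace ℝ E]
    [CompleteSpace E] {J : ℝ → E →L[ℝ] E} {x : ℝ → E} (hT : 0 ≤ T) (hJ : ContinuousOn J (Icc 0 T))
    (hx : IsIntegralCurveOn x (fun t z => J t z) (Icc 0 T)) (h0 : x T = 0) : x 0 = 0 := by
  have hmaps : MapsTo (fun t => T - t) (Icc 0 T) (Icc 0 T) := fun t ht =>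
    ⟨by linarith [ht.2], by linarith [ht.1]⟩
  have hJ' : ContinuousOn (fun t => -J (T - t)) (Icc 0 T) :=
    (hJ.comp (by fun_prop) hmaps).neg
  have hx' : IsIntegralCurveOn (fun t => x (T - t)) (fun t z => (-J (T - t)) z) (Icc 0 T) :=
    fun t ht => by
      have h1 := HasDerivWithinAt.scomp t (hx (T - t) (hmaps ht))
        ((hasDerivWithinAt_id t (Icc 0 T)).const_sub T) hmaps
      simpa using! h1
  have hz : IsIntegralCurveOn (fun _ => (0 : E)) (fun t z => (-J (T - t)) z) (Icc 0 T) :=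
    fun t _ => by simpa using hasDerivWithinAt_const t (Icc 0 T) (0 : E)
  have := IsIntegralCurveOn.linear_eq hJ' hx' hz (by simpa using h0) (t := T) ⟨hT, le_rfl⟩
  simpa using this

/-- A solution of the linearized boundary value problem whose control variation is admissible in
the coercivity condition vanishes: the second variation equals the integral of the nonpositive
quantity of `fderiv_control_nonpos`. -/
lemma Coercive.eq_zero_of_forall_mem (hcoer : Coercive f C Uad u T y p) (hU : Convex ℝ Uad)
    (hT : 0 < T) (hy : ContinuousOn y (Icc 0 T)) (hp : ContinuousOn p (Icc 0 T))
    (hf : ∀ t ∈ Icc 0 T, ContDiffAt ℝ 2 (Function.uncurry f) (y t, u (y t) (p t)))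
    (hu : ∀ t ∈ Icc 0 T, ContDiffAt ℝ 1 (Function.uncurry u) (y t, p t))
    (hC : ContDiffAt ℝ 2 C (y T))
    (hmin : ∀ t ∈ Icc 0 T, ∀ᶠ z in 𝓝 (y t, p t),
      IsLocallyUniqueMinimizer Uad (fun v => z.2 ⬝ᵥ f z.1 v) (u z.1 z.2))
    {x : ℝ → (Fin m → ℝ) × (Fin m → ℝ)}
    (hx : IsIntegralCurveOn x (fun t z => fderiv ℝ (srcField f u) (y t, p t) z) (Icc 0 T))
    (hx0 : (x 0).1 = 0) (hxT : (x T).2 = fderiv ℝ (gradC C) (y T) (x T).1)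
    (hν : ∀ t ∈ Icc 0 T, ∃ v₁ ∈ Uad, ∃ v₂ ∈ Uad,
      fderiv ℝ (Function.uncurry u) (y t, p t) (x t) = v₁ - v₂) : x 0 = 0 := by
  obtain ⟨α, hα, hco⟩ := hcoer
  have hzc : ContinuousOn (fun t => (y t, p t)) (Icc 0 T) := hy.prodMk hp
  have hxc : ContinuousOn x (Icc 0 T) := fun t ht => (hx t ht).continuousWithinAt
  have hcc : ContinuousOn (fun t => (y t, u (y t) (p t))) (Icc 0 T) := fun t ht =>
    (ContinuousAt.comp_continuousWithinAt (g := fun z : (Fin m → ℝ) × (Fin m → ℝ) => (z.1, u z.1 z.2))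
      (f := fun t => (y t, p t)) (hu t ht).control.continuousAt (hzc t ht))
  have hF₁c : ContinuousOn (fun t => fderiv ℝ (Function.uncurry f) (y t, u (y t) (p t)))
      (Icc 0 T) := fun t ht => ContinuousAt.comp_continuousWithinAt
    (g := fderiv ℝ (Function.uncurry f)) (f := fun t => (y t, u (y t) (p t)))
    ((hf t ht).fderiv_right (m := 1) (by norm_num)).continuousAt (hcc t ht)
  have hF₂c : ContinuousOn
      (fun t => fderiv ℝ (fderiv ℝ (Function.uncurry f)) (y t, u (y t) (p t))) (Icc 0 T) :=
    fun t ht => ContinuousAt.comp_continuousWithinAt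
      (g := fderiv ℝ (fderiv ℝ (Function.uncurry f))) (f := fun t => (y t, u (y t) (p t)))
      (((hf t ht).fderiv_right (m := 1) (by norm_num)).fderiv_right (m := 0)
        (by norm_num)).continuousAt (hcc t ht)
  have hU₁c : ContinuousOn (fun t => fderiv ℝ (Function.uncurry u) (y t, p t)) (Icc 0 T) :=
    fun t ht => ContinuousAt.comp_continuousWithinAt
      (g := fderiv ℝ (Function.uncurry u)) (f := fun t => (y t, p t))
      ((hu t ht).fderiv_right (m := 0) (by norm_num)).continuousAt (hzc t ht)
  have hνc : ContinuousOn (fun t => fderiv ℝ (Function.uncurry u) (y t, p t) (x t)) (Icc 0 T) :=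
    hU₁c.clm_apply hxc
  -- the equations for the components `ω` and `λ` of `x`
  have hJ : ∀ t ∈ Icc 0 T, fderiv ℝ (srcField f u) (y t, p t) (x t) = _ := fun t ht =>
    fderiv_srcField_apply (z := (y t, p t)) (hf t ht) (hu t ht) (x t)
  have hx' : ∀ t ∈ Icc 0 T, HasDerivWithinAt x _ (Icc 0 T) t := fun t ht =>
    (hx t ht).congr_deriv (hJ t ht)
  have hpair : ContinuousOn (fun t => ((x t).1, fderiv ℝ (Function.uncurry u) (y t, p t) (x t)))
      (Icc 0 T) := hxc.fst.prodMk hνc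
  generalize hνd : (fun t => fderiv ℝ (Function.uncurry u) (y t, p t) (x t)) = ν at hνc
  have hνd' : ∀ t, fderiv ℝ (Function.uncurry u) (y t, p t) (x t) = ν t := fun t => by rw [← hνd]
  simp only [hνd'] at hν hx' hpair hJ
  have hω : ∀ t ∈ Icc 0 T, HasDerivWithinAt (fun t => (x t).1)
      (fderiv ℝ (Function.uncurry f) (y t, u (y t) (p t)) ((x t).1, ν t)) (Icc 0 T) t :=
    fun t ht => (hx' t ht).fst
  have hq : ∀ t ∈ Icc 0 T, HasDerivWithinAt (fun t => (x t).2) _ (Icc 0 T) t :=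
    fun t ht => (hx' t ht).snd
  have key := hco (fun t => (x t).1) ν hνc hν hx0 hω
  have hψ : ∀ t ∈ Icc 0 T, iteratedFDeriv ℝ 2
      (fun z : (Fin m → ℝ) × (Fin d → ℝ) => p t ⬝ᵥ f z.1 z.2) (y t, u (y t) (p t))
      ![((x t).1, ν t), ((x t).1, ν t)] =
      p t ⬝ᵥ fderiv ℝ (fderiv ℝ (Function.uncurry f)) (y t, u (y t) (p t))
        ((x t).1, ν t) ((x t).1, ν t) := fun t ht =>
    iteratedFDeriv_hamiltonian (p t) (hf t ht) _
  have hψc : ContinuousOn (fun t => p t ⬝ᵥ fderiv ℝ (fderiv ℝ (Function.uncurry f))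
      (y t, u (y t) (p t)) ((x t).1, ν t) ((x t).1, ν t)) (Icc 0 T) :=
    hp.dotProduct_fin ((hF₂c.clm_apply hpair).clm_apply hpair)
  have hψi : ∫ t in (0 : ℝ)..T, iteratedFDeriv ℝ 2
      (fun z : (Fin m → ℝ) × (Fin d → ℝ) => p t ⬝ᵥ f z.1 z.2) (y t, u (y t) (p t))
      ![((x t).1, ν t), ((x t).1, ν t)] = ∫ t in (0 : ℝ)..T,
      p t ⬝ᵥ fderiv ℝ (fderiv ℝ (Function.uncurry f)) (y t, u (y t) (p t))
        ((x t).1, ν t) ((x t).1, ν t) :=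
    intervalIntegral.integral_congr fun t ht => hψ t (by rwa [uIcc_of_le hT.le] at ht)
  -- the boundary term as an integral
  have hH : ∀ t ∈ Icc 0 T, HasDerivWithinAt (fun t => (x t).2 ⬝ᵥ (x t).1)
      ((x t).2 ⬝ᵥ fderiv ℝ (Function.uncurry f) (y t, u (y t) (p t)) (0, ν t) -
        p t ⬝ᵥ fderiv ℝ (fderiv ℝ (Function.uncurry f)) (y t, u (y t) (p t))
          ((x t).1, ν t) ((x t).1, 0)) (Icc 0 T) t := fun t ht => by
    refine ((hq t ht).dotProduct_fin (hω t ht)).congr_deriv ?_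
    rw [add_dotProduct, adjointPart_dotProduct, adjointPart_dotProduct]
    have h1 : (((x t).1, ν t) : (Fin m → ℝ) × (Fin d → ℝ)) = ((x t).1, 0) + (0, ν t) := by simp
    have h2 : fderiv ℝ (Function.uncurry f) (y t, u (y t) (p t)) ((x t).1, ν t) =
        fderiv ℝ (Function.uncurry f) (y t, u (y t) (p t)) ((x t).1, 0) +
        fderiv ℝ (Function.uncurry f) (y t, u (y t) (p t)) (0, ν t) := by
      rw [← map_add, ← h1]
    rw [h2, dotProduct_add]
    ring
  have hHc : ContinuousOn (fun t =>
      (x t).2 ⬝ᵥ fderiv ℝ (Function.uncurry f) (y t, u (y t) (p t)) (0, ν t) -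
        p t ⬝ᵥ fderiv ℝ (fderiv ℝ (Function.uncurry f)) (y t, u (y t) (p t))
          ((x t).1, ν t) ((x t).1, 0)) (Icc 0 T) :=
    (hxc.snd.dotProduct_fin (hF₁c.clm_apply (continuousOn_const.prodMk hνc))).sub
      (hp.dotProduct_fin ((hF₂c.clm_apply hpair).clm_apply (hxc.fst.prodMk continuousOn_const)))
  have hb : iteratedFDeriv ℝ 2 C (y T) ![(x T).1, (x T).1] = ∫ t in (0 : ℝ)..T,
      ((x t).2 ⬝ᵥ fderiv ℝ (Function.uncurry f) (y t, u (y t) (p t)) (0, ν t) -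
        p t ⬝ᵥ fderiv ℝ (fderiv ℝ (Function.uncurry f)) (y t, u (y t) (p t))
          ((x t).1, ν t) ((x t).1, 0)) := by
    rw [intervalIntegral.integral_eq_sub_of_hasDerivAt_of_le hT.le
      (fun t ht => (hH t ht).continuousWithinAt)
      (fun t ht => (hH t (Ioo_subset_Icc_self ht)).hasDerivAt (Icc_mem_nhds ht.1 ht.2))
      (hHc.intervalIntegrable_of_Icc hT.le), hx0, dotProduct_zero, sub_zero, hxT,
      fderiv_gradC_dotProduct hC]
  rw [hψi, hb, ← intervalIntegral.integral_add (hHc.intervalIntegrable_of_Icc hT.le)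
    (hψc.intervalIntegrable_of_Icc hT.le)] at key
  have hneg : (∫ t in (0 : ℝ)..T,
      (((x t).2 ⬝ᵥ fderiv ℝ (Function.uncurry f) (y t, u (y t) (p t)) (0, ν t) -
        p t ⬝ᵥ fderiv ℝ (fderiv ℝ (Function.uncurry f)) (y t, u (y t) (p t))
          ((x t).1, ν t) ((x t).1, 0)) +
        p t ⬝ᵥ fderiv ℝ (fderiv ℝ (Function.uncurry f)) (y t, u (y t) (p t))
          ((x t).1, ν t) ((x t).1, ν t))) ≤ 0 := by
    rw [← neg_nonneg, ← intervalIntegral.integral_neg]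
    refine intervalIntegral.integral_nonneg hT.le fun t ht => neg_nonneg.2 ?_
    have h1 := fderiv_control_nonpos (z := (y t, p t)) hU (hf t ht) (hu t ht) (hmin t ht) (x t)
    simp only [hνd'] at h1
    have h2 : (((x t).1, ν t) : (Fin m → ℝ) × (Fin d → ℝ)) = ((x t).1, 0) + (0, ν t) := by simp
    have h3 : fderiv ℝ (fderiv ℝ (Function.uncurry f)) (y t, u (y t) (p t))
          ((x t).1, ν t) ((x t).1, ν t) =
        fderiv ℝ (fderiv ℝ (Function.uncurry f)) (y t, u (y t) (p t))
          ((x t).1, ν t) ((x t).1, 0) +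
        fderiv ℝ (fderiv ℝ (Function.uncurry f)) (y t, u (y t) (p t))
          ((x t).1, ν t) (0, ν t) := by
      rw [← map_add, ← h2]
    rw [h3, dotProduct_add]
    linarith
  -- hence the control variation vanishes
  have hν0 : ∀ t ∈ Icc 0 T, ν t = 0 := by
    intro t ht
    by_contra hne
    have hpos : 0 < ∫ t in (0 : ℝ)..T, ν t ⬝ᵥ ν t :=
      intervalIntegral.integral_pos hT (hνc.dotProduct_fin hνc)
        (fun t _ => Finset.sum_nonneg fun i _ => mul_self_nonneg _)
        ⟨t, ht, lt_of_le_of_ne (Finset.sum_nonneg fun i _ => mul_self_nonneg _)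
          fun h => hne (dotProduct_self_eq_zero.1 h.symm)⟩
    have := mul_pos hα hpos
    linarith
  -- and with it first the state and then the adjoint
  have hωz : ∀ t ∈ Icc 0 T, (x t).1 = 0 := by
    have hLc : ContinuousOn (fun t => (fderiv ℝ (Function.uncurry f) (y t, u (y t) (p t))).comp
        (ContinuousLinearMap.inl ℝ (Fin m → ℝ) (Fin d → ℝ))) (Icc 0 T) :=
      hF₁c.clm_comp continuousOn_const
    have h1 : IsIntegralCurveOn (fun t => (x t).1) (fun t z =>
        ((fderiv ℝ (Function.uncurry f) (y t, u (y t) (p t))).comp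
        (ContinuousLinearMap.inl ℝ (Fin m → ℝ) (Fin d → ℝ))) z) (Icc 0 T) := fun t ht => by
      have := hω t ht
      rw [hν0 t ht] at this
      exact this
    have h2 : IsIntegralCurveOn (fun _ => (0 : Fin m → ℝ)) (fun t z =>
        ((fderiv ℝ (Function.uncurry f) (y t, u (y t) (p t))).comp
        (ContinuousLinearMap.inl ℝ (Fin m → ℝ) (Fin d → ℝ))) z) (Icc 0 T) := fun t _ => by
      simpa only [map_zero] using hasDerivWithinAt_const t (Icc 0 T) (0 : Fin m → ℝ)
    exact fun t ht => IsIntegralCurveOn.linear_eq hLc h1 h2 hx0 ht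
  have hJc : ContinuousOn (fun t => fderiv ℝ (srcField f u) (y t, p t)) (Icc 0 T) := fun t ht =>
    ContinuousAt.comp_continuousWithinAt (g := fderiv ℝ (srcField f u)) (f := fun t => (y t, p t))
      ((ContDiffAt.srcField (n := 1) (z := (y t, p t)) (by simpa using! hf t ht)
        (hu t ht)).fderiv_right (m := 0) (by norm_num)).continuousAt (hzc t ht)
  refine IsIntegralCurveOn.eq_zero_of_right hT.le hJc hx (Prod.ext (hωz T ⟨hT.le, le_rfl⟩) ?_)
  rw [hxT, hωz T ⟨hT.le, le_rfl⟩, map_zero]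
  rfl

/-- The coercivity condition makes the linearized boundary value problem uniquely solvable. -/
theorem Coercive.uniquelySolvable (hcoer : Coercive f C Uad u T y p) (hU : Convex ℝ Uad)
    (hT : 0 < T) (hy : ContinuousOn y (Icc 0 T)) (hp : ContinuousOn p (Icc 0 T))
    (hf : ∀ t ∈ Icc 0 T, ContDiffAt ℝ 2 (Function.uncurry f) (y t, u (y t) (p t)))
    (hu : ∀ t ∈ Icc 0 T, ContDiffAt ℝ 1 (Function.uncurry u) (y t, p t))
    (hC : ContDiffAt ℝ 2 C (y T))
    (hmin : ∀ t ∈ Icc 0 T, ∀ᶠ z in 𝓝 (y t, p t),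
      IsLocallyUniqueMinimizer Uad (fun v => z.2 ⬝ᵥ f z.1 v) (u z.1 z.2)) :
    UniquelySolvable T (fun t => fderiv ℝ (srcField f u) (y t, p t))
      (fderiv ℝ (gradC C) (y T)) := by
  intro x hx hx0 hxT
  have hmem : ∀ t ∈ Icc 0 T, ∀ᶠ z : (Fin m → ℝ) × (Fin m → ℝ) in 𝓝 (y t, p t),
      u z.1 z.2 ∈ Uad := fun t ht => (hmin t ht).mono fun z hz => hz.1
  obtain ⟨r, hr, hsub⟩ := hU.exists_sub_of_mem_vectorSpan
    ⟨_, (hmem 0 ⟨le_rfl, hT.le⟩).self_of_nhds⟩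
  have hνc : ContinuousOn (fun t => fderiv ℝ (Function.uncurry u) (y t, p t) (x t)) (Icc 0 T) :=
    ContinuousOn.clm_apply (fun t ht => ContinuousAt.comp_continuousWithinAt
      (g := fderiv ℝ (Function.uncurry u)) (f := fun t => (y t, p t))
      ((hu t ht).fderiv_right (m := 0) (by norm_num)).continuousAt ((hy.prodMk hp) t ht))
      fun t ht => (hx t ht).continuousWithinAt
  obtain ⟨B, hB⟩ := isCompact_Icc.exists_bound_of_continuousOn hνc
  -- scale the solution until its control variation lies in `Uad - Uad`
  set a := r / (|B| + 1) with ha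
  have ha0 : 0 < a := by positivity
  have h1 := hcoer.eq_zero_of_forall_mem (x := fun t => a • x t) hU hT hy hp hf hu hC hmin
    (fun t ht => by simpa only [map_smul] using! (hx t ht).const_smul a)
    (by simp [hx0]) (by simp [hxT]) fun t ht => by
      refine hsub _ (fderiv_control_mem_vectorSpan
        ((hu t ht).differentiableAt (by norm_num)) (hmem t ht) _) ?_
      rw [map_smul, norm_smul, Real.norm_of_nonneg ha0.le]
      have h2 := mul_le_mul_of_nonneg_left ((hB t ht).trans (le_abs_self B)) ha0.le
      refine h2.trans ?_
      rw [ha, div_mul_eq_mul_div, div_le_iff₀ (by positivity)]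
      nlinarith [abs_nonneg B]
  exact (smul_eq_zero.1 h1).resolve_left ha0.ne'

end Coercivity

/-! ### Residuals along the exact solution -/

section Residual

variable {s m : ℕ} {I : Set ℝ} {D : ℕ → ℝ → Fin m → ℝ}

/-- All nodes `t + c_j h` lie in `I`. -/
def NodesIn (I : Set ℝ) (c : Fin s → ℝ) (t h : ℝ) : Prop := ∀ j, t + c j * h ∈ I

lemma stageVec_sub_one (φ : ℝ → Fin m → ℝ) (c : Fin s → ℝ) (t h : ℝ) :
    stageVec φ (c - 1) t h = stageVec φ c (t - h) h := by
  funext j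
  simp only [stageVec, Pi.sub_apply, Pi.one_apply]
  congr 1
  ring

lemma stageVec_add_one (φ : ℝ → Fin m → ℝ) (c : Fin s → ℝ) (t h : ℝ) :
    stageVec φ (c + 1) t h = stageVec φ c (t + h) h := by
  funext j
  simp only [stageVec, Pi.add_apply, Pi.one_apply]
  congr 1
  ring

lemma nodesIn_sub_one {c : Fin s → ℝ} {t h : ℝ} (hc : NodesIn I c (t - h) h) :
    NodesIn I (c - 1) t h := fun j => by
  have : t + (c - 1) j * h = t - h + c j * h := by simp only [Pi.sub_apply, Pi.one_apply]; ring
  rw [this]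
  exact hc j

lemma nodesIn_add_one {c : Fin s → ℝ} {t h : ℝ} (hc : NodesIn I c (t + h) h) :
    NodesIn I (c + 1) t h := fun j => by
  have : t + (c + 1) j * h = t + h + c j * h := by simp only [Pi.add_apply, Pi.one_apply]; ring
  rw [this]
  exact hc j

/-- The residual of the scheme `A Z = B Z' + h K F` at the jet `D`, with the nodes `c`, `c'`, `c''`
of the three terms. -/
def jetResidual (A B K : Matrix (Fin s) (Fin s) ℝ) (c c' c'' : Fin s → ℝ)
    (D : ℕ → ℝ → Fin m → ℝ) (t h : ℝ) : Fin s → Fin m → ℝ :=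
  stageMul A (stageVec (D 0) c t h) - stageMul B (stageVec (D 0) c' t h) -
    h • stageMul K (stageVec (D 1) c'' t h)

/-- The coefficient of the derivative of order `k` in the expansion of `jetResidual`. -/
def residualCoeff (A B K : Matrix (Fin s) (Fin s) ℝ) (c c' c'' : Fin s → ℝ) (k : ℕ) : Fin s → ℝ :=
  A *ᵥ c ^ k - B *ᵥ c' ^ k - (k : ℝ) • (K *ᵥ c'' ^ (k - 1))

lemma zero_stageTensor (x : Fin m → ℝ) : stageTensor (0 : Fin s → ℝ) x = 0 := by
  funext i; simp [stageTensor]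

variable {A B K : Matrix (Fin s) (Fin s) ℝ} {c c' c'' : Fin s → ℝ} {n : ℕ}

/-- If the coefficients up to order `n` vanish, the residual is of order `n + 1`. -/
lemma IsJet.exists_residual_order (hI : Convex ℝ I) (hD : IsJet I (n + 1) D)
    (h0 : ∀ k < n + 1, residualCoeff A B K c c' c'' k = 0) :
    ∃ C, 0 ≤ C ∧ ∀ t ∈ I, ∀ h, 0 ≤ h → NodesIn I c t h → NodesIn I c' t h → NodesIn I c'' t h →
      ‖jetResidual A B K c c' c'' D t h‖ ≤ C * h ^ (n + 1) := by
  obtain ⟨C, hC, hb⟩ := hD.exists_residual_bound hI A B K c c' c''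
  refine ⟨C, hC, fun t ht h hh h1 h2 h3 => ?_⟩
  have h4 := hb t ht h hh h1 h2 h3
  rw [Finset.sum_eq_zero, sub_zero] at h4
  · exact h4
  · intro k hk
    have := h0 k (Finset.mem_range.1 hk)
    rw [residualCoeff] at this
    rw [this, zero_stageTensor, smul_zero]

/-- The residual with its leading term split off. -/
lemma IsJet.exists_residual_lead (hI : Convex ℝ I) (hD : IsJet I (n + 2) D)
    (h0 : ∀ k < n + 1, residualCoeff A B K c c' c'' k = 0) :
    ∃ C, 0 ≤ C ∧ ∀ t ∈ I, ∀ h, 0 ≤ h → NodesIn I c t h → NodesIn I c' t h → NodesIn I c'' t h →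
      ‖jetResidual A B K c c' c'' D t h - (h ^ (n + 1) / ((n + 1).factorial : ℝ)) •
        stageTensor (residualCoeff A B K c c' c'' (n + 1)) (D (n + 1) t)‖ ≤ C * h ^ (n + 2) := by
  obtain ⟨C, hC, hb⟩ := hD.exists_residual_bound hI A B K c c' c''
  refine ⟨C, hC, fun t ht h hh h1 h2 h3 => ?_⟩
  have h4 := hb t ht h hh h1 h2 h3
  rw [Finset.sum_range_succ, Finset.sum_eq_zero, zero_add] at h4
  · exact h4
  · intro k hk
    have := h0 k (Finset.mem_range.1 hk)
    rw [residualCoeff] at this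
    rw [this, zero_stageTensor, smul_zero]

/-- The residual with its two leading terms split off. -/
lemma IsJet.exists_residual_lead_two (hI : Convex ℝ I) (hD : IsJet I (n + 3) D)
    (h0 : ∀ k < n + 1, residualCoeff A B K c c' c'' k = 0) :
    ∃ C, 0 ≤ C ∧ ∀ t ∈ I, ∀ h, 0 ≤ h → NodesIn I c t h → NodesIn I c' t h → NodesIn I c'' t h →
      ‖jetResidual A B K c c' c'' D t h - ((h ^ (n + 1) / ((n + 1).factorial : ℝ)) •
        stageTensor (residualCoeff A B K c c' c'' (n + 1)) (D (n + 1) t) +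
        (h ^ (n + 2) / ((n + 2).factorial : ℝ)) •
        stageTensor (residualCoeff A B K c c' c'' (n + 2)) (D (n + 2) t))‖ ≤ C * h ^ (n + 3) := by
  obtain ⟨C, hC, hb⟩ := hD.exists_residual_bound hI A B K c c' c''
  refine ⟨C, hC, fun t ht h hh h1 h2 h3 => ?_⟩
  have h4 := hb t ht h hh h1 h2 h3
  rw [Finset.sum_range_succ, Finset.sum_range_succ, Finset.sum_eq_zero, zero_add] at h4
  · exact h4
  · intro k hk
    have := h0 k (Finset.mem_range.1 hk)
    rw [residualCoeff] at this
    rw [this, zero_stageTensor, smul_zero]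

end Residual

section Consistency

variable {s m d q : ℕ} {f : (Fin m → ℝ) → (Fin d → ℝ) → (Fin m → ℝ)}
  {u : (Fin m → ℝ) → (Fin m → ℝ) → (Fin d → ℝ)} {I : Set ℝ} {T : ℝ}
  {Dy Dp : ℕ → ℝ → Fin m → ℝ} {c ρ : Fin s → ℝ}

/-- The jets `Dy`, `Dp` belong to a solution of the state and the adjoint equation on `I`, along
which the right-hand sides are smooth. -/
structure SmoothSolution (f : (Fin m → ℝ) → (Fin d → ℝ) → (Fin m → ℝ))
    (u : (Fin m → ℝ) → (Fin m → ℝ) → (Fin d → ℝ)) (I : Set ℝ) (T : ℝ) (q : ℕ)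
    (Dy Dp : ℕ → ℝ → Fin m → ℝ) : Prop where
  convex : Convex ℝ I
  subset : Icc 0 T ⊆ I
  jet_y : IsJet I (q + 3) Dy
  jet_p : IsJet I (q + 3) Dp
  ode_y : ∀ t ∈ I, Dy 1 t = srcG f u (Dy 0 t) (Dp 0 t)
  ode_p : ∀ t ∈ I, Dp 1 t = srcPhi f u (Dy 0 t) (Dp 0 t)
  smooth_adj : ∀ t ∈ Icc 0 T, ContDiffAt ℝ 2 (adjOp f u) (Dy 0 t, Dp 0 t)
  smooth_field : ∀ t ∈ Icc 0 T, ContDiffAt ℝ 2 (srcField f u) (Dy 0 t, Dp 0 t)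

/-- The reference values for the adjoint stages: the exact values plus the correction that makes
up for the order `s - 1` of the adjoint scheme in the interior of the grid. -/
def correctedAdjoint (ρ : Fin s → ℝ) (Dp : ℕ → ℝ → Fin m → ℝ) (q : ℕ) (c : Fin s → ℝ) (t h : ℝ) :
    Fin s → Fin m → ℝ :=
  stageVec (Dp 0) c t h + (h ^ (q + 1) / ((q + 1).factorial : ℝ)) • stageTensor ρ (Dp (q + 1) t)

namespace SmoothSolution

lemma stageG_eq (hS : SmoothSolution f u I T q Dy Dp) {t h : ℝ} (hc : NodesIn I c t h) :
    stageG f u (stageVec (Dy 0) c t h) (stageVec (Dp 0) c t h) = stageVec (Dy 1) c t h :=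
  funext fun i => (hS.ode_y _ (hc i)).symm

lemma stagePhi_of_isDiag {M : Matrix (Fin s) (Fin s) ℝ} (hM : M.IsDiag)
    (Z Q : Fin s → Fin m → ℝ) :
    stagePhi f u M Z Q = stageMul M (fun i => srcPhi f u (Z i) (Q i)) := by
  have h1 : ∀ (M : Matrix (Fin s) (Fin s) ℝ), M.IsDiag → ∀ (Q : Fin s → Fin m → ℝ) i,
      stageMul M Q i = M i i • Q i := fun M hM Q i => by
    rw [stageMul, Finset.sum_eq_single i (fun j _ hj => by rw [hM hj.symm, zero_smul])
      (fun h => absurd (Finset.mem_univ i) h)]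
  funext i
  rw [stagePhi_apply, h1 M hM, h1 Mᵀ hM.transpose, transpose_apply, map_smul]
  rfl

lemma stagePhi_eq (hS : SmoothSolution f u I T q Dy Dp) {M : Matrix (Fin s) (Fin s) ℝ}
    (hM : M.IsDiag) {t h : ℝ} (hc : NodesIn I c t h) :
    stagePhi f u M (stageVec (Dy 0) c t h) (stageVec (Dp 0) c t h) =
      stageMul M (stageVec (Dp 1) c t h) := by
  rw [stagePhi_of_isDiag hM]
  exact congrArg _ (funext fun i => (hS.ode_p _ (hc i)).symm)

lemma continuousOn_pair (hS : SmoothSolution f u I T q Dy Dp) :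
    ContinuousOn (fun t => (Dy 0 t, Dp 0 t)) (Icc 0 T) := fun t ht =>
  ((hS.jet_y.deriv 0 (by omega) t (hS.subset ht)).continuousWithinAt.mono hS.subset).prodMk
    ((hS.jet_p.deriv 0 (by omega) t (hS.subset ht)).continuousWithinAt.mono hS.subset)

lemma isCompact_image (hS : SmoothSolution f u I T q Dy Dp) :
    IsCompact ((fun t => (Dy 0 t, Dp 0 t)) '' Icc 0 T) :=
  isCompact_Icc.image_of_continuousOn hS.continuousOn_pair

lemma continuousOn_fderiv (hS : SmoothSolution f u I T q Dy Dp) :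
    ContinuousOn (fun t => fderiv ℝ (srcField f u) (Dy 0 t, Dp 0 t)) (Icc 0 T) := fun t ht =>
  ContinuousAt.comp_continuousWithinAt (g := fderiv ℝ (srcField f u))
    (f := fun t => (Dy 0 t, Dp 0 t))
    (((hS.smooth_field t ht).fderiv_right (m := 1) (by norm_num)).continuousAt)
    (hS.continuousOn_pair t ht)

lemma exists_norm_correction_le (hS : SmoothSolution f u I T q Dy Dp) (c ρ : Fin s → ℝ) :
    ∃ B, 0 ≤ B ∧ ∀ t ∈ I, ∀ h, 0 ≤ h →
      ‖correctedAdjoint ρ Dp q c t h - stageVec (Dp 0) c t h‖ ≤ B * h ^ (q + 1) := by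
  obtain ⟨M, hM⟩ := hS.jet_p.bound
  refine ⟨‖ρ‖ * max M 0, by positivity, fun t ht h hh => ?_⟩
  rw [correctedAdjoint, add_sub_cancel_left, norm_smul, Real.norm_of_nonneg (by positivity)]
  have h1 : h ^ (q + 1) / ((q + 1).factorial : ℝ) ≤ h ^ (q + 1) :=
    div_le_self (by positivity) (by exact_mod_cast Nat.one_le_iff_ne_zero.2 (Nat.factorial_ne_zero _))
  have h2 : ‖stageTensor ρ (Dp (q + 1) t)‖ ≤ ‖ρ‖ * max M 0 :=
    (stageTensor_norm_le _ _).trans (mul_le_mul_of_nonneg_left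
      ((hM (q + 1) (by omega) t ht).trans (le_max_left _ _)) (norm_nonneg _))
  rw [mul_comm]
  exact mul_le_mul h2 h1 (by positivity) (by positivity)

/-- Exact and corrected stage values lie within `O(h)` of the value of the solution at the grid point. -/
lemma exists_near (hS : SmoothSolution f u I T q Dy Dp) (c ρ : Fin s → ℝ) :
    ∃ B, 0 ≤ B ∧ ∀ t ∈ I, ∀ h, 0 ≤ h → h ≤ 1 → NodesIn I c t h →
      (∀ i, ‖(stageVec (Dy 0) c t h i, stageVec (Dp 0) c t h i) - (Dy 0 t, Dp 0 t)‖ ≤ B * h) ∧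
      (∀ i, ‖(stageVec (Dy 0) c t h i, correctedAdjoint ρ Dp q c t h i) - (Dy 0 t, Dp 0 t)‖ ≤
        B * h) ∧
      ‖correctedAdjoint ρ Dp q c t h - stageVec (Dp 0) c t h‖ ≤ B * h ^ (q + 1) := by
  obtain ⟨B₁, hB₁, h₁⟩ := (hS.jet_y.mono (by omega : 1 ≤ q + 3)).exists_stageVec_bound hS.convex c
  obtain ⟨B₂, hB₂, h₂⟩ := (hS.jet_p.mono (by omega : 1 ≤ q + 3)).exists_stageVec_bound hS.convex c
  obtain ⟨B₃, hB₃, h₃⟩ := hS.exists_norm_correction_le c ρ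
  refine ⟨B₁ + B₂ + B₃, by positivity, fun t ht h hh hh1 hc => ?_⟩
  have e1 := h₁ t ht h hh hc
  have e2 := h₂ t ht h hh hc
  have e3 := h₃ t ht h hh
  have hone : ∀ x : Fin m → ℝ, (h ^ 0 / (Nat.factorial 0 : ℝ)) • stageTensor (c ^ 0) x =
      stageTensor 1 x := fun x => by simp
  rw [Finset.sum_range_one, hone, pow_one] at e1 e2
  have hpow : h ^ (q + 1) ≤ h := by
    simpa using pow_le_pow_of_le_one hh hh1 (by omega : 1 ≤ q + 1)
  have p1 : 0 ≤ B₁ * h := by positivity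
  have p2 : 0 ≤ B₂ * h := by positivity
  have p3 : 0 ≤ B₃ * h := by positivity
  have p4 : 0 ≤ (B₁ + B₂) * h ^ (q + 1) := by positivity
  have d1 : ∀ i, ‖stageVec (Dy 0) c t h i - Dy 0 t‖ ≤ B₁ * h := fun i => by
    have := (norm_le_pi_norm _ i).trans e1
    simpa [stageTensor] using this
  have d2 : ∀ i, ‖stageVec (Dp 0) c t h i - Dp 0 t‖ ≤ B₂ * h := fun i => by
    have := (norm_le_pi_norm _ i).trans e2
    simpa [stageTensor] using this
  have d3 : ∀ i, ‖correctedAdjoint ρ Dp q c t h i - Dp 0 t‖ ≤ B₂ * h + B₃ * h := fun i => by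
    have a1 := (norm_le_pi_norm _ i).trans e3
    rw [Pi.sub_apply] at a1
    have a2 := norm_sub_le_norm_sub_add_norm_sub (correctedAdjoint ρ Dp q c t h i)
      (stageVec (Dp 0) c t h i) (Dp 0 t)
    have a3 := mul_le_mul_of_nonneg_left hpow hB₃
    linarith [d2 i]
  refine ⟨fun i => max_le ?_ ?_, fun i => max_le ?_ ?_, ?_⟩
  · have := d1 i; simp only [Prod.fst_sub]; linarith
  · have := d2 i; simp only [Prod.snd_sub]; linarith
  · have := d1 i; simp only [Prod.fst_sub]; linarith
  · have := d3 i; simp only [Prod.snd_sub]; linarith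
  · linarith

/-- The effect of the correction on the right-hand sides. -/
lemma exists_srcField_correction (hS : SmoothSolution f u I T q Dy Dp) (c ρ : Fin s → ℝ) :
    ∃ C, 0 ≤ C ∧ ∃ h₁ > 0, ∀ t ∈ Icc 0 T, ∀ h, 0 ≤ h → h ≤ h₁ → NodesIn I c t h → ∀ i,
      ‖srcField f u (stageVec (Dy 0) c t h i, correctedAdjoint ρ Dp q c t h i) -
        srcField f u (stageVec (Dy 0) c t h i, stageVec (Dp 0) c t h i) -
        (h ^ (q + 1) / ((q + 1).factorial : ℝ) * ρ i) •
          fderiv ℝ (srcField f u) (Dy 0 t, Dp 0 t) (0, Dp (q + 1) t)‖ ≤ C * h ^ (q + 2) := by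
  obtain ⟨r, hr, M, hM, hq⟩ := hS.isCompact_image.exists_quadratic_remainder (Φ := srcField f u)
    (by rintro _ ⟨t, ht, rfl⟩; exact hS.smooth_field t ht)
  obtain ⟨B, hB, hn⟩ := hS.exists_near c ρ
  refine ⟨M * (2 * B) * B, by positivity, min 1 (r / (B + 1)), by positivity,
    fun t ht h hh hle hc i => ?_⟩
  obtain ⟨n1, n2, n3⟩ := hn t (hS.subset ht) h hh (hle.trans (min_le_left _ _)) hc
  have hBr : B * h ≤ r := by
    have := hle.trans (min_le_right _ _)
    rw [le_div_iff₀ (by positivity)] at this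
    linarith
  have h1 := hq _ ⟨t, ht, rfl⟩ _ (by
    rw [Metric.mem_closedBall, dist_eq_norm]; exact (n2 i).trans hBr) _ (by
    rw [Metric.mem_closedBall, dist_eq_norm]; exact (n1 i).trans hBr)
  have e1 : (stageVec (Dy 0) c t h i, correctedAdjoint ρ Dp q c t h i) -
      (stageVec (Dy 0) c t h i, stageVec (Dp 0) c t h i) =
      (h ^ (q + 1) / ((q + 1).factorial : ℝ) * ρ i) • ((0 : Fin m → ℝ), Dp (q + 1) t) := by
    refine Prod.ext ?_ ?_
    · simp
    · simp [correctedAdjoint, stageTensor, smul_smul]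
  have e2 : ‖(stageVec (Dy 0) c t h i, correctedAdjoint ρ Dp q c t h i) -
      (stageVec (Dy 0) c t h i, stageVec (Dp 0) c t h i)‖ ≤ B * h ^ (q + 1) := by
    have := (norm_le_pi_norm _ i).trans n3
    rw [Pi.sub_apply] at this
    rw [Prod.mk_sub_mk, sub_self]
    exact max_le (by rw [norm_zero]; positivity) this
  rw [← map_smul, ← e1]
  refine h1.trans ?_
  calc M * (‖(stageVec (Dy 0) c t h i, correctedAdjoint ρ Dp q c t h i) - (Dy 0 t, Dp 0 t)‖ +
        ‖(stageVec (Dy 0) c t h i, stageVec (Dp 0) c t h i) - (Dy 0 t, Dp 0 t)‖) *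
        ‖(stageVec (Dy 0) c t h i, correctedAdjoint ρ Dp q c t h i) -
          (stageVec (Dy 0) c t h i, stageVec (Dp 0) c t h i)‖
      ≤ M * (B * h + B * h) * (B * h ^ (q + 1)) := by
        have := n1 i
        have := n2 i
        gcongr
    _ = M * (2 * B) * B * h ^ (q + 2) := by ring

/-- Lipschitz bound for the stage vectors `Φ`. -/
lemma exists_stagePhi_lipschitz (hS : SmoothSolution f u I T q Dy Dp)
    (M : Matrix (Fin s) (Fin s) ℝ) :
    ∃ L, 0 ≤ L ∧ ∃ R > 0, ∀ t ∈ Icc 0 T, ∀ Z Q Z' Q' : Fin s → Fin m → ℝ,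
      (∀ i, ‖(Z i, Q i) - (Dy 0 t, Dp 0 t)‖ ≤ R) → (∀ i, ‖(Z' i, Q' i) - (Dy 0 t, Dp 0 t)‖ ≤ R) →
      ‖stagePhi f u M Z Q - stagePhi f u M Z' Q'‖ ≤ L * (‖Z - Z'‖ + ‖Q - Q'‖) := by
  obtain ⟨R, hR, L, hL, hlip⟩ := hS.isCompact_image.exists_lipschitz_bound (Φ := adjOp f u)
    (by rintro _ ⟨t, ht, rfl⟩; exact hS.smooth_adj t ht)
  obtain ⟨B, hB⟩ := hS.isCompact_image.exists_bound_of_continuousOn (f := adjOp f u)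
    (by rintro _ ⟨t, ht, rfl⟩; exact (hS.smooth_adj t ht).continuousAt.continuousWithinAt)
  obtain ⟨b, hb⟩ := hS.jet_p.bound
  set μ := ‖stageMulL (m := m) Mᵀ‖ with hμ
  have hb0 : ∀ t ∈ Icc 0 T, ‖Dp 0 t‖ ≤ |b| := fun t ht =>
    (hb 0 (by omega) t (hS.subset ht)).trans (le_abs_self b)
  refine ⟨L * (μ * (|b| + R)) + (|B| + L * R) * μ, by positivity, R, hR,
    fun t ht Z Q Z' Q' hZ hZ' => ?_⟩
  have hball : ∀ i, (Z i, Q i) ∈ Metric.closedBall (Dy 0 t, Dp 0 t) R := fun i => by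
    rw [Metric.mem_closedBall, dist_eq_norm]; exact hZ i
  have hball' : ∀ i, (Z' i, Q' i) ∈ Metric.closedBall (Dy 0 t, Dp 0 t) R := fun i => by
    rw [Metric.mem_closedBall, dist_eq_norm]; exact hZ' i
  have hQ : ‖Q‖ ≤ |b| + R := (pi_norm_le_iff_of_nonneg (by positivity)).2 fun i => by
    have h1 := (norm_snd_le _).trans (hZ i)
    rw [Prod.snd_sub] at h1
    have h2 := norm_le_norm_sub_add (Q i) (Dp 0 t)
    have h3 := hb0 t ht
    dsimp only at h1
    linarith
  refine (pi_norm_le_iff_of_nonneg (by positivity)).2 fun i => ?_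
  rw [Pi.sub_apply, stagePhi_apply, stagePhi_apply]
  have e1 : adjOp f u (Z i, Q i) (stageMul Mᵀ Q i) - adjOp f u (Z' i, Q' i) (stageMul Mᵀ Q' i) =
      (adjOp f u (Z i, Q i) - adjOp f u (Z' i, Q' i)) (stageMul Mᵀ Q i) +
        adjOp f u (Z' i, Q' i) (stageMul Mᵀ (Q - Q') i) := by
    rw [stageMul_sub, Pi.sub_apply, map_sub, _root_.sub_apply]
    abel
  rw [e1]
  have hZQ : ‖(Z i, Q i) - (Z' i, Q' i)‖ ≤ ‖Z - Z'‖ + ‖Q - Q'‖ := by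
    refine (max_le_add_of_nonneg (norm_nonneg _) (norm_nonneg _)).trans ?_
    exact add_le_add (norm_le_pi_norm (Z - Z') i) (norm_le_pi_norm (Q - Q') i)
  have a1 := (hlip _ ⟨t, ht, rfl⟩ _ (hball i) _ (hball' i)).trans
    (mul_le_mul_of_nonneg_left hZQ hL)
  have a2 : ‖stageMul Mᵀ Q i‖ ≤ μ * (|b| + R) := (norm_le_pi_norm _ i).trans
    ((stageMul_norm_le _ _).trans (mul_le_mul_of_nonneg_left hQ (norm_nonneg _)))
  have a3 : ‖adjOp f u (Z' i, Q' i)‖ ≤ |B| + L * R := by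
    have b1 := hlip _ ⟨t, ht, rfl⟩ _ (hball' i) _ (Metric.mem_closedBall_self hR.le)
    have b2 := norm_le_norm_sub_add (adjOp f u (Z' i, Q' i)) (adjOp f u (Dy 0 t, Dp 0 t))
    have b3 := (hB _ ⟨t, ht, rfl⟩).trans (le_abs_self B)
    have b4 := mul_le_mul_of_nonneg_left (hZ' i) hL
    dsimp only at b1 b2 b3 b4
    linarith
  have a4 : ‖stageMul Mᵀ (Q - Q') i‖ ≤ μ * (‖Z - Z'‖ + ‖Q - Q'‖) :=
    (norm_le_pi_norm _ i).trans ((stageMul_norm_le _ _).trans (mul_le_mul_of_nonneg_left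
      (le_add_of_nonneg_left (norm_nonneg _)) (norm_nonneg _)))
  refine (norm_add_le _ _).trans ?_
  have r1 := ContinuousLinearMap.le_of_opNorm_le_of_le _ a1 a2
  have r2 := ContinuousLinearMap.le_of_opNorm_le_of_le _ a3 a4
  linarith

lemma exists_stageG_lipschitz (hS : SmoothSolution f u I T q Dy Dp) (s : ℕ) :
    ∃ L, 0 ≤ L ∧ ∃ R > 0, ∀ t ∈ Icc 0 T, ∀ Z Q Z' Q' : Fin s → Fin m → ℝ,
      (∀ i, ‖(Z i, Q i) - (Dy 0 t, Dp 0 t)‖ ≤ R) → (∀ i, ‖(Z' i, Q' i) - (Dy 0 t, Dp 0 t)‖ ≤ R) →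
      ‖stageG f u Z Q - stageG f u Z' Q'‖ ≤ L * (‖Z - Z'‖ + ‖Q - Q'‖) := by
  obtain ⟨R, hR, L, hL, hlip⟩ := hS.isCompact_image.exists_lipschitz_bound (Φ := srcField f u)
    (by rintro _ ⟨t, ht, rfl⟩; exact hS.smooth_field t ht)
  refine ⟨L, hL, R, hR, fun t ht Z Q Z' Q' hZ hZ' => ?_⟩
  refine (pi_norm_le_iff_of_nonneg (by positivity)).2 fun i => ?_
  have h1 := hlip _ ⟨t, ht, rfl⟩ (Z i, Q i) (by
    rw [Metric.mem_closedBall, dist_eq_norm]; exact hZ i) (Z' i, Q' i) (by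
    rw [Metric.mem_closedBall, dist_eq_norm]; exact hZ' i)
  have hZQ : ‖(Z i, Q i) - (Z' i, Q' i)‖ ≤ ‖Z - Z'‖ + ‖Q - Q'‖ := by
    refine (max_le_add_of_nonneg (norm_nonneg _) (norm_nonneg _)).trans ?_
    exact add_le_add (norm_le_pi_norm (Z - Z') i) (norm_le_pi_norm (Q - Q') i)
  exact (norm_fst_le _).trans (h1.trans (mul_le_mul_of_nonneg_left hZQ hL))

end SmoothSolution

end Consistency

/-! ### Full matrices in the boundary methods -/

section FullMatrices

variable {s m d q : ℕ} {f : (Fin m → ℝ) → (Fin d → ℝ) → (Fin m → ℝ)}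
  {u : (Fin m → ℝ) → (Fin m → ℝ) → (Fin d → ℝ)} {I : Set ℝ} {T : ℝ}
  {Dy Dp : ℕ → ℝ → Fin m → ℝ} {c : Fin s → ℝ} {M : Matrix (Fin s) (Fin s) ℝ}

namespace SmoothSolution

/-- Boundedness and Lipschitz continuity of the adjoint operators along the trajectory. -/
lemma exists_adjOp_bound (hS : SmoothSolution f u I T q Dy Dp) (c : Fin s → ℝ) :
    ∃ B, 0 ≤ B ∧ ∃ h₁ > 0, ∀ t ∈ Icc 0 T, ∀ h, 0 ≤ h → h ≤ h₁ → NodesIn I c t h → ∀ i,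
      ‖adjOp f u (Dy 0 (t + c i * h), Dp 0 (t + c i * h))‖ ≤ B ∧
      ‖adjOp f u (Dy 0 t, Dp 0 t)‖ ≤ B ∧
      ‖adjOp f u (Dy 0 (t + c i * h), Dp 0 (t + c i * h)) - adjOp f u (Dy 0 t, Dp 0 t)‖ ≤
        B * h := by
  obtain ⟨R, hR, L, hL, hlip⟩ := hS.isCompact_image.exists_lipschitz_bound (Φ := adjOp f u)
    (by rintro _ ⟨t, ht, rfl⟩; exact hS.smooth_adj t ht)
  obtain ⟨B, hB⟩ := hS.isCompact_image.exists_bound_of_continuousOn (f := adjOp f u)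
    (by rintro _ ⟨t, ht, rfl⟩; exact (hS.smooth_adj t ht).continuousAt.continuousWithinAt)
  obtain ⟨b, hb, hn⟩ := hS.exists_near c 0
  refine ⟨|B| + L * b, by positivity, min 1 (R / (b + 1)), by positivity,
    fun t ht h hh hle hc i => ?_⟩
  have hh1 := hle.trans (min_le_left _ _)
  have n1 := (hn t (hS.subset ht) h hh hh1 hc).1 i
  have hbR : b * h ≤ R := by
    have := hle.trans (min_le_right _ _)
    rw [le_div_iff₀ (by positivity)] at this
    linarith
  have h1 := (hlip _ ⟨t, ht, rfl⟩ _ (by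
    rw [Metric.mem_closedBall, dist_eq_norm]; exact n1.trans hbR) _
    (Metric.mem_closedBall_self hR.le)).trans (mul_le_mul_of_nonneg_left n1 hL)
  have h2 := (hB _ ⟨t, ht, rfl⟩).trans (le_abs_self B)
  have h3 : ‖adjOp f u (Dy 0 (t + c i * h), Dp 0 (t + c i * h)) - adjOp f u (Dy 0 t, Dp 0 t)‖ ≤
      L * (b * h) := h1
  have h4 : ‖adjOp f u (Dy 0 t, Dp 0 t)‖ ≤ |B| := h2
  have h5 := norm_le_norm_sub_add (adjOp f u (Dy 0 (t + c i * h), Dp 0 (t + c i * h)))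
    (adjOp f u (Dy 0 t, Dp 0 t))
  have h6 : L * (b * h) ≤ L * b := by
    rw [← mul_assoc]; exact mul_le_of_le_one_right (by positivity) hh1
  have h7 : 0 ≤ |B| * h := by positivity
  have h8 : 0 ≤ L * b := by positivity
  exact ⟨by linarith, by linarith, by linarith⟩

/-- The expansion of the entries of `Φ` for a full matrix about the node of the control. -/
lemma exists_node_expansion (hS : SmoothSolution f u I T q Dy Dp) (c : Fin s → ℝ) {k : ℕ}
    (hk : k < q + 3) :
    ∃ C, 0 ≤ C ∧ ∃ h₁ > 0, ∀ t ∈ Icc 0 T, ∀ h, 0 ≤ h → h ≤ h₁ → NodesIn I c t h → ∀ i j,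
      ‖adjOp f u (Dy 0 (t + c i * h), Dp 0 (t + c i * h)) (Dp 0 (t + c j * h)) -
        Dp 1 (t + c j * h) - ∑ l ∈ Finset.range k, (((c j - c i) * h) ^ l / (l.factorial : ℝ)) •
        (adjOp f u (Dy 0 (t + c i * h), Dp 0 (t + c i * h)) (Dp l (t + c i * h)) -
          Dp (l + 1) (t + c i * h))‖ ≤ C * h ^ k := by
  obtain ⟨B, hB, h₁, hh₁, hΛ⟩ := hS.exists_adjOp_bound c
  obtain ⟨M₁, hM₁, h1⟩ := (hS.jet_p.mono hk.le).exists_taylor_bound hS.convex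
  obtain ⟨M₂, hM₂, h2⟩ := (hS.jet_p.mono (Nat.succ_le_of_lt hk)).shift.exists_taylor_bound hS.convex
  refine ⟨(B * M₁ + M₂) * (‖c‖ + ‖c‖) ^ k, by positivity, h₁, hh₁, fun t ht h hh hle hc i j => ?_⟩
  have e1 := h1 _ (hc i) _ (hc j)
  have e2 := h2 _ (hc i) _ (hc j)
  have e0 : t + c j * h - (t + c i * h) = (c j - c i) * h := by ring
  have e3 : |(c j - c i) * h| ^ k ≤ (‖c‖ + ‖c‖) ^ k * h ^ k := by
    rw [abs_mul, abs_of_nonneg hh, mul_pow]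
    have : |c j - c i| ≤ ‖c‖ + ‖c‖ :=
      (abs_sub _ _).trans (add_le_add (norm_le_pi_norm c j) (norm_le_pi_norm c i))
    gcongr
  rw [e0] at e1 e2
  have hΛi := (hΛ t ht h hh hle hc i).1
  generalize adjOp f u (Dy 0 (t + c i * h), Dp 0 (t + c i * h)) = Λ at *
  generalize hX : Dp 0 (t + c j * h) - _ = X at e1
  generalize hY : Dp (0 + 1) (t + c j * h) - _ = Y at e2
  have key : Λ (Dp 0 (t + c j * h)) - Dp 1 (t + c j * h) -
      ∑ l ∈ Finset.range k, (((c j - c i) * h) ^ l / (l.factorial : ℝ)) •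
        (Λ (Dp l (t + c i * h)) - Dp (l + 1) (t + c i * h)) = Λ X - Y := by
    rw [← hX, ← hY, map_sub, map_sum]
    simp only [smul_sub, Finset.sum_sub_distrib, map_smul]
    abel
  rw [key]
  refine (norm_sub_le _ _).trans ?_
  have a1 := Λ.le_of_opNorm_le_of_le hΛi (e1.trans (mul_le_mul_of_nonneg_left e3 hM₁))
  have a2 := e2.trans (mul_le_mul_of_nonneg_left e3 hM₂)
  calc _ ≤ B * (M₁ * ((‖c‖ + ‖c‖) ^ k * h ^ k)) + M₂ * ((‖c‖ + ‖c‖) ^ k * h ^ k) := add_le_add a1 a2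
    _ = _ := by ring

/-- The defect of `Φ` for a full matrix, as compared with the derivatives of the adjoint. -/
lemma stagePhi_sub_apply (M : Matrix (Fin s) (Fin s) ℝ) (c : Fin s → ℝ) (t h : ℝ) (i : Fin s) :
    (stagePhi f u M (stageVec (Dy 0) c t h) (stageVec (Dp 0) c t h) -
      stageMul Mᵀ (stageVec (Dp 1) c t h)) i =
    ∑ j, M j i • (adjOp f u (Dy 0 (t + c i * h), Dp 0 (t + c i * h)) (Dp 0 (t + c j * h)) -
      Dp 1 (t + c j * h)) := by
  rw [Pi.sub_apply, stagePhi_apply]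
  simp only [stageMul, transpose_apply, smul_sub, Finset.sum_sub_distrib, map_sum, map_smul]
  rfl

/-- The term of order zero of the node expansion vanishes by the adjoint equation, the term of order one
by the one-leg condition. -/
lemma sum_node_expansion (hS : SmoothSolution f u I T q Dy Dp)
    (hM : ∀ j, ∑ i, (c i - c j) * M i j = 0) {t h : ℝ} (hc : NodesIn I c t h) (k : ℕ) (i : Fin s) :
    ∑ j, M j i • ∑ l ∈ Finset.range (k + 2), (((c j - c i) * h) ^ l / (l.factorial : ℝ)) •
        (adjOp f u (Dy 0 (t + c i * h), Dp 0 (t + c i * h)) (Dp l (t + c i * h)) -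
          Dp (l + 1) (t + c i * h)) =
    ∑ j, M j i • ∑ l ∈ Finset.range k, (((c j - c i) * h) ^ (l + 2) / ((l + 2).factorial : ℝ)) •
        (adjOp f u (Dy 0 (t + c i * h), Dp 0 (t + c i * h)) (Dp (l + 2) (t + c i * h)) -
          Dp (l + 3) (t + c i * h)) := by
  have h0 : adjOp f u (Dy 0 (t + c i * h), Dp 0 (t + c i * h)) (Dp 0 (t + c i * h)) -
      Dp 1 (t + c i * h) = 0 := by
    rw [hS.ode_p _ (hc i)]
    exact sub_self _
  simp only [Finset.sum_range_succ', zero_add, h0, smul_zero, add_zero, pow_one, Nat.factorial_one,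
    Nat.cast_one, div_one, smul_add, Finset.sum_add_distrib, add_assoc]
  norm_num
  simp only [smul_smul, ← Finset.sum_smul]
  have h1 : ∑ j, M j i * ((c j - c i) * h) = 0 := by
    have h2 : ∀ j, M j i * ((c j - c i) * h) = (c j - c i) * M j i * h := fun j => by ring
    simp only [h2, ← Finset.sum_mul, hM i, zero_mul]
  rw [h1, zero_smul]

/-- Under the one-leg condition the defect of `Φ` is of second order for any matrix. -/
lemma exists_stagePhi_oneleg (hS : SmoothSolution f u I T q Dy Dp)
    (hM : ∀ j, ∑ i, (c i - c j) * M i j = 0) :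
    ∃ C, 0 ≤ C ∧ ∃ h₁ > 0, ∀ t ∈ Icc 0 T, ∀ h, 0 ≤ h → h ≤ h₁ → NodesIn I c t h →
      ‖stagePhi f u M (stageVec (Dy 0) c t h) (stageVec (Dp 0) c t h) -
        stageMul Mᵀ (stageVec (Dp 1) c t h)‖ ≤ C * h ^ 2 := by
  obtain ⟨C, hC, h₁, hh₁, hb⟩ := hS.exists_node_expansion c (k := 2) (by omega)
  refine ⟨(∑ i, ∑ j, |M j i|) * C, by positivity, h₁, hh₁, fun t ht h hh hle hc => ?_⟩
  refine (pi_norm_le_iff_of_nonneg (by positivity)).2 fun i => ?_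
  have h1 := hS.sum_node_expansion hM hc 0 i
  simp only [Finset.range_zero, Finset.sum_empty, smul_zero, Finset.sum_const_zero, zero_add] at h1
  rw [stagePhi_sub_apply, ← sub_zero (∑ j, _), ← h1, ← Finset.sum_sub_distrib]
  simp only [← smul_sub]
  refine (norm_sum_le _ _).trans ?_
  have h2 : ∀ j ∈ Finset.univ, ‖M j i • (adjOp f u (Dy 0 (t + c i * h), Dp 0 (t + c i * h))
      (Dp 0 (t + c j * h)) - Dp 1 (t + c j * h) -
      ∑ l ∈ Finset.range 2, (((c j - c i) * h) ^ l / (l.factorial : ℝ)) •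
        (adjOp f u (Dy 0 (t + c i * h), Dp 0 (t + c i * h)) (Dp l (t + c i * h)) -
          Dp (l + 1) (t + c i * h)))‖ ≤ |M j i| * (C * h ^ 2) := fun j _ => by
    rw [norm_smul, Real.norm_eq_abs]
    exact mul_le_mul_of_nonneg_left (hb t ht h hh hle hc i j) (abs_nonneg _)
  refine (Finset.sum_le_sum h2).trans ?_
  rw [← Finset.sum_mul, mul_assoc]
  refine mul_le_mul_of_nonneg_right ?_ (by positivity)
  exact Finset.single_le_sum (f := fun i => ∑ j, |M j i|)
    (fun i _ => Finset.sum_nonneg fun j _ => abs_nonneg _) (Finset.mem_univ i)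

/-- If the quadratic moment vanishes in the mean as well, the mean defect is of third order. -/
lemma exists_stagePhi_oneleg_mean (hS : SmoothSolution f u I T q Dy Dp) (hq : 1 ≤ q)
    (hM : ∀ j, ∑ i, (c i - c j) * M i j = 0) (hM2 : ∑ i, ∑ j, M j i * (c j - c i) ^ 2 = 0) :
    ∃ C, 0 ≤ C ∧ ∃ h₁ > 0, ∀ t ∈ Icc 0 T, ∀ h, 0 ≤ h → h ≤ h₁ → NodesIn I c t h →
      ‖stageDot 1 (stagePhi f u M (stageVec (Dy 0) c t h) (stageVec (Dp 0) c t h) -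
        stageMul Mᵀ (stageVec (Dp 1) c t h))‖ ≤ C * h ^ 3 := by
  obtain ⟨C, hC, h₁, hh₁, hb⟩ := hS.exists_node_expansion c (k := 3) (by omega)
  obtain ⟨B, hB, h₂, hh₂, hΛ⟩ := hS.exists_adjOp_bound c
  obtain ⟨b, hbd⟩ := hS.jet_p.bound
  obtain ⟨L₁, hL₁, hl₁⟩ := ((hS.jet_p.mono (by omega : 1 + 2 ≤ q + 3)).shift_add 2).exists_taylor_bound
    hS.convex
  obtain ⟨L₂, hL₂, hl₂⟩ := ((hS.jet_p.mono (by omega : 1 + 3 ≤ q + 3)).shift_add 3).exists_taylor_bound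
    hS.convex
  set μ := ∑ i, ∑ j, |M j i| with hμ
  set ν := ∑ i, ∑ j, |M j i * (c j - c i) ^ 2| with hν
  have hμ0 : 0 ≤ μ := Finset.sum_nonneg fun i _ => Finset.sum_nonneg fun j _ => abs_nonneg _
  have hν0 : 0 ≤ ν := Finset.sum_nonneg fun i _ => Finset.sum_nonneg fun j _ => abs_nonneg _
  set κ := B * |b| + B * (L₁ * ‖c‖) + L₂ * ‖c‖ with hκ
  have hκ0 : 0 ≤ κ := by positivity
  refine ⟨μ * C + ν * κ, by positivity, min h₁ h₂, by positivity, fun t ht h hh hle hc => ?_⟩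
  have hb' := hb t ht h hh (hle.trans (min_le_left _ _)) hc
  have hΛ' := hΛ t ht h hh (hle.trans (min_le_right _ _)) hc
  set X : ℝ → Fin m → ℝ := fun t' => adjOp f u (Dy 0 t', Dp 0 t') (Dp 2 t') - Dp 3 t' with hX
  -- the second-order coefficients at the nodes differ by `O(h)` from those at `t`
  have hXi : ∀ i, ‖X (t + c i * h) - X t‖ ≤ κ * h := fun i => by
    have hci : |t + c i * h - t| ≤ ‖c‖ * h := by
      rw [add_sub_cancel_left, abs_mul, abs_of_nonneg hh]
      exact mul_le_mul_of_nonneg_right (norm_le_pi_norm c i) hh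
    have a1 := hl₁ t (hS.subset ht) _ (hc i)
    have a2 := hl₂ t (hS.subset ht) _ (hc i)
    rw [Finset.sum_range_one] at a1 a2
    simp only [pow_zero, Nat.factorial_zero, Nat.cast_one, div_one, one_smul, zero_add,
      pow_one] at a1 a2
    have a1' := a1.trans (mul_le_mul_of_nonneg_left hci hL₁)
    have a2' := a2.trans (mul_le_mul_of_nonneg_left hci hL₂)
    have a3 : ‖Dp 2 (t + c i * h)‖ ≤ |b| := (hbd 2 (by omega) _ (hc i)).trans (le_abs_self b)
    obtain ⟨_, b2, b3⟩ := hΛ' i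
    have e1 : X (t + c i * h) - X t =
        (adjOp f u (Dy 0 (t + c i * h), Dp 0 (t + c i * h)) - adjOp f u (Dy 0 t, Dp 0 t))
          (Dp 2 (t + c i * h)) + adjOp f u (Dy 0 t, Dp 0 t) (Dp 2 (t + c i * h) - Dp 2 t) -
          (Dp 3 (t + c i * h) - Dp 3 t) := by
      simp only [hX]
      rw [_root_.sub_apply, map_sub]
      abel
    rw [e1]
    refine (norm_sub_le _ _).trans ((add_le_add (norm_add_le _ _) le_rfl).trans ?_)
    have r1 := ContinuousLinearMap.le_of_opNorm_le_of_le _ b3 a3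
    have r2 := ContinuousLinearMap.le_of_opNorm_le_of_le _ b2 a1'
    rw [hκ]
    linarith
  have hsum : ∀ i, ∑ j, M j i • (adjOp f u (Dy 0 (t + c i * h), Dp 0 (t + c i * h))
      (Dp 0 (t + c j * h)) - Dp 1 (t + c j * h)) =
      ∑ j, M j i • (adjOp f u (Dy 0 (t + c i * h), Dp 0 (t + c i * h)) (Dp 0 (t + c j * h)) -
        Dp 1 (t + c j * h) - ∑ l ∈ Finset.range 3, (((c j - c i) * h) ^ l / (l.factorial : ℝ)) •
        (adjOp f u (Dy 0 (t + c i * h), Dp 0 (t + c i * h)) (Dp l (t + c i * h)) -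
          Dp (l + 1) (t + c i * h))) +
      ∑ j, (M j i * (c j - c i) ^ 2) • (h ^ 2 / 2) • X (t + c i * h) := fun i => by
    have h1 : ∑ j, (M j i * (c j - c i) ^ 2) • (h ^ 2 / 2) • X (t + c i * h) =
        ∑ j, M j i • ∑ l ∈ Finset.range 3, (((c j - c i) * h) ^ l / (l.factorial : ℝ)) •
          (adjOp f u (Dy 0 (t + c i * h), Dp 0 (t + c i * h)) (Dp l (t + c i * h)) -
            Dp (l + 1) (t + c i * h)) := by
      refine Eq.trans ?_ (hS.sum_node_expansion hM hc 1 i).symm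
      refine Finset.sum_congr rfl fun j _ => ?_
      rw [Finset.sum_range_one, smul_smul, smul_smul]
      congr 1
      simp only [Nat.factorial]
      push_cast
      ring
    rw [h1, ← Finset.sum_add_distrib]
    refine Finset.sum_congr rfl fun j _ => ?_
    rw [← smul_add, sub_add_cancel]
  have e1 : stageDot 1 (stagePhi f u M (stageVec (Dy 0) c t h) (stageVec (Dp 0) c t h) -
        stageMul Mᵀ (stageVec (Dp 1) c t h)) =
      ∑ i, ∑ j, M j i • (adjOp f u (Dy 0 (t + c i * h), Dp 0 (t + c i * h)) (Dp 0 (t + c j * h)) -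
        Dp 1 (t + c j * h) - ∑ l ∈ Finset.range 3, (((c j - c i) * h) ^ l / (l.factorial : ℝ)) •
        (adjOp f u (Dy 0 (t + c i * h), Dp 0 (t + c i * h)) (Dp l (t + c i * h)) -
          Dp (l + 1) (t + c i * h))) +
      ∑ i, ∑ j, (M j i * (c j - c i) ^ 2) • (h ^ 2 / 2) • (X (t + c i * h) - X t) := by
    have e2 : ∑ i, ∑ j, (M j i * (c j - c i) ^ 2) • (h ^ 2 / 2) • X t = 0 := by
      simp only [← Finset.sum_smul]
      rw [hM2, zero_smul]
    simp only [stageDot, Pi.one_apply, one_smul]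
    simp only [stagePhi_sub_apply, hsum, Finset.sum_add_distrib, smul_sub (_ : ℝ) (X _) (X _)]
    simp only [smul_sub (_ : ℝ) (_ • X _) (_ • X _), Finset.sum_sub_distrib]
    rw [e2, sub_zero]
  rw [e1]
  have r1 : ‖∑ i, ∑ j, M j i • (adjOp f u (Dy 0 (t + c i * h), Dp 0 (t + c i * h))
        (Dp 0 (t + c j * h)) -
        Dp 1 (t + c j * h) - ∑ l ∈ Finset.range 3, (((c j - c i) * h) ^ l / (l.factorial : ℝ)) •
        (adjOp f u (Dy 0 (t + c i * h), Dp 0 (t + c i * h)) (Dp l (t + c i * h)) -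
          Dp (l + 1) (t + c i * h)))‖ ≤ μ * (C * h ^ 3) := by
    rw [hμ, Finset.sum_mul]
    refine (norm_sum_le _ _).trans (Finset.sum_le_sum fun i _ => ?_)
    rw [Finset.sum_mul]
    refine (norm_sum_le _ _).trans (Finset.sum_le_sum fun j _ => ?_)
    rw [norm_smul, Real.norm_eq_abs]
    exact mul_le_mul_of_nonneg_left (hb' i j) (abs_nonneg _)
  have r2 : ‖∑ i, ∑ j, (M j i * (c j - c i) ^ 2) • (h ^ 2 / 2) • (X (t + c i * h) - X t)‖ ≤
      ν * (h ^ 2 * (κ * h)) := by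
    rw [hν, Finset.sum_mul]
    refine (norm_sum_le _ _).trans (Finset.sum_le_sum fun i _ => ?_)
    rw [Finset.sum_mul]
    refine (norm_sum_le _ _).trans (Finset.sum_le_sum fun j _ => ?_)
    rw [norm_smul, Real.norm_eq_abs]
    refine mul_le_mul_of_nonneg_left ?_ (abs_nonneg _)
    rw [norm_smul, Real.norm_of_nonneg (by positivity)]
    exact mul_le_mul (by have := sq_nonneg h; linarith) (hXi i) (norm_nonneg _) (by positivity)
  refine (norm_add_le _ _).trans ?_
  calc _ ≤ μ * (C * h ^ 3) + ν * (h ^ 2 * (κ * h)) := add_le_add r1 r2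
    _ = _ := by ring

/-- The defect of `Φ` along the exact solution: it vanishes for a diagonal matrix, and is at
least of second order for a full one. -/
lemma exists_stagePhi_full (hS : SmoothSolution f u I T q Dy Dp)
    (hM : ∀ j, ∑ i, (c i - c j) * M i j = 0) (hfull : q + 2 ≤ 4 ∨ M.IsDiag) :
    ∃ C, 0 ≤ C ∧ ∃ h₁ > 0, ∀ t ∈ Icc 0 T, ∀ h, 0 ≤ h → h ≤ h₁ → NodesIn I c t h →
      ‖stagePhi f u M (stageVec (Dy 0) c t h) (stageVec (Dp 0) c t h) -
        stageMul Mᵀ (stageVec (Dp 1) c t h)‖ ≤ C * h ^ q := by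
  rcases hfull with hq | hd
  · obtain ⟨C, hC, h₁, hh₁, hb⟩ := hS.exists_stagePhi_oneleg hM
    refine ⟨C, hC, min 1 h₁, by positivity, fun t ht h hh hle hc => ?_⟩
    refine (hb t ht h hh (hle.trans (min_le_right _ _)) hc).trans ?_
    exact mul_le_mul_of_nonneg_left (pow_le_pow_of_le_one hh (hle.trans (min_le_left _ _))
      (by omega)) hC
  · refine ⟨0, le_rfl, 1, one_pos, fun t ht h hh hle hc => ?_⟩
    rw [hS.stagePhi_eq hd hc, hd.isSymm.eq, sub_self, norm_zero, zero_mul]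

/-- In the mean, the defect of `Φ` is one order smaller than in `exists_stagePhi_full`. -/
lemma exists_stagePhi_full_mean (hS : SmoothSolution f u I T q Dy Dp)
    (hM : ∀ j, ∑ i, (c i - c j) * M i j = 0)
    (hM2 : q = 2 → ∑ i, ∑ j, M j i * (c j - c i) ^ 2 = 0) (hfull : q + 2 ≤ 4 ∨ M.IsDiag) :
    ∃ C, 0 ≤ C ∧ ∃ h₁ > 0, ∀ t ∈ Icc 0 T, ∀ h, 0 ≤ h → h ≤ h₁ → NodesIn I c t h →
      ‖stageDot 1 (stagePhi f u M (stageVec (Dy 0) c t h) (stageVec (Dp 0) c t h) -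
        stageMul Mᵀ (stageVec (Dp 1) c t h))‖ ≤ C * h ^ (q + 1) := by
  rcases hfull with hq | hd
  · rcases (by omega : q ≤ 1 ∨ q = 2) with hq1 | hq2
    · obtain ⟨C, hC, h₁, hh₁, hb⟩ := hS.exists_stagePhi_oneleg hM
      refine ⟨‖stageDotL (m := m) (1 : Fin s → ℝ)‖ * C, by positivity, min 1 h₁, by positivity,
        fun t ht h hh hle hc => ?_⟩
      refine (stageDot_norm_le _ _).trans ?_
      rw [mul_assoc]
      refine mul_le_mul_of_nonneg_left ?_ (norm_nonneg _)
      refine (hb t ht h hh (hle.trans (min_le_right _ _)) hc).trans ?_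
      exact mul_le_mul_of_nonneg_left (pow_le_pow_of_le_one hh (hle.trans (min_le_left _ _))
        (by omega)) hC
    · subst hq2
      exact hS.exists_stagePhi_oneleg_mean (by omega) hM (hM2 rfl)
  · refine ⟨0, le_rfl, 1, one_pos, fun t ht h hh hle hc => ?_⟩
    rw [hS.stagePhi_eq hd hc, hd.isSymm.eq, sub_self, zero_mul]
    simp [stageDot]

end SmoothSolution

end FullMatrices

/-! ### Residuals of the corrected reference values -/

section ReferenceResiduals

lemma norm_le_of_forall_sub_smul {s m : ℕ} {ρ : Fin s → ℝ} {X : Fin s → Fin m → ℝ} {γ ε : ℝ}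
    {v : Fin m → ℝ} (hε : 0 ≤ ε) (hX : ∀ i, ‖X i - (γ * ρ i) • v‖ ≤ ε) :
    ‖X‖ ≤ ε + |γ| * (‖ρ‖ * ‖v‖) := by
  refine (pi_norm_le_iff_of_nonneg (by positivity)).2 fun i => ?_
  have h1 := norm_le_norm_sub_add (X i) ((γ * ρ i) • v)
  have h2 : ‖(γ * ρ i) • v‖ ≤ |γ| * (‖ρ‖ * ‖v‖) := by
    rw [norm_smul, norm_mul, Real.norm_eq_abs, mul_assoc]
    have := norm_le_pi_norm ρ i
    gcongr
  linarith [hX i]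

/-- A stage vector in the direction `ρ` has no mean after the multiplication with `M`, if
`𝟙ᵀ M ρ = 0`. -/
lemma norm_mean_stageMul_le_of_forall_sub_smul {s m : ℕ} {ρ : Fin s → ℝ}
    {M : Matrix (Fin s) (Fin s) ℝ} (hρ : (1 : Fin s → ℝ) ⬝ᵥ (M *ᵥ ρ) = 0)
    {X : Fin s → Fin m → ℝ} {γ ε : ℝ} {v : Fin m → ℝ} (hε : 0 ≤ ε)
    (hX : ∀ i, ‖X i - (γ * ρ i) • v‖ ≤ ε) :
    ‖stageDot 1 (stageMul M X)‖ ≤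
      ‖stageDotL (m := m) (1 : Fin s → ℝ)‖ * (‖stageMulL (m := m) M‖ * ε) := by
  have h1 : stageDot 1 (stageMul M X) = stageDot 1 (stageMul M (X - γ • stageTensor ρ v)) := by
    rw [stageMul_sub, stageMul_smul, stageMul_stageTensor, stageDot_sub, stageDot_smul,
      stageDot_stageTensor, hρ, zero_smul, smul_zero, sub_zero]
  rw [h1]
  refine (stageDot_norm_le _ _).trans (mul_le_mul_of_nonneg_left
    ((stageMul_norm_le _ _).trans (mul_le_mul_of_nonneg_left ?_ (norm_nonneg _))) (norm_nonneg _))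
  refine (pi_norm_le_iff_of_nonneg hε).2 fun i => ?_
  have := hX i
  rwa [mul_smul] at this

variable {m d q : ℕ} {f : (Fin m → ℝ) → (Fin d → ℝ) → (Fin m → ℝ)}
  {u : (Fin m → ℝ) → (Fin m → ℝ) → (Fin d → ℝ)} {I : Set ℝ} {T : ℝ}
  {Dy Dp : ℕ → ℝ → Fin m → ℝ}

namespace SmoothSolution

/-- The correction changes the right-hand sides by terms of the order of the correction, which are
of higher order in the mean after the multiplication with `M`, if `𝟙ᵀ M ρ = 0`. -/
lemma exists_field_correction {s : ℕ} {c ρ : Fin s → ℝ} (hS : SmoothSolution f u I T q Dy Dp)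
    {M : Matrix (Fin s) (Fin s) ℝ} (hρ : (1 : Fin s → ℝ) ⬝ᵥ (M *ᵥ ρ) = 0) :
    ∃ C, 0 ≤ C ∧ ∃ h₁ > 0, ∀ t ∈ Icc 0 T, ∀ h, 0 ≤ h → h ≤ h₁ → NodesIn I c t h →
      (‖stageMul M (stageG f u (stageVec (Dy 0) c t h) (correctedAdjoint ρ Dp q c t h) -
          stageVec (Dy 1) c t h)‖ ≤ C * h ^ (q + 1) ∧
        ‖stageDot 1 (stageMul M (stageG f u (stageVec (Dy 0) c t h)
          (correctedAdjoint ρ Dp q c t h) - stageVec (Dy 1) c t h))‖ ≤ C * h ^ (q + 2)) ∧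
      (‖stageMul M ((fun i => srcPhi f u (stageVec (Dy 0) c t h i)
          (correctedAdjoint ρ Dp q c t h i)) - stageVec (Dp 1) c t h)‖ ≤ C * h ^ (q + 1) ∧
        ‖stageDot 1 (stageMul M ((fun i => srcPhi f u (stageVec (Dy 0) c t h i)
          (correctedAdjoint ρ Dp q c t h i)) - stageVec (Dp 1) c t h))‖ ≤ C * h ^ (q + 2)) := by
  obtain ⟨C, hC, h₁, hh₁, hb⟩ := hS.exists_srcField_correction c ρ
  obtain ⟨B, hB⟩ := isCompact_Icc.exists_bound_of_continuousOn hS.continuousOn_fderiv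
  obtain ⟨b, hbd⟩ := hS.jet_p.bound
  set μ := ‖stageMulL (m := m) M‖
  set ν := ‖stageDotL (m := m) (1 : Fin s → ℝ)‖
  refine ⟨μ * (C + ‖ρ‖ * (|B| * |b|)) + ν * (μ * C), by positivity, min 1 h₁, by positivity,
    fun t ht h hh hle hc => ?_⟩
  have hb' := hb t ht h hh (hle.trans (min_le_right _ _)) hc
  have hh1 := hle.trans (min_le_left _ _)
  set γ := h ^ (q + 1) / ((q + 1).factorial : ℝ) with hγ
  set v := fderiv ℝ (srcField f u) (Dy 0 t, Dp 0 t) (0, Dp (q + 1) t) with hv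
  have hv1 : ‖v‖ ≤ |B| * |b| := by
    refine ContinuousLinearMap.le_of_opNorm_le_of_le _ ((hB t ht).trans (le_abs_self B)) ?_
    refine max_le (by rw [norm_zero]; positivity) ?_
    exact (hbd (q + 1) (by omega) t (hS.subset ht)).trans (le_abs_self b)
  have hγ1 : |γ| ≤ h ^ (q + 1) := by
    rw [abs_of_nonneg (by positivity)]
    exact div_le_self (by positivity)
      (by exact_mod_cast Nat.one_le_iff_ne_zero.2 (Nat.factorial_ne_zero _))
  have hε : C * h ^ (q + 2) ≤ C * h ^ (q + 1) :=
    mul_le_mul_of_nonneg_left (pow_le_pow_of_le_one hh hh1 (by omega)) hC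
  have gen : ∀ (X : Fin s → Fin m → ℝ) (v' : Fin m → ℝ), ‖v'‖ ≤ |B| * |b| →
      (∀ i, ‖X i - (γ * ρ i) • v'‖ ≤ C * h ^ (q + 2)) →
      ‖stageMul M X‖ ≤ (μ * (C + ‖ρ‖ * (|B| * |b|)) + ν * (μ * C)) * h ^ (q + 1) ∧
      ‖stageDot 1 (stageMul M X)‖ ≤ (μ * (C + ‖ρ‖ * (|B| * |b|)) + ν * (μ * C)) * h ^ (q + 2) := by
    intro X v' hv' hX
    constructor
    · have h2 := norm_le_of_forall_sub_smul (by positivity) hX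
      have h3 : |γ| * (‖ρ‖ * ‖v'‖) ≤ h ^ (q + 1) * (‖ρ‖ * (|B| * |b|)) := by gcongr
      have h4 : ‖X‖ ≤ (C + ‖ρ‖ * (|B| * |b|)) * h ^ (q + 1) := by linarith
      refine (stageMul_norm_le M X).trans ((mul_le_mul_of_nonneg_left h4 (norm_nonneg _)).trans ?_)
      have : 0 ≤ ν * (μ * C) * h ^ (q + 1) := by positivity
      linarith
    · have h2 := norm_mean_stageMul_le_of_forall_sub_smul hρ (by positivity) hX
      refine h2.trans ?_
      have : 0 ≤ μ * (C + ‖ρ‖ * (|B| * |b|)) * h ^ (q + 2) := by positivity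
      change ν * (μ * (C * h ^ (q + 2))) ≤ _
      linarith
  refine ⟨gen _ v.1 ((norm_fst_le v).trans hv1) fun i => ?_,
    gen _ v.2 ((norm_snd_le v).trans hv1) fun i => ?_⟩
  · have := (norm_fst_le _).trans (hb' i)
    rw [← hS.stageG_eq hc]
    exact this
  · have := (norm_snd_le _).trans (hb' i)
    rw [show stageVec (Dp 1) c t h = fun i => srcPhi f u (stageVec (Dy 0) c t h i)
      (stageVec (Dp 0) c t h i) from funext fun i => hS.ode_p _ (hc i)]
    exact this

/-- The effect of the correction on the stage vectors `G` and `Φ`. -/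
lemma exists_stage_correction {s : ℕ} (hS : SmoothSolution f u I T q Dy Dp) (c ρ : Fin s → ℝ)
    (M : Matrix (Fin s) (Fin s) ℝ) :
    ∃ C, 0 ≤ C ∧ ∃ h₁ > 0, ∀ t ∈ Icc 0 T, ∀ h, 0 ≤ h → h ≤ h₁ → NodesIn I c t h →
      ‖stageG f u (stageVec (Dy 0) c t h) (correctedAdjoint ρ Dp q c t h) -
          stageVec (Dy 1) c t h‖ ≤ C * h ^ (q + 1) ∧
      ‖stagePhi f u M (stageVec (Dy 0) c t h) (correctedAdjoint ρ Dp q c t h) -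
          stagePhi f u M (stageVec (Dy 0) c t h) (stageVec (Dp 0) c t h)‖ ≤ C * h ^ (q + 1) := by
  obtain ⟨L₁, hL₁, R₁, hR₁, hl₁⟩ := hS.exists_stageG_lipschitz s
  obtain ⟨L₂, hL₂, R₂, hR₂, hl₂⟩ := hS.exists_stagePhi_lipschitz M
  obtain ⟨B, hB, hn⟩ := hS.exists_near c ρ
  refine ⟨(L₁ + L₂) * B, by positivity, min 1 (min R₁ R₂ / (B + 1)), by positivity,
    fun t ht h hh hle hc => ?_⟩
  obtain ⟨n1, n2, n3⟩ := hn t (hS.subset ht) h hh (hle.trans (min_le_left _ _)) hc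
  have hBr : B * h ≤ min R₁ R₂ := by
    have := hle.trans (min_le_right _ _)
    rw [le_div_iff₀ (by positivity)] at this
    linarith
  have hBr₁ := hBr.trans (min_le_left _ _)
  have hBr₂ := hBr.trans (min_le_right _ _)
  have a1 := hl₁ t ht _ _ _ _ (fun i => (n2 i).trans hBr₁) (fun i => (n1 i).trans hBr₁)
  have a2 := hl₂ t ht _ _ _ _ (fun i => (n2 i).trans hBr₂) (fun i => (n1 i).trans hBr₂)
  rw [sub_self, norm_zero, zero_add] at a1 a2
  have b1 := mul_le_mul_of_nonneg_left n3 hL₁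
  have b2 := mul_le_mul_of_nonneg_left n3 hL₂
  have p1 : 0 ≤ L₁ * (B * h ^ (q + 1)) := by positivity
  have p2 : 0 ≤ L₂ * (B * h ^ (q + 1)) := by positivity
  rw [hS.stageG_eq hc] at a1
  constructor <;> linarith

/-- The local error of a forward equation that satisfies the order conditions. -/
lemma exists_forward_residual_order {s : ℕ} {c : Fin s → ℝ}
    (hS : SmoothSolution f u I T q Dy Dp) (ρ : Fin s → ℝ) {A B K : Matrix (Fin s) (Fin s) ℝ}
    (hord : ∀ k < q + 2, A *ᵥ c ^ k = B *ᵥ (c - 1) ^ k + (k : ℝ) • (K *ᵥ c ^ (k - 1))) :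
    ∃ C, 0 ≤ C ∧ ∃ h₁ > 0, ∀ t ∈ Icc 0 T, ∀ h, 0 ≤ h → h ≤ h₁ → NodesIn I c t h →
      NodesIn I c (t - h) h →
      ‖stageMul A (stageVec (Dy 0) c t h) - stageMul B (stageVec (Dy 0) c (t - h) h) -
        h • stageMul K (stageG f u (stageVec (Dy 0) c t h) (correctedAdjoint ρ Dp q c t h))‖ ≤
        C * h ^ (q + 2) := by
  obtain ⟨C₁, hC₁, h₁, hh₁, hb₁⟩ := hS.exists_stage_correction c ρ K
  obtain ⟨C₂, hC₂, hb₂⟩ := (hS.jet_y.mono (by omega : q + 1 + 1 ≤ q + 3)).exists_residual_order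
    (A := A) (B := B) (K := K) (c := c) (c' := c - 1) (c'' := c) hS.convex (fun k hk => by
      rw [residualCoeff, hord k hk]; abel)
  refine ⟨C₂ + ‖stageMulL (m := m) K‖ * C₁, by positivity, h₁, hh₁,
    fun t ht h hh hle hc hc' => ?_⟩
  have a1 := (hb₁ t ht h hh hle hc).1
  have a2 := hb₂ t (hS.subset ht) h hh hc (nodesIn_sub_one hc') hc
  rw [jetResidual, stageVec_sub_one] at a2
  set X := stageG f u (stageVec (Dy 0) c t h) (correctedAdjoint ρ Dp q c t h)
  have e : ∀ Z W : Fin s → Fin m → ℝ, Z - W - h • stageMul K X =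
      (Z - W - h • stageMul K (stageVec (Dy 1) c t h)) -
      h • stageMul K (X - stageVec (Dy 1) c t h) := fun Z W => by
    rw [stageMul_sub, smul_sub]; abel
  rw [e]
  refine (norm_sub_le _ _).trans ?_
  rw [norm_smul, Real.norm_of_nonneg hh, add_mul]
  refine add_le_add a2 ?_
  calc h * ‖stageMul K (X - stageVec (Dy 1) c t h)‖
      ≤ h * (‖stageMulL (m := m) K‖ * (C₁ * h ^ (q + 1))) := mul_le_mul_of_nonneg_left
        ((stageMul_norm_le _ _).trans (mul_le_mul_of_nonneg_left a1 (norm_nonneg _))) hh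
    _ = _ := by ring

/-- The local error of the standard forward equation: superconvergence gains one order in the
mean. -/
lemma exists_forward_residual {θ : PeerTriplet (q + 2)} {ρ : Fin (q + 2) → ℝ}
    (hS : SmoothSolution f u I T q Dy Dp) (hord : θ.OrderConditions) (hsup : θ.Superconvergence)
    (hρ : θ.IsCorrector ρ) :
    ∃ C, 0 ≤ C ∧ ∃ h₁ > 0, ∀ t ∈ Icc 0 T, ∀ h, 0 ≤ h → h ≤ h₁ → NodesIn I θ.c t h →
      NodesIn I θ.c (t - h) h →
      ‖stageMul θ.A (stageVec (Dy 0) θ.c t h) - stageMul θ.B (stageVec (Dy 0) θ.c (t - h) h) -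
        h • stageMul θ.K (stageG f u (stageVec (Dy 0) θ.c t h)
          (correctedAdjoint ρ Dp q θ.c t h))‖ ≤ C * h ^ (q + 2) ∧
      ‖stageDot 1 (stageMul θ.A (stageVec (Dy 0) θ.c t h) -
        stageMul θ.B (stageVec (Dy 0) θ.c (t - h) h) -
        h • stageMul θ.K (stageG f u (stageVec (Dy 0) θ.c t h)
          (correctedAdjoint ρ Dp q θ.c t h)))‖ ≤ C * h ^ (q + 3) := by
  obtain ⟨C₁, hC₁, h₁, hh₁, hb₁⟩ := hS.exists_forward_residual_order ρ
    (fun k hk => hord.fwd_standard_moment (k := k) hk)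
  obtain ⟨C₂, hC₂, h₂, hh₂, hb₂⟩ := hS.exists_field_correction (c := θ.c) hρ.mean_K
  obtain ⟨C₃, hC₃, hb₃⟩ := hS.jet_y.exists_residual_lead (n := q + 1)
    (A := θ.A) (B := θ.B) (K := θ.K) (c := θ.c) (c' := θ.c - 1) (c'' := θ.c) hS.convex
    (fun k hk => by rw [residualCoeff, hord.fwd_standard_moment hk]; abel)
  set ν := ‖stageDotL (m := m) (1 : Fin (q + 2) → ℝ)‖ with hν
  refine ⟨C₁ + (ν * C₃ + C₂), by positivity, min h₁ h₂, by positivity,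
    fun t ht h hh hle hc hc' => ?_⟩
  have a1 := hb₁ t ht h hh (hle.trans (min_le_left _ _)) hc hc'
  have a2 := (hb₂ t ht h hh (hle.trans (min_le_right _ _)) hc).1.2
  have a3 := hb₃ t (hS.subset ht) h hh hc (nodesIn_sub_one hc') hc
  have hmean : (1 : Fin (q + 2) → ℝ) ⬝ᵥ
      residualCoeff θ.A θ.B θ.K θ.c (θ.c - 1) θ.c (q + 1 + 1) = 0 := hsup.fwd
  constructor
  · refine a1.trans (mul_le_mul_of_nonneg_right ?_ (by positivity))
    linarith [show 0 ≤ ν * C₃ by positivity]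
  · have a4 := (stageDot_norm_le 1 _).trans (mul_le_mul_of_nonneg_left a3 (norm_nonneg _))
    rw [stageDot_sub, stageDot_smul, stageDot_stageTensor, hmean, zero_smul, smul_zero, sub_zero,
      jetResidual, stageVec_sub_one] at a4
    set X := stageG f u (stageVec (Dy 0) θ.c t h) (correctedAdjoint ρ Dp q θ.c t h)
    have e : ∀ Z W : Fin (q + 2) → Fin m → ℝ, Z - W - h • stageMul θ.K X =
        (Z - W - h • stageMul θ.K (stageVec (Dy 1) θ.c t h)) -
        h • stageMul θ.K (X - stageVec (Dy 1) θ.c t h) := fun Z W => by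
      rw [stageMul_sub, smul_sub]; abel
    rw [e, stageDot_sub, stageDot_smul]
    refine (norm_sub_le _ _).trans ?_
    rw [norm_smul, Real.norm_of_nonneg hh]
    have a5 := mul_le_mul_of_nonneg_left a2 hh
    have p1 : 0 ≤ C₁ * h ^ (q + 3) := by positivity
    calc _ ≤ ν * (C₃ * h ^ (q + 1 + 2)) + h * (C₂ * h ^ (q + 2)) := add_le_add a4 a5
      _ = (ν * C₃ + C₂) * h ^ (q + 3) := by ring
      _ ≤ _ := by linarith

/-- The local error of the starting equation. -/
lemma exists_start_residual {θ : PeerTriplet (q + 2)} (hS : SmoothSolution f u I T q Dy Dp)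
    (hT : 0 ≤ T) (ρ : Fin (q + 2) → ℝ) (hord : θ.OrderConditions) :
    ∃ C, 0 ≤ C ∧ ∃ h₁ > 0, ∀ h, 0 ≤ h → h ≤ h₁ → NodesIn I θ.c 0 h →
      ‖stageMul θ.A0 (stageVec (Dy 0) θ.c 0 h) - stageTensor θ.a (Dy 0 0) -
        h • stageTensor θ.b (Dy 1 0) - h • stageMul θ.K0 (stageG f u (stageVec (Dy 0) θ.c 0 h)
          (correctedAdjoint ρ Dp q θ.c 0 h))‖ ≤ C * h ^ (q + 2) := by
  have h0T : (0 : ℝ) ∈ Icc 0 T := ⟨le_rfl, hT⟩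
  obtain ⟨C₁, hC₁, h₁, hh₁, hb₁⟩ := hS.exists_stage_correction θ.c ρ θ.K0
  obtain ⟨C₂, hC₂, hb₂⟩ := (hS.jet_y.mono (by omega : q + 1 + 1 ≤ q + 3)).exists_residual_bound
    hS.convex θ.A0 0 θ.K0 θ.c θ.c θ.c
  refine ⟨C₂ + ‖stageMulL (m := m) θ.K0‖ * C₁, by positivity, h₁, hh₁, fun h hh hle hc => ?_⟩
  have a1 := (hb₁ 0 h0T h hh hle hc).1
  have a2 := hb₂ 0 (hS.subset h0T) h hh hc hc hc
  have hsum : ∑ k ∈ Finset.range (q + 1 + 1), (h ^ k / (k.factorial : ℝ)) • stageTensor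
      (θ.A0 *ᵥ θ.c ^ k - 0 *ᵥ θ.c ^ k - (k : ℝ) • (θ.K0 *ᵥ θ.c ^ (k - 1))) (Dy k 0) =
      stageTensor θ.a (Dy 0 0) + h • stageTensor θ.b (Dy 1 0) := by
    have e1 : ∀ k ∈ Finset.range (q + 1 + 1), (h ^ k / (k.factorial : ℝ)) • stageTensor
        (θ.A0 *ᵥ θ.c ^ k - 0 *ᵥ θ.c ^ k - (k : ℝ) • (θ.K0 *ᵥ θ.c ^ (k - 1))) (Dy k 0) =
        (h ^ k / (k.factorial : ℝ)) • stageTensor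
          ((if k = 0 then θ.a else 0) + (if k = 1 then θ.b else 0)) (Dy k 0) := fun k hk => by
      rw [hord.fwd_start_moment (Finset.mem_range.1 hk), zero_mulVec, sub_zero,
        add_sub_cancel_right]
    rw [Finset.sum_congr rfl e1, Finset.sum_range_succ', Finset.sum_range_succ', Finset.sum_eq_zero]
    · simp [add_comm]
    · intro k _
      rw [if_neg (by omega), if_neg (by omega), add_zero, zero_stageTensor, smul_zero]
  have hz : stageMul (0 : Matrix (Fin (q + 2)) (Fin (q + 2)) ℝ) (stageVec (Dy 0) θ.c 0 h) = 0 := by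
    funext i; simp [stageMul]
  rw [hsum, hz, sub_zero] at a2
  set X := stageG f u (stageVec (Dy 0) θ.c 0 h) (correctedAdjoint ρ Dp q θ.c 0 h)
  have e : ∀ Z W V : Fin (q + 2) → Fin m → ℝ, Z - W - V - h • stageMul θ.K0 X =
      (Z - h • stageMul θ.K0 (stageVec (Dy 1) θ.c 0 h) - (W + V)) -
      h • stageMul θ.K0 (X - stageVec (Dy 1) θ.c 0 h) := fun Z W V => by
    rw [stageMul_sub, smul_sub]; abel
  rw [e]
  refine (norm_sub_le _ _).trans ?_
  rw [norm_smul, Real.norm_of_nonneg hh, add_mul]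
  refine add_le_add a2 ?_
  calc h * ‖stageMul θ.K0 (X - stageVec (Dy 1) θ.c 0 h)‖
      ≤ h * (‖stageMulL (m := m) θ.K0‖ * (C₁ * h ^ (q + 1))) := mul_le_mul_of_nonneg_left
        ((stageMul_norm_le _ _).trans (mul_le_mul_of_nonneg_left a1 (norm_nonneg _))) hh
    _ = _ := by ring

end SmoothSolution

end ReferenceResiduals

/-! ### Residuals of the adjoint equations -/

section AdjointResiduals

lemma neg_stageMul {s m : ℕ} (M : Matrix (Fin s) (Fin s) ℝ) (Z : Fin s → Fin m → ℝ) :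
    stageMul (-M) Z = -stageMul M Z := by
  funext i
  simp [stageMul]

lemma sum_sub_mul_eq_zero_of_isDiag {s : ℕ} {M : Matrix (Fin s) (Fin s) ℝ} (hM : M.IsDiag)
    (c : Fin s → ℝ) (j : Fin s) : ∑ i, (c i - c j) * M i j = 0 := by
  refine Finset.sum_eq_zero fun i _ => ?_
  rcases eq_or_ne i j with rfl | hij
  · rw [sub_self, zero_mul]
  · rw [hM hij, mul_zero]

variable {m d q : ℕ} {f : (Fin m → ℝ) → (Fin d → ℝ) → (Fin m → ℝ)}
  {u : (Fin m → ℝ) → (Fin m → ℝ) → (Fin d → ℝ)} {I : Set ℝ} {T : ℝ}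
  {Dy Dp : ℕ → ℝ → Fin m → ℝ}

/-- The residual of an adjoint equation at the corrected reference values. -/
def adjointResidual {s : ℕ} (f : (Fin m → ℝ) → (Fin d → ℝ) → (Fin m → ℝ))
    (u : (Fin m → ℝ) → (Fin m → ℝ) → (Fin d → ℝ)) (A B K : Matrix (Fin s) (Fin s) ℝ)
    (c ρ : Fin s → ℝ) (Dy Dp : ℕ → ℝ → Fin m → ℝ) (q : ℕ) (t h : ℝ) : Fin s → Fin m → ℝ :=
  stageMul Aᵀ (correctedAdjoint ρ Dp q c t h) -
    stageMul Bᵀ (correctedAdjoint ρ Dp q c (t + h) h) +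
    h • stagePhi f u K (stageVec (Dy 0) c t h) (correctedAdjoint ρ Dp q c t h)

/-- The residual of the last adjoint equation at the corrected reference values. -/
def adjointEndResidual {s : ℕ} (f : (Fin m → ℝ) → (Fin d → ℝ) → (Fin m → ℝ))
    (u : (Fin m → ℝ) → (Fin m → ℝ) → (Fin d → ℝ)) (A K : Matrix (Fin s) (Fin s) ℝ)
    (w c ρ : Fin s → ℝ) (Dy Dp : ℕ → ℝ → Fin m → ℝ) (q : ℕ) (t h : ℝ) : Fin s → Fin m → ℝ :=
  stageMul Aᵀ (correctedAdjoint ρ Dp q c t h) - stageTensor w (Dp 0 (t + h)) +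
    h • stagePhi f u K (stageVec (Dy 0) c t h) (correctedAdjoint ρ Dp q c t h)

lemma adjointResidual_eq {s : ℕ} (A B K : Matrix (Fin s) (Fin s) ℝ) (c ρ : Fin s → ℝ)
    (t h : ℝ) : adjointResidual f u A B K c ρ Dy Dp q t h =
      jetResidual Aᵀ Bᵀ (-Kᵀ) c (c + 1) c Dp t h +
      (h ^ (q + 1) / ((q + 1).factorial : ℝ)) • (stageTensor (Aᵀ *ᵥ ρ) (Dp (q + 1) t) -
        stageTensor (Bᵀ *ᵥ ρ) (Dp (q + 1) (t + h))) +
      h • (stagePhi f u K (stageVec (Dy 0) c t h) (correctedAdjoint ρ Dp q c t h) -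
        stageMul Kᵀ (stageVec (Dp 1) c t h)) := by
  rw [adjointResidual, jetResidual, stageVec_add_one, neg_stageMul, smul_neg, sub_neg_eq_add,
    smul_sub, smul_sub]
  generalize stagePhi f u K _ _ = Φ
  simp only [correctedAdjoint, stageMul_add, stageMul_smul, stageMul_stageTensor]
  abel

lemma adjointEndResidual_eq {s : ℕ} (A K : Matrix (Fin s) (Fin s) ℝ) {w : Fin s → ℝ}
    (hw : w ⬝ᵥ (1 : Fin s → ℝ) = 1) (c ρ : Fin s → ℝ)
    (t h : ℝ) : adjointEndResidual f u A K w c ρ Dy Dp q t h =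
      jetResidual Aᵀ (vecMulVec w w) (-Kᵀ) c 1 c Dp t h +
      (h ^ (q + 1) / ((q + 1).factorial : ℝ)) • stageTensor (Aᵀ *ᵥ ρ) (Dp (q + 1) t) +
      h • (stagePhi f u K (stageVec (Dy 0) c t h) (correctedAdjoint ρ Dp q c t h) -
        stageMul Kᵀ (stageVec (Dp 1) c t h)) := by
  have h1 : stageVec (Dp 0) (1 : Fin s → ℝ) t h = stageTensor 1 (Dp 0 (t + h)) := by
    funext i
    simp [stageVec, stageTensor]
  rw [adjointEndResidual, jetResidual, neg_stageMul, smul_neg, sub_neg_eq_add,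
    stageMul_vecMulVec, h1, stageDot_stageTensor, hw, one_smul, smul_sub]
  generalize stagePhi f u K _ _ = Φ
  simp only [correctedAdjoint, stageMul_add, stageMul_smul, stageMul_stageTensor]
  abel

lemma pow_div_factorial_le {h : ℝ} (hh : 0 ≤ h) (n : ℕ) : h ^ n / (n.factorial : ℝ) ≤ h ^ n :=
  div_le_self (by positivity) (by exact_mod_cast Nat.one_le_iff_ne_zero.2 (Nat.factorial_ne_zero _))

namespace SmoothSolution

/-- The defect of `Φ` along the reference values. -/
lemma exists_reference_phi {s : ℕ} {c : Fin s → ℝ} (hS : SmoothSolution f u I T q Dy Dp)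
    (ρ : Fin s → ℝ) {K : Matrix (Fin s) (Fin s) ℝ} (hK : ∀ j, ∑ i, (c i - c j) * K i j = 0)
    (hfull : q + 2 ≤ 4 ∨ K.IsDiag) :
    ∃ C, 0 ≤ C ∧ ∃ h₁ > 0, ∀ t ∈ Icc 0 T, ∀ h, 0 ≤ h → h ≤ h₁ → NodesIn I c t h →
      ‖stagePhi f u K (stageVec (Dy 0) c t h) (correctedAdjoint ρ Dp q c t h) -
        stageMul Kᵀ (stageVec (Dp 1) c t h)‖ ≤ C * h ^ q := by
  obtain ⟨C₁, hC₁, h₁, hh₁, hb₁⟩ := hS.exists_stage_correction c ρ K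
  obtain ⟨C₂, hC₂, h₂, hh₂, hb₂⟩ := hS.exists_stagePhi_full hK hfull
  refine ⟨C₁ + C₂, by positivity, min 1 (min h₁ h₂), by positivity, fun t ht h hh hle hc => ?_⟩
  have hle' := hle.trans (min_le_right _ _)
  have a1 := (hb₁ t ht h hh (hle'.trans (min_le_left _ _)) hc).2
  have a2 := hb₂ t ht h hh (hle'.trans (min_le_right _ _)) hc
  have a3 : C₁ * h ^ (q + 1) ≤ C₁ * h ^ q := mul_le_mul_of_nonneg_left
    (pow_le_pow_of_le_one hh (hle.trans (min_le_left _ _)) (by omega)) hC₁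
  refine (norm_sub_le_norm_sub_add_norm_sub _
    (stagePhi f u K (stageVec (Dy 0) c t h) (stageVec (Dp 0) c t h)) _).trans ?_
  linarith

/-- The mean of the defect of `Φ` along the reference values. The correction enters at the order
`q + 1 = s - 1` already, so that no normalization of `ρ` is needed. -/
lemma exists_reference_phi_mean {s : ℕ} {c : Fin s → ℝ} (hS : SmoothSolution f u I T q Dy Dp)
    (ρ : Fin s → ℝ) {K : Matrix (Fin s) (Fin s) ℝ} (hK : ∀ j, ∑ i, (c i - c j) * K i j = 0)
    (hK2 : q = 2 → ∑ i, ∑ j, K j i * (c j - c i) ^ 2 = 0) (hfull : q + 2 ≤ 4 ∨ K.IsDiag) :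
    ∃ C, 0 ≤ C ∧ ∃ h₁ > 0, ∀ t ∈ Icc 0 T, ∀ h, 0 ≤ h → h ≤ h₁ → NodesIn I c t h →
      ‖stageDot 1 (stagePhi f u K (stageVec (Dy 0) c t h) (correctedAdjoint ρ Dp q c t h) -
        stageMul Kᵀ (stageVec (Dp 1) c t h))‖ ≤ C * h ^ (q + 1) := by
  obtain ⟨C₁, hC₁, h₁, hh₁, hb₁⟩ := hS.exists_stage_correction c ρ K
  obtain ⟨C₂, hC₂, h₂, hh₂, hb₂⟩ := hS.exists_stagePhi_full_mean hK hK2 hfull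
  refine ⟨‖stageDotL (m := m) (1 : Fin s → ℝ)‖ * C₁ + C₂, by positivity, min h₁ h₂, by positivity,
    fun t ht h hh hle hc => ?_⟩
  have a1 := (stageDot_norm_le 1 _).trans (mul_le_mul_of_nonneg_left
    (hb₁ t ht h hh (hle.trans (min_le_left _ _)) hc).2 (norm_nonneg (stageDotL 1)))
  have a2 := hb₂ t ht h hh (hle.trans (min_le_right _ _)) hc
  rw [stageDot_sub] at a1 a2
  rw [stageDot_sub]
  refine (norm_sub_le_norm_sub_add_norm_sub _
    (stageDot 1 (stagePhi f u K (stageVec (Dy 0) c t h) (stageVec (Dp 0) c t h))) _).trans ?_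
  rw [add_mul, mul_assoc]
  exact add_le_add a1 a2

/-- The local error of an adjoint equation that satisfies the order conditions. -/
lemma exists_adjoint_residual_order {s : ℕ} {c : Fin s → ℝ}
    (hS : SmoothSolution f u I T q Dy Dp) (ρ : Fin s → ℝ) {A B K : Matrix (Fin s) (Fin s) ℝ}
    (hK : ∀ j, ∑ i, (c i - c j) * K i j = 0) (hfull : q + 2 ≤ 4 ∨ K.IsDiag)
    (hord : ∀ k < q + 1, Aᵀ *ᵥ c ^ k = Bᵀ *ᵥ (c + 1) ^ k - (k : ℝ) • (Kᵀ *ᵥ c ^ (k - 1))) :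
    ∃ C, 0 ≤ C ∧ ∃ h₁ > 0, ∀ t ∈ Icc 0 T, ∀ h, 0 ≤ h → h ≤ h₁ → t + h ∈ I → NodesIn I c t h →
      NodesIn I c (t + h) h →
      ‖adjointResidual f u A B K c ρ Dy Dp q t h‖ ≤ C * h ^ (q + 1) := by
  obtain ⟨C₁, hC₁, h₁, hh₁, hb₁⟩ := hS.exists_reference_phi ρ hK hfull
  obtain ⟨C₂, hC₂, hb₂⟩ := (hS.jet_p.mono (by omega : q + 1 ≤ q + 3)).exists_residual_order
    (A := Aᵀ) (B := Bᵀ) (K := -Kᵀ) (c := c) (c' := c + 1) (c'' := c) hS.convex (fun k hk => by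
      rw [residualCoeff, hord k hk, neg_mulVec, smul_neg]; abel)
  obtain ⟨b, hbd⟩ := hS.jet_p.bound
  refine ⟨C₂ + (‖Aᵀ *ᵥ ρ‖ * |b| + ‖Bᵀ *ᵥ ρ‖ * |b|) + C₁, by positivity, h₁, hh₁,
    fun t ht h hh hle hth hc hc' => ?_⟩
  have a1 := mul_le_mul_of_nonneg_left (hb₁ t ht h hh hle hc) hh
  have a2 := hb₂ t (hS.subset ht) h hh hc (nodesIn_add_one hc') hc
  have a3 : ∀ t' ∈ I, ‖Dp (q + 1) t'‖ ≤ |b| := fun t' ht' =>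
    (hbd (q + 1) (by omega) t' ht').trans (le_abs_self b)
  have a4 : ∀ (x : Fin s → ℝ), ∀ t' ∈ I, ‖stageTensor x (Dp (q + 1) t')‖ ≤ ‖x‖ * |b| :=
    fun x t' ht' => (stageTensor_norm_le _ _).trans
      (mul_le_mul_of_nonneg_left (a3 t' ht') (norm_nonneg _))
  rw [adjointResidual_eq]
  refine (norm_add₃_le).trans ?_
  rw [norm_smul, norm_smul, Real.norm_of_nonneg hh, Real.norm_of_nonneg (by positivity)]
  have a5 := mul_le_mul (pow_div_factorial_le hh (q + 1)) ((norm_sub_le _ _).trans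
    (add_le_add (a4 (Aᵀ *ᵥ ρ) t (hS.subset ht)) (a4 (Bᵀ *ᵥ ρ) _ hth))) (norm_nonneg _)
    (by positivity)
  calc _ ≤ C₂ * h ^ (q + 1) + h ^ (q + 1) * (‖Aᵀ *ᵥ ρ‖ * |b| + ‖Bᵀ *ᵥ ρ‖ * |b|) +
        h * (C₁ * h ^ q) := add_le_add (add_le_add a2 a5) a1
    _ = _ := by ring

/-- The local error of the last adjoint equation. -/
lemma exists_adjoint_end_residual_order {s : ℕ} {c : Fin s → ℝ}
    (hS : SmoothSolution f u I T q Dy Dp) (ρ : Fin s → ℝ) {A K : Matrix (Fin s) (Fin s) ℝ}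
    {w : Fin s → ℝ} (hw : w ⬝ᵥ (1 : Fin s → ℝ) = 1)
    (hK : ∀ j, ∑ i, (c i - c j) * K i j = 0) (hfull : q + 2 ≤ 4 ∨ K.IsDiag)
    (hord : ∀ k < q + 1, Aᵀ *ᵥ c ^ k = w - (k : ℝ) • (Kᵀ *ᵥ c ^ (k - 1))) :
    ∃ C, 0 ≤ C ∧ ∃ h₁ > 0, ∀ t ∈ Icc 0 T, ∀ h, 0 ≤ h → h ≤ h₁ → t + h ∈ I → NodesIn I c t h →
      ‖adjointEndResidual f u A K w c ρ Dy Dp q t h‖ ≤ C * h ^ (q + 1) := by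
  obtain ⟨C₁, hC₁, h₁, hh₁, hb₁⟩ := hS.exists_reference_phi ρ hK hfull
  obtain ⟨C₂, hC₂, hb₂⟩ := (hS.jet_p.mono (by omega : q + 1 ≤ q + 3)).exists_residual_order
    (A := Aᵀ) (B := vecMulVec w w) (K := -Kᵀ) (c := c) (c' := 1) (c'' := c) hS.convex
    (fun k hk => by
      rw [residualCoeff, hord k hk, neg_mulVec, smul_neg, one_pow, vecMulVec_mulVec, hw]
      simp)
  obtain ⟨b, hbd⟩ := hS.jet_p.bound
  refine ⟨C₂ + ‖Aᵀ *ᵥ ρ‖ * |b| + C₁, by positivity, h₁, hh₁,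
    fun t ht h hh hle hth hc => ?_⟩
  have a1 := mul_le_mul_of_nonneg_left (hb₁ t ht h hh hle hc) hh
  have a2 := hb₂ t (hS.subset ht) h hh hc (fun j => by rwa [Pi.one_apply, one_mul]) hc
  have a3 := (hbd (q + 1) (by omega) t (hS.subset ht)).trans (le_abs_self b)
  rw [adjointEndResidual_eq A K hw]
  refine (norm_add₃_le).trans ?_
  rw [norm_smul, norm_smul, Real.norm_of_nonneg hh, Real.norm_of_nonneg (by positivity)]
  have a5 := mul_le_mul (pow_div_factorial_le hh (q + 1)) ((stageTensor_norm_le (Aᵀ *ᵥ ρ) _).trans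
    (mul_le_mul_of_nonneg_left a3 (norm_nonneg _))) (norm_nonneg _) (by positivity)
  calc _ ≤ C₂ * h ^ (q + 1) + h ^ (q + 1) * (‖Aᵀ *ᵥ ρ‖ * |b|) +
        h * (C₁ * h ^ q) := add_le_add (add_le_add a2 a5) a1
    _ = _ := by ring

variable {θ : PeerTriplet (q + 2)} {ρ : Fin (q + 2) → ℝ}

lemma residualCoeff_adjoint (A B K : Matrix (Fin (q + 2)) (Fin (q + 2)) ℝ) (c : Fin (q + 2) → ℝ)
    (k : ℕ) : residualCoeff Aᵀ Bᵀ (-Kᵀ) c (c + 1) c k = PeerTriplet.adjDefect A B K c k := by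
  rw [residualCoeff, PeerTriplet.adjDefect, neg_mulVec, smul_neg, sub_neg_eq_add]

/-- The local error of the standard adjoint equation: the correction removes its leading term, and
the mean of the next one. -/
lemma exists_adjoint_residual (hS : SmoothSolution f u I T q Dy Dp) (hord : θ.OrderConditions)
    (hK : θ.K.IsDiag) (hsup : θ.Superconvergence) (hρ : θ.IsCorrector ρ) :
    ∃ C, 0 ≤ C ∧ ∃ h₁ > 0, ∀ t ∈ Icc 0 T, ∀ h, 0 ≤ h → h ≤ h₁ → t + h ∈ I → NodesIn I θ.c t h →
      NodesIn I θ.c (t + h) h →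
      ‖adjointResidual f u θ.A θ.B θ.K θ.c ρ Dy Dp q t h‖ ≤ C * h ^ (q + 2) ∧
      ‖stageDot 1 (adjointResidual f u θ.A θ.B θ.K θ.c ρ Dy Dp q t h)‖ ≤ C * h ^ (q + 3) := by
  obtain ⟨C₁, hC₁, h₁, hh₁, hb₁⟩ := hS.exists_field_correction (c := θ.c) hρ.mean_K
  obtain ⟨C₂, hC₂, hb₂⟩ := hS.jet_p.exists_residual_lead_two (n := q)
    (A := θ.Aᵀ) (B := θ.Bᵀ) (K := -θ.Kᵀ) (c := θ.c) (c' := θ.c + 1) (c'' := θ.c) hS.convex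
    (fun k hk => by
      rw [residualCoeff, hord.adj_standard_moment hk, neg_mulVec, smul_neg]; abel)
  obtain ⟨C₃, hC₃, hb₃⟩ := ((hS.jet_p.mono (by omega : 2 + (q + 1) ≤ q + 3)).shift_add
    (q + 1)).exists_taylor_bound hS.convex
  obtain ⟨b, hbd⟩ := hS.jet_p.bound
  set ν := ‖stageDotL (m := m) (1 : Fin (q + 2) → ℝ)‖ with hν
  set β := ‖θ.Bᵀ *ᵥ ρ‖ with hβ
  set τ := PeerTriplet.adjDefect θ.A θ.B θ.K θ.c (q + 2) - ((q : ℝ) + 2) • (θ.Bᵀ *ᵥ ρ) with hτ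
  have hτ0 : (1 : Fin (q + 2) → ℝ) ⬝ᵥ τ = 0 := by
    rw [hτ, dotProduct_sub, hρ.mean_adjDefect_succ hord hK hsup, dotProduct_smul, smul_eq_mul,
      sub_self]
  refine ⟨‖τ‖ * |b| + (C₂ + β * C₃) + C₁ + ν * (C₂ + β * C₃), by positivity, min 1 h₁,
    by positivity, fun t ht h hh hle hth hc hc' => ?_⟩
  have hh1 := hle.trans (min_le_left _ _)
  obtain ⟨a1, a1'⟩ := (hb₁ t ht h hh (hle.trans (min_le_right _ _)) hc).2
  have a2 := hb₂ t (hS.subset ht) h hh hc (nodesIn_add_one hc') hc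
  have a3 := hb₃ t (hS.subset ht) (t + h) hth
  have a4 := (hbd (q + 2) (by omega) t (hS.subset ht)).trans (le_abs_self b)
  simp only [residualCoeff_adjoint, Finset.sum_range_succ, Finset.sum_range_zero, zero_add,
    add_sub_cancel_left, pow_zero, pow_one, Nat.factorial_zero, Nat.factorial_one, Nat.cast_one,
    div_one, one_smul, abs_of_nonneg hh, add_comm 1 (q + 1)] at a2 a3
  rw [hK.isSymm.eq] at a2
  set X := (fun i => srcPhi f u (stageVec (Dy 0) θ.c t h i)
          (correctedAdjoint ρ Dp q θ.c t h i)) - stageVec (Dp 1) θ.c t h with hX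
  set R := jetResidual θ.Aᵀ θ.Bᵀ (-θ.K) θ.c (θ.c + 1) θ.c Dp t h with hR
  set γ := h ^ (q + 1) / ((q + 1).factorial : ℝ) with hγ
  set γ₂ := h ^ (q + 2) / ((q + 2).factorial : ℝ) with hγ₂
  have hγγ : γ₂ * ((q : ℝ) + 2) = γ * h := by
    rw [hγ, hγ₂, Nat.factorial_succ (q + 1)]
    push_cast
    field_simp
    ring
  have hγ0 : 0 ≤ γ := by positivity
  have hγ1 : γ ≤ h ^ (q + 1) := pow_div_factorial_le hh _
  set η := PeerTriplet.adjDefect θ.A θ.B θ.K θ.c (q + 1)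
  set η₂ := PeerTriplet.adjDefect θ.A θ.B θ.K θ.c (q + 2)
  have hη : θ.Aᵀ *ᵥ ρ = θ.Bᵀ *ᵥ ρ - η := by
    have := hρ.solves
    rw [transpose_sub, sub_mulVec] at this
    rw [sub_eq_iff_eq_add.1 this]
    abel
  set x := Dp (q + 1) t
  set x' := Dp (q + 1) (t + h)
  set x₂ := Dp (q + 2) t
  set Z := R - (γ • stageTensor η x + γ₂ • stageTensor η₂ x₂) -
    γ • stageTensor (θ.Bᵀ *ᵥ ρ) (x' - (x + h • x₂)) with hZ
  have hZb : ‖Z‖ ≤ (C₂ + β * C₃) * h ^ (q + 3) := by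
    refine (norm_sub_le _ _).trans ?_
    rw [norm_smul, Real.norm_of_nonneg hγ0]
    have b1 := (stageTensor_norm_le (θ.Bᵀ *ᵥ ρ) (x' - (x + h • x₂))).trans
      (mul_le_mul_of_nonneg_left a3 (norm_nonneg _))
    calc _ ≤ C₂ * h ^ (q + 3) + h ^ (q + 1) * (β * (C₃ * h ^ 2)) :=
          add_le_add a2 (mul_le_mul hγ1 b1 (norm_nonneg _) (by positivity))
      _ = _ := by ring
  have key : adjointResidual f u θ.A θ.B θ.K θ.c ρ Dy Dp q t h =
      γ₂ • stageTensor τ x₂ + Z + h • stageMul θ.K X := by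
    rw [adjointResidual_eq, stagePhi_of_isDiag hK, hK.isSymm.eq, ← stageMul_sub, hη, hZ, hτ,
      sub_stageTensor, sub_stageTensor, smul_stageTensor, stageTensor_sub, stageTensor_add,
      stageTensor_smul]
    simp only [smul_sub, smul_add, smul_smul, hγγ]
    change R + _ + h • stageMul θ.K X = _
    abel
  rw [key]
  constructor
  · have b1 : ‖γ₂ • stageTensor τ x₂‖ ≤ h ^ (q + 2) * (‖τ‖ * |b|) := by
      rw [norm_smul, Real.norm_of_nonneg (by positivity)]
      exact mul_le_mul (pow_div_factorial_le hh _) ((stageTensor_norm_le _ _).trans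
        (mul_le_mul_of_nonneg_left a4 (norm_nonneg _))) (norm_nonneg _) (by positivity)
    have b2 : ‖Z‖ ≤ (C₂ + β * C₃) * h ^ (q + 2) := hZb.trans (mul_le_mul_of_nonneg_left
      (pow_le_pow_of_le_one hh hh1 (by omega)) (by positivity))
    have b3 : ‖h • stageMul θ.K X‖ ≤ C₁ * h ^ (q + 2) := by
      rw [norm_smul, Real.norm_of_nonneg hh]
      refine (mul_le_mul_of_nonneg_left a1 hh).trans (le_of_eq ?_)
      ring
    have b4 : 0 ≤ ν * (C₂ + β * C₃) * h ^ (q + 2) := by positivity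
    refine norm_add₃_le.trans ?_
    linarith
  · rw [stageDot_add, stageDot_add, stageDot_smul, stageDot_stageTensor, hτ0, zero_smul, smul_zero,
      zero_add, stageDot_smul]
    refine (norm_add_le _ _).trans ?_
    have b1 := (stageDot_norm_le 1 Z).trans (mul_le_mul_of_nonneg_left hZb (norm_nonneg _))
    have b2 : ‖h • stageDot 1 (stageMul θ.K X)‖ ≤ C₁ * h ^ (q + 3) := by
      rw [norm_smul, Real.norm_of_nonneg hh]
      refine (mul_le_mul_of_nonneg_left a1' hh).trans (le_of_eq ?_)
      ring
    have b3 : 0 ≤ (‖τ‖ * |b| + (C₂ + β * C₃)) * h ^ (q + 3) := by positivity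
    change _ ≤ ν * _ at b1
    linarith

/-- The errors of the last two adjoint equations cancel in the mean, up to terms of higher order. -/
lemma exists_adjoint_mean_end (hS : SmoothSolution f u I T q Dy Dp) (hord : θ.OrderConditions)
    (hK : θ.K.IsDiag) (hsup : θ.Superconvergence) (hρ : θ.IsCorrector ρ)
    (hfull : q + 2 ≤ 4 ∨ θ.KN.IsDiag) (hN : θ.AN *ᵥ 1 = θ.BN *ᵥ 1)
    (hKN2 : q = 2 → ∑ i, ∑ j, θ.KN j i * (θ.c j - θ.c i) ^ 2 = 0) :
    ∃ C, 0 ≤ C ∧ ∃ h₁ > 0, ∀ t ∈ Icc 0 T, ∀ h, 0 ≤ h → h ≤ h₁ → t + h ∈ Icc 0 T →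
      t + h + h ∈ I → NodesIn I θ.c t h → NodesIn I θ.c (t + h) h →
      ‖stageDot 1 (adjointResidual f u θ.A θ.BN θ.K θ.c ρ Dy Dp q t h) +
        stageDot 1 (adjointEndResidual f u θ.AN θ.KN θ.w θ.c ρ Dy Dp q (t + h) h)‖ ≤
        C * h ^ (q + 2) := by
  have hw : θ.w ⬝ᵥ (1 : Fin (q + 2) → ℝ) = 1 := by
    simpa using hord.fwd_end_moment (k := 0) (by omega)
  obtain ⟨C₁, hC₁, h₁, hh₁, hb₁⟩ := hS.exists_stage_correction θ.c ρ θ.K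
  obtain ⟨C₂, hC₂, h₂, hh₂, hb₂⟩ := hS.exists_reference_phi_mean ρ hord.oneleg_end hKN2 hfull
  obtain ⟨C₃, hC₃, hb₃⟩ := (hS.jet_p.mono (by omega : q + 2 ≤ q + 3)).exists_residual_lead (n := q)
    (A := θ.Aᵀ) (B := θ.BNᵀ) (K := -θ.Kᵀ) (c := θ.c) (c' := θ.c + 1) (c'' := θ.c) hS.convex
    (fun k hk => by
      rw [residualCoeff, hord.adj_last_moment hk, neg_mulVec, smul_neg]; abel)
  obtain ⟨C₄, hC₄, hb₄⟩ := (hS.jet_p.mono (by omega : q + 2 ≤ q + 3)).exists_residual_lead (n := q)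
    (A := θ.ANᵀ) (B := vecMulVec θ.w θ.w) (K := -θ.KNᵀ) (c := θ.c) (c' := 1) (c'' := θ.c) hS.convex
    (fun k hk => by
      rw [residualCoeff, hord.adj_end_moment hk, neg_mulVec, smul_neg, one_pow, vecMulVec_mulVec,
        hw]
      simp)
  obtain ⟨C₅, hC₅, hb₅⟩ := ((hS.jet_p.mono (by omega : 1 + (q + 1) ≤ q + 3)).shift_add
    (q + 1)).exists_taylor_bound hS.convex
  set ν := ‖stageDotL (m := m) (1 : Fin (q + 2) → ℝ)‖ with hν
  set η₁ := (1 : Fin (q + 2) → ℝ) ⬝ᵥ PeerTriplet.adjDefect θ.A θ.BN θ.K θ.c (q + 1) with hη₁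
  set η₂ := (1 : Fin (q + 2) → ℝ) ⬝ᵥ (θ.ANᵀ *ᵥ (θ.c ^ (q + 1)) - θ.w +
        ((q : ℝ) + 1) • (θ.KNᵀ *ᵥ (θ.c ^ q))) with hη₂
  set α := (1 : Fin (q + 2) → ℝ) ⬝ᵥ (θ.Aᵀ *ᵥ ρ) with hα
  set β := (1 : Fin (q + 2) → ℝ) ⬝ᵥ (θ.ANᵀ *ᵥ ρ) with hβ
  have hsum : η₁ + η₂ + α = 0 := hρ.mean_adjDefect_end hord hK hsup hfull
  have hβ' : (1 : Fin (q + 2) → ℝ) ⬝ᵥ (θ.BNᵀ *ᵥ ρ) = β := by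
    rw [hβ, mulVec_transpose, mulVec_transpose, dotProduct_comm, dotProduct_comm _ (ρ ᵥ* θ.AN),
      ← dotProduct_mulVec, ← dotProduct_mulVec, hN]
  refine ⟨ν * C₃ + ν * C₄ + ν * C₁ + C₂ + |η₂| * C₅, by positivity, min h₁ h₂, by positivity,
    fun t ht h hh hle hth hthh hc hc' => ?_⟩
  have a1 := (stageDot_norm_le 1 _).trans (mul_le_mul_of_nonneg_left
    ((hb₁ t ht h hh (hle.trans (min_le_left _ _)) hc).2) (norm_nonneg (stageDotL 1)))
  have a2 := hb₂ (t + h) hth h hh (hle.trans (min_le_right _ _)) hc'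
  have a3 := (stageDot_norm_le 1 _).trans (mul_le_mul_of_nonneg_left
    (hb₃ t (hS.subset ht) h hh hc (nodesIn_add_one hc') hc) (norm_nonneg (stageDotL 1)))
  have a4 := (stageDot_norm_le 1 _).trans (mul_le_mul_of_nonneg_left
    (hb₄ (t + h) (hS.subset hth) h hh hc' (fun j => by rwa [Pi.one_apply, one_mul]) hc')
    (norm_nonneg (stageDotL 1)))
  have a5 := hb₅ t (hS.subset ht) (t + h) (hS.subset hth)
  simp only [Finset.sum_range_one, zero_add, add_sub_cancel_left, pow_zero, pow_one,
    Nat.factorial_zero, Nat.cast_one, div_one, one_smul, abs_of_nonneg hh] at a5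
  have e4 : (1 : Fin (q + 2) → ℝ) ⬝ᵥ residualCoeff θ.ANᵀ (vecMulVec θ.w θ.w) (-θ.KNᵀ) θ.c 1 θ.c
      (q + 1) = η₂ := by
    rw [residualCoeff, hη₂, neg_mulVec, smul_neg, one_pow, vecMulVec_mulVec, hw]
    simp
  rw [stageDot_sub, stageDot_smul, stageDot_stageTensor, residualCoeff_adjoint, ← hη₁] at a3
  rw [stageDot_sub, stageDot_smul, stageDot_stageTensor, e4] at a4
  rw [hS.stagePhi_eq hK hc] at a1
  rw [adjointResidual_eq, adjointEndResidual_eq _ _ hw, hK.isSymm.eq]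
  rw [hK.isSymm.eq] at a3
  simp only [stageDot_add, stageDot_sub, stageDot_smul, stageDot_stageTensor, ← hα, ← hβ, hβ'] at *
  generalize stageDot 1 (jetResidual θ.Aᵀ θ.BNᵀ (-θ.K) θ.c (θ.c + 1) θ.c Dp t h) = R₁ at *
  generalize stageDot 1 (jetResidual θ.ANᵀ (vecMulVec θ.w θ.w) (-θ.KNᵀ) θ.c 1 θ.c Dp (t + h) h) =
    R₂ at *
  set γ := h ^ (q + 1) / ((q + 1).factorial : ℝ) with hγ
  have hγ0 : 0 ≤ γ := by positivity
  have hγ1 : γ ≤ h ^ (q + 1) := pow_div_factorial_le hh _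
  generalize hX₁ : stageDot 1 (stagePhi f u θ.K _ _) - _ = X₁ at *
  generalize hX₂ : stageDot 1 (stagePhi f u θ.KN _ _) - _ = X₂ at *
  generalize Dp (q + 1) t = x at *
  generalize Dp (q + 1) (t + h) = x' at *
  have key : R₁ + γ • (α • x - β • x') + h • X₁ + (R₂ + γ • β • x' + h • X₂) =
      (R₁ - γ • η₁ • x) + (R₂ - γ • η₂ • x') + h • X₁ + h • X₂ + γ • η₂ • (x' - x) := by
    have : η₁ = -η₂ - α := by linarith
    rw [this]
    module
  rw [key]
  have b1 : ‖h • X₁‖ ≤ h * (ν * (C₁ * h ^ (q + 1))) := by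
    rw [norm_smul, Real.norm_of_nonneg hh]; exact mul_le_mul_of_nonneg_left a1 hh
  have b2 : ‖h • X₂‖ ≤ h * (C₂ * h ^ (q + 1)) := by
    rw [norm_smul, Real.norm_of_nonneg hh]; exact mul_le_mul_of_nonneg_left a2 hh
  have b3 : ‖γ • η₂ • (x' - x)‖ ≤ h ^ (q + 1) * (|η₂| * (C₅ * h)) := by
    rw [norm_smul, norm_smul, Real.norm_of_nonneg hγ0, Real.norm_eq_abs]
    exact mul_le_mul hγ1 (mul_le_mul_of_nonneg_left a5 (abs_nonneg _)) (by positivity)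
      (by positivity)
  calc _ ≤ ν * (C₃ * h ^ (q + 2)) + ν * (C₄ * h ^ (q + 2)) + h * (ν * (C₁ * h ^ (q + 1))) +
        h * (C₂ * h ^ (q + 1)) + h ^ (q + 1) * (|η₂| * (C₅ * h)) := by
        refine (norm_add_le _ _).trans (add_le_add ?_ b3)
        refine (norm_add_le _ _).trans (add_le_add ?_ b2)
        refine (norm_add_le _ _).trans (add_le_add ?_ b1)
        exact (norm_add_le _ _).trans (add_le_add a3 a4)
    _ = _ := by ring

end SmoothSolution

end AdjointResiduals

/-! ### The error equations -/

section ErrorEquations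

variable {m d q : ℕ} {f : (Fin m → ℝ) → (Fin d → ℝ) → (Fin m → ℝ)}
  {C : (Fin m → ℝ) → ℝ}
  {u : (Fin m → ℝ) → (Fin m → ℝ) → (Fin d → ℝ)} {I : Set ℝ} {T : ℝ}
  {Dy Dp : ℕ → ℝ → Fin m → ℝ}

namespace SmoothSolution

/-- Stage vectors near the exact solution have their pairs of stages in a prescribed neighbourhood
of the trajectory. -/
lemma exists_pair_mem {s : ℕ} (hS : SmoothSolution f u I T q Dy Dp) (c ρ : Fin s → ℝ) {R : ℝ}
    (hR : 0 < R) :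
    ∃ r > 0, ∃ h₁ > 0, ∀ t ∈ Icc 0 T, ∀ h, 0 ≤ h → h ≤ h₁ → NodesIn I c t h →
      ∀ Z Q : Fin s → Fin m → ℝ,
      (∀ j, ‖Z j - Dy 0 (t + c j * h)‖ ≤ r ∧ ‖Q j - Dp 0 (t + c j * h)‖ ≤ r) →
      (∀ j, ‖(Z j, Q j) - (Dy 0 t, Dp 0 t)‖ ≤ R) ∧
      ∀ j, ‖(stageVec (Dy 0) c t h j, correctedAdjoint ρ Dp q c t h j) - (Dy 0 t, Dp 0 t)‖ ≤ R := by
  obtain ⟨B, hB, hn⟩ := hS.exists_near c ρ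
  refine ⟨R / 2, by positivity, min 1 (R / 2 / (B + 1)), by positivity,
    fun t ht h hh hle hc Z Q hZ => ?_⟩
  obtain ⟨n1, n2, _⟩ := hn t (hS.subset ht) h hh (hle.trans (min_le_left _ _)) hc
  have hBr : B * h ≤ R / 2 := by
    have := hle.trans (min_le_right _ _)
    rw [le_div_iff₀ (by positivity)] at this
    linarith
  refine ⟨fun j => ?_, fun j => (n2 j).trans (by linarith)⟩
  refine (norm_sub_le_norm_sub_add_norm_sub _
    (stageVec (Dy 0) c t h j, stageVec (Dp 0) c t h j) _).trans ?_
  have h1 : ‖(Z j, Q j) - (stageVec (Dy 0) c t h j, stageVec (Dp 0) c t h j)‖ ≤ R / 2 :=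
    max_le (hZ j).1 (hZ j).2
  linarith [n1 j]

/-- Lipschitz bounds for the stage vectors about the reference values. -/
lemma exists_reference_lipschitz {s : ℕ} (hS : SmoothSolution f u I T q Dy Dp) (c ρ : Fin s → ℝ)
    (M : Matrix (Fin s) (Fin s) ℝ) :
    ∃ L, 0 ≤ L ∧ ∃ r > 0, ∃ h₁ > 0, ∀ t ∈ Icc 0 T, ∀ h, 0 ≤ h → h ≤ h₁ → NodesIn I c t h →
      ∀ Z Q : Fin s → Fin m → ℝ,
      (∀ j, ‖Z j - Dy 0 (t + c j * h)‖ ≤ r ∧ ‖Q j - Dp 0 (t + c j * h)‖ ≤ r) →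
      ‖stageMul M (stageG f u Z Q -
          stageG f u (stageVec (Dy 0) c t h) (correctedAdjoint ρ Dp q c t h))‖ ≤
        L * (‖Z - stageVec (Dy 0) c t h‖ + ‖Q - correctedAdjoint ρ Dp q c t h‖) ∧
      ‖stagePhi f u M Z Q -
          stagePhi f u M (stageVec (Dy 0) c t h) (correctedAdjoint ρ Dp q c t h)‖ ≤
        L * (‖Z - stageVec (Dy 0) c t h‖ + ‖Q - correctedAdjoint ρ Dp q c t h‖) := by
  obtain ⟨L₁, hL₁, R₁, hR₁, hl₁⟩ := hS.exists_stageG_lipschitz s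
  obtain ⟨L₂, hL₂, R₂, hR₂, hl₂⟩ := hS.exists_stagePhi_lipschitz M
  obtain ⟨r, hr, h₁, hh₁, hm⟩ := hS.exists_pair_mem c ρ (R := min R₁ R₂) (by positivity)
  refine ⟨‖stageMulL (m := m) M‖ * L₁ + L₂, by positivity, r, hr, h₁, hh₁,
    fun t ht h hh hle hc Z Q hZ => ?_⟩
  obtain ⟨m1, m2⟩ := hm t ht h hh hle hc Z Q hZ
  have a1 := (stageMul_norm_le M _).trans (mul_le_mul_of_nonneg_left
    (hl₁ t ht Z Q _ _ (fun j => (m1 j).trans (min_le_left _ _))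
    fun j => (m2 j).trans (min_le_left _ _)) (norm_nonneg _))
  have a2 := hl₂ t ht Z Q _ _ (fun j => (m1 j).trans (min_le_right _ _))
    fun j => (m2 j).trans (min_le_right _ _)
  rw [add_mul, mul_assoc]
  constructor
  · refine a1.trans (le_add_of_nonneg_right (by positivity))
  · refine a2.trans (le_add_of_nonneg_left (by positivity))

/-- The linearization of the right-hand sides about the reference values. -/
lemma exists_reference_linearization {s : ℕ} (hS : SmoothSolution f u I T q Dy Dp)
    (c ρ : Fin s → ℝ) {ε : ℝ} (hε : 0 < ε) :
    ∃ r > 0, ∃ h₁ > 0, ∀ t ∈ Icc 0 T, ∀ h, 0 ≤ h → h ≤ h₁ → NodesIn I c t h →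
      ∀ Z Q : Fin s → Fin m → ℝ,
      (∀ j, ‖Z j - Dy 0 (t + c j * h)‖ ≤ r ∧ ‖Q j - Dp 0 (t + c j * h)‖ ≤ r) →
      ‖stageG f u Z Q - stageG f u (stageVec (Dy 0) c t h) (correctedAdjoint ρ Dp q c t h) -
        stageFst (fderiv ℝ (srcField f u) (Dy 0 t, Dp 0 t)) (Z - stageVec (Dy 0) c t h)
          (Q - correctedAdjoint ρ Dp q c t h)‖ ≤
        ε * (‖Z - stageVec (Dy 0) c t h‖ + ‖Q - correctedAdjoint ρ Dp q c t h‖) ∧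
      ‖(fun j => srcPhi f u (Z j) (Q j)) -
          (fun j => srcPhi f u (stageVec (Dy 0) c t h j) (correctedAdjoint ρ Dp q c t h j)) -
        stageSnd (fderiv ℝ (srcField f u) (Dy 0 t, Dp 0 t)) (Z - stageVec (Dy 0) c t h)
          (Q - correctedAdjoint ρ Dp q c t h)‖ ≤
        ε * (‖Z - stageVec (Dy 0) c t h‖ + ‖Q - correctedAdjoint ρ Dp q c t h‖) := by
  obtain ⟨R, hR, M, hM, hq⟩ := hS.isCompact_image.exists_quadratic_remainder (Φ := srcField f u)
    (by rintro _ ⟨t, ht, rfl⟩; exact hS.smooth_field t ht)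
  obtain ⟨r, hr, h₁, hh₁, hm⟩ := hS.exists_pair_mem c ρ (R := min R (ε / (2 * (M + 1))))
    (by positivity)
  refine ⟨r, hr, h₁, hh₁, fun t ht h hh hle hc Z Q hZ => ?_⟩
  obtain ⟨m1, m2⟩ := hm t ht h hh hle hc Z Q hZ
  have key : ∀ j, ‖srcField f u (Z j, Q j) -
      srcField f u (stageVec (Dy 0) c t h j, correctedAdjoint ρ Dp q c t h j) -
      fderiv ℝ (srcField f u) (Dy 0 t, Dp 0 t) ((Z - stageVec (Dy 0) c t h) j,
        (Q - correctedAdjoint ρ Dp q c t h) j)‖ ≤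
      ε * (‖Z - stageVec (Dy 0) c t h‖ + ‖Q - correctedAdjoint ρ Dp q c t h‖) := fun j => by
    have b1 := hq _ ⟨t, ht, rfl⟩ (Z j, Q j) (by
      rw [Metric.mem_closedBall, dist_eq_norm]; exact (m1 j).trans (min_le_left _ _))
      (stageVec (Dy 0) c t h j, correctedAdjoint ρ Dp q c t h j) (by
      rw [Metric.mem_closedBall, dist_eq_norm]; exact (m2 j).trans (min_le_left _ _))
    refine b1.trans (mul_le_mul ?_ ?_ (norm_nonneg _) hε.le)
    · have b2 := (m1 j).trans (min_le_right _ _)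
      have b3 := (m2 j).trans (min_le_right _ _)
      have b4 : M * (ε / (2 * (M + 1)) + ε / (2 * (M + 1))) ≤ ε := by
        have : M * (ε / (2 * (M + 1)) + ε / (2 * (M + 1))) = M / (M + 1) * ε := by
          field_simp
          ring
        rw [this]
        exact mul_le_of_le_one_left hε.le ((div_le_one (by positivity)).2 (by linarith))
      exact (mul_le_mul_of_nonneg_left (add_le_add b2 b3) hM).trans b4
    · refine (max_le_add_of_nonneg (norm_nonneg _) (norm_nonneg _)).trans ?_
      exact add_le_add (norm_le_pi_norm (Z - stageVec (Dy 0) c t h) j)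
        (norm_le_pi_norm (Q - correctedAdjoint ρ Dp q c t h) j)
  constructor
  · exact (pi_norm_le_iff_of_nonneg (by positivity)).2 fun j => (norm_fst_le _).trans (key j)
  · exact (pi_norm_le_iff_of_nonneg (by positivity)).2 fun j => (norm_snd_le _).trans (key j)

/-- The end point evaluation of the reference values. -/
lemma exists_end_value {s : ℕ} {c w : Fin s → ℝ} (hS : SmoothSolution f u I T q Dy Dp)
    (hT : 0 ≤ T) (hw : ∀ k < q + 2, w ⬝ᵥ c ^ k = 1) :
    ∃ B, 0 ≤ B ∧ ∀ h, 0 ≤ h → h ≤ T → NodesIn I c (T - h) h →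
      ‖stageDot w (stageVec (Dy 0) c (T - h) h) - Dy 0 T‖ ≤ B * h ^ (q + 2) := by
  obtain ⟨B₁, hB₁, h₁⟩ := (hS.jet_y.mono (by omega : q + 2 ≤ q + 3)).exists_stageVec_bound
    hS.convex c
  obtain ⟨B₂, hB₂, h₂⟩ := (hS.jet_y.mono (by omega : q + 2 ≤ q + 3)).exists_taylor_bound hS.convex
  refine ⟨‖stageDotL (m := m) w‖ * B₁ + B₂, by positivity, fun h hh hhT hc => ?_⟩
  have ht : T - h ∈ I := hS.subset ⟨by linarith, by linarith⟩
  have a1 := (stageDot_norm_le w _).trans (mul_le_mul_of_nonneg_left (h₁ _ ht h hh hc)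
    (norm_nonneg _))
  have a2 := h₂ _ ht T (hS.subset ⟨hT, le_rfl⟩)
  rw [sub_sub_cancel, abs_of_nonneg hh] at a2
  rw [stageDot_sub, stageDot_sum] at a1
  have e : ∑ k ∈ Finset.range (q + 2), stageDot w ((h ^ k / (k.factorial : ℝ)) •
      stageTensor (c ^ k) (Dy k (T - h))) =
      ∑ k ∈ Finset.range (q + 2), (h ^ k / (k.factorial : ℝ)) • Dy k (T - h) :=
    Finset.sum_congr rfl fun k hk => by
      rw [stageDot_smul, stageDot_stageTensor, hw k (Finset.mem_range.1 hk), one_smul]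
  rw [e] at a1
  rw [norm_sub_rev] at a2
  refine (norm_sub_le_norm_sub_add_norm_sub _ _ _).trans ((add_le_add a1 a2).trans (le_of_eq ?_))
  ring

/-- The interpolation of the adjoint reference values at the initial point. -/
lemma exists_initial_adjoint {s : ℕ} {c v : Fin s → ℝ} (hS : SmoothSolution f u I T q Dy Dp)
    (hT : 0 ≤ T) (ρ : Fin s → ℝ) (hv : ∀ k < q + 1, v ⬝ᵥ c ^ k = if k = 0 then 1 else 0) :
    ∃ B, 0 ≤ B ∧ ∀ h, 0 ≤ h → h ≤ 1 → NodesIn I c 0 h →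
      ‖stageDot v (stageVec (Dp 0) c 0 h) - Dp 0 0‖ ≤ B * h ^ (q + 1) ∧
      ‖stageDot v (correctedAdjoint ρ Dp q c 0 h) - Dp 0 0‖ ≤ B * h ^ (q + 1) := by
  have ht : (0 : ℝ) ∈ I := hS.subset ⟨le_rfl, hT⟩
  obtain ⟨B₁, hB₁, h₁⟩ := (hS.jet_p.mono (by omega : q + 1 ≤ q + 3)).exists_stageVec_bound
    hS.convex c
  obtain ⟨B₂, hB₂, h₂⟩ := hS.exists_norm_correction_le c ρ
  set ν := ‖stageDotL (m := m) v‖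
  refine ⟨ν * B₁ + ν * B₂, by positivity, fun h hh hh1 hc => ?_⟩
  have a1 := (stageDot_norm_le v _).trans (mul_le_mul_of_nonneg_left (h₁ _ ht h hh hc)
    (norm_nonneg _))
  have a2 := (stageDot_norm_le v _).trans (mul_le_mul_of_nonneg_left (h₂ _ ht h hh)
    (norm_nonneg _))
  rw [stageDot_sub, stageDot_sum] at a1
  rw [stageDot_sub] at a2
  have e : ∑ k ∈ Finset.range (q + 1), stageDot v ((h ^ k / (k.factorial : ℝ)) •
      stageTensor (c ^ k) (Dp k 0)) = Dp 0 0 := by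
    rw [Finset.sum_range_succ', Finset.sum_eq_zero, zero_add, stageDot_smul, stageDot_stageTensor,
      hv 0 (by omega)]
    · simp
    · intro k hk
      rw [stageDot_smul, stageDot_stageTensor, hv (k + 1) (by simpa using Finset.mem_range.1 hk),
        if_neg (by omega), zero_smul, smul_zero]
  rw [e] at a1
  change _ ≤ ν * _ at a1
  change _ ≤ ν * _ at a2
  have p1 : 0 ≤ ν * (B₂ * h ^ (q + 1)) := by positivity
  refine ⟨by linarith, ?_⟩
  refine (norm_sub_le_norm_sub_add_norm_sub _ (stageDot v (stageVec (Dp 0) c 0 h)) _).trans ?_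
  linarith

end SmoothSolution

/-- A Peer solution on a grid with the step size `h`, with all stages within the distance `r` of the
exact solution. -/
structure NearSolution (θ : PeerTriplet (q + 2)) (f : (Fin m → ℝ) → (Fin d → ℝ) → (Fin m → ℝ))
    (C : (Fin m → ℝ) → ℝ) (u : (Fin m → ℝ) → (Fin m → ℝ) → (Fin d → ℝ)) (I : Set ℝ) (T : ℝ)
    (Dy Dp : ℕ → ℝ → Fin m → ℝ) (r : ℝ) (N : ℕ) (h : ℝ) (Y P : ℕ → Fin (q + 2) → Fin m → ℝ) :
    Prop where
  two_le : 2 ≤ N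
  pos : 0 < h
  mesh : (N + 1) * h = T
  nodes : ∀ n ≤ N, NodesIn I θ.c (n * h) h
  sol : IsPeerSolution θ f C u (Dy 0 0) h N Y P
  near : ∀ n ≤ N, ∀ j, ‖Y n j - Dy 0 (n * h + θ.c j * h)‖ ≤ r ∧
    ‖P n j - Dp 0 (n * h + θ.c j * h)‖ ≤ r

namespace NearSolution

variable {θ : PeerTriplet (q + 2)} {r h : ℝ} {N n : ℕ} {Y P : ℕ → Fin (q + 2) → Fin m → ℝ}

lemma mono {r' : ℝ} (hN : NearSolution θ f C u I T Dy Dp r N h Y P) (hr : r ≤ r') :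
    NearSolution θ f C u I T Dy Dp r' N h Y P :=
  ⟨hN.two_le, hN.pos, hN.mesh, hN.nodes, hN.sol,
    fun n hn j => ⟨((hN.near n hn j).1).trans hr, ((hN.near n hn j).2).trans hr⟩⟩

lemma mem (hN : NearSolution θ f C u I T Dy Dp r N h Y P) (hn : n ≤ N + 1) :
    (n : ℝ) * h ∈ Icc 0 T := by
  have h1 : (n : ℝ) ≤ N + 1 := by exact_mod_cast hn
  have := hN.pos.le
  exact ⟨by positivity, by rw [← hN.mesh]; gcongr⟩

lemma succ_mem (hN : NearSolution θ f C u I T Dy Dp r N h Y P) (hn : n ≤ N) :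
    (n : ℝ) * h + h ∈ Icc 0 T := by
  have := hN.mem (n := n + 1) (by omega)
  push_cast at this
  rwa [add_one_mul] at this

lemma pred_mul (hn : 1 ≤ n) (h : ℝ) : ((n - 1 : ℕ) : ℝ) * h = n * h - h := by
  rw [Nat.cast_sub hn, Nat.cast_one, sub_one_mul]

lemma succ_mul' (n : ℕ) (h : ℝ) : ((n + 1 : ℕ) : ℝ) * h = n * h + h := by
  push_cast; ring

lemma standard_fwd (hN : NearSolution θ f C u I T Dy Dp r N h Y P) (h1 : 1 ≤ n) (hn : n < N) :
    stageMul θ.A (Y n) = stageMul θ.B (Y (n - 1)) + h • stageMul θ.K (stageG f u (Y n) (P n)) := by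
  have := hN.sol.fwd_step n h1 hn.le
  simpa only [PeerTriplet.AA, PeerTriplet.BB, PeerTriplet.KK, if_neg (by omega : ¬ n = 0),
    if_neg hn.ne] using this

lemma start_fwd (hN : NearSolution θ f C u I T Dy Dp r N h Y P) :
    stageMul θ.A0 (Y 0) = stageTensor θ.a (Dy 0 0) +
      h • stageTensor θ.b (srcG f u (Dy 0 0) (stageDot θ.v (P 0))) +
      h • stageMul θ.K0 (stageG f u (Y 0) (P 0)) := by
  simpa only [PeerTriplet.AA, PeerTriplet.KK, if_true] using hN.sol.fwd_start

lemma last_fwd (hN : NearSolution θ f C u I T Dy Dp r N h Y P) :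
    stageMul θ.AN (Y N) = stageMul θ.BN (Y (N - 1)) + h • stageMul θ.KN (stageG f u (Y N) (P N)) := by
  have h2 := hN.two_le
  have := hN.sol.fwd_step N (by omega) le_rfl
  simpa only [PeerTriplet.AA, PeerTriplet.BB, PeerTriplet.KK, if_neg (by omega : ¬ N = 0),
    if_true] using this

lemma start_adj (hN : NearSolution θ f C u I T Dy Dp r N h Y P) :
    stageMul θ.A0ᵀ (P 0) = stageMul θ.Bᵀ (P 1) - h • stagePhi f u θ.K0 (Y 0) (P 0) := by
  have h2 := hN.two_le
  have := hN.sol.adj_step 0 (by omega)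
  simpa only [PeerTriplet.AA, PeerTriplet.BB, PeerTriplet.KK, if_true, zero_add,
    if_neg (by omega : ¬ 1 = N)] using this

lemma standard_adj (hN : NearSolution θ f C u I T Dy Dp r N h Y P) (h1 : 1 ≤ n) (hn : n < N - 1) :
    stageMul θ.Aᵀ (P n) = stageMul θ.Bᵀ (P (n + 1)) - h • stagePhi f u θ.K (Y n) (P n) := by
  have := hN.sol.adj_step n (by omega)
  simpa only [PeerTriplet.AA, PeerTriplet.BB, PeerTriplet.KK, if_neg (by omega : ¬ n = 0),
    if_neg (by omega : ¬ n = N), if_neg (by omega : ¬ n + 1 = N)] using this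

lemma last_adj (hN : NearSolution θ f C u I T Dy Dp r N h Y P) :
    stageMul θ.Aᵀ (P (N - 1)) = stageMul θ.BNᵀ (P N) -
      h • stagePhi f u θ.K (Y (N - 1)) (P (N - 1)) := by
  have h2 := hN.two_le
  have := hN.sol.adj_step (N - 1) (by omega)
  rw [Nat.sub_add_cancel (by omega)] at this
  simpa only [PeerTriplet.AA, PeerTriplet.BB, PeerTriplet.KK, if_neg (by omega : ¬ N - 1 = 0),
    if_neg (by omega : ¬ N - 1 = N), if_true] using this

lemma end_adj (hN : NearSolution θ f C u I T Dy Dp r N h Y P) :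
    stageMul θ.ANᵀ (P N) = stageTensor θ.w (gradC C (stageDot θ.w (Y N))) -
      h • stagePhi f u θ.KN (Y N) (P N) := by
  have h2 := hN.two_le
  simpa only [PeerTriplet.AA, PeerTriplet.KK, if_neg (by omega : ¬ N = 0), if_true] using
    hN.sol.adj_end

end NearSolution

end ErrorEquations

/-! ### Errors of a Peer solution in the interior of the grid -/

section ErrorFields

variable {m d q : ℕ} {f : (Fin m → ℝ) → (Fin d → ℝ) → (Fin m → ℝ)}
  {C : (Fin m → ℝ) → ℝ}
  {u : (Fin m → ℝ) → (Fin m → ℝ) → (Fin d → ℝ)} {I : Set ℝ} {T : ℝ}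
  {Dy Dp : ℕ → ℝ → Fin m → ℝ} {θ : PeerTriplet (q + 2)} {ρ : Fin (q + 2) → ℝ}

/-- The state errors. -/
def stateError (θ : PeerTriplet (q + 2)) (Dy : ℕ → ℝ → Fin m → ℝ) (h : ℝ)
    (Y : ℕ → Fin (q + 2) → Fin m → ℝ) (n : ℕ) : Fin (q + 2) → Fin m → ℝ :=
  Y n - stageVec (Dy 0) θ.c (n * h) h

/-- The adjoint errors with respect to the corrected reference values. -/
def adjointError (θ : PeerTriplet (q + 2)) (ρ : Fin (q + 2) → ℝ) (Dp : ℕ → ℝ → Fin m → ℝ) (h : ℝ)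
    (P : ℕ → Fin (q + 2) → Fin m → ℝ) (n : ℕ) : Fin (q + 2) → Fin m → ℝ :=
  P n - correctedAdjoint ρ Dp q θ.c (n * h) h

/-- A standard forward step in terms of the errors. -/
lemma exists_error_step (hS : SmoothSolution f u I T q Dy Dp) (hord : θ.OrderConditions)
    (hsup : θ.Superconvergence) (hρ : θ.IsCorrector ρ) {ε : ℝ} (hε : 0 < ε) :
    ∃ M, 0 ≤ M ∧ ∃ r > 0, ∃ h₁ > 0, ∀ N h Y P, NearSolution θ f C u I T Dy Dp r N h Y P → h ≤ h₁ →
      ∀ n, 1 ≤ n → n < N → ∃ σ : Fin (q + 2) → Fin m → ℝ, ‖σ‖ ≤ M * h ^ (q + 2) ∧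
        ‖stageDot 1 σ‖ ≤ h * (M * h ^ (q + 2)) ∧
        ‖stageMul θ.A (stateError θ Dy h Y n) - stageMul θ.B (stateError θ Dy h Y (n - 1)) -
          h • stageMul θ.K (stageFst (fderiv ℝ (srcField f u) (Dy 0 (n * h), Dp 0 (n * h)))
            (stateError θ Dy h Y n) (adjointError θ ρ Dp h P n)) - σ‖ ≤
          ε * h * (‖stateError θ Dy h Y n‖ + ‖adjointError θ ρ Dp h P n‖) := by
  set κ := ‖stageMulL (m := m) θ.K‖ with hκ
  obtain ⟨M, hM, h₁, hh₁, hres⟩ := hS.exists_forward_residual hord hsup hρ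
  obtain ⟨r, hr, h₂, hh₂, hlin⟩ := hS.exists_reference_linearization θ.c ρ
    (ε := ε / (κ + 1)) (by positivity)
  refine ⟨M, hM, r, hr, min h₁ h₂, by positivity, fun N h Y P hN hle n h1 hn => ?_⟩
  have hh := hN.pos.le
  have e0 := NearSolution.pred_mul h1 h
  have a1 := hres _ (hN.mem (by omega : n ≤ N + 1)) h hh (hle.trans (min_le_left _ _))
    (hN.nodes n hn.le) (by rw [← e0]; exact hN.nodes (n - 1) (by omega))
  have a2 := (hlin _ (hN.mem (by omega : n ≤ N + 1)) h hh (hle.trans (min_le_right _ _))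
    (hN.nodes n hn.le) (Y n) (P n) (hN.near n hn.le)).1
  have hs := hN.standard_fwd h1 hn
  rw [← e0] at a1
  rw [stateError, stateError, adjointError]
  set E := Y n - stageVec (Dy 0) θ.c (n * h) h
  set e := P n - correctedAdjoint ρ Dp q θ.c (n * h) h
  set L := stageFst (fderiv ℝ (srcField f u) (Dy 0 (n * h), Dp 0 (n * h))) E e
  set yv := stageVec (Dy 0) θ.c (n * h) h
  set G := stageG f u yv (correctedAdjoint ρ Dp q θ.c (n * h) h)
  set yv' := stageVec (Dy 0) θ.c ((n - 1 : ℕ) * h) h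
  refine ⟨-(stageMul θ.A yv - stageMul θ.B yv' - h • stageMul θ.K G), ?_, ?_, ?_⟩
  · rw [norm_neg]; exact a1.1
  · have : stageDot 1 (-(stageMul θ.A yv - stageMul θ.B yv' - h • stageMul θ.K G)) =
        -stageDot 1 (stageMul θ.A yv - stageMul θ.B yv' - h • stageMul θ.K G) :=
      map_neg (stageDotL 1) _
    rw [this, norm_neg]
    refine a1.2.trans (le_of_eq ?_)
    ring
  · have key : stageMul θ.A E - stageMul θ.B (Y (n - 1) - yv') - h • stageMul θ.K L -
        -(stageMul θ.A yv - stageMul θ.B yv' - h • stageMul θ.K G) =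
        h • stageMul θ.K (stageG f u (Y n) (P n) - G - L) := by
      simp only [E, stageMul_sub, hs, smul_sub]
      abel
    rw [key, norm_smul, Real.norm_of_nonneg hh]
    have a3 := (stageMul_norm_le θ.K _).trans (mul_le_mul_of_nonneg_left a2 (norm_nonneg _))
    have a4 : κ * (ε / (κ + 1) * (‖E‖ + ‖e‖)) ≤ ε * (‖E‖ + ‖e‖) := by
      rw [← mul_assoc]
      refine mul_le_mul_of_nonneg_right ?_ (by positivity)
      rw [mul_div_assoc', div_le_iff₀ (by positivity)]
      nlinarith
    calc _ ≤ h * (ε * (‖E‖ + ‖e‖)) := mul_le_mul_of_nonneg_left (a3.trans a4) hh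
      _ = _ := by ring

/-- A standard adjoint step in terms of the errors. -/
lemma exists_error_adj_step (hS : SmoothSolution f u I T q Dy Dp) (hord : θ.OrderConditions)
    (hK : θ.K.IsDiag) (hsup : θ.Superconvergence) (hρ : θ.IsCorrector ρ) {ε : ℝ} (hε : 0 < ε) :
    ∃ M, 0 ≤ M ∧ ∃ r > 0, ∃ h₁ > 0, ∀ N h Y P, NearSolution θ f C u I T Dy Dp r N h Y P → h ≤ h₁ →
      ∀ n, 1 ≤ n → n < N - 1 → ∃ σ : Fin (q + 2) → Fin m → ℝ, ‖σ‖ ≤ M * h ^ (q + 2) ∧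
        ‖stageDot 1 σ‖ ≤ h * (M * h ^ (q + 2)) ∧
        ‖stageMul θ.Aᵀ (adjointError θ ρ Dp h P n) - stageMul θ.Bᵀ (adjointError θ ρ Dp h P (n + 1)) +
          h • stageMul θ.K (stageSnd (fderiv ℝ (srcField f u) (Dy 0 (n * h), Dp 0 (n * h)))
            (stateError θ Dy h Y n) (adjointError θ ρ Dp h P n)) - σ‖ ≤
          ε * h * (‖stateError θ Dy h Y n‖ + ‖adjointError θ ρ Dp h P n‖) := by
  set κ := ‖stageMulL (m := m) θ.K‖ with hκ
  obtain ⟨M, hM, h₁, hh₁, hres⟩ := hS.exists_adjoint_residual hord hK hsup hρ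
  obtain ⟨r, hr, h₂, hh₂, hlin⟩ := hS.exists_reference_linearization θ.c ρ
    (ε := ε / (κ + 1)) (by positivity)
  refine ⟨M, hM, r, hr, min h₁ h₂, by positivity, fun N h Y P hN hle n h1 hn => ?_⟩
  have hh := hN.pos.le
  have e0 := NearSolution.succ_mul' n h
  have a1 := hres _ (hN.mem (by omega : n ≤ N + 1)) h hh (hle.trans (min_le_left _ _))
    (hS.subset (hN.succ_mem (by omega))) (hN.nodes n (by omega))
    (by rw [← e0]; exact hN.nodes (n + 1) (by omega))
  have a2 := (hlin _ (hN.mem (by omega : n ≤ N + 1)) h hh (hle.trans (min_le_right _ _))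
    (hN.nodes n (by omega)) (Y n) (P n) (hN.near n (by omega))).2
  have hs := hN.standard_adj h1 hn
  rw [adjointResidual, ← e0, SmoothSolution.stagePhi_of_isDiag hK] at a1
  rw [SmoothSolution.stagePhi_of_isDiag hK] at hs
  rw [adjointError, adjointError, stateError]
  set E := Y n - stageVec (Dy 0) θ.c (n * h) h
  set pv := correctedAdjoint ρ Dp q θ.c (n * h) h
  set e := P n - pv with he
  set L := stageSnd (fderiv ℝ (srcField f u) (Dy 0 (n * h), Dp 0 (n * h))) E e
  set yv := stageVec (Dy 0) θ.c (n * h) h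
  set F : Fin (q + 2) → Fin m → ℝ := fun i => srcPhi f u (yv i) (pv i)
  set pv' := correctedAdjoint ρ Dp q θ.c ((n + 1 : ℕ) * h) h
  refine ⟨-(stageMul θ.Aᵀ pv - stageMul θ.Bᵀ pv' + h • stageMul θ.K F), ?_, ?_, ?_⟩
  · rw [norm_neg]; exact a1.1
  · have : stageDot 1 (-(stageMul θ.Aᵀ pv - stageMul θ.Bᵀ pv' + h • stageMul θ.K F)) =
        -stageDot 1 (stageMul θ.Aᵀ pv - stageMul θ.Bᵀ pv' + h • stageMul θ.K F) :=
      map_neg (stageDotL 1) _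
    rw [this, norm_neg]
    refine a1.2.trans (le_of_eq ?_)
    ring
  · have key : stageMul θ.Aᵀ e - stageMul θ.Bᵀ (P (n + 1) - pv') + h • stageMul θ.K L -
        -(stageMul θ.Aᵀ pv - stageMul θ.Bᵀ pv' + h • stageMul θ.K F) =
        -(h • stageMul θ.K ((fun i => srcPhi f u (Y n i) (P n i)) - F - L)) := by
      simp only [he, stageMul_sub, hs, smul_sub]
      abel
    rw [key, norm_neg, norm_smul, Real.norm_of_nonneg hh]
    have a3 := (stageMul_norm_le θ.K _).trans (mul_le_mul_of_nonneg_left a2 (norm_nonneg _))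
    have a4 : κ * (ε / (κ + 1) * (‖E‖ + ‖e‖)) ≤ ε * (‖E‖ + ‖e‖) := by
      rw [← mul_assoc]
      refine mul_le_mul_of_nonneg_right ?_ (by positivity)
      rw [mul_div_assoc', div_le_iff₀ (by positivity)]
      nlinarith
    calc _ ≤ h * (ε * (‖E‖ + ‖e‖)) := mul_le_mul_of_nonneg_left (a3.trans a4) hh
      _ = _ := by ring

/-- The starting step in terms of the errors. -/
lemma exists_error_start (hS : SmoothSolution f u I T q Dy Dp) (hT : 0 ≤ T)
    (hord : θ.OrderConditions) (ρ : Fin (q + 2) → ℝ) :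
    ∃ M, 0 ≤ M ∧ ∃ r > 0, ∃ h₁ > 0, ∀ N h Y P, NearSolution θ f C u I T Dy Dp r N h Y P → h ≤ h₁ →
      ‖stageMul θ.A0 (stateError θ Dy h Y 0)‖ ≤
        M * h * (‖stateError θ Dy h Y 0‖ + ‖adjointError θ ρ Dp h P 0‖) + M * h ^ (q + 2) := by
  have h0T : (0 : ℝ) ∈ Icc 0 T := ⟨le_rfl, hT⟩
  obtain ⟨M, hM, h₁, hh₁, hres⟩ := hS.exists_start_residual hT ρ hord
  obtain ⟨L, hL, r, hr, h₂, hh₂, hlip⟩ := hS.exists_reference_lipschitz θ.c ρ θ.K0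
  obtain ⟨B, hB, hini⟩ := hS.exists_initial_adjoint (v := θ.v) hT ρ
    (fun k hk => hord.adj_init_moment (k := k) hk)
  obtain ⟨R, hR, L₂, hL₂, hl₂⟩ := hS.isCompact_image.exists_lipschitz_bound (Φ := srcField f u)
    (by rintro _ ⟨t, ht, rfl⟩; exact hS.smooth_field t ht)
  set ν := ‖stageDotL (m := m) θ.v‖ with hν
  set β := ‖θ.b‖ with hβ
  refine ⟨M + L + β * L₂ * (ν + B), by positivity, min r (R / 2 / (ν + 1)), by positivity,
    min (min 1 (R / 2 / (B + 1))) (min h₁ h₂), by positivity, fun N h Y P hN hle => ?_⟩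
  have hh := hN.pos.le
  have hle1 := hle.trans (min_le_left _ _)
  have hle2 := hle.trans (min_le_right _ _)
  have hh1 := hle1.trans (min_le_left _ _)
  have hc := hN.nodes 0 (Nat.zero_le _)
  have hnear := hN.near 0 (Nat.zero_le _)
  have hst := hN.start_fwd
  rw [stateError, adjointError]
  rw [Nat.cast_zero, zero_mul] at *
  have a1 := hres h hh (hle2.trans (min_le_left _ _)) hc
  have a2 := (hlip 0 h0T h hh (hle2.trans (min_le_right _ _)) hc (Y 0) (P 0)
    (fun j => ⟨(hnear j).1.trans (min_le_left _ _), (hnear j).2.trans (min_le_left _ _)⟩)).1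
  obtain ⟨a3, a4⟩ := hini h hh hh1 hc
  -- the interpolated value stays in the neighbourhood where the field is Lipschitz continuous
  have hpv : ‖stageDot θ.v (P 0) - Dp 0 0‖ ≤ R := by
    have b1 : ‖P 0 - stageVec (Dp 0) θ.c 0 h‖ ≤ R / 2 / (ν + 1) :=
      (pi_norm_le_iff_of_nonneg (by positivity)).2 fun j => (hnear j).2.trans (min_le_right _ _)
    have b2 := (stageDot_norm_le θ.v _).trans (mul_le_mul_of_nonneg_left b1 (norm_nonneg _))
    rw [stageDot_sub] at b2
    have b3 : ν * (R / 2 / (ν + 1)) ≤ R / 2 := by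
      rw [mul_div_assoc', div_le_iff₀ (by positivity)]
      nlinarith
    have b4 : B * h ^ (q + 1) ≤ R / 2 := by
      have c1 : h ^ (q + 1) ≤ h := by
        simpa using pow_le_pow_of_le_one hh hh1 (by omega : 1 ≤ q + 1)
      have c2 := hle1.trans (min_le_right _ _)
      rw [le_div_iff₀ (by positivity)] at c2
      nlinarith
    refine (norm_sub_le_norm_sub_add_norm_sub _ (stageDot θ.v (stageVec (Dp 0) θ.c 0 h)) _).trans ?_
    change _ ≤ ν * _ at b2
    linarith
  have a5 : ‖srcG f u (Dy 0 0) (stageDot θ.v (P 0)) - Dy 1 0‖ ≤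
      L₂ * ‖stageDot θ.v (P 0) - Dp 0 0‖ := by
    have b1 := hl₂ _ ⟨0, h0T, rfl⟩ (Dy 0 0, stageDot θ.v (P 0)) (by
      rw [Metric.mem_closedBall, dist_eq_norm, Prod.mk_sub_mk, sub_self]
      exact max_le (by rw [norm_zero]; exact hR.le) hpv) _ (Metric.mem_closedBall_self hR.le)
    have b2 : ‖(Dy 0 0, stageDot θ.v (P 0)) - (Dy 0 0, Dp 0 0)‖ =
        ‖stageDot θ.v (P 0) - Dp 0 0‖ := by
      rw [Prod.mk_sub_mk, sub_self, Prod.norm_def, norm_zero, max_eq_right (norm_nonneg _)]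
    rw [b2] at b1
    rw [hS.ode_y 0 (hS.subset h0T)]
    exact (norm_fst_le _).trans b1
  set E := Y 0 - stageVec (Dy 0) θ.c 0 h with hE
  set e := P 0 - correctedAdjoint ρ Dp q θ.c 0 h with he
  have a6 : ‖stageDot θ.v (P 0) - Dp 0 0‖ ≤ ν * ‖e‖ + B * h ^ (q + 1) := by
    refine (norm_sub_le_norm_sub_add_norm_sub _
      (stageDot θ.v (correctedAdjoint ρ Dp q θ.c 0 h)) _).trans (add_le_add ?_ a4)
    rw [← stageDot_sub]
    exact stageDot_norm_le _ _
  set yv := stageVec (Dy 0) θ.c 0 h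
  set G := stageG f u yv (correctedAdjoint ρ Dp q θ.c 0 h)
  set x := srcG f u (Dy 0 0) (stageDot θ.v (P 0))
  have key : stageMul θ.A0 E = h • stageTensor θ.b (x - Dy 1 0) +
      h • stageMul θ.K0 (stageG f u (Y 0) (P 0) - G) -
      (stageMul θ.A0 yv - stageTensor θ.a (Dy 0 0) - h • stageTensor θ.b (Dy 1 0) -
        h • stageMul θ.K0 G) := by
    rw [hE, stageMul_sub, hst, stageTensor_sub, stageMul_sub, smul_sub, smul_sub]
    abel
  rw [key]
  have b1 : ‖h • stageTensor θ.b (x - Dy 1 0)‖ ≤ h * (β * (L₂ * (ν * ‖e‖ + B * h ^ (q + 1)))) := by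
    rw [norm_smul, Real.norm_of_nonneg hh]
    refine mul_le_mul_of_nonneg_left ((stageTensor_norm_le _ _).trans
      (mul_le_mul_of_nonneg_left (a5.trans (mul_le_mul_of_nonneg_left a6 hL₂)) (norm_nonneg _))) hh
  have b2 : ‖h • stageMul θ.K0 (stageG f u (Y 0) (P 0) - G)‖ ≤ h * (L * (‖E‖ + ‖e‖)) := by
    rw [norm_smul, Real.norm_of_nonneg hh]
    exact mul_le_mul_of_nonneg_left a2 hh
  refine (norm_sub_le _ _).trans ((add_le_add ((norm_add_le _ _).trans (add_le_add b1 b2))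
    a1).trans ?_)
  have p1 : 0 ≤ h * (β * L₂ * ν * ‖E‖) := by positivity
  have p2 : 0 ≤ h * (M * (‖E‖ + ‖e‖)) := by positivity
  have p3 : 0 ≤ h * (β * L₂ * B * (‖E‖ + ‖e‖)) := by positivity
  have p4 : 0 ≤ (L + β * L₂ * ν) * h ^ (q + 2) := by positivity
  have e1 : h * (β * (L₂ * (ν * ‖e‖ + B * h ^ (q + 1)))) =
    h * (β * L₂ * ν * ‖e‖) + β * L₂ * B * h ^ (q + 2) := by ring
  rw [e1]
  linarith

end ErrorFields

/-! ### Errors of a Peer solution near the boundary -/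

section BoundaryFields

variable {m d q : ℕ} {f : (Fin m → ℝ) → (Fin d → ℝ) → (Fin m → ℝ)}
  {C : (Fin m → ℝ) → ℝ}
  {u : (Fin m → ℝ) → (Fin m → ℝ) → (Fin d → ℝ)} {I : Set ℝ} {T : ℝ}
  {Dy Dp : ℕ → ℝ → Fin m → ℝ} {θ : PeerTriplet (q + 2)} {ρ : Fin (q + 2) → ℝ}

/-- The last forward step in terms of the errors. -/
lemma exists_error_last (hS : SmoothSolution f u I T q Dy Dp)
    (hord : θ.OrderConditions) (ρ : Fin (q + 2) → ℝ) :
    ∃ M, 0 ≤ M ∧ ∃ r > 0, ∃ h₁ > 0, ∀ N h Y P, NearSolution θ f C u I T Dy Dp r N h Y P → h ≤ h₁ →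
      ‖stageMul θ.AN (stateError θ Dy h Y N) - stageMul θ.BN (stateError θ Dy h Y (N - 1))‖ ≤
        M * h * (‖stateError θ Dy h Y N‖ + ‖adjointError θ ρ Dp h P N‖) + M * h ^ (q + 2) := by
  obtain ⟨M, hM, h₁, hh₁, hres⟩ := hS.exists_forward_residual_order ρ
    (fun k hk => hord.fwd_last_moment (k := k) hk)
  obtain ⟨L, hL, r, hr, h₂, hh₂, hlip⟩ := hS.exists_reference_lipschitz θ.c ρ θ.KN
  refine ⟨M + L, by positivity, r, hr, min h₁ h₂, by positivity, fun N h Y P hN hle => ?_⟩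
  have hh := hN.pos.le
  have hN2 := hN.two_le
  have e0 := NearSolution.pred_mul (n := N) (by omega) h
  have a1 := hres _ (hN.mem (by omega : N ≤ N + 1)) h hh (hle.trans (min_le_left _ _))
    (hN.nodes N le_rfl) (by rw [← e0]; exact hN.nodes (N - 1) (by omega))
  have a2 := (hlip _ (hN.mem (by omega : N ≤ N + 1)) h hh (hle.trans (min_le_right _ _))
    (hN.nodes N le_rfl) (Y N) (P N) (hN.near N le_rfl)).1
  have hs := hN.last_fwd
  rw [← e0] at a1
  rw [stateError, stateError, adjointError]
  set E := Y N - stageVec (Dy 0) θ.c (N * h) h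
  set e := P N - correctedAdjoint ρ Dp q θ.c (N * h) h
  set yv := stageVec (Dy 0) θ.c (N * h) h
  set G := stageG f u yv (correctedAdjoint ρ Dp q θ.c (N * h) h)
  set yv' := stageVec (Dy 0) θ.c ((N - 1 : ℕ) * h) h
  have key : stageMul θ.AN E - stageMul θ.BN (Y (N - 1) - yv') =
      h • stageMul θ.KN (stageG f u (Y N) (P N) - G) -
      (stageMul θ.AN yv - stageMul θ.BN yv' - h • stageMul θ.KN G) := by
    simp only [E, stageMul_sub, hs, smul_sub]
    abel
  rw [key]
  have b1 := mul_le_mul_of_nonneg_left a2 hh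
  refine (norm_sub_le _ _).trans ?_
  rw [norm_smul, Real.norm_of_nonneg hh]
  have p1 : 0 ≤ M * h * (‖E‖ + ‖e‖) := by positivity
  have p2 : 0 ≤ L * h ^ (q + 2) := by positivity
  linarith

/-- An adjoint step near the boundary in terms of the errors. -/
lemma exists_error_adj (hS : SmoothSolution f u I T q Dy Dp) (ρ : Fin (q + 2) → ℝ)
    {A B K : Matrix (Fin (q + 2)) (Fin (q + 2)) ℝ}
    (hK : ∀ j, ∑ i, (θ.c i - θ.c j) * K i j = 0) (hfull : q + 2 ≤ 4 ∨ K.IsDiag)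
    (hord : ∀ k < q + 1,
      Aᵀ *ᵥ θ.c ^ k = Bᵀ *ᵥ (θ.c + 1) ^ k - (k : ℝ) • (Kᵀ *ᵥ θ.c ^ (k - 1))) :
    ∃ M, 0 ≤ M ∧ ∃ r > 0, ∃ h₁ > 0, ∀ N h Y P, NearSolution θ f C u I T Dy Dp r N h Y P → h ≤ h₁ →
      ∀ n < N, stageMul Aᵀ (P n) = stageMul Bᵀ (P (n + 1)) - h • stagePhi f u K (Y n) (P n) →
      h * ‖stageMul Aᵀ (adjointError θ ρ Dp h P n) -
          stageMul Bᵀ (adjointError θ ρ Dp h P (n + 1))‖ ≤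
        h * (M * h * (‖stateError θ Dy h Y n‖ + ‖adjointError θ ρ Dp h P n‖)) +
          M * h ^ (q + 2) := by
  obtain ⟨M, hM, h₁, hh₁, hres⟩ := hS.exists_adjoint_residual_order ρ hK hfull hord
  obtain ⟨L, hL, r, hr, h₂, hh₂, hlip⟩ := hS.exists_reference_lipschitz θ.c ρ K
  refine ⟨M + L, by positivity, r, hr, min h₁ h₂, by positivity, fun N h Y P hN hle n hn hs => ?_⟩
  have hh := hN.pos.le
  have e0 := NearSolution.succ_mul' n h
  have a1 := hres _ (hN.mem (by omega : n ≤ N + 1)) h hh (hle.trans (min_le_left _ _))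
    (hS.subset (hN.succ_mem hn.le)) (hN.nodes n hn.le)
    (by rw [← e0]; exact hN.nodes (n + 1) hn)
  have a2 := (hlip _ (hN.mem (by omega : n ≤ N + 1)) h hh (hle.trans (min_le_right _ _))
    (hN.nodes n hn.le) (Y n) (P n) (hN.near n hn.le)).2
  rw [adjointResidual, ← e0] at a1
  rw [adjointError, adjointError, stateError]
  set E := Y n - stageVec (Dy 0) θ.c (n * h) h
  set pv := correctedAdjoint ρ Dp q θ.c (n * h) h
  set e := P n - pv with he
  set Φ := stagePhi f u K (stageVec (Dy 0) θ.c (n * h) h) pv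
  set pv' := correctedAdjoint ρ Dp q θ.c ((n + 1 : ℕ) * h) h
  have key : stageMul Aᵀ e - stageMul Bᵀ (P (n + 1) - pv') =
      -(h • (stagePhi f u K (Y n) (P n) - Φ)) -
      (stageMul Aᵀ pv - stageMul Bᵀ pv' + h • Φ) := by
    simp only [he, stageMul_sub, hs, smul_sub]
    abel
  rw [key]
  have b1 := mul_le_mul_of_nonneg_left a2 hh
  have b2 : ‖-(h • (stagePhi f u K (Y n) (P n) - Φ)) -
      (stageMul Aᵀ pv - stageMul Bᵀ pv' + h • Φ)‖ ≤ h * (L * (‖E‖ + ‖e‖)) + M * h ^ (q + 1) := by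
    refine (norm_sub_le _ _).trans (add_le_add ?_ a1)
    rw [norm_neg, norm_smul, Real.norm_of_nonneg hh]
    exact b1
  have b3 := mul_le_mul_of_nonneg_left b2 hh
  have p1 : 0 ≤ h * (M * h * (‖E‖ + ‖e‖)) := by positivity
  have p2 : 0 ≤ L * h ^ (q + 2) := by positivity
  have e1 : h * (h * (L * (‖E‖ + ‖e‖)) + M * h ^ (q + 1)) =
    h * (L * h * (‖E‖ + ‖e‖)) + M * h ^ (q + 2) := by ring
  linarith

/-- The end condition of the adjoint: its linearization, up to a relative perturbation `ε`. -/
lemma exists_error_gradient (hS : SmoothSolution f u I T q Dy Dp) (hT : 0 ≤ T)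
    (hord : θ.OrderConditions) (hC : ContDiffAt ℝ 2 C (Dy 0 T))
    (hfin : Dp 0 T = gradC C (Dy 0 T)) {ε : ℝ} (hε : 0 < ε) :
    ∃ M, 0 ≤ M ∧ ∃ r > 0, ∃ h₁ > 0, ∀ N h Y P, NearSolution θ f C u I T Dy Dp r N h Y P → h ≤ h₁ →
      ‖gradC C (stageDot θ.w (Y N)) - Dp 0 T -
        fderiv ℝ (gradC C) (Dy 0 T) (stageDot θ.w (stateError θ Dy h Y N))‖ ≤
        ε * ‖stateError θ Dy h Y N‖ + M * h ^ (q + 2) := by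
  obtain ⟨B, hB, hend⟩ := hS.exists_end_value hT (fun k hk => hord.fwd_end_moment (k := k) hk)
  set ν := ‖stageDotL (m := m) θ.w‖ with hν
  have hd := (hC.gradC.differentiableAt (by norm_num)).hasFDerivAt.isLittleO
  have hd2 := hd.def (show 0 < ε / (ν + 1) by positivity)
  obtain ⟨R, hR, hball⟩ := Metric.eventually_nhds_iff_ball.1 hd2
  set Q := fderiv ℝ (gradC C) (Dy 0 T) with hQ
  refine ⟨(ε + ‖Q‖) * B, by positivity, R / 4 / (ν + 1), by positivity,
    min 1 (R / 4 / (B + 1)), by positivity, fun N h Y P hN hle => ?_⟩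
  have hh := hN.pos.le
  have hh1 := hle.trans (min_le_left _ _)
  have eN : (N : ℝ) * h = T - h := by rw [← hN.mesh]; ring
  have hhT : h ≤ T := by
    have := (hN.mem (by omega : N ≤ N + 1)).1
    linarith
  have hc := hN.nodes N le_rfl
  rw [eN] at hc
  have a1 := hend h hh hhT hc
  have hnear := hN.near N le_rfl
  rw [eN] at hnear
  rw [stateError, eN]
  set yv := stageVec (Dy 0) θ.c (T - h) h
  set E := Y N - yv with hE
  have hBh : B * h ^ (q + 2) ≤ R / 4 := by
    have c1 : h ^ (q + 2) ≤ h := by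
      simpa using pow_le_pow_of_le_one hh hh1 (by omega : 1 ≤ q + 2)
    have c2 := hle.trans (min_le_right _ _)
    rw [le_div_iff₀ (by positivity)] at c2
    nlinarith
  have hEr : ‖E‖ ≤ R / 4 / (ν + 1) :=
    (pi_norm_le_iff_of_nonneg (by positivity)).2 fun j => (hnear j).1
  have hνE : ν * ‖E‖ ≤ R / 4 := by
    refine (mul_le_mul_of_nonneg_left hEr (norm_nonneg _)).trans ?_
    rw [mul_div_assoc', div_le_iff₀ (by positivity)]
    nlinarith
  have e1 : stageDot θ.w (Y N) = stageDot θ.w E + stageDot θ.w yv := by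
    rw [← stageDot_add, hE, sub_add_cancel]
  have a2 : ‖stageDot θ.w (Y N) - Dy 0 T‖ ≤ ν * ‖E‖ + B * h ^ (q + 2) := by
    rw [e1, add_sub_assoc]
    exact (norm_add_le _ _).trans (add_le_add (stageDot_norm_le _ _) a1)
  have a3 := hball (stageDot θ.w (Y N)) (by
    rw [Metric.mem_ball, dist_eq_norm]; linarith)
  rw [← hfin] at a3
  have e2 : gradC C (stageDot θ.w (Y N)) - Dp 0 T - Q (stageDot θ.w E) =
      (gradC C (stageDot θ.w (Y N)) - Dp 0 T - Q (stageDot θ.w (Y N) - Dy 0 T)) +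
        Q (stageDot θ.w yv - Dy 0 T) := by
    rw [e1, add_sub_assoc, map_add]
    abel
  rw [e2]
  refine (norm_add_le _ _).trans ?_
  have a4 := Q.le_opNorm_of_le a1
  have a5 := a3.trans (mul_le_mul_of_nonneg_left a2 (by positivity))
  have hεν : ε / (ν + 1) * ν ≤ ε := by
    rw [div_mul_eq_mul_div, div_le_iff₀ (by positivity)]
    nlinarith [norm_nonneg (stageDotL (m := m) θ.w)]
  have hε1 : ε / (ν + 1) ≤ ε := div_le_self hε.le (by linarith [norm_nonneg (stageDotL (m := m) θ.w)])
  have a6 : ε / (ν + 1) * (ν * ‖E‖ + B * h ^ (q + 2)) ≤ ε * ‖E‖ + ε * (B * h ^ (q + 2)) := by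
    rw [mul_add, ← mul_assoc]
    exact add_le_add (mul_le_mul_of_nonneg_right hεν (norm_nonneg _))
      (mul_le_mul_of_nonneg_right hε1 (by positivity))
  linarith

/-- The last adjoint equation in terms of the errors. -/
lemma exists_error_end (hS : SmoothSolution f u I T q Dy Dp) (hT : 0 ≤ T)
    (hord : θ.OrderConditions) (ρ : Fin (q + 2) → ℝ) (hfull : q + 2 ≤ 4 ∨ θ.KN.IsDiag)
    (hC : ContDiffAt ℝ 2 C (Dy 0 T)) (hfin : Dp 0 T = gradC C (Dy 0 T)) :
    ∃ M, 0 ≤ M ∧ ∃ r > 0, ∃ h₁ > 0, ∀ N h Y P, NearSolution θ f C u I T Dy Dp r N h Y P → h ≤ h₁ →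
      h * ‖stageMul θ.ANᵀ (adjointError θ ρ Dp h P N)‖ ≤
        M * h * (‖stateError θ Dy h Y N‖ + h * ‖adjointError θ ρ Dp h P N‖) + M * h ^ (q + 2) := by
  have hw : θ.w ⬝ᵥ (1 : Fin (q + 2) → ℝ) = 1 := by
    simpa using hord.fwd_end_moment (k := 0) (by omega)
  obtain ⟨M, hM, h₁, hh₁, hres⟩ := hS.exists_adjoint_end_residual_order ρ hw hord.oneleg_end hfull
    (fun k hk => hord.adj_end_moment (k := k) hk)
  obtain ⟨L, hL, r, hr, h₂, hh₂, hlip⟩ := hS.exists_reference_lipschitz θ.c ρ θ.KN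
  obtain ⟨B, hB, r', hr', h₃, hh₃, hgr⟩ := exists_error_gradient hS hT hord hC hfin one_pos
  set Q := fderiv ℝ (gradC C) (Dy 0 T) with hQ
  set ν := ‖stageDotL (m := m) θ.w‖ with hν
  set ω := ‖θ.w‖ with hω
  refine ⟨M + L + ω * (‖Q‖ * ν + 1) + ω * B, by positivity, min r r', by positivity,
    min (min 1 h₁) (min h₂ h₃), by positivity, fun N h Y P hN hle => ?_⟩
  have hh := hN.pos.le
  have hh1 := (hle.trans (min_le_left _ _)).trans (min_le_left _ _)
  have hle' := hle.trans (min_le_right _ _)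
  have eN : (N : ℝ) * h + h = T := by rw [← hN.mesh]; ring
  have a1 := hres _ (hN.mem (by omega : N ≤ N + 1)) h hh
    ((hle.trans (min_le_left _ _)).trans (min_le_right _ _))
    (hS.subset (hN.succ_mem le_rfl)) (hN.nodes N le_rfl)
  have a2 := (hlip _ (hN.mem (by omega : N ≤ N + 1)) h hh (hle'.trans (min_le_left _ _))
    (hN.nodes N le_rfl) (Y N) (P N) ((hN.mono (min_le_left _ _)).near N le_rfl)).2
  have a3 := hgr N h Y P (hN.mono (min_le_right _ _)) (hle'.trans (min_le_right _ _))
  have hs := hN.end_adj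
  rw [adjointEndResidual, eN] at a1
  rw [stateError] at a3 ⊢
  rw [adjointError]
  set E := Y N - stageVec (Dy 0) θ.c (N * h) h
  set pv := correctedAdjoint ρ Dp q θ.c (N * h) h
  set e := P N - pv with he
  set Φ := stagePhi f u θ.KN (stageVec (Dy 0) θ.c (N * h) h) pv
  set g := gradC C (stageDot θ.w (Y N))
  have key : stageMul θ.ANᵀ e = stageTensor θ.w (g - Dp 0 T) -
      h • (stagePhi f u θ.KN (Y N) (P N) - Φ) -
      (stageMul θ.ANᵀ pv - stageTensor θ.w (Dp 0 T) + h • Φ) := by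
    rw [he, stageMul_sub, hs, smul_sub, stageTensor_sub]
    abel
  have b1 : ‖g - Dp 0 T‖ ≤ (‖Q‖ * ν + 1) * ‖E‖ + B * h ^ (q + 2) := by
    have c1 := norm_le_norm_sub_add (g - Dp 0 T) (Q (stageDot θ.w E))
    have c2 := Q.le_opNorm_of_le (stageDot_norm_le θ.w E)
    change _ ≤ ‖Q‖ * (ν * ‖E‖) at c2
    linarith
  have b2 := mul_le_mul_of_nonneg_left a2 hh
  have b3 : ‖stageMul θ.ANᵀ e‖ ≤ ω * ((‖Q‖ * ν + 1) * ‖E‖ + B * h ^ (q + 2)) +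
      h * (L * (‖E‖ + ‖e‖)) + M * h ^ (q + 1) := by
    rw [key]
    refine (norm_sub_le _ _).trans (add_le_add ((norm_sub_le _ _).trans (add_le_add ?_ ?_)) a1)
    · exact (stageTensor_norm_le _ _).trans (mul_le_mul_of_nonneg_left b1 (norm_nonneg _))
    · rw [norm_smul, Real.norm_of_nonneg hh]
      exact b2
  have b4 := mul_le_mul_of_nonneg_left b3 hh
  have c1 : h * (L * h * ‖E‖) ≤ h * (L * 1 * ‖E‖) := by gcongr
  have c2 : h * (ω * B * h ^ (q + 2)) ≤ 1 * (ω * B * h ^ (q + 2)) := by gcongr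
  have p1 : 0 ≤ h * ((M + ω * B) * ‖E‖) := by positivity
  have p2 : 0 ≤ h * ((M + ω * (‖Q‖ * ν + 1) + ω * B) * (h * ‖e‖)) := by positivity
  have p3 : 0 ≤ (L + ω * (‖Q‖ * ν + 1)) * h ^ (q + 2) := by positivity
  have e1 : h * (ω * ((‖Q‖ * ν + 1) * ‖E‖ + B * h ^ (q + 2)) +
      h * (L * (‖E‖ + ‖e‖)) + M * h ^ (q + 1)) = h * (ω * (‖Q‖ * ν + 1) * ‖E‖) +
      h * (ω * B * h ^ (q + 2)) + h * (L * h * ‖E‖) + h * (L * (h * ‖e‖)) + M * h ^ (q + 2) := by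
    ring
  linarith

/-- The mean of the last two adjoint equations in terms of the errors. -/
lemma exists_error_mean_end (hS : SmoothSolution f u I T q Dy Dp) (hT : 0 ≤ T)
    (hord : θ.OrderConditions) (hK : θ.K.IsDiag) (hsup : θ.Superconvergence)
    (hρ : θ.IsCorrector ρ) (hfull : q + 2 ≤ 4 ∨ θ.KN.IsDiag) (hN1 : θ.AN *ᵥ 1 = θ.BN *ᵥ 1)
    (hKN2 : q = 2 → ∑ i, ∑ j, θ.KN j i * (θ.c j - θ.c i) ^ 2 = 0)
    (hC : ContDiffAt ℝ 2 C (Dy 0 T)) (hfin : Dp 0 T = gradC C (Dy 0 T)) :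
    ∃ κ, 0 ≤ κ ∧ ∀ ε > 0,
    ∃ M, 0 ≤ M ∧ ∃ r > 0, ∃ h₁ > 0, ∀ N h Y P, NearSolution θ f C u I T Dy Dp r N h Y P → h ≤ h₁ →
      ‖stageDot 1 (stageMul θ.Aᵀ (adjointError θ ρ Dp h P (N - 1)) -
          stageMul θ.BNᵀ (adjointError θ ρ Dp h P N)) +
        stageDot 1 (stageMul θ.ANᵀ (adjointError θ ρ Dp h P N) -
          stageTensor θ.w (fderiv ℝ (gradC C) (Dy 0 T)
            (stageDot θ.w (stateError θ Dy h Y N))))‖ ≤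
      κ * h * (‖stateError θ Dy h Y (N - 1)‖ + ‖adjointError θ ρ Dp h P (N - 1)‖ +
        ‖stateError θ Dy h Y N‖ + ‖adjointError θ ρ Dp h P N‖) +
        ε * ‖stateError θ Dy h Y N‖ + M * h ^ (q + 2) := by
  have hw : (1 : Fin (q + 2) → ℝ) ⬝ᵥ θ.w = 1 := by
    rw [dotProduct_comm]
    simpa using hord.fwd_end_moment (k := 0) (by omega)
  obtain ⟨L₁, hL₁, r₁, hr₁, h₁, hh₁, hlip₁⟩ := hS.exists_reference_lipschitz θ.c ρ θ.K
  obtain ⟨L₂, hL₂, r₂, hr₂, h₂, hh₂, hlip₂⟩ := hS.exists_reference_lipschitz θ.c ρ θ.KN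
  obtain ⟨M, hM, h₃, hh₃, hres⟩ := hS.exists_adjoint_mean_end hord hK hsup hρ hfull hN1 hKN2
  set ν := ‖stageDotL (m := m) (1 : Fin (q + 2) → ℝ)‖ with hν
  refine ⟨ν * L₁ + ν * L₂, by positivity, fun ε hε => ?_⟩
  obtain ⟨B, hB, r₃, hr₃, h₄, hh₄, hgr⟩ := exists_error_gradient hS hT hord hC hfin hε
  set Q := fderiv ℝ (gradC C) (Dy 0 T) with hQ
  refine ⟨M + B, by positivity, min r₁ (min r₂ r₃), by positivity,
    min (min h₁ h₂) (min h₃ h₄), by positivity, fun N h Y P hN hle => ?_⟩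
  have hh := hN.pos.le
  have hN2 := hN.two_le
  have hle1 := hle.trans (min_le_left _ _)
  have hle2 := hle.trans (min_le_right _ _)
  have e0 : ((N - 1 : ℕ) : ℝ) * h + h = N * h := by
    rw [NearSolution.pred_mul (by omega : 1 ≤ N)]; ring
  have eN : (N : ℝ) * h + h = T := by rw [← hN.mesh]; ring
  have hr2 : min r₁ (min r₂ r₃) ≤ r₂ := (min_le_right _ _).trans (min_le_left _ _)
  have hr3 : min r₁ (min r₂ r₃) ≤ r₃ := (min_le_right _ _).trans (min_le_right _ _)
  have a1 := (hlip₁ _ (hN.mem (by omega : N - 1 ≤ N + 1)) h hh (hle1.trans (min_le_left _ _))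
    (hN.nodes (N - 1) (by omega)) (Y (N - 1)) (P (N - 1))
    ((hN.mono (min_le_left _ _)).near (N - 1) (by omega))).2
  have a2 := (hlip₂ _ (hN.mem (by omega : N ≤ N + 1)) h hh (hle1.trans (min_le_right _ _))
    (hN.nodes N le_rfl) (Y N) (P N) ((hN.mono hr2).near N le_rfl)).2
  have a3 := hgr N h Y P (hN.mono hr3) (hle2.trans (min_le_right _ _))
  have a4 := hres _ (hN.mem (by omega : N - 1 ≤ N + 1)) h hh (hle2.trans (min_le_left _ _))
    (by rw [e0]; exact hN.mem (by omega)) (by rw [e0, eN]; exact hS.subset ⟨hT, le_rfl⟩)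
    (hN.nodes (N - 1) (by omega)) (by rw [e0]; exact hN.nodes N le_rfl)
  have hs1 := hN.last_adj
  have hs2 := hN.end_adj
  rw [adjointResidual, adjointEndResidual, e0, eN] at a4
  rw [stateError] at a3
  rw [stateError, stateError, adjointError, adjointError]
  set E := Y N - stageVec (Dy 0) θ.c (N * h) h
  set E' := Y (N - 1) - stageVec (Dy 0) θ.c ((N - 1 : ℕ) * h) h
  set pv := correctedAdjoint ρ Dp q θ.c (N * h) h
  set pv' := correctedAdjoint ρ Dp q θ.c ((N - 1 : ℕ) * h) h
  set e := P N - pv with he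
  set e' := P (N - 1) - pv' with he'
  set Φ := stagePhi f u θ.KN (stageVec (Dy 0) θ.c (N * h) h) pv
  set Φ' := stagePhi f u θ.K (stageVec (Dy 0) θ.c ((N - 1 : ℕ) * h) h) pv'
  set g := gradC C (stageDot θ.w (Y N))
  have key : stageDot 1 (stageMul θ.Aᵀ e' - stageMul θ.BNᵀ e) +
        stageDot 1 (stageMul θ.ANᵀ e - stageTensor θ.w (Q (stageDot θ.w E))) =
      (g - Dp 0 T - Q (stageDot θ.w E)) -
      h • stageDot 1 (stagePhi f u θ.K (Y (N - 1)) (P (N - 1)) - Φ') -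
      h • stageDot 1 (stagePhi f u θ.KN (Y N) (P N) - Φ) -
      (stageDot 1 (stageMul θ.Aᵀ pv' - stageMul θ.BNᵀ pv + h • Φ') +
        stageDot 1 (stageMul θ.ANᵀ pv - stageTensor θ.w (Dp 0 T) + h • Φ)) := by
    simp only [he, he', stageMul_sub, hs1, hs2, stageDot_sub, stageDot_add, stageDot_smul,
      stageDot_stageTensor, hw, one_smul, smul_sub]
    abel
  rw [key]
  have b1 : ‖h • stageDot 1 (stagePhi f u θ.K (Y (N - 1)) (P (N - 1)) - Φ')‖ ≤
      h * (ν * (L₁ * (‖E'‖ + ‖e'‖))) := by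
    rw [norm_smul, Real.norm_of_nonneg hh]
    exact mul_le_mul_of_nonneg_left ((stageDot_norm_le _ _).trans
      (mul_le_mul_of_nonneg_left a1 (norm_nonneg _))) hh
  have b2 : ‖h • stageDot 1 (stagePhi f u θ.KN (Y N) (P N) - Φ)‖ ≤
      h * (ν * (L₂ * (‖E‖ + ‖e‖))) := by
    rw [norm_smul, Real.norm_of_nonneg hh]
    exact mul_le_mul_of_nonneg_left ((stageDot_norm_le _ _).trans
      (mul_le_mul_of_nonneg_left a2 (norm_nonneg _))) hh
  refine (norm_sub_le _ _).trans ((add_le_add ((norm_sub_le _ _).trans (add_le_add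
    ((norm_sub_le _ _).trans (add_le_add a3 b1)) b2)) a4).trans ?_)
  have p1 : 0 ≤ h * (ν * L₁ * (‖E‖ + ‖e‖)) := by positivity
  have p2 : 0 ≤ h * (ν * L₂ * (‖E'‖ + ‖e'‖)) := by positivity
  linarith

end BoundaryFields

/-! ### Global errors -/

section GlobalError

variable {m d q : ℕ} {f : (Fin m → ℝ) → (Fin d → ℝ) → (Fin m → ℝ)}
  {C : (Fin m → ℝ) → ℝ}
  {u : (Fin m → ℝ) → (Fin m → ℝ) → (Fin d → ℝ)} {I : Set ℝ} {T : ℝ}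
  {Dy Dp : ℕ → ℝ → Fin m → ℝ} {θ : PeerTriplet (q + 2)}

/-- For methods with four stages, the quadratic moment of the one-leg conditions vanishes for the
end method. -/
lemma PeerTriplet.sum_KN_mul_sub_sq (hord : θ.OrderConditions) (hK : θ.K.IsDiag)
    (hsup : θ.Superconvergence) (hq : q = 2) :
    ∑ i, ∑ j, θ.KN j i * (θ.c j - θ.c i) ^ 2 = 0 := by
  subst hq
  have h1 := form_KN_oneleg (n := 2) hord (fun y => y)
  have h2 := form_KN_sq hord hK hsup
  have e1 : (fun x y : ℝ => (x - y) ^ 2) = ((fun x _ : ℝ => x ^ 2) - (2 : ℝ) • (fun x y : ℝ => x * y)) +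
      (fun _ y : ℝ => y ^ 2) := by
    funext x y
    simp only [Pi.add_apply, Pi.sub_apply, Pi.smul_apply, smul_eq_mul]
    ring
  have e2 : (fun _ y : ℝ => y * y) = fun _ y : ℝ => y ^ 2 := by funext x y; ring
  rw [e2] at h1
  have h3 : nodeForm θ.KN θ.c (fun x y => (x - y) ^ 2) = 0 := by
    rw [e1, map_add, map_sub, map_smul, h1, h2, smul_eq_mul]
    ring
  rw [Finset.sum_comm]
  exact h3

/-- The errors of a Peer solution near the exact solution satisfy the perturbed linearized
equations, with an arbitrarily small relative perturbation and with defects of order `s`. -/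
lemma exists_perturbedLinearization {ρ : Fin (q + 2) → ℝ} (hS : SmoothSolution f u I T q Dy Dp)
    (hT : 0 ≤ T) (hord : θ.OrderConditions) (hK : θ.K.IsDiag) (hsup : θ.Superconvergence)
    (hρ : θ.IsCorrector ρ) (hfull : q + 2 ≤ 4 ∨ (θ.K0.IsDiag ∧ θ.KN.IsDiag))
    (hN1 : θ.AN *ᵥ 1 = θ.BN *ᵥ 1) (hC : ContDiffAt ℝ 2 C (Dy 0 T))
    (hfin : Dp 0 T = gradC C (Dy 0 T)) :
    ∃ c, ∀ ε > 0, ∃ M, 0 ≤ M ∧ ∃ r > 0, ∃ h₁ > 0, ∀ N h Y P,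
      NearSolution θ f C u I T Dy Dp r N h Y P → h ≤ h₁ →
      PerturbedLinearization θ (fun t => fderiv ℝ (srcField f u) (Dy 0 t, Dp 0 t))
        (fderiv ℝ (gradC C) (Dy 0 T)) N h ε c (M * h ^ (q + 2)) (stateError θ Dy h Y)
        (adjointError θ ρ Dp h P) := by
  obtain ⟨M₁, hM₁, r₁, hr₁, h₁, hh₁, b₁⟩ := exists_error_start (C := C) hS hT hord ρ
  obtain ⟨M₂, hM₂, r₂, hr₂, h₂, hh₂, b₂⟩ := exists_error_last (C := C) hS hord ρ
  obtain ⟨M₃, hM₃, r₃, hr₃, h₃, hh₃, b₃⟩ := exists_error_adj (C := C) hS ρ hord.oneleg_start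
    (hfull.imp_right And.left) (fun k hk => hord.adj_start_moment (k := k) hk)
  obtain ⟨M₄, hM₄, r₄, hr₄, h₄, hh₄, b₄⟩ := exists_error_adj (C := C) hS ρ
    (sum_sub_mul_eq_zero_of_isDiag hK θ.c) (Or.inr hK)
    (fun k hk => hord.adj_last_moment (k := k) hk)
  obtain ⟨M₅, hM₅, r₅, hr₅, h₅, hh₅, b₅⟩ := exists_error_end hS hT hord ρ
    (hfull.imp_right And.right) hC hfin
  obtain ⟨κ, hκ, b₆⟩ := exists_error_mean_end hS hT hord hK hsup hρ (hfull.imp_right And.right) hN1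
    (PeerTriplet.sum_KN_mul_sub_sq hord hK hsup) hC hfin
  refine ⟨M₁ + M₂ + M₃ + M₄ + M₅ + κ, fun ε hε => ?_⟩
  obtain ⟨M₆, hM₆, r₆, hr₆, h₆, hh₆, b₆⟩ := b₆ ε hε
  obtain ⟨M₇, hM₇, r₇, hr₇, h₇, hh₇, b₇⟩ := exists_error_step (C := C) hS hord hsup hρ hε
  obtain ⟨M₈, hM₈, r₈, hr₈, h₈, hh₈, b₈⟩ := exists_error_adj_step (C := C) hS hord hK hsup hρ hε
  set c := M₁ + M₂ + M₃ + M₄ + M₅ + κ with hc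
  set M := M₁ + M₂ + M₃ + M₄ + M₅ + M₆ + M₇ + M₈ with hM
  obtain ⟨r, hr, hr'⟩ : ∃ r > 0, r ≤ r₁ ∧ r ≤ r₂ ∧ r ≤ r₃ ∧ r ≤ r₄ ∧ r ≤ r₅ ∧ r ≤ r₆ ∧ r ≤ r₇ ∧
      r ≤ r₈ := ⟨min r₁ (min r₂ (min r₃ (min r₄ (min r₅ (min r₆ (min r₇ r₈)))))), by positivity,
        by simp⟩
  obtain ⟨h₀, hh₀, hh'⟩ : ∃ h₀ > 0, h₀ ≤ h₁ ∧ h₀ ≤ h₂ ∧ h₀ ≤ h₃ ∧ h₀ ≤ h₄ ∧ h₀ ≤ h₅ ∧ h₀ ≤ h₆ ∧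
      h₀ ≤ h₇ ∧ h₀ ≤ h₈ := ⟨min h₁ (min h₂ (min h₃ (min h₄ (min h₅ (min h₆ (min h₇ h₈)))))),
        by positivity, by simp⟩
  obtain ⟨s1, s2, s3, s4, s5, s6, s7, s8⟩ := hr'
  obtain ⟨t1, t2, t3, t4, t5, t6, t7, t8⟩ := hh'
  refine ⟨M, by positivity, r, hr, h₀, hh₀, fun N h Y P hN hle => ?_⟩
  have hh := hN.pos.le
  have hN2 := hN.two_le
  have hD : ∀ M', M' ≤ M → M' * h ^ (q + 2) ≤ M * h ^ (q + 2) := fun M' h' =>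
    mul_le_mul_of_nonneg_right h' (by positivity)
  have hcx : ∀ M' x, M' ≤ c → 0 ≤ x → M' * h * x ≤ c * h * x := fun M' x h' hx =>
    mul_le_mul_of_nonneg_right (mul_le_mul_of_nonneg_right h' hh) hx
  refine ⟨?_, ?_, ?_, ?_, ?_, ?_, ?_, ?_⟩
  · exact (b₁ N h Y P (hN.mono s1) (hle.trans t1)).trans
      (add_le_add (hcx _ _ (by linarith) (by positivity)) (hD _ (by linarith)))
  · intro n n1 n2
    obtain ⟨σ, σ1, σ2, σ3⟩ := b₇ N h Y P (hN.mono s7) (hle.trans t7) n n1 n2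
    exact ⟨σ, σ1.trans (hD _ (by linarith)),
      σ2.trans (mul_le_mul_of_nonneg_left (hD _ (by linarith)) hh), σ3⟩
  · exact (b₂ N h Y P (hN.mono s2) (hle.trans t2)).trans
      (add_le_add (hcx _ _ (by linarith) (by positivity)) (hD _ (by linarith)))
  · exact (b₃ N h Y P (hN.mono s3) (hle.trans t3) 0 (by omega) hN.start_adj).trans
      (add_le_add (mul_le_mul_of_nonneg_left (hcx _ _ (by linarith) (by positivity)) hh)
        (hD _ (by linarith)))
  · intro n n1 n2
    obtain ⟨σ, σ1, σ2, σ3⟩ := b₈ N h Y P (hN.mono s8) (hle.trans t8) n n1 n2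
    exact ⟨σ, σ1.trans (hD _ (by linarith)),
      σ2.trans (mul_le_mul_of_nonneg_left (hD _ (by linarith)) hh), σ3⟩
  · have e1 : N - 1 + 1 = N := by omega
    have := b₄ N h Y P (hN.mono s4) (hle.trans t4) (N - 1) (by omega) (by
      rw [e1]; exact hN.last_adj)
    rw [e1] at this
    exact this.trans
      (add_le_add (mul_le_mul_of_nonneg_left (hcx _ _ (by linarith) (by positivity)) hh)
        (hD _ (by linarith)))
  · exact (b₅ N h Y P (hN.mono s5) (hle.trans t5)).trans
      (add_le_add (hcx _ _ (by linarith) (by positivity)) (hD _ (by linarith)))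
  · exact (b₆ N h Y P (hN.mono s6) (hle.trans t6)).trans
      (add_le_add (add_le_add (hcx _ _ (by linarith) (by positivity)) le_rfl)
        (hD _ (by linarith)))

/-- For small `h` the nodes of all intervals stay in the interval on which the solution exists. -/
lemma exists_nodesIn {s : ℕ} {c : Fin s → ℝ} {T δ : ℝ} (hδ : 0 ≤ δ)
    (hc : 0 < δ ∨ ∀ j, c j ∈ Icc (0 : ℝ) 1) :
    ∃ h₁ > 0, ∀ h, 0 ≤ h → h ≤ h₁ → ∀ t, 0 ≤ t → t + h ≤ T →
      NodesIn (Icc (-δ) (T + δ)) c t h := by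
  rcases hc with hδ' | hc
  · refine ⟨δ / (‖c‖ + 1), by positivity, fun h hh hle t ht htT j => ?_⟩
    have h1 : ‖c‖ * h ≤ δ := by
      rw [le_div_iff₀ (by positivity)] at hle
      linarith
    have h2 : |c j * h| ≤ ‖c‖ * h := by
      rw [abs_mul, abs_of_nonneg hh]
      exact mul_le_mul_of_nonneg_right (norm_le_pi_norm c j) hh
    have h3 := abs_le.1 (h2.trans h1)
    exact ⟨by linarith [h3.1], by linarith [h3.2]⟩
  · refine ⟨1, one_pos, fun h hh _ t ht htT j => ?_⟩
    have h1 := mul_nonneg (hc j).1 hh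
    have h2 := mul_le_of_le_one_left hh (hc j).2
    exact ⟨by linarith, by linarith⟩

end GlobalError

end

theorem mainTheorem1 {s m d : ℕ} (hs : 1 < s)
    (θ : PeerTriplet s) (hadm : θ.Admissible) (hord : θ.OrderConditions)
    (hfull : s ≤ 4 ∨ (θ.K0.IsDiag ∧ θ.KN.IsDiag))
    (hsup : θ.Superconvergence) (hdom : OneStrictlyDominant (θ.A⁻¹ * θ.B))
    (f : (Fin m → ℝ) → (Fin d → ℝ) → (Fin m → ℝ)) (C : (Fin m → ℝ) → ℝ)
    (Uad : Set (Fin d → ℝ)) (hUclosed : IsClosed Uad) (hUconvex : Convex ℝ Uad)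
    (u : (Fin m → ℝ) → (Fin m → ℝ) → (Fin d → ℝ)) (y0 : Fin m → ℝ)
    (T : ℝ) (hT : 0 < T) (δ : ℝ) (hδ : 0 ≤ δ)
    (hnodes : 0 < δ ∨ ∀ j, θ.c j ∈ Set.Icc (0 : ℝ) 1)
    (y p : ℝ → Fin m → ℝ) (hyp : SolvesBVP f C u y0 T δ y p)
    (hy : ContDiffOn ℝ (s + 1) y (Set.Icc (-δ) (T + δ)))
    (hp : ContDiffOn ℝ s p (Set.Icc (-δ) (T + δ)))
    (hf : ∀ t ∈ Set.Icc (-δ) (T + δ),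
      ContDiffAt ℝ (s + 1) (Function.uncurry f) (y t, u (y t) (p t)))
    (hu : ∀ t ∈ Set.Icc (-δ) (T + δ), ContDiffAt ℝ s (Function.uncurry u) (y t, p t))
    (hC : ContDiffAt ℝ 2 C (y T))
    (hmin : ∀ t ∈ Set.Icc (-δ) (T + δ), ∀ᶠ z in 𝓝 (y t, p t),
      IsLocallyUniqueMinimizer Uad (fun v => z.2 ⬝ᵥ f z.1 v) (u z.1 z.2))
    (hcoer : Coercive f C Uad u T y p) :
    ∃ r > 0, ∃ h₀ > 0, ∃ M : ℝ, ∀ (N : ℕ) (h : ℝ), h = T / (N + 1) → h ≤ h₀ →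
      ∀ Y P : ℕ → Fin s → Fin m → ℝ, IsPeerSolution θ f C u y0 h N Y P →
        (∀ n ≤ N, ∀ j, ‖Y n j - y (n * h + θ.c j * h)‖ ≤ r ∧
          ‖P n j - p (n * h + θ.c j * h)‖ ≤ r) →
        ∀ n ≤ N, ∀ j, ‖Y n j - y (n * h + θ.c j * h)‖
          + h * ‖P n j - p (n * h + θ.c j * h)‖ ≤ M * h ^ s := by
  obtain ⟨q, rfl⟩ : ∃ q, s = q + 2 := ⟨s - 2, by omega⟩
  have hab : -δ < T + δ := by linarith
  have hun := uniqueDiffOn_Icc hab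
  have hsub : Icc 0 T ⊆ Icc (-δ) (T + δ) := Icc_subset_Icc (by linarith) (by linarith)
  have hle : ((2 : ℕ) : WithTop ℕ∞) ≤ ((q + 2 : ℕ) : WithTop ℕ∞) := by exact_mod_cast (by omega)
  have hle' : ((2 : ℕ) : WithTop ℕ∞) + 1 ≤ ((q + 2 : ℕ) : WithTop ℕ∞) + 1 := by
    exact_mod_cast (by omega : 2 + 1 ≤ q + 2 + 1)
  have hp' := contDiffOn_adjoint_succ hab (hy.of_le le_self_add) hp hyp.ode_p hf hu
  have hres : ∀ {φ : ℝ → Fin m → ℝ}, ContDiffOn ℝ ((q + 2 : ℕ) + 1) φ (Icc (-δ) (T + δ)) →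
      ∃ D : ℕ → ℝ → Fin m → ℝ, D 0 = φ ∧ IsJet (Icc (-δ) (T + δ)) (q + 3) D := fun hφ =>
    ⟨_, iteratedDerivWithin_zero, ContDiffOn.isJet hab (n := q + 3) (by exact_mod_cast hφ)⟩
  obtain ⟨Dy, rfl, hjy⟩ := hres hy
  obtain ⟨Dp, rfl, hjp⟩ := hres hp'
  have hS : SmoothSolution f u (Icc (-δ) (T + δ)) T q Dy Dp :=
    { convex := convex_Icc _ _
      subset := hsub
      jet_y := hjy
      jet_p := hjp
      ode_y := fun t ht => (hun t ht).eq_deriv _ (hjy.deriv 0 (by omega) t ht) (hyp.ode_y t ht)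
      ode_p := fun t ht => (hun t ht).eq_deriv _ (hjp.deriv 0 (by omega) t ht) (hyp.ode_p t ht)
      smooth_adj := fun t ht => ContDiffAt.adjOp (n := (2 : ℕ)) ((hf t (hsub ht)).of_le hle')
        ((hu t (hsub ht)).of_le hle)
      smooth_field := fun t ht => ContDiffAt.srcField (n := (2 : ℕ)) ((hf t (hsub ht)).of_le hle')
        ((hu t (hsub ht)).of_le hle) }
  have hst := PeerTriplet.strictlyStable hord (by omega) hadm hdom
  obtain ⟨ρ, hρ⟩ := PeerTriplet.exists_isCorrector hord hadm hsup hst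
  have hN1 : θ.AN *ᵥ 1 = θ.BN *ᵥ 1 := by simpa using hord.fwd_last_moment (k := 0) (by omega)
  have hw : θ.w ⬝ᵥ 1 = 1 := by simpa using hord.fwd_end_moment (k := 0) (by omega)
  have hJQ := hcoer.uniquelySolvable hUconvex hT
    (fun t ht => (hS.jet_y.deriv 0 (by omega) t (hsub ht)).continuousWithinAt.mono hsub)
    (fun t ht => (hS.jet_p.deriv 0 (by omega) t (hsub ht)).continuousWithinAt.mono hsub)
    (fun t ht => (hf t (hsub ht)).of_le (hle.trans le_self_add))
    (fun t ht => (hu t (hsub ht)).of_le (le_trans (by norm_num) hle)) hC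
    (fun t ht => hmin t (hsub ht))
  obtain ⟨c₀, hpert⟩ := exists_perturbedLinearization hS hT.le hord hadm.K_diag hsup hρ hfull hN1
    hC hyp.final
  obtain ⟨ε, hε, h₁, hh₁, κ, hstab⟩ := hst.exists_discrete_bound hadm.A0_unit hadm.AN_unit hN1
    (PeerTriplet.one_dotProduct_K_one hord) hw hJQ hT hS.continuousOn_fderiv c₀
  obtain ⟨M, hM, r, hr, h₂, hh₂, hpert⟩ := hpert ε hε
  obtain ⟨B, hB, hcor⟩ := hS.exists_norm_correction_le θ.c ρ
  obtain ⟨h₃, hh₃, hnod⟩ := exists_nodesIn (T := T) hδ hnodes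
  refine ⟨r, hr, min (min h₁ h₂) (min h₃ (T / 3)), by positivity, κ * M + B,
    fun N h hN hle Y P hsol hnear n hn j => ?_⟩
  have hh : 0 < h := by rw [hN]; positivity
  have hmesh : (N + 1) * h = T := by rw [hN]; field_simp
  have hns : NearSolution θ f C u (Icc (-δ) (T + δ)) T Dy Dp r N h Y P :=
    { two_le := by
        have h3 : h ≤ T / 3 := hle.trans ((min_le_right _ _).trans (min_le_right _ _))
        have h4 : (3 : ℝ) ≤ N + 1 := by
          by_contra hlt
          have : ((N : ℝ) + 1) * h < 3 * h := by gcongr; linarith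
          linarith
        have : 3 ≤ N + 1 := by exact_mod_cast h4
        omega
      pos := hh
      mesh := hmesh
      nodes := fun n hn => hnod h hh.le (hle.trans ((min_le_right _ _).trans (min_le_left _ _))) _
        (by positivity) (by
          have : (n : ℝ) ≤ N := by exact_mod_cast hn
          rw [← hmesh, add_one_mul]
          gcongr)
      sol := by rw [hyp.init]; exact hsol
      near := hnear }
  have hb := hstab N h hN (hle.trans ((min_le_left _ _).trans (min_le_left _ _))) _ _ _
    (by positivity) (hpert N h Y P hns (hle.trans ((min_le_left _ _).trans (min_le_right _ _)))) n hn
  have hy1 : ‖Y n j - Dy 0 (n * h + θ.c j * h)‖ ≤ ‖stateError θ Dy h Y n‖ :=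
    norm_le_pi_norm (stateError θ Dy h Y n) j
  have hp1 : ‖P n j - Dp 0 (n * h + θ.c j * h)‖ ≤
      ‖adjointError θ ρ Dp h P n‖ + B * h ^ (q + 1) := by
    have a1 := (norm_le_pi_norm _ j).trans
      (hcor (n * h) (hsub (hns.mem (by omega))) h hh.le)
    have a2 := norm_le_pi_norm (adjointError θ ρ Dp h P n) j
    refine (norm_sub_le_norm_sub_add_norm_sub _ (correctedAdjoint ρ Dp q θ.c (n * h) h j) _).trans ?_
    exact add_le_add a2 a1
  have hp2 := mul_le_mul_of_nonneg_left hp1 hh.le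
  have e1 : h * (‖adjointError θ ρ Dp h P n‖ + B * h ^ (q + 1)) =
      h * ‖adjointError θ ρ Dp h P n‖ + B * h ^ (q + 2) := by ring
  linarith
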